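/- Let $q=p^f$ be a power of a prime $p$ and let $\epsilon\in\{\pm1\}$ with $3\mid(q-\epsilon)$. Let $\mathrm{GL}_3^{\epsilon}(q)$ be $\mathrm{GL}_3(q)$ if $\epsilon=1$ and the general unitary group $\mathrm{GU}_3(q)\le\mathrm{GL}_3(q^2)$ of the standard hermitian form if $\epsilon=-1$. Let $G=\mathrm{SL}_3^{\epsilon}(q)$ be its subgroup of elements of determinant $1$, let $S=\mathrm{PSL}_3^{\epsilon}(q)=G/\mathbf{Z}(G)$ and $\widetilde S=\mathrm{PGL}_3^{\epsilon}(q)=\mathrm{GL}_3^{\epsilon}(q)/\mathbf{Z}(\mathrm{GL}_3^{\epsilon}(q))$. Identify $S$ with the group $\mathrm{Inn}(S)\le\mathrm{Aut}(S)$, and write $n_3$ for the highest power of $3$ dividing $n$ and $R'$ for the derived subgroup of $R$. Let $G\langle\delta\rangle$ denote any extension of $G$ by a diagonal automorphism of order $3$, that is, any group that contains $G$ and is generated by $G$ and an element $\delta$ with $\delta^3\in G$ which acts on $G$ by conjugation as some element of $\mathrm{GL}_3^{\epsilon}(q)$ does, this action not being an inner automorphism of $G$. (For example, $G\rtimes\langle\delta\rangle$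 for such an automorphism $\delta$ of $G$ with $\delta^3=1$.) (i) If $X$ is one of $S$, $\widetilde S$, $G$, $G\langle\delta\rangle$ and $R\in\mathrm{Syl}_3(X)$, then $[R:R']=9$. (ii) Let $S\le A\le\mathrm{Aut}(S)$ with $|A/S|_3=3$, let $R\in\mathrm{Syl}_3(A)$ and let $Y\in\mathrm{Syl}_3(A/S)$. Then $[R:R']\neq 9$ if and only if $Y$ induces a field automorphism on $S$, that is, $Y$ is generated by the image in $A/S$ of an element of $A$ that is induced by applying an automorphism of the field ($\mathbb F_q$ if $\epsilon=1$, $\mathbb F_{q^2}$ if $\epsilon=-1$) to all matrix entries. (iii) Let $S\le A\le\mathrm{Aut}(S)$ with $3\nmid|A/S|$ and let $R\in\mathrm{Syl}_3(A)$. Then $[A:S\,\mathbf{C}_A(R)]\le 2$. -/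

import Mathlib

open scoped Matrix

namespace SL3Sylow

section Groups

variable (p f : ℕ) (K : Type*) [Field K] [ExpChar K p]

/-- The general unitary group of the standard hermitian form on `K³`: the matrices `g` with
`(g^(q))ᵀ * g = 1`, where `q = p ^ f` and `g^(q)` is obtained from `g` by raising all entries to
the power `q`. It is used for a field `K` with `q²` elements. -/
def unitaryGL : Subgroup (GL (Fin 3) K) where
  carrier := {g | ((g : Matrix (Fin 3) (Fin 3) K).map (iterateFrobenius K p f))ᵀ *
    (g : Matrix (Fin 3) (Fin 3) K) = 1}
  one_mem' := by
    simp [Matrix.map_one]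
  mul_mem' := by
    intro a b ha hb
    simp only [Set.mem_ofPred_eq, Units.val_mul, Matrix.map_mul, Matrix.transpose_mul] at ha hb ⊢
    rw [Matrix.mul_assoc, ← Matrix.mul_assoc _ (a : Matrix (Fin 3) (Fin 3) K), ha,
      Matrix.one_mul, hb]
  inv_mem' := by
    intro a ha
    simp only [Set.mem_ofPred_eq] at ha ⊢
    have h1 : (a : Matrix (Fin 3) (Fin 3) K) *
        ((a : Matrix (Fin 3) (Fin 3) K).map (iterateFrobenius K p f))ᵀ = 1 :=
      mul_eq_one_comm.mp ha
    have h2 : ((a⁻¹ : GL (Fin 3) K) : Matrix (Fin 3) (Fin 3) K) =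
        ((a : Matrix (Fin 3) (Fin 3) K).map (iterateFrobenius K p f))ᵀ := by
      rw [← Matrix.mul_one ((a⁻¹ : GL (Fin 3) K) : Matrix (Fin 3) (Fin 3) K), ← h1,
        ← Matrix.mul_assoc, Units.inv_mul, Matrix.one_mul]
    have h3 : (((a⁻¹ : GL (Fin 3) K) : Matrix (Fin 3) (Fin 3) K).map
        (iterateFrobenius K p f))ᵀ *
        ((a : Matrix (Fin 3) (Fin 3) K).map (iterateFrobenius K p f))ᵀ = 1 := by
      rw [← Matrix.transpose_mul, ← Matrix.map_mul, Units.mul_inv]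
      simp [Matrix.map_one]
    rw [h2]
    rw [h2] at h3
    exact h3

/-- The number of elements of the field over which the matrices of `GL₃^ε(q)` are written:
`q` for `ε = 1` and `q²` for `ε = -1`. -/
def fieldCard (ε : ℤˣ) (q : ℕ) : ℕ := if ε = 1 then q else q ^ 2

/-- `GL₃^ε(q)` with `q = p ^ f`, over a field `K` with `fieldCard ε q` elements: the group
`GL₃(q)` if `ε = 1` and the general unitary group `GU₃(q)` if `ε = -1`. -/
def GLe (ε : ℤˣ) : Subgroup (GL (Fin 3) K) := if ε = 1 then ⊤ else unitaryGL p f K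

/-- `SL₃^ε(q)`: the elements of `GL₃^ε(q)` of determinant `1`. -/
def SLe (ε : ℤˣ) : Subgroup (GL (Fin 3) K) :=
  GLe p f K ε ⊓ (Matrix.GeneralLinearGroup.det : GL (Fin 3) K →* Kˣ).ker

/-- `PGL₃^ε(q)`: the quotient of `GL₃^ε(q)` by its centre. -/
abbrev PGLe (ε : ℤˣ) : Type _ := GLe p f K ε ⧸ Subgroup.center (GLe p f K ε)

/-- `PSL₃^ε(q)`: the quotient of `SL₃^ε(q)` by its centre. -/
abbrev PSLe (ε : ℤˣ) : Type _ := SLe p f K ε ⧸ Subgroup.center (SLe p f K ε)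

/-- `φ` is a field automorphism of `PSL₃^ε(q)`: it is induced by applying an automorphism `σ` of
the field `K` to all matrix entries. -/
def IsFieldAut (ε : ℤˣ) (φ : MulAut (PSLe p f K ε)) : Prop :=
  ∃ σ : K ≃+* K, ∀ g : SLe p f K ε, ∃ h : SLe p f K ε,
    (h : GL (Fin 3) K) = Matrix.GeneralLinearGroup.map (σ : K →+* K) (g : GL (Fin 3) K) ∧
    φ (g : PSLe p f K ε) = (h : PSLe p f K ε)

/-- `Γ = G⟨δ⟩`, where `G = SL₃^ε(q)` is embedded in `Γ` by `ι` and `δ` is a diagonal automorphism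
of order `3`: `Γ` is generated by `G` and `δ`, the element `δ` acts on `G` like conjugation by an
element `d` of `GL₃^ε(q)`, this action is not an inner automorphism of `G`, and `δ ^ 3` lies in
`G`. The semidirect product of `G` with the group generated by an inner-diagonal, not inner
automorphism `δ` with `δ ^ 3 = 1` is an example; if `9 ∣ q - ε` then no automorphism that is induced
by a diagonal matrix and is not inner has cube `1`, and `δ ^ 3 ∈ G` is what order `3` means. -/
def IsDiagonalExtension (ε : ℤˣ) {Γ : Type*} [Group Γ] (ι : SLe p f K ε →* Γ) (δ : Γ) : Prop :=
  Function.Injective ι ∧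
  ι.range ⊔ Subgroup.zpowers δ = ⊤ ∧
  (∃ d ∈ GLe p f K ε, ∀ g h : SLe p f K ε,
    (h : GL (Fin 3) K) = d * (g : GL (Fin 3) K) * d⁻¹ → δ * ι g * δ⁻¹ = ι h) ∧
  (¬ ∃ x : SLe p f K ε, ∀ g : SLe p f K ε, δ * ι g * δ⁻¹ = ι (x * g * x⁻¹)) ∧
  δ ^ 3 ∈ ι.range

end Groups

section Automorphisms

variable (S : Type*) [Group S]

/-- The group of inner automorphisms of `S`, which is the copy of `S` in `Aut(S)` when the centre
of `S` is trivial. -/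
abbrev Inn : Subgroup (MulAut S) := (MulAut.conj : S →* MulAut S).range

instance innNormal : (Inn S).Normal where
  conj_mem := by
    rintro _ ⟨s, rfl⟩ α
    refine ⟨α s, ?_⟩
    ext x
    simp [MulAut.mul_apply, MulAut.conj_apply]

variable {S}

/-- The copy of `S` inside `A ≤ Aut(S)`, as a subgroup of `A`, for `Inn(S) ≤ A`. -/
abbrev inside (A : Subgroup (MulAut S)) : Subgroup A := (Inn S).subgroupOf A

end Automorphisms

end SL3Sylow

set_option linter.unusedSectionVars false

namespace SL3Sylow

/-! ### Derived subgroups and Sylow subgroups of finite groups. -/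

section GroupTheory

/-! Let `T` be the group of diagonal matrices of determinant 1 whose entries are scalars of 3-power
order in `GL₁^ε(q)`, let `c` be the cyclic permutation matrix and `Q = T⟨c⟩`. A 3-element of
`GL₃^ε(q)` normalizing the corresponding monomial group without the determinant condition already
lies in that group, so the latter is a Sylow 3-subgroup of `GL₃^ε(q)` and `Q` is one of `G`
(`not_dvd_index_sylQ`). Every element of `T` has the form `[diag u, c]` with `u` determined up to a
scalar, where `diag u` need not have determinant 1. If `det u` is a cube, then `u` can be rescaled
to determinant 1 and the element lies in `Q'`. Since the scalars of 3-power order form a cyclic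
group, there are three classes modulo cubes, hence `[Q : Q'] ≤ 9`. On the other hand, a `p`-group of
order divisible by `p²` has abelianization of order divisible by `p²` (`sq_dvd_index_commutator`).
The same argument works modulo central subgroups.

If the ambient group contributes one further factor 3, then `R = Q⟨w⟩`. When `w` acts as `diag(β, 1,
1)` times a field automorphism, with `β` not a cube, `[w, c]` supplies the missing classes of `T`;
so `T ≤ R'` and again `[R : R'] = 9` (`index_commutator_of_det_ne_cube`). When `w` acts as a field
automorphism fixing the cube roots of unity, it raises the scalars of 3-power order to a power `1 +
3l`, so it acts trivially modulo `Q'`; then `R' = Q'` and `[R : R'] = 27`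
(`index_commutator_of_field`). The determinant of the semilinear map modulo cubes decides between
these cases. In (ii) a generator of `Y` is replaced by its square, which generates the same group
and always fixes the cube roots of unity.

For (iii), Frattini's argument gives `A = S N_A(R)`, and `N_A(R)` acts on `R/R'`, a plane over the
field with three elements. An element acting trivially there acts on `R` as an automorphism of
3-power order, hence lies in `S C_A(R)`. So it is enough that every element of `N_A(R)` of
determinant 1 on `R/R'` can be multiplied by an element of `S` so that its matrix has cube 1; the
determinant then bounds the index by 2. If the scalars of 3-power order exceed order 3, the image of
`T` in `R/R'` is an invariant line, the matrices are triangular, and an element of `S` inverting the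
plane suffices. If they have order 3, the discrete Fourier transform and a conjugate of it induce a
quaternion group on the plane, which is normal of index 3 in `SL₂(3)`.

Part (ii) also needs that an automorphism of `S` whose cube is inner is semilinear. For `PSL₃(q)`,
an automorphism sends the centres of Sylow `p`-subgroups to such centres, and these are groups of
transvections with a fixed centre and axis. The six root subgroups thus give a hexagon of flags in
the projective plane. It comes from a basis, possibly after applying the inverse transpose, and the
commutator relations produce the field automorphism; so the square of every automorphism is
semilinear (`sq_mem_semilinearAut`). For `PSU₃(q)`, an automorphism can be adjusted to preserve two
opposite Sylow `p`-subgroups. Its action on one of them modulo the centre commutes with the torus up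
to an automorphism of the torus and is therefore semilinear. After division by a semilinear map it
fixes this Sylow subgroup elementwise, hence stabilizes every isotropic line, hence is trivial
(`mem_semilinearAut_unitary`); `q = 2`, where the torus is scalar, is treated by the Weyl element
instead. -/

theorem commutator_le_comap {G H : Type*} [Group G] [Group H] (φ : G →* H) :
    commutator G ≤ (commutator H).comap φ := by
  rw [← Subgroup.map_le_iff_le_comap, commutator_def, Subgroup.map_commutator, commutator_def]
  exact Subgroup.commutator_mono le_top le_top

/-- Induction through `G/Z(G)`: for nonabelian `G` this quotient is not cyclic, so its order is
again divisible by `p²`, and its abelianization is a quotient of that of `G`. -/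
theorem sq_dvd_index_commutator (p : ℕ) [Fact p.Prime] (n : ℕ) : ∀ (G : Type*) [Group G] [Finite G],
    IsPGroup p G → Nat.card G = n → p ^ 2 ∣ n → p ^ 2 ∣ (commutator G).index := by
  induction n using Nat.strong_induction_on with
  | _ n ih =>
    intro G _ _ hG hn h2
    by_cases hcomm : ∀ a b : G, a * b = b * a
    · have : commutator G = ⊥ := by
        rw [commutator_def, eq_bot_iff, Subgroup.commutator_le]
        intro a _ b _
        rw [Subgroup.mem_bot, commutatorElement_eq_one_iff_mul_comm]
        exact hcomm a b
      rw [this, Subgroup.index_bot, hn]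
      exact h2
    · have hQ : IsPGroup p (G ⧸ Subgroup.center G) := hG.to_quotient _
      obtain ⟨k, hk⟩ := IsPGroup.iff_card.mp hQ
      have hncyc : ¬ IsCyclic (G ⧸ Subgroup.center G) := by
        intro hc
        exact hcomm (MonoidHom.isMulCommutative_of_isCyclic_of_ker_le_center
          (QuotientGroup.mk' (Subgroup.center G)) (by simp)).is_comm.comm
      have hk2 : 2 ≤ k := by
        by_contra hlt
        have : k = 0 ∨ k = 1 := by omega
        rcases this with rfl | rfl
        · apply hncyc
          have : Subsingleton (G ⧸ Subgroup.center G) :=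
            (Nat.card_eq_one_iff_unique.mp (by simpa using hk)).1
          exact isCyclic_of_subsingleton
        · exact hncyc (isCyclic_of_prime_card (p := p) (by simpa using hk))
      have hG1 : Nontrivial G := by
        by_contra h
        rw [not_nontrivial_iff_subsingleton] at h
        exact hcomm fun a b => Subsingleton.elim _ _
      have hlt : Nat.card (G ⧸ Subgroup.center G) < n := by
        rw [← hn, Subgroup.card_eq_card_quotient_mul_card_subgroup (Subgroup.center G)]
        have := hG.center_nontrivial
        have h1 : 1 < Nat.card (Subgroup.center G) := Finite.one_lt_card
        have h2 : 0 < Nat.card (G ⧸ Subgroup.center G) := Nat.card_pos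
        nlinarith
      have := ih _ hlt (G ⧸ Subgroup.center G) hQ rfl (hk ▸ pow_dvd_pow p hk2)
      rw [← Subgroup.index_comap_of_surjective _ (QuotientGroup.mk'_surjective
        (Subgroup.center G))] at this
      exact this.trans (Subgroup.index_dvd_of_le (commutator_le_comap _))

/-- Normalizers grow in `p`-groups: if `Q` were properly contained in a Sylow subgroup, some
`p`-element outside `Q` would normalize it. -/
theorem exists_sylow_coe_eq {p : ℕ} [Fact p.Prime] {G : Type*} [Group G] [Finite G]
    (Q : Subgroup G) (hQ : IsPGroup p Q)
    (h : ∀ y : G, (∀ x ∈ Q, y * x * y⁻¹ ∈ Q) → (∃ k, y ^ p ^ k = 1) → y ∈ Q) :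
    ∃ P : Sylow p G, (P : Subgroup G) = Q := by
  obtain ⟨P, hP⟩ := hQ.exists_le_sylow
  refine ⟨P, le_antisymm ?_ hP⟩
  by_contra hlt
  have hne : Q.subgroupOf P < ⊤ := by
    rw [lt_top_iff_ne_top, Ne, Subgroup.subgroupOf_eq_top]
    exact hlt
  have hnil : Group.IsNilpotent P := P.isPGroup'.isNilpotent
  have := Group.normalizerCondition_of_isNilpotent (G := P) _ hne
  obtain ⟨y, hy1, hy2⟩ := SetLike.exists_of_lt this
  apply hy2
  rw [Subgroup.mem_subgroupOf]
  apply h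
  · intro x hx
    have := (Subgroup.mem_normalizer_iff.mp hy1 ⟨x, hP hx⟩).mp hx
    exact this
  · obtain ⟨k, hk⟩ := P.isPGroup' y
    exact ⟨k, by simpa using congrArg Subtype.val hk⟩

theorem index_commutator_sylow_eq {p : ℕ} [Fact p.Prime] {G : Type*} [Group G] [Finite G]
    (P Q : Sylow p G) : (commutator P).index = (commutator Q).index := by
  have e := Sylow.equiv P Q
  rw [← Subgroup.index_comap_of_surjective (commutator Q) (f := (e : P →* Q)) e.surjective]
  congr 1
  refine le_antisymm (commutator_le_comap _) ?_
  have := commutator_le_comap (e.symm : Q →* P)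
  intro x hx
  have h2 := this hx
  simpa using h2

theorem index_le_of_forall_exists {G ι : Type*} [Group G] [Fintype ι] (H : Subgroup G)
    (r : ι → G) (h : ∀ g, ∃ i, (r i)⁻¹ * g ∈ H) : H.index ≤ Fintype.card ι := by
  rw [Subgroup.index, ← Nat.card_eq_fintype_card]
  refine Nat.card_le_card_of_surjective (fun i => (r i : G ⧸ H)) ?_
  intro x
  induction x using QuotientGroup.induction_on with
  | H g =>
    obtain ⟨i, hi⟩ := h g
    exact ⟨i, QuotientGroup.eq.mpr hi⟩

/-- Modulo `H'` the group is generated by the abelian image of `H` and the image of `x`, which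
commutes with it; so the quotient by `H'` is abelian. -/
theorem commutator_le_of_sup_zpowers {G : Type*} [Group G] (H : Subgroup G) [H.Normal] (x : G)
    (htop : H ⊔ Subgroup.zpowers x = ⊤) (hx : ∀ h ∈ H, x * h * x⁻¹ * h⁻¹ ∈ ⁅H, H⁆) :
    commutator G ≤ ⁅H, H⁆ := by
  set L := ⁅H, H⁆ with hL
  have hHH : ∀ a ∈ H, ∀ b ∈ H, (a : G ⧸ L) * b = b * a := by
    intro a ha b hb
    rw [← commutatorElement_eq_one_iff_mul_comm]
    have : a * b * a⁻¹ * b⁻¹ ∈ L := Subgroup.commutator_mem_commutator ha hb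
    exact (QuotientGroup.eq_one_iff _).mpr this
  have hxH : ∀ h ∈ H, Commute (x : G ⧸ L) h := by
    intro h hh
    have := (QuotientGroup.eq_one_iff _).mpr (hx h hh)
    exact commutatorElement_eq_one_iff_mul_comm.mp this
  have key : ∀ g : G, ∃ h ∈ H, ∃ n : ℤ, g = h * x ^ n := by
    intro g
    have : g ∈ H ⊔ Subgroup.zpowers x := htop ▸ Subgroup.mem_top g
    rw [Subgroup.mem_sup_of_normal_left] at this
    obtain ⟨y, hy, z, hz, rfl⟩ := this
    obtain ⟨n, rfl⟩ := hz
    exact ⟨y, hy, n, rfl⟩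
  rw [commutator_def, Subgroup.commutator_le]
  intro a _ b _
  obtain ⟨h, hh, m, rfl⟩ := key a
  obtain ⟨k, hk, n, rfl⟩ := key b
  rw [← QuotientGroup.eq_one_iff, ← QuotientGroup.mk'_apply, map_commutatorElement,
    commutatorElement_eq_one_iff_commute]
  simp only [QuotientGroup.mk'_apply, QuotientGroup.mk_mul, QuotientGroup.mk_zpow]
  have c1 : Commute (h : G ⧸ L) k := hHH h hh k hk
  have c2 := hxH h hh
  have c3 := hxH k hk
  have c4 : Commute ((x : G ⧸ L) ^ m) (x ^ n) := (Commute.refl _).zpow_zpow m n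
  exact ((c1.mul_right (c2.zpow_left n).symm).mul_left ((c3.zpow_left m).mul_right c4))

end GroupTheory

end SL3Sylow

namespace SL3Sylow

/-! ### Scalars of 3-power order and their classes modulo cubes. -/

section Scalars

variable (p f : ℕ) (K : Type*) [Field K] (ε : ℤˣ)

/-- The scalars `c` for which the scalar matrix `c` lies in `GL₃^ε(q)`. -/
def scalars : Subgroup Kˣ where
  carrier := {c | ε = 1 ∨ c ^ (p ^ f + 1) = 1}
  one_mem' := by simp
  mul_mem' := by
    rintro a b (ha | ha) (hb | hb)
    · exact Or.inl ha
    · exact Or.inl ha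
    · exact Or.inl hb
    · exact Or.inr (by rw [mul_pow, ha, hb, one_mul])
  inv_mem' := by
    rintro a (ha | ha)
    · exact Or.inl ha
    · exact Or.inr (by rw [inv_pow, ha, inv_one])

/-- The scalars of `3`-power order. -/
def scalars3 : Subgroup Kˣ where
  carrier := {c | c ∈ scalars p f K ε ∧ ∃ n : ℕ, c ^ 3 ^ n = 1}
  one_mem' := ⟨one_mem _, 0, by simp⟩
  mul_mem' := by
    rintro a b ⟨ha, m, hm⟩ ⟨hb, n, hn⟩
    refine ⟨mul_mem ha hb, m + n, ?_⟩
    rw [mul_pow, pow_add, pow_mul, hm, mul_comm (3 ^ m), pow_mul, hn]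
    simp
  inv_mem' := by
    rintro a ⟨ha, m, hm⟩
    exact ⟨inv_mem ha, m, by rw [inv_pow, hm, inv_one]⟩

variable {p f K ε}

theorem mem_scalars {c : Kˣ} : c ∈ scalars p f K ε ↔ ε = 1 ∨ c ^ (p ^ f + 1) = 1 := Iff.rfl

theorem scalars3_le : scalars3 p f K ε ≤ scalars p f K ε := fun _ h => h.1

theorem map_mem_scalars {c : Kˣ} (hc : c ∈ scalars p f K ε) (σ : K ≃+* K) :
    Units.map (σ : K →* K) c ∈ scalars p f K ε := by
  rcases hc with h | h
  · exact Or.inl h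
  · exact Or.inr (by rw [← map_pow, h, map_one])

theorem map_mem_scalars3 {c : Kˣ} (hc : c ∈ scalars3 p f K ε) (σ : K ≃+* K) :
    Units.map (σ : K →* K) c ∈ scalars3 p f K ε := by
  obtain ⟨h, n, hn⟩ := hc
  exact ⟨map_mem_scalars h σ, n, by rw [← map_pow, hn, map_one]⟩

theorem mem_scalars3_of_pow {c : Kˣ} (hc : c ∈ scalars p f K ε) {n : ℕ} (h : c ^ 3 ^ n ∈ scalars3 p f K ε) :
    c ∈ scalars3 p f K ε := by
  obtain ⟨-, m, hm⟩ := h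
  exact ⟨hc, n + m, by rw [pow_add, pow_mul, hm]⟩

theorem finite_of_card {p : ℕ} [Fact p.Prime] {f : ℕ} {ε : ℤˣ} {K : Type*}
    (hK : Nat.card K = fieldCard ε (p ^ f)) : Finite K := by
  apply Nat.finite_of_card_ne_zero
  rw [hK, fieldCard]
  have : p ≠ 0 := (Fact.out : p.Prime).ne_zero
  split_ifs <;> positivity

/-- Cauchy's theorem in `Kˣ`. For `ε = -1` the number `q + 1` is a multiple of 3, so every cube root
of unity is automatically a scalar of the unitary group. -/
theorem exists_cube_root [Fact p.Prime] (h3 : (3 : ℤ) ∣ (p : ℤ) ^ f - (ε : ℤ))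
    (hK : Nat.card K = fieldCard ε (p ^ f)) :
    ∃ z : Kˣ, z ∈ scalars3 p f K ε ∧ z ≠ 1 ∧ z ^ 3 = 1 := by
  have hfin : Finite K := finite_of_card hK
  have hp1 : 1 ≤ p ^ f := Nat.one_le_pow _ _ (Fact.out : p.Prime).pos
  have hcard : Nat.card Kˣ = Nat.card K - 1 := Nat.card_units K
  have hdvd : 3 ∣ Nat.card Kˣ := by
    rw [hcard, hK, fieldCard]
    have hp2 : 1 ≤ (p ^ f) ^ 2 := Nat.one_le_pow _ _ hp1
    zify
    split_ifs with hε
    · subst hε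
      push_cast [Nat.cast_sub hp1]
      simpa using h3
    · have hε : ε = -1 := (Int.units_eq_one_or ε).resolve_left hε
      subst hε
      push_cast [Nat.cast_sub hp2]
      have : ((p : ℤ) ^ f) ^ 2 - 1 = ((p : ℤ) ^ f - ((-1 : ℤˣ) : ℤ)) * ((p : ℤ) ^ f - 1) := by
        push_cast; ring
      rw [this]
      exact h3.mul_right _
  have : Finite Kˣ := inferInstance
  obtain ⟨z, hz⟩ := exists_prime_orderOf_dvd_card' (G := Kˣ) 3 hdvd
  have hz3 : z ^ 3 = 1 := hz ▸ pow_orderOf_eq_one z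
  refine ⟨z, ⟨?_, 1, by simpa using hz3⟩, ?_, hz3⟩
  · rcases Int.units_eq_one_or ε with h | h
    · exact Or.inl h
    · right
      subst h
      have : 3 ∣ p ^ f + 1 := by zify; simpa using h3
      obtain ⟨m, hm⟩ := this
      rw [hm, pow_mul, hz3, one_pow]
  · rintro rfl
    simp at hz

/-- `α` generates the group of scalars of `3`-power order. -/
def IsGen3 (p f : ℕ) {K : Type*} [Field K] (ε : ℤˣ) (α : Kˣ) : Prop :=
  α ∈ scalars3 p f K ε ∧ (∀ x ∈ scalars3 p f K ε, ∃ k : ℕ, x = α ^ k) ∧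
    ∃ m : ℕ, orderOf α = 3 ^ (m + 1)

theorem exists_isGen3 [Fact p.Prime] (h3 : (3 : ℤ) ∣ (p : ℤ) ^ f - (ε : ℤ))
    (hK : Nat.card K = fieldCard ε (p ^ f)) : ∃ α : Kˣ, IsGen3 p f ε α := by
  have hfin : Finite K := finite_of_card hK
  obtain ⟨g, hg⟩ := IsCyclic.exists_monoid_generator (α := scalars3 p f K ε)
  obtain ⟨z, hz, hz1, hz3⟩ := exists_cube_root h3 hK
  refine ⟨g, g.2, ?_, ?_⟩
  · intro x hx
    obtain ⟨k, hk⟩ := hg ⟨x, hx⟩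
    exact ⟨k, by simpa using (congrArg Subtype.val hk).symm⟩
  · obtain ⟨-, n, hn⟩ := g.2
    obtain ⟨k, -, hk⟩ := (Nat.dvd_prime_pow Nat.prime_three).mp (orderOf_dvd_of_pow_eq_one hn)
    cases k with
    | succ m => exact ⟨m, hk⟩
    | zero =>
      exfalso
      rw [pow_zero, orderOf_eq_one_iff] at hk
      obtain ⟨k, hk'⟩ := hg ⟨z, hz⟩
      apply hz1
      have := congrArg Subtype.val hk'
      simp only [SubgroupClass.coe_pow, hk, one_pow] at this
      exact this.symm

variable {α : Kˣ}

theorem IsGen3.exists_pow_mul_cube (hα : IsGen3 p f ε α) {x : Kˣ} (hx : x ∈ scalars3 p f K ε) :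
    ∃ j : Fin 3, ∃ c ∈ scalars3 p f K ε, x = α ^ (j : ℕ) * c ^ 3 := by
  obtain ⟨k, rfl⟩ := hα.2.1 x hx
  refine ⟨⟨k % 3, Nat.mod_lt _ (by norm_num)⟩, α ^ (k / 3), pow_mem hα.1 _, ?_⟩
  rw [← pow_mul, ← pow_add, Nat.mod_add_div']

/-- With `m` the part of the order of `x` prime to 3, `m² ≡ 1` modulo 3. So `x ^ (m ^ 2)` has
3-power order and differs from `x` by a cube. -/
theorem IsGen3.exists_pow_mul_cube' [Finite K] (hα : IsGen3 p f ε α) {x : Kˣ}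
    (hx : x ∈ scalars p f K ε) :
    ∃ j : Fin 3, ∃ c ∈ scalars p f K ε, x = α ^ (j : ℕ) * c ^ 3 := by
  obtain ⟨n, m, hm, hnm⟩ := Nat.exists_eq_pow_mul_and_not_dvd (orderOf_pos x).ne' 3 (by norm_num)
  have hmm : m ^ 2 % 3 = 1 := by
    have : m % 3 = 1 ∨ m % 3 = 2 := by omega
    rcases this with h | h <;> simp [Nat.pow_mod, h]
  have hx3 : x ^ (m ^ 2) ∈ scalars3 p f K ε := by
    refine ⟨pow_mem hx _, n, ?_⟩
    rw [← pow_mul, show m ^ 2 * 3 ^ n = orderOf x * m by rw [hnm]; ring, pow_mul,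
      pow_orderOf_eq_one, one_pow]
  obtain ⟨j, c, hc, h⟩ := hα.exists_pow_mul_cube hx3
  refine ⟨j, c * (x ^ (m ^ 2 / 3))⁻¹, mul_mem (scalars3_le hc) (inv_mem (pow_mem hx _)), ?_⟩
  have h2 : x ^ (m ^ 2) = x * (x ^ (m ^ 2 / 3)) ^ 3 := by
    rw [← pow_mul]
    nth_rewrite 2 [← pow_one x]
    rw [← pow_add]
    congr 1
    omega
  rw [mul_pow, ← mul_assoc, ← h, h2, inv_pow, mul_inv_cancel_right]

/-- A cube root of a power of `α` would itself have 3-power order, hence be a power of `α`; as 3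
divides the order of `α`, exponents are well defined modulo 3. -/
theorem IsGen3.not_cube_pow (hα : IsGen3 p f ε α) {j : ℕ} (hj : ¬ 3 ∣ j) (c : Kˣ)
    (hc : c ∈ scalars p f K ε) : α ^ j ≠ c ^ 3 := by
  intro h
  have hc3 : c ∈ scalars3 p f K ε := by
    apply mem_scalars3_of_pow hc (n := 1)
    rw [pow_one, ← h]
    exact pow_mem hα.1 _
  obtain ⟨k, rfl⟩ := hα.2.1 c hc3
  obtain ⟨m, hm⟩ := hα.2.2
  rw [← pow_mul, pow_eq_pow_iff_modEq, hm] at h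
  have h2 : j ≡ k * 3 [MOD 3] := h.of_dvd (dvd_pow_self 3 (by omega))
  apply hj
  unfold Nat.ModEq at h2
  omega

theorem three_ne_zero_of_cube_root {z : Kˣ} (hz1 : z ≠ 1) (hz : z ^ 3 = 1) : (3 : K) ≠ 0 := by
  intro h
  apply hz1
  have hz' : (z : K) ^ 3 = 1 := by rw [← Units.val_pow_eq_pow_val, hz, Units.val_one]
  have : ((z : K) - 1) ^ 3 = 0 := by linear_combination hz' + (-(z : K) ^ 2 + z) * h
  ext
  simpa [sub_eq_zero] using this

theorem cube_root_sum {z : Kˣ} (hz1 : z ≠ 1) (hz : z ^ 3 = 1) : (z : K) ^ 2 + z + 1 = 0 := by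
  have hz' : (z : K) ^ 3 = 1 := by rw [← Units.val_pow_eq_pow_val, hz, Units.val_one]
  have h1 : (z : K) - 1 ≠ 0 := by
    rw [sub_ne_zero]
    simpa using hz1
  apply mul_left_cancel₀ h1
  linear_combination hz'

end Scalars

/-! ### Monomial matrices with cyclic permutation part. -/

section Monomial

variable {K : Type*} [Field K]

/-- The invertible monomial matrix with entry `a i` in position `(i, i + k)`. -/
def mono (a : Fin 3 → Kˣ) (k : Fin 3) : GL (Fin 3) K where
  val := Matrix.of fun i j => if j = i + k then (a i : K) else 0
  inv := Matrix.of fun i j => if i = j + k then ((a j)⁻¹ : Kˣ) else (0 : K)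
  val_inv := by
    ext i j
    fin_cases k <;> fin_cases i <;> fin_cases j <;>
      simp [Matrix.mul_apply]
  inv_val := by
    ext i j
    fin_cases k <;> fin_cases i <;> fin_cases j <;>
      simp [Matrix.mul_apply, Fin.sum_univ_three]

theorem mono_apply (a : Fin 3 → Kˣ) (k i j : Fin 3) :
    (mono a k : Matrix (Fin 3) (Fin 3) K) i j = if j = i + k then (a i : K) else 0 := rfl

theorem mono_mul (a b : Fin 3 → Kˣ) (k l : Fin 3) :
    mono a k * mono b l = mono (fun i => a i * b (i + k)) (k + l) := by
  ext i j
  rw [Units.val_mul, Matrix.mul_apply, Finset.sum_eq_single (i + k)]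
  · simp only [mono_apply, if_true, mul_ite, mul_zero, Units.val_mul, add_assoc]
  · intro x _ hx
    simp [mono_apply, hx]
  · simp

theorem mono_one : mono (1 : Fin 3 → Kˣ) 0 = 1 := by
  ext i j
  simp [mono_apply, Matrix.one_apply, eq_comm]

theorem mono_inv (a : Fin 3 → Kˣ) (k : Fin 3) :
    (mono a k)⁻¹ = mono (fun i => (a (i - k))⁻¹) (-k) := by
  rw [inv_eq_iff_mul_eq_one, mono_mul, ← mono_one]
  congr 1
  · ext i
    simp
  · simp

theorem mono_injective {a b : Fin 3 → Kˣ} {k l : Fin 3} (h : mono a k = mono b l) :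
    a = b ∧ k = l := by
  have h1 : ∀ i j, (mono a k : Matrix (Fin 3) (Fin 3) K) i j = (mono b l) i j := fun i j => by rw [h]
  simp only [mono_apply] at h1
  have hkl : k = l := by
    have := h1 0 (0 + k)
    rw [if_pos rfl] at this
    by_contra hne
    rw [if_neg (by simpa using hne)] at this
    exact (a 0).ne_zero this
  subst hkl
  refine ⟨?_, rfl⟩
  ext i
  simpa using h1 i (i + k)

theorem det_mono (a : Fin 3 → Kˣ) (k : Fin 3) :
    Matrix.GeneralLinearGroup.det (mono a k) = a 0 * a 1 * a 2 := by
  ext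
  simp only [Matrix.GeneralLinearGroup.val_det_apply, Matrix.det_fin_three, mono_apply, Units.val_mul]
  fin_cases k <;> simp

theorem map_mono (σ : K →+* K) (a : Fin 3 → Kˣ) (k : Fin 3) :
    Matrix.GeneralLinearGroup.map σ (mono a k) = mono (fun i => Units.map (σ : K →* K) (a i)) k := by
  ext i j
  simp only [Matrix.GeneralLinearGroup.map_apply, mono_apply]
  split_ifs <;> simp

theorem mono_const_comm (c : Kˣ) (g : GL (Fin 3) K) :
    mono (fun _ => c) 0 * g = g * mono (fun _ => c) 0 := by
  have : (mono (fun _ => c) 0 : GL (Fin 3) K) = Matrix.GeneralLinearGroup.scalar (Fin 3) c := by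
    ext i j
    simp [mono_apply, Matrix.GeneralLinearGroup.coe_scalar, Matrix.scalar_apply,
      Matrix.diagonal_apply, eq_comm]
  rw [this, Matrix.GeneralLinearGroup.scalar_commute]

end Monomial

end SL3Sylow

namespace SL3Sylow

/-! ### The groups `GL₃^ε(q)` and `SL₃^ε(q)`, their centres and their semilinear automorphisms. -/

section Basic

variable {p f : ℕ} {K : Type*} [Field K] [ExpChar K p] {ε : ℤˣ}

theorem mem_GLe {g : GL (Fin 3) K} : g ∈ GLe p f K ε ↔ ε = 1 ∨
    ((g : Matrix (Fin 3) (Fin 3) K).map (iterateFrobenius K p f))ᵀ *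
      (g : Matrix (Fin 3) (Fin 3) K) = 1 := by
  unfold GLe
  split_ifs with h
  · simp [h]
  · simp only [h, false_or]
    rfl

theorem mono_mem_GLe {a : Fin 3 → Kˣ} {k : Fin 3} :
    mono a k ∈ GLe p f K ε ↔ ∀ i, a i ∈ scalars p f K ε := by
  rw [mem_GLe]
  by_cases h : ε = 1
  · simp [h, mem_scalars]
  · simp only [h, false_or, mem_scalars]
    have key : ((mono a k : Matrix (Fin 3) (Fin 3) K).map (iterateFrobenius K p f))ᵀ *
      (mono a k : Matrix (Fin 3) (Fin 3) K) =
        Matrix.diagonal fun i => ((a (i - k) ^ (p ^ f + 1) : Kˣ) : K) := by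
      ext i j
      simp only [Matrix.mul_apply, Matrix.transpose_apply, Matrix.map_apply, mono_apply]
      rw [Finset.sum_eq_single (i - k)]
      · rw [Matrix.diagonal_apply]
        simp only [sub_add_cancel, if_true]
        by_cases hij : i = j
        · simp [hij, pow_succ, iterateFrobenius_def]
        · simp [hij, Ne.symm hij]
      · intro b _ hb
        have : i ≠ b + k := fun h => hb (by rw [h]; simp)
        simp [this]
      · simp
    rw [key, ← Matrix.diagonal_one]
    rw [Matrix.diagonal_eq_diagonal_iff]
    constructor
    · intro h i
      ext
      have := h (i + k)
      simpa using this
    · intro h i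
      rw [h, Units.val_one]

theorem det_mem_scalars {g : GL (Fin 3) K} (hg : g ∈ GLe p f K ε) :
    Matrix.GeneralLinearGroup.det g ∈ scalars p f K ε := by
  rw [mem_GLe] at hg
  rcases hg with h | h
  · exact Or.inl h
  · right
    have := congrArg Matrix.det h
    rw [Matrix.det_mul, Matrix.det_transpose, Matrix.det_one] at this
    ext
    rw [pow_succ, Units.val_mul, Units.val_pow_eq_pow_val, Matrix.GeneralLinearGroup.val_det_apply,
      Units.val_one, ← this]
    congr 1
    rw [← iterateFrobenius_def, RingHom.map_det]
    rfl

theorem map_mem_GLe {g : GL (Fin 3) K} (hg : g ∈ GLe p f K ε) (σ : K ≃+* K) :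
    Matrix.GeneralLinearGroup.map (σ : K →+* K) g ∈ GLe p f K ε := by
  rw [mem_GLe] at hg ⊢
  rcases hg with h | h
  · exact Or.inl h
  · right
    have := congrArg (fun M => M.map (σ : K →+* K)) h
    simp only [Matrix.map_mul] at this
    rw [Matrix.map_one _ (map_zero _) (map_one _)] at this
    rw [← this]
    congr 1
    ext i j
    simp [iterateFrobenius_def]

theorem mem_SLe {g : GL (Fin 3) K} :
    g ∈ SLe p f K ε ↔ g ∈ GLe p f K ε ∧ Matrix.GeneralLinearGroup.det g = 1 := Iff.rfl

theorem SLe_le_GLe : SLe p f K ε ≤ GLe p f K ε := fun _ h => h.1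

theorem conj_mem_SLe {d g : GL (Fin 3) K} (hd : d ∈ GLe p f K ε) (hg : g ∈ SLe p f K ε) :
    d * g * d⁻¹ ∈ SLe p f K ε := by
  refine mem_SLe.mpr ⟨mul_mem (mul_mem hd hg.1) (inv_mem hd), ?_⟩
  have := (mem_SLe.mp hg).2
  rw [map_mul, map_mul, this, map_inv]
  simp

theorem map_mem_SLe {g : GL (Fin 3) K} (hg : g ∈ SLe p f K ε) (σ : K ≃+* K) :
    Matrix.GeneralLinearGroup.map (σ : K →+* K) g ∈ SLe p f K ε := by
  refine mem_SLe.mpr ⟨map_mem_GLe hg.1 σ, ?_⟩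
  rw [Matrix.GeneralLinearGroup.map_det, (mem_SLe.mp hg).2, map_one]

/-- The semilinear automorphism `g ↦ d σ(g) d⁻¹` of `SL₃^ε(q)`, as a homomorphism. -/
def twist (d : GLe p f K ε) (σ : K ≃+* K) : SLe p f K ε →* SLe p f K ε where
  toFun g := ⟨d * Matrix.GeneralLinearGroup.map (σ : K →+* K) (g : GL (Fin 3) K) * (d : GL (Fin 3) K)⁻¹,
    conj_mem_SLe d.2 (map_mem_SLe g.2 σ)⟩
  map_one' := by
    ext1
    simp
  map_mul' a b := by
    ext1
    simp [mul_assoc]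

theorem coe_twist (d : GLe p f K ε) (σ : K ≃+* K) (g : SLe p f K ε) :
    (twist d σ g : GL (Fin 3) K) =
      d * Matrix.GeneralLinearGroup.map (σ : K →+* K) (g : GL (Fin 3) K) * (d : GL (Fin 3) K)⁻¹ := rfl

/-- The action of a field automorphism on `GL₃^ε(q)`. -/
def fieldMap (σ : K ≃+* K) (d : GLe p f K ε) : GLe p f K ε :=
  ⟨Matrix.GeneralLinearGroup.map (σ : K →+* K) (d : GL (Fin 3) K), map_mem_GLe d.2 σ⟩

theorem coe_fieldMap (σ : K ≃+* K) (d : GLe p f K ε) :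
    (fieldMap σ d : GL (Fin 3) K) = Matrix.GeneralLinearGroup.map (σ : K →+* K) (d : GL (Fin 3) K) :=
  rfl

theorem map_map_GL (σ τ : K ≃+* K) (g : GL (Fin 3) K) :
    Matrix.GeneralLinearGroup.map (σ : K →+* K) (Matrix.GeneralLinearGroup.map (τ : K →+* K) g) =
      Matrix.GeneralLinearGroup.map ((σ * τ : K ≃+* K) : K →+* K) g := by
  ext i j
  simp [Matrix.GeneralLinearGroup.map_apply]

theorem map_one_GL (g : GL (Fin 3) K) :
    Matrix.GeneralLinearGroup.map ((1 : K ≃+* K) : K →+* K) g = g := by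
  ext i j
  simp [Matrix.GeneralLinearGroup.map_apply]

theorem twist_twist (d e : GLe p f K ε) (σ τ : K ≃+* K) (g : SLe p f K ε) :
    twist d σ (twist e τ g) = twist (d * fieldMap σ e) (σ * τ) g := by
  ext1
  simp only [coe_twist, coe_fieldMap, Subgroup.coe_mul, map_mul, map_inv, map_map_GL, mul_inv_rev,
    mul_assoc]

theorem twist_one_one (g : SLe p f K ε) : twist 1 1 g = g := by
  ext1
  simp [coe_twist, map_one_GL]

/-- `twist d σ` as an automorphism. -/
def twistEquiv (d : GLe p f K ε) (σ : K ≃+* K) : SLe p f K ε ≃* SLe p f K ε :=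
  MonoidHom.toMulEquiv (twist d σ) (twist (fieldMap σ⁻¹ d)⁻¹ σ⁻¹)
    (by
      ext1 g
      rw [MonoidHom.comp_apply, twist_twist, inv_mul_cancel, MonoidHom.id_apply, inv_mul_cancel,
        twist_one_one])
    (by
      ext1 g
      have : fieldMap σ ((fieldMap σ⁻¹ d)⁻¹) = d⁻¹ := by
        ext1
        simp only [coe_fieldMap, Subgroup.coe_inv, map_inv, map_map_GL, mul_inv_cancel, map_one_GL]
      rw [MonoidHom.comp_apply, twist_twist, this, mul_inv_cancel, mul_inv_cancel, twist_one_one]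
      rfl)

theorem twistEquiv_apply (d : GLe p f K ε) (σ : K ≃+* K) (g : SLe p f K ε) :
    twistEquiv d σ g = twist d σ g := rfl

/-- The automorphism of `PSL₃^ε(q)` induced by `g ↦ d σ(g) d⁻¹`. -/
def twistAut (d : GLe p f K ε) (σ : K ≃+* K) : MulAut (PSLe p f K ε) :=
  QuotientGroup.congr _ _ (twistEquiv d σ)
    (Subgroup.characteristic_iff_map_eq.mp inferInstance (twistEquiv d σ))

theorem twistAut_mk (d : GLe p f K ε) (σ : K ≃+* K) (g : SLe p f K ε) :
    twistAut d σ (g : PSLe p f K ε) = (twist d σ g : PSLe p f K ε) := rfl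

theorem twistAut_mul (d e : GLe p f K ε) (σ τ : K ≃+* K) :
    twistAut d σ * twistAut e τ = twistAut (d * fieldMap σ e) (σ * τ) := by
  ext x
  induction x using QuotientGroup.induction_on with
  | H g => rw [MulAut.mul_apply, twistAut_mk, twistAut_mk, twistAut_mk, twist_twist]

variable (p f K ε) in
/-- The group of automorphisms of `PSL₃^ε(q)` that are induced by semilinear maps. -/
def semilinearAut : Subgroup (MulAut (PSLe p f K ε)) where
  carrier := {φ | ∃ d σ, φ = twistAut d σ}
  one_mem' := ⟨1, 1, by
    ext x
    induction x using QuotientGroup.induction_on with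
    | H g => rw [twistAut_mk, twist_one_one]; rfl⟩
  mul_mem' := by
    rintro _ _ ⟨d, σ, rfl⟩ ⟨e, τ, rfl⟩
    exact ⟨_, _, twistAut_mul d e σ τ⟩
  inv_mem' := by
    rintro _ ⟨d, σ, rfl⟩
    refine ⟨(fieldMap σ⁻¹ d)⁻¹, σ⁻¹, ?_⟩
    rw [inv_eq_iff_mul_eq_one, twistAut_mul]
    have : fieldMap σ ((fieldMap σ⁻¹ d)⁻¹) = d⁻¹ := by
      ext1
      simp only [coe_fieldMap, Subgroup.coe_inv, map_inv, map_map_GL, mul_inv_cancel, map_one_GL]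
    rw [this, mul_inv_cancel, mul_inv_cancel]
    ext x
    induction x using QuotientGroup.induction_on with
    | H g => rw [twistAut_mk, twist_one_one]; rfl

theorem Inn_le_semilinearAut : Inn (PSLe p f K ε) ≤ semilinearAut p f K ε := by
  rintro _ ⟨x, rfl⟩
  induction x using QuotientGroup.induction_on with
  | H g =>
    refine ⟨⟨g, SLe_le_GLe g.2⟩, 1, ?_⟩
    ext y
    induction y using QuotientGroup.induction_on with
    | H h =>
      rw [twistAut_mk, MulAut.conj_apply, ← QuotientGroup.mk_mul, ← QuotientGroup.mk_inv,
        ← QuotientGroup.mk_mul]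
      congr 1

/-- The cyclic permutation matrix in `SL₃^ε(q)`. -/
def cyc : SLe p f K ε := ⟨mono 1 1, mem_SLe.mpr ⟨mono_mem_GLe.mpr fun _ => one_mem _, by simp [det_mono]⟩⟩

theorem coe_cyc : ((cyc : SLe p f K ε) : GL (Fin 3) K) = mono 1 1 := rfl

/-- The diagonal matrix `diag(1, z, z²)` in `SL₃^ε(q)` for a cube root of unity `z`. -/
def diagRoot (z : Kˣ) (hz : z ∈ scalars p f K ε) (hz3 : z ^ 3 = 1) : SLe p f K ε :=
  ⟨mono ![1, z, z ^ 2] 0, mem_SLe.mpr ⟨mono_mem_GLe.mpr fun i => by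
    fin_cases i
    · exact one_mem _
    · exact hz
    · exact pow_mem hz 2, by simp [det_mono, ← pow_succ', hz3]⟩⟩

theorem cyc_comm_apply {g : Matrix (Fin 3) (Fin 3) K} {c : K}
    (h : (mono 1 1 : GL (Fin 3) K) * g = c • (g * (mono 1 1 : GL (Fin 3) K))) (i j : Fin 3) :
    g (i + 1) (j + 1) = c * g i j := by
  have := congrFun (congrFun h i) (j + 1)
  rw [Matrix.mul_apply, Finset.sum_eq_single (i + 1), Matrix.smul_apply, Matrix.mul_apply,
    Finset.sum_eq_single j] at this
  · simpa [mono_apply] using this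
  · intro b _ hb
    simp [mono_apply, Ne.symm hb]
  · simp
  · intro b _ hb
    simp [mono_apply, hb]
  · simp

theorem diag_comm_apply {g : Matrix (Fin 3) (Fin 3) K} {a : Fin 3 → Kˣ} {c : K}
    (h : (mono a 0 : GL (Fin 3) K) * g = c • (g * (mono a 0 : GL (Fin 3) K))) (i j : Fin 3) :
    a i * g i j = c * (g i j * a j) := by
  have := congrFun (congrFun h i) j
  rw [Matrix.mul_apply, Finset.sum_eq_single i, Matrix.smul_apply, Matrix.mul_apply,
    Finset.sum_eq_single j] at this
  · simpa [mono_apply] using this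
  · intro b _ hb
    simp [mono_apply, Ne.symm hb]
  · simp
  · intro b _ hb
    simp [mono_apply, hb]
  · simp

theorem diagRoot_ne {z : Kˣ} (hz1 : z ≠ 1) (hz3 : z ^ 3 = 1) {i j : Fin 3} (hij : i ≠ j) :
    ((![1, z, z ^ 2] : Fin 3 → Kˣ) i : K) ≠ (![1, z, z ^ 2] : Fin 3 → Kˣ) j := by
  have h2 : z ^ 2 ≠ 1 := fun h => hz1 (by rw [pow_succ, h, one_mul] at hz3; exact hz3)
  have h3 : z ^ 2 ≠ z := fun h => hz1 (by rw [pow_two, mul_eq_left] at h; exact h)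
  rw [Ne, Units.val_inj]
  fin_cases i <;> fin_cases j <;> simp_all [Ne.symm hz1, Ne.symm h2, Ne.symm h3]

/-- A matrix commuting with `diag(1, z, z²)` and with the cyclic permutation matrix is scalar. -/
theorem eq_scalar_of_comm {z : Kˣ} (hz1 : z ≠ 1) (hz3 : z ^ 3 = 1) {g : GL (Fin 3) K}
    (h1 : mono ![1, z, z ^ 2] 0 * g = g * mono ![1, z, z ^ 2] 0) (h2 : mono 1 1 * g = g * mono 1 1) :
    ∃ c : Kˣ, g = mono (fun _ => c) 0 := by
  have h1' := fun i j => diag_comm_apply (g := (g : Matrix (Fin 3) (Fin 3) K)) (c := 1)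
    (by rw [one_smul, ← Units.val_mul, h1, Units.val_mul]) i j
  have h2' := fun i j => cyc_comm_apply (g := (g : Matrix (Fin 3) (Fin 3) K)) (c := 1)
    (by rw [one_smul, ← Units.val_mul, h2, Units.val_mul]) i j
  have hoff : ∀ i j, i ≠ j → g i j = 0 := by
    intro i j hij
    have h := h1' i j
    by_contra h0
    apply diagRoot_ne hz1 hz3 hij
    apply mul_right_cancel₀ h0
    rw [h]; ring
  have h00 : g 1 1 = g 0 0 := by simpa using h2' 0 0
  have h22 : g 2 2 = g 0 0 := by rw [← h00]; simpa using h2' 1 1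
  have hne : g 0 0 ≠ 0 := by
    intro h
    have := Matrix.GeneralLinearGroup.det_ne_zero g
    apply this
    rw [Matrix.det_fin_three, h00, h22, h, hoff 0 1 (by decide), hoff 0 2 (by decide)]
    ring
  refine ⟨Units.mk0 (g 0 0) hne, ?_⟩
  ext i j
  rw [mono_apply, add_zero]
  by_cases hij : j = i
  · subst hij
    rw [if_pos rfl]
    fin_cases j
    · rfl
    · exact h00
    · exact h22
  · rw [if_neg hij, hoff i j (Ne.symm hij)]

theorem mem_center_SLe {z : Kˣ} (hz : z ∈ scalars p f K ε) (hz1 : z ≠ 1) (hz3 : z ^ 3 = 1)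
    {g : SLe p f K ε} :
    g ∈ Subgroup.center (SLe p f K ε) ↔ ∃ c : Kˣ, (g : GL (Fin 3) K) = mono (fun _ => c) 0 := by
  rw [Subgroup.mem_center_iff]
  constructor
  · intro h
    exact eq_scalar_of_comm hz1 hz3 (congrArg Subtype.val (h (diagRoot z hz hz3)))
      (congrArg Subtype.val (h cyc))
  · rintro ⟨c, hc⟩ h
    ext1
    rw [Subgroup.coe_mul, Subgroup.coe_mul, hc, mono_const_comm]

theorem mem_center_GLe {z : Kˣ} (hz : z ∈ scalars p f K ε) (hz1 : z ≠ 1) (hz3 : z ^ 3 = 1)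
    {g : GLe p f K ε} :
    g ∈ Subgroup.center (GLe p f K ε) ↔ ∃ c : Kˣ, (g : GL (Fin 3) K) = mono (fun _ => c) 0 := by
  rw [Subgroup.mem_center_iff]
  constructor
  · intro h
    exact eq_scalar_of_comm hz1 hz3 (congrArg Subtype.val (h ⟨_, (diagRoot z hz hz3).2.1⟩))
      (congrArg Subtype.val (h ⟨_, (cyc : SLe p f K ε).2.1⟩))
  · rintro ⟨c, hc⟩ h
    ext1
    rw [Subgroup.coe_mul, Subgroup.coe_mul, hc, mono_const_comm]

end Basic

end SL3Sylow

namespace SL3Sylow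

/-! ### The monomial Sylow 3-subgroup. -/

section Sylow3

variable {p f : ℕ} {K : Type*} [Field K] [ExpChar K p] {ε : ℤˣ}

variable (p f K ε) in
/-- The monomial matrices with entries in the scalars of `3`-power order and with cyclic
permutation part. -/
def monoGroup : Subgroup (GL (Fin 3) K) where
  carrier := {g | ∃ a k, (∀ i, a i ∈ scalars3 p f K ε) ∧ g = mono a k}
  one_mem' := ⟨1, 0, fun _ => one_mem _, mono_one.symm⟩
  mul_mem' := by
    rintro _ _ ⟨a, k, ha, rfl⟩ ⟨b, l, hb, rfl⟩
    exact ⟨_, _, fun i => mul_mem (ha i) (hb _), mono_mul a b k l⟩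
  inv_mem' := by
    rintro _ ⟨a, k, ha, rfl⟩
    exact ⟨_, _, fun i => inv_mem (ha _), mono_inv a k⟩

theorem mono_mem_monoGroup {a : Fin 3 → Kˣ} {k : Fin 3} (h : ∀ i, a i ∈ scalars3 p f K ε) :
    mono a k ∈ monoGroup p f K ε := ⟨a, k, h, rfl⟩

theorem monoGroup_le : monoGroup p f K ε ≤ GLe p f K ε := by
  rintro _ ⟨a, k, ha, rfl⟩
  exact mono_mem_GLe.mpr fun i => scalars3_le (ha i)

theorem mono_zero_pow (a : Fin 3 → Kˣ) (n : ℕ) : (mono a 0) ^ n = mono (a ^ n) 0 := by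
  induction n with
  | zero => rw [pow_zero, pow_zero, mono_one]
  | succ n ih =>
    rw [pow_succ, ih, mono_mul]
    congr 1
    ext i
    simp [pow_succ]

theorem isPGroup_monoGroup : IsPGroup 3 (monoGroup p f K ε) := by
  rw [isPGroup_iff_pow_pow_eq_one]
  rintro ⟨_, a, k, ha, rfl⟩
  have h3 : k + k + k = 0 := by revert k; decide
  have hb : ∃ b : Fin 3 → Kˣ, (∀ i, b i ∈ scalars3 p f K ε) ∧ (mono a k) ^ 3 = mono b 0 := by
    have e : (mono a k) ^ 3 = mono (fun i => a i * a (i + k) * a (i + (k + k))) 0 := by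
      rw [pow_succ, pow_two, mono_mul, mono_mul, h3]
    exact ⟨_, fun i => mul_mem (mul_mem (ha _) (ha _)) (ha _), e⟩
  obtain ⟨b, hb, hbk⟩ := hb
  choose n hn using fun i => (hb i).2
  refine ⟨1 + (n 0 + n 1 + n 2), ?_⟩
  ext1
  rw [Subgroup.coe_pow, Subgroup.coe_one, pow_add, pow_mul, pow_one, hbk, mono_zero_pow, ← mono_one]
  congr 1
  ext1 i
  rw [Pi.pow_apply, Pi.one_apply, ← orderOf_dvd_iff_pow_eq_one]
  refine (orderOf_dvd_of_pow_eq_one (hn i)).trans (pow_dvd_pow 3 ?_)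
  fin_cases i <;> simp <;> omega

theorem trace_mono_of_ne {a : Fin 3 → Kˣ} {k : Fin 3} (hk : k ≠ 0) :
    Matrix.trace (mono a k : Matrix (Fin 3) (Fin 3) K) = 0 := by
  rw [Matrix.trace]
  apply Finset.sum_eq_zero
  intro i _
  simp [mono_apply, hk]

/-- The diagonal matrix with a single entry `z ≠ 1` has trace `z + 2 ≠ 0`, whereas a nontrivial
permutation part forces trace 0; so its conjugate by `y` is again diagonal. Each row of `y` is then
an eigenvector, and positions `j` and `j'` belong to the distinct eigenvalues `z` and 1. This makes
`y` monomial. -/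
theorem eq_zero_or_of_normalizes {z : Kˣ} (hz : z ∈ scalars3 p f K ε) (hz1 : z ≠ 1)
    (hz3 : z ^ 3 = 1) {y : GL (Fin 3) K}
    (hy : ∀ x ∈ monoGroup p f K ε, y * x * y⁻¹ ∈ monoGroup p f K ε) (i j j' : Fin 3)
    (hjj : j ≠ j') : y i j = 0 ∨ y i j' = 0 := by
  have he : mono (Pi.mulSingle j z) 0 ∈ monoGroup p f K ε := by
    apply mono_mem_monoGroup
    intro l
    by_cases h : l = j
    · subst h; simpa using hz
    · simp [Pi.mulSingle_eq_of_ne h, one_mem]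
  obtain ⟨a, k, -, hak⟩ := hy _ he
  have hk : k = 0 := by
    by_contra hk
    have h1 := trace_mono_of_ne (a := a) hk
    rw [← hak] at h1
    rw [Units.val_mul, Matrix.trace_mul_comm, ← Units.val_mul, ← mul_assoc, inv_mul_cancel,
      one_mul] at h1
    have h2 : (z : K) + 2 = 0 := by
      rw [← h1, Matrix.trace, Fin.sum_univ_three]
      fin_cases j <;> simp [mono_apply] <;> ring
    have h3 := three_ne_zero_of_cube_root hz1 hz3
    have h4 := cube_root_sum hz1 hz3
    apply h3
    linear_combination h4 + (1 - z) * h2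
  subst hk
  have h1 : y * mono (Pi.mulSingle j z) 0 = mono a 0 * y := by
    rw [← hak, inv_mul_cancel_right]
  have h2 : ∀ l, y i l * (Pi.mulSingle (M := fun _ => Kˣ) j z l : Kˣ) = a i * y i l := by
    intro l
    have := congrArg (fun g : GL (Fin 3) K => g i l) h1
    simp only [Units.val_mul] at this
    rw [Matrix.mul_apply, Matrix.mul_apply, Finset.sum_eq_single l, Finset.sum_eq_single i] at this
    · simpa [mono_apply] using this
    · intro b _ hb; simp [mono_apply, hb]
    · simp
    · intro b _ hb; simp [mono_apply, Ne.symm hb]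
    · simp
  by_contra hcon
  push Not at hcon
  have e1 := h2 j
  have e2 := h2 j'
  rw [Pi.mulSingle_eq_same, mul_comm] at e1
  rw [Pi.mulSingle_eq_of_ne (Ne.symm hjj), mul_comm] at e2
  have e3 := mul_right_cancel₀ hcon.1 e1
  have e4 := mul_right_cancel₀ hcon.2 e2
  apply hz1
  ext
  rw [e3, ← e4]

/-- The image of the cyclic permutation matrix under conjugation by `y` reveals the permutation part
of `y`: shift 1 means that it is cyclic, shift 2 that it is a transposition. In the cyclic case the
entries of `y` agree up to scalars of 3-power order, and the determinant, itself of 3-power order,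
controls their common class. -/
theorem mem_monoGroup_of_normalizes {z : Kˣ} (hz : z ∈ scalars3 p f K ε) (hz1 : z ≠ 1)
    (hz3 : z ^ 3 = 1) {y : GL (Fin 3) K} (hyG : y ∈ GLe p f K ε)
    (hy : ∀ x ∈ monoGroup p f K ε, y * x * y⁻¹ ∈ monoGroup p f K ε)
    (hpow : ∃ n, y ^ 3 ^ n = 1) : y ∈ monoGroup p f K ε := by
  have hrow := eq_zero_or_of_normalizes hz hz1 hz3 hy
  have hne : ∀ i, ∃ j, y i j ≠ 0 := by
    intro i
    by_contra hcon
    push Not at hcon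
    exact Matrix.GeneralLinearGroup.det_ne_zero y (Matrix.det_eq_zero_of_row_eq_zero i hcon)
  obtain ⟨b, l, hb, hbl⟩ := hy (mono 1 1) (mono_mem_monoGroup fun _ => one_mem _)
  have h1 : y * mono 1 1 = mono b l * y := by rw [← hbl, inv_mul_cancel_right]
  have h2 : ∀ i j, y i j = b i * y (i + l) (j + 1) := by
    intro i j
    have := congrArg (fun g : GL (Fin 3) K => g i (j + 1)) h1
    simp only [Units.val_mul] at this
    rw [Matrix.mul_apply, Matrix.mul_apply, Finset.sum_eq_single j,
      Finset.sum_eq_single (i + l)] at this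
    · simpa [mono_apply] using this
    · intro c _ hc; simp [mono_apply, hc]
    · simp
    · intro c _ hc; simp [mono_apply, Ne.symm hc]
    · simp
  have h3 : ∀ i j, y i j ≠ 0 → y (i + l) (j + 1) ≠ 0 := by
    intro i j h h'
    apply h
    rw [h2, h', mul_zero]
  obtain ⟨k, hk⟩ := hne 0
  have hl : l = 0 ∨ l = 1 ∨ l = 2 := (by decide : ∀ l : Fin 3, l = 0 ∨ l = 1 ∨ l = 2) l
  rcases hl with rfl | rfl | rfl
  -- With shift 0 a nonzero entry in row 0 would be accompanied by a second nonzero entry in the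
  -- same row.
  · exfalso
    have h4 := h3 0 k hk
    rcases hrow 0 k (k + 1) (by simp) with h | h
    · exact hk h
    · exact h4 (by simpa using h)
  · have hall : ∀ i, y i (i + k) ≠ 0 := by
      have h4 := h3 0 k hk
      have h5 := h3 _ _ h4
      intro i
      fin_cases i
      · simpa using hk
      · simpa [add_comm] using h4
      · have e : k + 1 + 1 = 2 + k := (by decide : ∀ k : Fin 3, k + 1 + 1 = 2 + k) k
        rw [e] at h5
        exact h5
    set a : Fin 3 → Kˣ := fun i => Units.mk0 (y i (i + k)) (hall i) with ha
    have hya : y = mono a k := by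
      ext i j
      rw [mono_apply]
      split_ifs with h
      · subst h; rfl
      · rcases hrow i j (i + k) h with h' | h'
        · exact h'
        · exact absurd h' (hall i)
    refine ⟨a, k, ?_, hya⟩
    rw [hya, mono_mul, mono_mul] at h1
    obtain ⟨h6, -⟩ := mono_injective h1
    have h7 : ∀ i, a i = b i * a (i + 1) := fun i => by simpa using congrFun h6 i
    have hsc : ∀ i, a i ∈ scalars p f K ε := mono_mem_GLe.mp (hya ▸ hyG)
    have hprod : a 0 * a 1 * a 2 ∈ scalars3 p f K ε := by
      obtain ⟨n, hn⟩ := hpow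
      refine ⟨mul_mem (mul_mem (hsc 0) (hsc 1)) (hsc 2), n, ?_⟩
      rw [← det_mono a k, ← hya, ← map_pow, hn, map_one]
    have h2' : a 2 ∈ scalars3 p f K ε := by
      apply mem_scalars3_of_pow (hsc 2) (n := 1)
      have e0 := h7 0
      have e1 := h7 1
      simp only [zero_add] at e0
      have e1 : a 1 = b 1 * a 2 := e1
      have : a 2 ^ 3 ^ 1 = (a 0 * a 1 * a 2) * ((b 0)⁻¹ * (b 1)⁻¹ ^ 2) := by
        rw [e0, e1]
        simp only [pow_one]
        ext
        push_cast
        field_simp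
      rw [this]
      exact mul_mem hprod (mul_mem (inv_mem (hb 0)) (pow_mem (inv_mem (hb 1)) 2))
    have h1' : a 1 ∈ scalars3 p f K ε := by rw [h7 1]; exact mul_mem (hb 1) h2'
    intro i
    fin_cases i
    · show a 0 ∈ _
      rw [h7 0]; exact mul_mem (hb 0) h1'
    · exact h1'
    · exact h2'
  -- The support of `y` lies on `i + j = k`. Even powers are diagonal and odd powers keep this
  -- support, so the odd power `y ^ 3 ^ n` cannot be the identity: its entries at `(0, 0)` and `(1,
  -- 1)` would give two values of `k`.
  · exfalso
    have hsupp : ∀ i j, i + j ≠ k → y i j = 0 := by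
      have h4 := h3 0 k hk
      have h5 := h3 _ _ h4
      intro i j hij
      have : y i (k - i) ≠ 0 := by
        have e : ∀ i k : Fin 3, (i = 0 ∧ k - i = k) ∨ (i = 0 + 2 ∧ k - i = k + 1) ∨
          (i = 0 + 2 + 2 ∧ k - i = k + 1 + 1) := by decide
        rcases e i k with ⟨e1, e2⟩ | ⟨e1, e2⟩ | ⟨e1, e2⟩ <;> rw [e1] at e2 ⊢ <;> rw [e2]
        · exact hk
        · exact h4
        · exact h5
      rcases hrow i j (k - i) (by intro h; apply hij; rw [h]; simp) with h' | h'
      · exact h'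
      · exact absurd h' this
    have hsq : ∀ i j, i ≠ j → (y ^ 2) i j = 0 := by
      intro i j hij
      rw [pow_two, Units.val_mul, Matrix.mul_apply]
      apply Finset.sum_eq_zero
      intro c _
      by_cases h : i + c = k
      · rw [hsupp c j, mul_zero]
        intro h'
        apply hij
        have : i + c = j + c := by rw [h, ← h', add_comm]
        simpa using this
      · rw [hsupp i c h, zero_mul]
    have hev : ∀ n, ∀ i j, i ≠ j → (y ^ (2 * n)) i j = 0 := by
      intro n
      induction n with
      | zero => intro i j hij; simp [hij]
      | succ n ih =>
        intro i j hij
        rw [mul_add, mul_one, pow_add, Units.val_mul, Matrix.mul_apply]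
        apply Finset.sum_eq_zero
        intro c _
        by_cases h : i = c
        · rw [hsq c j (h ▸ hij), mul_zero]
        · rw [ih i c h, zero_mul]
    have hodd : ∀ n, ∀ i j, i + j ≠ k → (y ^ (2 * n + 1)) i j = 0 := by
      intro n i j hij
      rw [pow_succ, Units.val_mul, Matrix.mul_apply]
      apply Finset.sum_eq_zero
      intro c _
      by_cases h : i = c
      · rw [hsupp c j (h ▸ hij), mul_zero]
      · rw [hev n i c h, zero_mul]
    obtain ⟨n, hn⟩ := hpow
    obtain ⟨m, hm⟩ : Odd (3 ^ n) := Odd.pow (by decide)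
    rw [hm] at hn
    have h0 := hodd m 0 0
    have h1 := hodd m 1 1
    rw [hn] at h0 h1
    simp only [Units.val_one, Matrix.one_apply_eq, one_ne_zero, imp_false, not_not] at h0 h1
    rw [← h0] at h1
    exact absurd h1 (by decide)

/-- `[N : H ∩ N] = [HN : H]`, which divides the index of `H`. -/
theorem not_dvd_relIndex_of_normal {G : Type*} [Group G] [Finite G] (H N : Subgroup G) [N.Normal] {n : ℕ}
    (h : ¬ n ∣ H.index) : ¬ n ∣ H.relIndex N := by
  have h1 : (H ⊓ N).relIndex H * H.relIndex (H ⊔ N) = (H ⊓ N).relIndex (H ⊔ N) :=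
    Subgroup.relIndex_mul_relIndex _ _ _ inf_le_left le_sup_left
  have h2 : (H ⊓ N).relIndex N * N.relIndex (H ⊔ N) = (H ⊓ N).relIndex (H ⊔ N) :=
    Subgroup.relIndex_mul_relIndex _ _ _ inf_le_right le_sup_right
  rw [Subgroup.relIndex_sup_right, Subgroup.inf_relIndex_right] at h2
  rw [Subgroup.inf_relIndex_left] at h1
  rw [← h2, mul_comm] at h1
  have h3 : N.relIndex H ≠ 0 := Subgroup.index_ne_zero_of_finite
  have h4 := Nat.eq_of_mul_eq_mul_right (Nat.pos_of_ne_zero h3) h1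
  rw [← h4]
  exact fun hd => h (hd.trans (Subgroup.relIndex_dvd_index_of_le le_sup_left))

variable (p f K ε) in
/-- The standard Sylow `3`-subgroup of `SL₃^ε(q)`. -/
def sylQ : Subgroup (SLe p f K ε) := (monoGroup p f K ε).subgroupOf (SLe p f K ε)

theorem isPGroup_sylQ : IsPGroup 3 (sylQ p f K ε) :=
  isPGroup_monoGroup.comap_of_injective _ Subtype.val_injective

/-- The monomial group is a Sylow subgroup of `GL₃^ε(q)`, and a Sylow subgroup meets the normal
subgroup `SL₃^ε(q)` in a Sylow subgroup. -/
theorem not_dvd_index_sylQ [Finite K] {z : Kˣ} (hz : z ∈ scalars3 p f K ε) (hz1 : z ≠ 1)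
    (hz3 : z ^ 3 = 1) : ¬ 3 ∣ (sylQ p f K ε).index := by
  have : Finite (GL (Fin 3) K) := inferInstance
  obtain ⟨P, hP⟩ := exists_sylow_coe_eq (p := 3)
    ((monoGroup p f K ε).subgroupOf (GLe p f K ε))
    (isPGroup_monoGroup.comap_of_injective _ Subtype.val_injective) (by
      intro y hy hpow
      rw [Subgroup.mem_subgroupOf]
      refine mem_monoGroup_of_normalizes hz hz1 hz3 y.2 ?_ ?_
      · intro x hx
        exact hy ⟨x, monoGroup_le hx⟩ hx
      · obtain ⟨k, hk⟩ := hpow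
        exact ⟨k, by simpa using congrArg Subtype.val hk⟩)
  have h1 := P.not_dvd_index
  rw [hP] at h1
  have : ((SLe p f K ε).subgroupOf (GLe p f K ε)).Normal := ⟨by
    intro n hn g
    exact conj_mem_SLe g.2 hn⟩
  have h2 := not_dvd_relIndex_of_normal _ ((SLe p f K ε).subgroupOf (GLe p f K ε)) h1
  rwa [Subgroup.relIndex_subgroupOf SLe_le_GLe] at h2

end Sylow3

end SL3Sylow

namespace SL3Sylow

/-! ### The abelianization of the Sylow 3-subgroup, via commutators with the cyclic permutation. -/

section Extension

variable {p f : ℕ} {K : Type*} [Field K] [ExpChar K p] {ε : ℤˣ}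

/-- The commutator of the diagonal matrix `u` with the cyclic permutation matrix. -/
def commDiag : (Fin 3 → Kˣ) →* GL (Fin 3) K where
  toFun u := mono (fun i => u i * (u (i + 1))⁻¹) 0
  map_one' := by
    rw [← mono_one]
    congr 1
    ext i
    simp
  map_mul' u v := by
    rw [mono_mul]
    congr 1
    ext i
    simp only [Pi.mul_apply, add_zero, mul_inv]
    rw [mul_mul_mul_comm]

theorem commDiag_apply (u : Fin 3 → Kˣ) :
    (commDiag u : GL (Fin 3) K) = mono (fun i => u i * (u (i + 1))⁻¹) 0 := rfl

theorem commDiag_eq (u : Fin 3 → Kˣ) :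
    (commDiag u : GL (Fin 3) K) = mono u 0 * mono 1 1 * (mono u 0)⁻¹ * (mono 1 1)⁻¹ := by
  rw [commDiag_apply, mono_inv, mono_inv, mono_mul, mono_mul, mono_mul]
  congr 1
  ext i
  simp

theorem commDiag_const (c : Kˣ) : (commDiag (fun _ => c) : GL (Fin 3) K) = 1 := by
  rw [commDiag_apply, ← mono_one]
  congr 1
  ext i
  simp

theorem commDiag_mem_SLe {u : Fin 3 → Kˣ} (hu : ∀ i, u i ∈ scalars p f K ε) :
    commDiag u ∈ SLe p f K ε := by
  refine mem_SLe.mpr ⟨mono_mem_GLe.mpr fun i => mul_mem (hu _) (inv_mem (hu _)), ?_⟩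
  rw [commDiag_eq]
  simp only [map_mul, map_inv]
  rw [mul_right_comm, mul_inv_cancel_right, mul_inv_cancel]

variable (p f K ε) in
/-- The diagonal matrices in the standard Sylow `3`-subgroup. -/
def sylT : Subgroup (SLe p f K ε) where
  carrier := {g | ∃ a, (∀ i, a i ∈ scalars3 p f K ε) ∧ (g : GL (Fin 3) K) = mono a 0}
  one_mem' := ⟨1, fun _ => one_mem _, mono_one.symm⟩
  mul_mem' := by
    rintro g h ⟨a, ha, h1⟩ ⟨b, hb, h2⟩
    exact ⟨_, fun i => mul_mem (ha i) (hb _), by rw [Subgroup.coe_mul, h1, h2, mono_mul, add_zero]⟩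
  inv_mem' := by
    rintro g ⟨a, ha, h1⟩
    exact ⟨_, fun i => inv_mem (ha _), by rw [Subgroup.coe_inv, h1, mono_inv, neg_zero]⟩

theorem sylT_le : sylT p f K ε ≤ sylQ p f K ε := by
  rintro g ⟨a, ha, h⟩
  exact ⟨a, 0, ha, h⟩

theorem cyc_mem_sylQ : (cyc : SLe p f K ε) ∈ sylQ p f K ε := ⟨1, 1, fun _ => one_mem _, rfl⟩

theorem mono_one_pow (n : ℕ) : (mono (1 : Fin 3 → Kˣ) 1 : GL (Fin 3) K) ^ n =
    mono 1 (Fin.ofNat 3 n) := by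
  induction n with
  | zero => rw [pow_zero, ← mono_one]; rfl
  | succ n ih =>
    rw [pow_succ, ih, mono_mul]
    congr 1
    · ext i
      simp
    · ext
      simp [Fin.val_add]

theorem cyc_pow_three : (cyc : SLe p f K ε) ^ 3 = 1 := by
  ext1
  rw [Subgroup.coe_pow, coe_cyc, mono_one_pow, Subgroup.coe_one, ← mono_one]
  rfl

theorem exists_cyc_inv_mul_mem {g : SLe p f K ε} (hg : g ∈ sylQ p f K ε) :
    ∃ k : Fin 3, (cyc ^ (k : ℕ))⁻¹ * g ∈ sylT p f K ε := by
  obtain ⟨a, k, ha, h⟩ := hg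
  refine ⟨k, fun i => a (i - k), fun i => ha _, ?_⟩
  rw [Subgroup.coe_mul, Subgroup.coe_inv, Subgroup.coe_pow, coe_cyc, mono_one_pow,
    show Fin.ofNat 3 (k : ℕ) = k from by ext; simp]
  rw [show (g : GL (Fin 3) K) = mono a k from h, mono_inv, mono_mul]
  simp [sub_eq_add_neg]

/-- The commutators of the cyclic permutation matrix with the diagonal matrices of determinant `1`
in the standard Sylow `3`-subgroup lie in its derived subgroup. -/
theorem commDiag_mem_commutator {u : Fin 3 → Kˣ} (hu : ∀ i, u i ∈ scalars3 p f K ε)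
    (h1 : u 0 * u 1 * u 2 = 1) {g : SLe p f K ε} (hg : (g : GL (Fin 3) K) = commDiag u) :
    g ∈ ⁅sylQ p f K ε, sylQ p f K ε⁆ := by
  have hd : mono u 0 ∈ SLe p f K ε :=
    mem_SLe.mpr ⟨mono_mem_GLe.mpr fun i => scalars3_le (hu i), by rw [det_mono, h1]⟩
  have : g = (⟨mono u 0, hd⟩ : SLe p f K ε) * cyc * (⟨mono u 0, hd⟩ : SLe p f K ε)⁻¹ * cyc⁻¹ := by
    ext1
    rw [hg, commDiag_eq]
    rfl
  rw [this]
  exact Subgroup.commutator_mem_commutator ⟨u, 0, hu, rfl⟩ cyc_mem_sylQ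

/-- The equations `u i / u (i + 1) = a i` are solved recursively from `u 0 = 1`; the last one holds
because the product of the `a i` is 1. -/
theorem exists_commDiag {g : SLe p f K ε} (hg : g ∈ sylT p f K ε) :
    ∃ u : Fin 3 → Kˣ, (∀ i, u i ∈ scalars3 p f K ε) ∧ (g : GL (Fin 3) K) = commDiag u := by
  obtain ⟨a, ha, h⟩ := hg
  have hdet : a 0 * a 1 * a 2 = 1 := by
    rw [← det_mono a 0, ← show (g : GL (Fin 3) K) = mono a 0 from h]
    exact (mem_SLe.mp g.2).2
  refine ⟨![1, (a 0)⁻¹, (a 0)⁻¹ * (a 1)⁻¹], ?_, ?_⟩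
  · intro i
    fin_cases i
    · exact one_mem _
    · exact inv_mem (ha 0)
    · exact mul_mem (inv_mem (ha 0)) (inv_mem (ha 1))
  · rw [show (g : GL (Fin 3) K) = mono a 0 from h, commDiag_apply]
    congr 1
    ext1 i
    fin_cases i
    · simp
    · simp
    · simp only [Fin.reduceFinMk, Fin.isValue, Matrix.cons_val, Fin.reduceAdd, Matrix.cons_val_zero,
        inv_one, mul_one]
      rw [← mul_inv, eq_inv_iff_mul_eq_one, ← hdet]
      exact mul_comm _ _

/-- The scalar `β` of `3`-power order generates the scalars of `3`-power order modulo cubes. -/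
def IsNoncube (p f : ℕ) {K : Type*} [Field K] (ε : ℤˣ) (β : Kˣ) : Prop :=
  β ∈ scalars3 p f K ε ∧
    ∀ x ∈ scalars3 p f K ε, ∃ l : Fin 3, ∃ c ∈ scalars3 p f K ε, x = β ^ (l : ℕ) * c ^ 3

theorem IsGen3.isNoncube {α : Kˣ} (hα : IsGen3 p f ε α) : IsNoncube p f ε α :=
  ⟨hα.1, fun _ hx => hα.exists_pow_mul_cube hx⟩

/-- `j` is its own inverse modulo 3, so `β` is recovered from `β ^ j` up to a cube. -/
theorem IsNoncube.pow_mul_cube {β : Kˣ} (hβ : IsNoncube p f ε β) {j : ℕ} (hj : ¬ 3 ∣ j) {c : Kˣ}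
    (hc : c ∈ scalars3 p f K ε) : IsNoncube p f ε (β ^ j * c ^ 3) := by
  refine ⟨mul_mem (pow_mem hβ.1 _) (pow_mem hc 3), ?_⟩
  intro x hx
  obtain ⟨l, d, hd, rfl⟩ := hβ.2 x hx
  have hj2 : j * j % 3 = 1 := by
    have : j % 3 = 1 ∨ j % 3 = 2 := by omega
    rcases this with h | h <;> simp [Nat.mul_mod, h]
  obtain ⟨t, ht⟩ : ∃ t, j * j = 3 * t + 1 := ⟨j * j / 3, by omega⟩
  refine ⟨⟨(j * l) % 3, Nat.mod_lt _ (by norm_num)⟩,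
    d * (β⁻¹) ^ (t * l) * (c⁻¹) ^ (j * l % 3) * (β ^ j) ^ (j * l / 3),
    mul_mem (mul_mem (mul_mem hd (pow_mem (inv_mem hβ.1) _)) (pow_mem (inv_mem hc) _))
      (pow_mem (pow_mem hβ.1 _) _), ?_⟩
  have h1 : β ^ (l : ℕ) * β ^ (3 * t * l) = (β ^ j) ^ (j * l % 3) * (β ^ j) ^ (3 * (j * l / 3)) := by
    rw [← pow_add, ← pow_add, Nat.mod_add_div, ← pow_mul]
    congr 1
    rw [← mul_assoc, ht]; ring
  have h2 : β ^ (l : ℕ) = (β ^ j) ^ (j * l % 3) * (β ^ j) ^ (3 * (j * l / 3)) * (β⁻¹) ^ (3 * t * l) := by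
    rw [← h1, inv_pow, mul_inv_cancel_right]
  rw [h2]
  ext
  push_cast
  have hc0 : (c : K) ≠ 0 := c.ne_zero
  have hb0 : (β : K) ≠ 0 := β.ne_zero
  simp only [mul_pow, ← pow_mul, mul_comm (3 : ℕ), inv_pow]
  rw [show t * 3 * l = t * l * 3 by ring]
  field_simp
  congr 1
  ring

/-- Writing a diagonal element as `commDiag u`, only the class of `u 0 * u 1 * u 2` modulo cubes
matters: it is matched by a power of `β`, and the remaining cube is removed by dividing `u` by a
scalar, on which `commDiag` is trivial. -/
theorem IsNoncube.exists_inv_mul_mem {β : Kˣ} (hβ : IsNoncube p f ε β) {g : SLe p f K ε}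
    (hg : g ∈ sylT p f K ε) {t : SLe p f K ε} (ht : (t : GL (Fin 3) K) = commDiag ![β, 1, 1]) :
    ∃ l : Fin 3, (t ^ (l : ℕ))⁻¹ * g ∈ ⁅sylQ p f K ε, sylQ p f K ε⁆ := by
  obtain ⟨u, hu, h⟩ := exists_commDiag hg
  obtain ⟨l, c, hc, hl⟩ := hβ.2 _ (mul_mem (mul_mem (hu 0) (hu 1)) (hu 2))
  refine ⟨l, ?_⟩
  refine commDiag_mem_commutator (u := (![β, 1, 1] ^ (l : ℕ))⁻¹ * u * (fun _ => c)⁻¹) ?_ ?_ ?_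
  · intro i
    refine mul_mem (mul_mem (inv_mem (pow_mem ?_ _)) (hu i)) (inv_mem hc)
    fin_cases i
    · exact hβ.1
    · exact one_mem _
    · exact one_mem _
  · simp only [Pi.mul_apply, Pi.inv_apply, Pi.pow_apply]
    simp only [Fin.isValue, Matrix.cons_val_zero, Matrix.cons_val_one, one_pow, inv_one, one_mul,
      Matrix.cons_val]
    calc _ = (β ^ (l : ℕ))⁻¹ * (u 0 * u 1 * u 2) * (c ^ 3)⁻¹ := by
            rw [pow_three, mul_inv, mul_inv]
            simp only [mul_assoc, mul_comm, mul_left_comm]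
      _ = 1 := by rw [hl, inv_mul_cancel_left, mul_inv_cancel]
  · rw [Subgroup.coe_mul, Subgroup.coe_inv, Subgroup.coe_pow, h, ht, map_mul, map_mul, map_inv,
      map_inv, map_pow, commDiag_const, inv_one, mul_one]

variable {X : Type*} [Group X] (ι : SLe p f K ε →* X)

theorem mem_commutator_iff_coe {G : Type*} [Group G] (H : Subgroup G) (x : H) :
    x ∈ commutator H ↔ (x : G) ∈ ⁅H, H⁆ := by
  rw [← Subgroup.map_subtype_commutator, Subgroup.mem_map]
  constructor
  · intro h
    exact ⟨x, h, rfl⟩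
  · rintro ⟨y, hy, h⟩
    rwa [← Subtype.ext h]

theorem index_commutator_coe {G : Type*} [Group G] (H : Subgroup G) :
    (commutator H).index = ⁅H, H⁆.relIndex H := by
  rw [Subgroup.relIndex]
  congr 1
  ext x
  rw [mem_commutator_iff_coe, Subgroup.mem_subgroupOf]

instance finite_map_sylQ [Finite K] : Finite ((sylQ p f K ε).map ι) :=
  Finite.of_surjective _ (ι.subgroupMap_surjective (sylQ p f K ε))

/-- The image is a 3-group, and the four products of `diag(1, z, z²)` or 1 with `cyc` or 1 are
distinct modulo scalars. So its order exceeds 3. -/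
theorem nine_dvd_card_map [Finite K] {z : Kˣ} (hz : z ∈ scalars3 p f K ε) (hz1 : z ≠ 1) (hz3 : z ^ 3 = 1)
    (hker : ι.ker ≤ Subgroup.center _) : 3 ^ 2 ∣ Nat.card ((sylQ p f K ε).map ι) := by
  have hp : IsPGroup 3 ((sylQ p f K ε).map ι) := isPGroup_sylQ.map ι
  obtain ⟨n, hn⟩ := IsPGroup.iff_card.mp hp
  rw [hn]
  apply pow_dvd_pow
  by_contra hlt
  have hle : Nat.card ((sylQ p f K ε).map ι) ≤ 3 := by
    rw [hn]
    calc 3 ^ n ≤ 3 ^ 1 := Nat.pow_le_pow_right (by norm_num) (by omega)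
      _ = 3 := by norm_num
  set t : SLe p f K ε := diagRoot z (scalars3_le hz) hz3 with ht
  have htQ : t ∈ sylQ p f K ε := by
    refine ⟨![1, z, z ^ 2], 0, ?_, rfl⟩
    intro i
    fin_cases i
    · exact one_mem _
    · exact hz
    · exact pow_mem hz 2
  let r : Fin 2 × Fin 2 → (sylQ p f K ε).map ι := fun x =>
    ⟨ι (t ^ (x.1 : ℕ) * cyc ^ (x.2 : ℕ)), Subgroup.mem_map_of_mem _
      (mul_mem (pow_mem htQ _) (pow_mem cyc_mem_sylQ _))⟩
  have hinj : Function.Injective r := by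
    rintro ⟨i, j⟩ ⟨i', j'⟩ h
    have h1 : ι (t ^ (i : ℕ) * cyc ^ (j : ℕ)) = ι (t ^ (i' : ℕ) * cyc ^ (j' : ℕ)) :=
      congrArg Subtype.val h
    rw [← inv_mul_eq_one, ← map_inv, ← map_mul, ← MonoidHom.mem_ker] at h1
    obtain ⟨c, hc⟩ := (mem_center_SLe (scalars3_le hz) hz1 hz3).mp (hker h1)
    have h2 : ((t ^ (i' : ℕ) * cyc ^ (j' : ℕ) : SLe p f K ε) : GL (Fin 3) K) =
        ((t ^ (i : ℕ) * cyc ^ (j : ℕ) : SLe p f K ε) : GL (Fin 3) K) * mono (fun _ => c) 0 := by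
      rw [← hc, ← Subgroup.coe_mul, mul_inv_cancel_left]
    simp only [Subgroup.coe_mul, Subgroup.coe_pow, coe_cyc, mono_one_pow] at h2
    have h3 : (t : GL (Fin 3) K) = mono ![1, z, z ^ 2] 0 := rfl
    rw [h3, mono_zero_pow, mono_zero_pow, mono_mul, mono_mul, mono_mul] at h2
    obtain ⟨h4, h5⟩ := mono_injective h2
    have h6 := congrFun h4 0
    have h7 := congrFun h4 1
    simp at h6 h7
    rw [← h6, mul_one] at h7
    have hjj : j' = j := by
      have : ∀ j j' : Fin 2, Fin.ofNat 3 (j' : ℕ) = Fin.ofNat 3 (j : ℕ) → j' = j := by decide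
      exact this j j' (by simpa using h5)
    have hii : i' = i := by
      clear * - h7 hz1
      fin_cases i <;> fin_cases i' <;> simp_all
    rw [hjj, hii]
  have := Nat.card_le_card_of_injective r hinj
  rw [show Nat.card (Fin 2 × Fin 2) = 4 by simp] at this
  exact absurd (this.trans hle) (by norm_num)

/-- The nine products of powers of `cyc` and of `commDiag ![α, 1, 1]` represent all cosets of the
derived subgroup, and the index is a nonzero multiple of 9. -/
theorem index_commutator_map_sylQ [Finite K] {α : Kˣ} (hα : IsGen3 p f ε α) {z : Kˣ}
    (hz : z ∈ scalars3 p f K ε) (hz1 : z ≠ 1) (hz3 : z ^ 3 = 1)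
    (hker : ι.ker ≤ Subgroup.center _) : (commutator ((sylQ p f K ε).map ι)).index = 9 := by
  have hp : IsPGroup 3 ((sylQ p f K ε).map ι) := isPGroup_sylQ.map ι
  have h9 := sq_dvd_index_commutator 3 _ _ hp rfl (nine_dvd_card_map ι hz hz1 hz3 hker)
  have hu : ∀ i, (![α, 1, 1] : Fin 3 → Kˣ) i ∈ scalars3 p f K ε := by
    intro i
    fin_cases i
    · exact hα.1
    · exact one_mem _
    · exact one_mem _
  set t : SLe p f K ε := ⟨commDiag ![α, 1, 1], commDiag_mem_SLe fun i => scalars3_le (hu i)⟩ with ht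
  have htT : t ∈ sylT p f K ε := ⟨_, fun i => mul_mem (hu _) (inv_mem (hu _)), rfl⟩
  have hle := index_le_of_forall_exists (commutator ((sylQ p f K ε).map ι))
    (fun x : Fin 3 × Fin 3 => (⟨ι (cyc ^ (x.1 : ℕ) * t ^ (x.2 : ℕ)), Subgroup.mem_map_of_mem _
      (mul_mem (pow_mem cyc_mem_sylQ _) (pow_mem (sylT_le htT) _))⟩ : (sylQ p f K ε).map ι)) (by
      rintro ⟨_, g, hg, rfl⟩
      obtain ⟨k, hk⟩ := exists_cyc_inv_mul_mem hg
      obtain ⟨l, hl⟩ := hα.isNoncube.exists_inv_mul_mem hk (t := t) rfl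
      refine ⟨(k, l), ?_⟩
      rw [mem_commutator_iff_coe, ← Subgroup.map_commutator]
      refine ⟨_, hl, ?_⟩
      simp [mul_assoc])
  simp only [Fintype.card_prod, Fintype.card_fin] at hle
  have h0 : (commutator ((sylQ p f K ε).map ι)).index ≠ 0 := Subgroup.index_ne_zero_of_finite
  obtain ⟨m, hm⟩ := h9
  rw [hm] at hle h0 ⊢
  have : m ≠ 0 := by rintro rfl; simp at h0
  omega

theorem not_dvd_relIndex_map [Finite K] {z : Kˣ}
    (hz : z ∈ scalars3 p f K ε) (hz1 : z ≠ 1) (hz3 : z ^ 3 = 1) :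
    ¬ 3 ∣ ((sylQ p f K ε).map ι).relIndex ι.range := by
  intro h
  have h1 : ((sylQ p f K ε).map ι).relIndex ι.range = (sylQ p f K ε ⊔ ι.ker).index := by
    rw [MonoidHom.range_eq_map, Subgroup.relIndex_map_map, top_sup_eq, Subgroup.relIndex_top_right]
  rw [h1] at h
  exact not_dvd_index_sylQ hz hz1 hz3 (h.trans (Subgroup.index_dvd_of_le le_sup_left))

theorem index_map_sylQ :
    ((sylQ p f K ε).map ι).index = ((sylQ p f K ε).map ι).relIndex ι.range * ι.range.index :=
  (Subgroup.relIndex_mul_index (by rintro _ ⟨g, -, rfl⟩; exact ⟨g, rfl⟩)).symm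

/-- The Sylow `3`-subgroups of a group in which the image of `SL₃^ε(q)` has index prime to `3`. -/
theorem exists_sylow_eq_map [Finite K] {z : Kˣ}
    (hz : z ∈ scalars3 p f K ε) (hz1 : z ≠ 1) (hz3 : z ^ 3 = 1) (hι : ¬ 3 ∣ ι.range.index) :
    ∃ P : Sylow 3 X, (P : Subgroup X) = (sylQ p f K ε).map ι := by
  have hp : IsPGroup 3 ((sylQ p f K ε).map ι) := isPGroup_sylQ.map ι
  refine ⟨hp.toSylow ?_, rfl⟩
  rw [index_map_sylQ, Nat.Prime.dvd_mul Nat.prime_three]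
  exact not_or.mpr ⟨not_dvd_relIndex_map ι hz hz1 hz3, hι⟩

theorem index_commutator_of_not_dvd [Finite K] [Finite X] {α : Kˣ} (hα : IsGen3 p f ε α) {z : Kˣ}
    (hz : z ∈ scalars3 p f K ε) (hz1 : z ≠ 1) (hz3 : z ^ 3 = 1)
    (hker : ι.ker ≤ Subgroup.center _) (hι : ¬ 3 ∣ ι.range.index) (R : Sylow 3 X) :
    (commutator R).index = 9 := by
  obtain ⟨P, hP⟩ := exists_sylow_eq_map ι hz hz1 hz3 hι
  rw [index_commutator_sylow_eq R P, ← index_commutator_map_sylQ ι hα hz hz1 hz3 hker,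
    index_commutator_coe, index_commutator_coe, hP]

end Extension

end SL3Sylow

/-! ### Sylow 3-subgroups of extensions with one further factor 3. -/

namespace SL3Sylow

theorem mem_normalizer_of_forall {X : Type*} [Group X] [Finite X] (H : Subgroup X) {x : X}
    (hnorm : ∀ h ∈ H, x * h * x⁻¹ ∈ H) : x ∈ Subgroup.normalizer (H : Set X) := by
  have hmap : H.map (MulAut.conj x).toMonoidHom = H := by
    apply Subgroup.eq_of_le_of_card_ge
    · rintro _ ⟨h, hh, rfl⟩
      exact hnorm h hh
    · exact (Nat.card_congr (H.equivMapOfInjective _ (MulAut.conj x).injective).toEquiv).le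
  rw [Subgroup.mem_normalizer_iff]
  intro h
  constructor
  · exact hnorm h
  · intro hh
    rw [← hmap] at hh
    obtain ⟨h', hh', h2⟩ := hh
    have : h' = h := by simpa using h2
    exact this ▸ hh'

theorem index_commutator_eq_nine {X : Type*} [Group X] [Finite X] (R T : Subgroup X)
    (hR : IsPGroup 3 R) (hcard : 3 ^ 2 ∣ Nat.card R) (hT : T ≤ ⁅R, R⁆) (hle : T.relIndex R ≤ 9) :
    (commutator R).index = 9 := by
  have h1 : (commutator R).index ≤ 9 := by
    rw [index_commutator_coe]
    refine le_trans (Nat.le_of_dvd ?_ (Subgroup.relIndex_dvd_of_le_left R hT)) hle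
    exact Nat.pos_of_ne_zero Subgroup.index_ne_zero_of_finite
  have h9 : 3 ^ 2 ∣ (commutator R).index := sq_dvd_index_commutator 3 _ _ hR rfl hcard
  have h0 : (commutator R).index ≠ 0 := Subgroup.index_ne_zero_of_finite
  obtain ⟨k, hk⟩ := h9
  rw [hk] at h1 h0 ⊢
  have : k ≠ 0 := by rintro rfl; simp at h0
  omega

/-- `H⟨x⟩` is a 3-group properly containing `H`, so it uses up the only factor 3 in the index of
`H`. -/
theorem exists_sylow_sup_zpowers {X : Type*} [Group X] [Finite X] (H : Subgroup X)
    (hH : IsPGroup 3 H) (h3 : ordProj[3] H.index = 3) (x : X)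
    (hx : ∃ n, x ^ 3 ^ n = 1) (hxH : x ∉ H) (hnorm : ∀ h ∈ H, x * h * x⁻¹ ∈ H) :
    ∃ R : Sylow 3 X, (R : Subgroup X) = H ⊔ Subgroup.zpowers x ∧ H.relIndex R = 3 := by
  have hxn := mem_normalizer_of_forall H hnorm
  have hz : IsPGroup 3 (Subgroup.zpowers x) := by
    obtain ⟨n, hn⟩ := hx
    apply IsPGroup.of_card_dvd_pow (n := n)
    rw [Nat.card_zpowers]
    exact orderOf_dvd_of_pow_eq_one hn
  have hR : IsPGroup 3 (H ⊔ Subgroup.zpowers x : Subgroup X) := by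
    rw [sup_comm]
    exact IsPGroup.to_sup_of_normal_right' hz hH (by rwa [Subgroup.zpowers_le])
  set R := H ⊔ Subgroup.zpowers x with hRdef
  have hmul : H.relIndex R * R.index = H.index := Subgroup.relIndex_mul_index le_sup_left
  obtain ⟨n, hn⟩ := hR.index (H.subgroupOf R)
  change H.relIndex R = 3 ^ n at hn
  have hn0 : n ≠ 0 := by
    rintro rfl
    rw [pow_zero, Subgroup.relIndex_eq_one] at hn
    exact hxH (hn (le_sup_right (a := H) (Subgroup.mem_zpowers x)))
  have hidx0 : H.index ≠ 0 := Subgroup.index_ne_zero_of_finite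
  have hval : H.index.factorization 3 = 1 := by
    have : 3 ^ H.index.factorization 3 = 3 ^ 1 := by rw [h3]; norm_num
    exact Nat.pow_right_injective (le_refl 2 |>.trans (by norm_num)) this
  have hR0 : R.index ≠ 0 := Subgroup.index_ne_zero_of_finite
  rw [← hmul, hn, Nat.factorization_mul (by positivity) hR0,
    Nat.Prime.factorization_pow Nat.prime_three] at hval
  simp only [Finsupp.coe_add, Pi.add_apply, Finsupp.single_eq_same] at hval
  have hn1 : n = 1 := by omega
  have hv0 : R.index.factorization 3 = 0 := by omega
  have hnd : ¬ 3 ∣ R.index := fun h =>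
    (Nat.Prime.factorization_pos_of_dvd Nat.prime_three hR0 h).ne' hv0
  refine ⟨hR.toSylow hnd, rfl, ?_⟩
  change H.relIndex R = 3
  rw [hn, hn1, pow_one]

section Extension

variable {p f : ℕ} {K : Type*} [Field K] [ExpChar K p] {ε : ℤˣ}
variable {X : Type*} [Group X] (ι : SLe p f K ε →* X)

/-- The element `x` acts on the image of `SL₃^ε(q)` under `ι` like the semilinear automorphism
`g ↦ d σ(g) d⁻¹`. -/
def ActsAs (x : X) (d : GLe p f K ε) (σ : K ≃+* K) : Prop :=
  ∀ g, x * ι g * x⁻¹ = ι (twist d σ g)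

variable {ι}

theorem ActsAs.mul {x y : X} {d e : GLe p f K ε} {σ τ : K ≃+* K} (hx : ActsAs ι x d σ)
    (hy : ActsAs ι y e τ) : ActsAs ι (x * y) (d * fieldMap σ e) (σ * τ) := by
  intro g
  rw [← twist_twist, ← hx, ← hy]
  group

theorem actsAs_one : ActsAs ι 1 1 1 := by
  intro g
  rw [twist_one_one]
  simp

theorem actsAs_coe (h : SLe p f K ε) : ActsAs ι (ι h) ⟨h, SLe_le_GLe h.2⟩ 1 := by
  intro g
  rw [← map_mul, ← map_inv, ← map_mul]
  congr 1

theorem ActsAs.of_eq_mul_scalar {x : X} {d e : GLe p f K ε} {σ : K ≃+* K} (hx : ActsAs ι x d σ)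
    (c : Kˣ) (h : (d : GL (Fin 3) K) = e * mono (fun _ => c) 0) : ActsAs ι x e σ := by
  intro g
  rw [hx g]
  congr 1
  ext1
  rw [coe_twist, coe_twist, h, mul_inv_rev, mul_assoc (e : GL (Fin 3) K), mono_const_comm]
  group

/-- The matrix `diag(b, 1, 1)`. -/
def diagOne (b : Kˣ) (hb : b ∈ scalars3 p f K ε) : GLe p f K ε :=
  ⟨mono ![b, 1, 1] 0, mono_mem_GLe.mpr fun i => by
    fin_cases i
    · exact scalars3_le hb
    · exact one_mem _
    · exact one_mem _⟩

/-- The automorphism `σ` acts trivially on the scalars of `3`-power order modulo cubes. -/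
theorem exists_map_eq_mul_cube {z : Kˣ} (hz : z ∈ scalars3 p f K ε) (hz1 : z ≠ 1) (hz3 : z ^ 3 = 1)
    {α : Kˣ} (hα : IsGen3 p f ε α) {σ : K ≃+* K} (hσ : σ z = z) :
    ∃ l : ℤ, ∀ x ∈ scalars3 p f K ε, Units.map (σ : K →* K) x = x * (x ^ l) ^ 3 := by
  obtain ⟨k, hk⟩ := hα.2.1 _ (map_mem_scalars3 hα.1 σ)
  obtain ⟨j, rfl⟩ := hα.2.1 z hz
  have hj : Units.map (σ : K →* K) (α ^ j) = α ^ j := by ext; simpa using hσ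
  have hzo : orderOf (α ^ j) = 3 := orderOf_eq_prime hz3 hz1
  -- `z` is a power of `α` of order 3 fixed by `σ`, and `σ` raises `α` to the power `k`; hence `k ≡
  -- 1` modulo 3.
  have hk1 : ((k : ℤ) - 1) % 3 = 0 := by
    rw [map_pow, hk, ← pow_mul] at hj
    have h2 : (α ^ j) ^ ((k : ℤ) - 1) = 1 := by
      rw [zpow_sub, zpow_natCast, zpow_one, mul_inv_eq_one, ← pow_mul, mul_comm j, hj]
    rw [← orderOf_dvd_iff_zpow_eq_one, hzo] at h2
    exact Int.emod_eq_zero_of_dvd (by exact_mod_cast h2)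
  refine ⟨((k : ℤ) - 1) / 3, ?_⟩
  intro x hx
  obtain ⟨m, rfl⟩ := hα.2.1 x hx
  rw [map_pow, hk, ← zpow_natCast _ 3, ← zpow_mul]
  have : ((k : ℤ) - 1) / 3 * (3 : ℕ) = k - 1 := by push_cast; omega
  rw [this, zpow_sub, zpow_one, zpow_natCast, ← pow_mul, ← pow_mul, mul_comm k,
    mul_inv_cancel_comm_assoc]

/-- Since `σ` is trivial on scalars modulo cubes, the factor `b` twisted by powers of `σ` multiplies
up to `b ^ n` times a cube. Powers of `x` thus keep the noncube property when 3 does not divide `n`.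
-/
theorem ActsAs.pow_diagOne {z : Kˣ} (hz : z ∈ scalars3 p f K ε) (hz1 : z ≠ 1) (hz3 : z ^ 3 = 1)
    {α : Kˣ} (hα : IsGen3 p f ε α) {σ : K ≃+* K} (hσ : σ z = z) {x : X} {b : Kˣ}
    (hb : b ∈ scalars3 p f K ε) (hx : ActsAs ι x (diagOne b hb) σ) (n : ℕ) :
    ∃ c, ∃ hc : c ∈ scalars3 p f K ε,
      ActsAs ι (x ^ n) (diagOne (b ^ n * c ^ 3) (mul_mem (pow_mem hb n) (pow_mem hc 3))) (σ ^ n) := by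
  obtain ⟨l, hl⟩ := exists_map_eq_mul_cube hz hz1 hz3 hα hσ
  induction n with
  | zero =>
    refine ⟨1, one_mem _, ?_⟩
    have e : diagOne (b ^ 0 * 1 ^ 3) (mul_mem (pow_mem hb 0) (pow_mem (one_mem _) 3)) =
        (1 : GLe p f K ε) := by
      ext1
      change mono _ 0 = 1
      rw [← mono_one]
      congr 1
      ext i
      fin_cases i <;> simp
    rw [e, pow_zero, pow_zero]
    exact actsAs_one
  | succ n ih =>
    obtain ⟨c, hc, ih⟩ := ih
    set y := b ^ n * c ^ 3 with hy
    have hyS : y ∈ scalars3 p f K ε := mul_mem (pow_mem hb n) (pow_mem hc 3)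
    refine ⟨c * y ^ l, mul_mem hc (zpow_mem hyS l), ?_⟩
    have e : diagOne (b ^ (n + 1) * (c * y ^ l) ^ 3)
        (mul_mem (pow_mem hb _) (pow_mem (mul_mem hc (zpow_mem hyS l)) 3)) =
        (diagOne b hb * fieldMap σ (diagOne y hyS) : GLe p f K ε) := by
      ext1
      change mono _ 0 = mono _ 0 * Matrix.GeneralLinearGroup.map _ (mono _ 0)
      rw [map_mono, mono_mul]
      congr 1
      ext1 i
      fin_cases i
      · change _ = b * Units.map (σ : K →* K) y
        rw [hl y hyS, mul_pow]
        simp only [Fin.zero_eta, Fin.isValue, Matrix.cons_val_zero]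
        rw [hy, pow_succ']
        simp only [mul_assoc]
      · simp
      · simp
    rw [e, pow_succ', pow_succ']
    exact hx.mul ih

theorem conj_mono_zero_mul (u : Fin 3 → Kˣ) (a : Fin 3 → Kˣ) (k : Fin 3) :
    mono u 0 * mono a k * (mono u 0)⁻¹ = mono (fun i => u i * a i * (u (i + k))⁻¹) k := by
  rw [mono_inv, mono_mul, mono_mul]
  simp

/-- Existence of an element of `3`-power order among the powers of `x`. -/
theorem exists_pow_of_order {X : Type*} [Group X] [Finite X] (N : Subgroup X) (x : X)
    (hxN : x ∉ N) (hx3 : x ^ 3 ∈ N) :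
    ∃ m : ℕ, ¬ 3 ∣ m ∧ x ^ m ∉ N ∧ (x ^ m) ^ 3 ∈ N ∧ ∃ n, (x ^ m) ^ 3 ^ n = 1 := by
  obtain ⟨n, m, hm, hnm⟩ := Nat.exists_eq_pow_mul_and_not_dvd (orderOf_pos x).ne' 3 (by norm_num)
  refine ⟨m, hm, ?_, ?_, n, ?_⟩
  · intro h
    apply hxN
    have h1 : (m % 3 = 1 ∨ m % 3 = 2) := by omega
    rcases h1 with h1 | h1
    · have : x = x ^ m * ((x ^ 3) ^ (m / 3))⁻¹ := by
        rw [← pow_mul, eq_mul_inv_iff_mul_eq, ← pow_succ']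
        congr 1; omega
      rw [this]
      exact mul_mem h (inv_mem (pow_mem hx3 _))
    · have : x = (x ^ m)⁻¹ * (x ^ 3) ^ (m / 3 + 1) := by
        rw [← pow_mul, eq_inv_mul_iff_mul_eq, ← pow_succ]
        congr 1; omega
      rw [this]
      exact mul_mem (inv_mem h) (pow_mem hx3 _)
  · rw [← pow_mul, mul_comm, pow_mul]
    exact pow_mem hx3 m
  · rw [← pow_mul, mul_comm, ← hnm, pow_orderOf_eq_one]

theorem twist_mem_sylQ {u : Fin 3 → Kˣ} (hu : ∀ i, u i ∈ scalars3 p f K ε) {d : GLe p f K ε}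
    (hd : (d : GL (Fin 3) K) = mono u 0) (σ : K ≃+* K) {g : SLe p f K ε} (hg : g ∈ sylQ p f K ε) :
    twist d σ g ∈ sylQ p f K ε := by
  obtain ⟨a, k, ha, h⟩ := hg
  refine ⟨fun i => u i * Units.map (σ : K →* K) (a i) * (u (i + k))⁻¹, k, fun i =>
    mul_mem (mul_mem (hu i) (map_mem_scalars3 (ha i) σ)) (inv_mem (hu _)), ?_⟩
  rw [Subgroup.subtype_apply, coe_twist, hd, show (g : GL (Fin 3) K) = mono a k from h,
      map_mono, conj_mono_zero_mul]
  rfl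

theorem ordProj_index_map [Finite K] [Finite X] {z : Kˣ} (hz : z ∈ scalars3 p f K ε) (hz1 : z ≠ 1)
    (hz3 : z ^ 3 = 1) (h3 : ordProj[3] ι.range.index = 3) :
    ordProj[3] ((sylQ p f K ε).map ι).index = 3 := by
  rw [index_map_sylQ, Nat.factorization_mul, Finsupp.add_apply,
    Nat.factorization_eq_zero_of_not_dvd (not_dvd_relIndex_map ι hz hz1 hz3), zero_add, h3]
  · exact Subgroup.index_ne_zero_of_finite
  · exact Subgroup.index_ne_zero_of_finite

/-- An element acting as a semilinear map whose determinant is not a cube can be changed by an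
element of `SL₃^ε(q)` so that it acts as a diagonal matrix times a field automorphism. -/
theorem exists_actsAs_diagOne [Finite K] {α : Kˣ} (hα : IsGen3 p f ε α)
    [hN : ι.range.Normal] {x : X}
    (hxN : x ∉ ι.range) (hx3 : x ^ 3 ∈ ι.range) {d : GLe p f K ε} {σ : K ≃+* K}
    (hx : ActsAs ι x d σ)
    (hd : ¬ ∃ c ∈ scalars p f K ε, Matrix.GeneralLinearGroup.det (d : GL (Fin 3) K) = c ^ 3) :
    ∃ y, y ∉ ι.range ∧ y ^ 3 ∈ ι.range ∧ ∃ j : ℕ, ¬ 3 ∣ j ∧ ∃ h : α ^ j ∈ scalars3 p f K ε,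
      ActsAs ι y (diagOne (α ^ j) h) σ := by
  obtain ⟨j, c, hc, hj⟩ := hα.exists_pow_mul_cube' (det_mem_scalars d.2)
  have hj0 : ¬ 3 ∣ (j : ℕ) := by
    intro h
    have : (j : ℕ) = 0 := by omega
    exact hd ⟨c, hc, by rw [hj, this, pow_zero, one_mul]⟩
  have hαj : α ^ (j : ℕ) ∈ scalars3 p f K ε := pow_mem hα.1 _
  set e := diagOne (α ^ (j : ℕ)) hαj with he
  have hcG : mono (fun _ => c) 0 ∈ GLe p f K ε := mono_mem_GLe.mpr fun _ => hc
  have hg : (d : GL (Fin 3) K) * (mono (fun _ => c) 0)⁻¹ * (e : GL (Fin 3) K)⁻¹ ∈ SLe p f K ε := by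
    refine mem_SLe.mpr ⟨mul_mem (mul_mem d.2 (inv_mem hcG)) (inv_mem e.2), ?_⟩
    have h1 : Matrix.GeneralLinearGroup.det (e : GL (Fin 3) K) = α ^ (j : ℕ) := by
      change Matrix.GeneralLinearGroup.det (mono _ 0) = _
      rw [det_mono]
      simp
    rw [map_mul, map_mul, map_inv, map_inv, h1, det_mono, hj, ← pow_three', mul_inv_cancel_right,
      mul_inv_cancel]
  set g : SLe p f K ε := ⟨_, hg⟩ with hgdef
  have hgX : (ι g)⁻¹ ∈ ι.range := inv_mem ⟨g, rfl⟩
  set y := (ι g)⁻¹ * x with hy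
  have hyN : y ∉ ι.range := fun h => hxN ((Subgroup.mul_mem_cancel_left _ hgX).mp h)
  have hy3 : y ^ 3 ∈ ι.range := by
    have h1 : (y : X ⧸ ι.range) = x := by
      rw [hy, QuotientGroup.mk_mul, (QuotientGroup.eq_one_iff _).mpr hgX, one_mul]
    rw [← QuotientGroup.eq_one_iff, QuotientGroup.mk_pow, h1, ← QuotientGroup.mk_pow,
      QuotientGroup.eq_one_iff]
    exact hx3
  have hya : ActsAs ι y e σ := by
    have h1 := (actsAs_coe (ι := ι) g⁻¹).mul hx
    rw [one_mul, map_inv] at h1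
    refine h1.of_eq_mul_scalar c ?_
    simp only [Subgroup.coe_mul, coe_fieldMap, map_one_GL, Subgroup.coe_inv, hgdef, mul_inv_rev,
      inv_inv, mul_assoc, inv_mul_cancel, mul_one]
  exact ⟨y, hyN, hy3, j, hj0, hαj, hya⟩

/-- The commutator of `w` with the cyclic permutation is `commDiag ![β, 1, 1]`, because `σ` fixes a
permutation matrix. This is exactly the class of diagonal elements missing from `Q'`. -/
theorem sylT_map_le_commutator {β : Kˣ} (hnc : IsNoncube p f ε β) {w : X} {σ : K ≃+* K}
    (hxa : ActsAs ι w (diagOne β hnc.1) σ) (P : Subgroup X) (hwP : w ∈ P)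
    (hQP : (sylQ p f K ε).map ι ≤ P) : (sylT p f K ε).map ι ≤ ⁅P, P⁆ := by
  have hu : ∀ i, (![β, 1, 1] : Fin 3 → Kˣ) i ∈ scalars3 p f K ε := by
    intro i
    fin_cases i
    · exact hnc.1
    · exact one_mem _
    · exact one_mem _
  rintro _ ⟨g, hg, rfl⟩
  set t : SLe p f K ε := ⟨commDiag ![β, 1, 1], commDiag_mem_SLe fun i => scalars3_le (hu i)⟩ with ht
  obtain ⟨l, hl⟩ := hnc.exists_inv_mul_mem hg (t := t) rfl
  have h1 : ι ((t ^ (l : ℕ))⁻¹ * g) ∈ ⁅P, P⁆ := by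
    refine Subgroup.commutator_mono hQP hQP ?_
    rw [← Subgroup.map_commutator]
    exact Subgroup.mem_map_of_mem _ hl
  have h2 : ι t ∈ ⁅P, P⁆ := by
    have : ι t = w * ι cyc * w⁻¹ * (ι cyc)⁻¹ := by
      rw [hxa cyc, ← map_inv, ← map_mul]
      congr 1
      ext1
      rw [Subgroup.coe_mul, coe_twist, Subgroup.coe_inv, coe_cyc, map_mono]
      change commDiag _ = _
      rw [commDiag_eq]
      congr 4
      ext i
      simp
    rw [this]
    exact Subgroup.commutator_mem_commutator hwP (hQP (Subgroup.mem_map_of_mem _ cyc_mem_sylQ))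
  have h3 : ι g = ι t ^ (l : ℕ) * ι ((t ^ (l : ℕ))⁻¹ * g) := by
    rw [← map_pow, ← map_mul, mul_inv_cancel_left]
  rw [h3]
  exact mul_mem (pow_mem h2 _) h1

theorem relIndex_sylT_map_le (ι : SLe p f K ε →* X) : ((sylT p f K ε).map ι).relIndex ((sylQ p f K ε).map ι) ≤ 3 := by
  have := index_le_of_forall_exists (((sylT p f K ε).map ι).subgroupOf ((sylQ p f K ε).map ι))
    (fun k : Fin 3 => (⟨ι (cyc ^ (k : ℕ)), Subgroup.mem_map_of_mem _ (pow_mem cyc_mem_sylQ _)⟩ : (sylQ p f K ε).map ι))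
    (by
      rintro ⟨_, g, hg, rfl⟩
      obtain ⟨k, hk⟩ := exists_cyc_inv_mul_mem hg
      refine ⟨k, _, hk, ?_⟩
      simp)
  rwa [Fintype.card_fin] at this

/-- For `P = Q⟨w⟩` the diagonal part of `Q` lies in `P'`, it has index at most 3 in `Q`, and `Q` has
index 3 in `P`; so `[P : P'] ≤ 9`. -/
theorem index_commutator_of_diagOne [Finite K] [Finite X] {z : Kˣ}
    (hz : z ∈ scalars3 p f K ε) (hz1 : z ≠ 1) (hz3 : z ^ 3 = 1)
    (hker : ι.ker ≤ Subgroup.center _) (h3 : ordProj[3] ι.range.index = 3) {w : X}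
    (hwN : w ∉ ι.range) (hw : ∃ n, w ^ 3 ^ n = 1) {β : Kˣ} (hnc : IsNoncube p f ε β)
    {σ : K ≃+* K} (hxa : ActsAs ι w (diagOne β hnc.1) σ) (R : Sylow 3 X) :
    (commutator R).index = 9 := by
  have hu : ∀ i, (![β, 1, 1] : Fin 3 → Kˣ) i ∈ scalars3 p f K ε := by
    intro i
    fin_cases i
    · exact hnc.1
    · exact one_mem _
    · exact one_mem _
  have hQp : IsPGroup 3 ((sylQ p f K ε).map ι) := isPGroup_sylQ.map ι
  have hQN : (sylQ p f K ε).map ι ≤ ι.range := by rintro _ ⟨g, -, rfl⟩; exact ⟨g, rfl⟩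
  have hnorm : ∀ h ∈ (sylQ p f K ε).map ι, w * h * w⁻¹ ∈ (sylQ p f K ε).map ι := by
    rintro _ ⟨g, hg, rfl⟩
    rw [hxa g]
    exact Subgroup.mem_map_of_mem _ (twist_mem_sylQ hu rfl _ hg)
  obtain ⟨P, hP, hPQ⟩ := exists_sylow_sup_zpowers _ hQp (ordProj_index_map hz hz1 hz3 h3) w hw
    (fun h => hwN (hQN h)) hnorm
  have hQP : (sylQ p f K ε).map ι ≤ (P : Subgroup X) := hP ▸ le_sup_left
  have hwP : w ∈ (P : Subgroup X) := by
    rw [hP]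
    exact le_sup_right (a := (sylQ p f K ε).map ι) (Subgroup.mem_zpowers w)
  rw [index_commutator_sylow_eq R P]
  have hTQ' : (sylT p f K ε).map ι ≤ (sylQ p f K ε).map ι := Subgroup.map_mono sylT_le
  have hTP : ((sylT p f K ε).map ι).relIndex P ≤ 9 := by
    rw [← Subgroup.relIndex_mul_relIndex _ _ _ hTQ' hQP, hPQ]
    exact Nat.mul_le_mul_right 3 (relIndex_sylT_map_le ι)
  have hcard : 3 ^ 2 ∣ Nat.card (P : Subgroup X) :=
    (nine_dvd_card_map ι hz hz1 hz3 hker).trans (Subgroup.card_dvd_of_le hQP)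
  exact index_commutator_eq_nine (P : Subgroup X) _ P.isPGroup' hcard
    (sylT_map_le_commutator hnc hxa _ hwP hQP) hTP

/-- An extension by an automorphism that is not field-like. -/
theorem index_commutator_of_det_ne_cube [Finite K] [Finite X] {α : Kˣ} (hα : IsGen3 p f ε α) {z : Kˣ}
    (hz : z ∈ scalars3 p f K ε) (hz1 : z ≠ 1) (hz3 : z ^ 3 = 1) [hN : ι.range.Normal]
    (hker : ι.ker ≤ Subgroup.center _) (h3 : ordProj[3] ι.range.index = 3) {x : X}
    (hxN : x ∉ ι.range) (hx3 : x ^ 3 ∈ ι.range) {d : GLe p f K ε} {σ : K ≃+* K} (hσ : σ z = z)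
    (hx : ActsAs ι x d σ)
    (hd : ¬ ∃ c ∈ scalars p f K ε, Matrix.GeneralLinearGroup.det (d : GL (Fin 3) K) = c ^ 3)
    (R : Sylow 3 X) : (commutator R).index = 9 := by
  obtain ⟨y, hyN, hy3, j, hj0, hαj, hya⟩ := exists_actsAs_diagOne hα hxN hx3 hx hd
  obtain ⟨m, hm3, hmN, -, hmn⟩ := exists_pow_of_order _ y hyN hy3
  obtain ⟨c', hc', hxa⟩ := ActsAs.pow_diagOne hz hz1 hz3 hα hσ hαj hya m
  have hnc : IsNoncube p f ε ((α ^ j) ^ m * c' ^ 3) := by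
    rw [← pow_mul]
    refine hα.isNoncube.pow_mul_cube ?_ hc'
    rw [Nat.Prime.dvd_mul Nat.prime_three]
    exact not_or.mpr ⟨hj0, hm3⟩
  exact index_commutator_of_diagOne hz hz1 hz3 hker h3 hmN hmn hnc hxa R

/-- An extension by a field automorphism. -/
theorem index_commutator_of_field [Finite K] [Finite X] {α : Kˣ} (hα : IsGen3 p f ε α) {z : Kˣ}
    (hz : z ∈ scalars3 p f K ε) (hz1 : z ≠ 1) (hz3 : z ^ 3 = 1)
    (hker : ι.ker ≤ Subgroup.center _) (h3 : ordProj[3] ι.range.index = 3) {x : X}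
    (hxN : x ∉ ι.range) (hx3 : x ^ 3 ∈ ι.range) {σ : K ≃+* K} (hσ : σ z = z)
    (hx : ActsAs ι x 1 σ) (R : Sylow 3 X) : (commutator R).index ≠ 9 := by
  obtain ⟨m, hm3, hmN, hmN3, hmn⟩ := exists_pow_of_order _ x hxN hx3
  have hpow : ∀ n : ℕ, ActsAs ι (x ^ n) 1 (σ ^ n) := by
    intro n
    induction n with
    | zero =>
      rw [pow_zero, pow_zero]
      exact actsAs_one
    | succ n ih =>
      have e : (1 : GLe p f K ε) = 1 * fieldMap σ 1 := by
        ext1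
        simp [coe_fieldMap]
      rw [pow_succ', pow_succ', e]
      exact hx.mul ih
  have hσn : ∀ n : ℕ, (σ ^ n) z = z := by
    intro n
    induction n with
    | zero => rfl
    | succ n ih => rw [pow_succ', RingAut.mul_apply, ih, hσ]
  have hxa := hpow m
  obtain ⟨l, hl⟩ := exists_map_eq_mul_cube hz hz1 hz3 hα (hσn m)
  set w := x ^ m with hw
  set τ := σ ^ m with hτ
  set Q := (sylQ p f K ε).map ι with hQ
  have hQp : IsPGroup 3 Q := isPGroup_sylQ.map ι
  have hQN : Q ≤ ι.range := by rintro _ ⟨g, -, rfl⟩; exact ⟨g, rfl⟩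
  have hnorm : ∀ h ∈ Q, w * h * w⁻¹ ∈ Q := by
    rintro _ ⟨g, hg, rfl⟩
    rw [hxa g]
    exact Subgroup.mem_map_of_mem _ (twist_mem_sylQ (u := 1) (fun _ => one_mem _) mono_one.symm _ hg)
  obtain ⟨P, hP, hPQ⟩ := exists_sylow_sup_zpowers Q hQp (ordProj_index_map hz hz1 hz3 h3) w hmn
    (fun h => hmN (hQN h)) hnorm
  have hQP : Q ≤ P := hP ▸ le_sup_left
  have hwP : w ∈ (P : Subgroup X) := by
    rw [hP]
    exact le_sup_right (a := Q) (Subgroup.mem_zpowers w)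
  rw [index_commutator_sylow_eq R P]
  -- The field automorphism multiplies the entry `a i` by the cube of `b i = (a i) ^ l`, so `[w, g]`
  -- is diagonal with entries `b i ^ 3`. Its presentation as `commDiag u` can be chosen with `det u
  -- = 1`, which puts it into `Q'`.
  have hcomm : ∀ h ∈ Q, w * h * w⁻¹ * h⁻¹ ∈ ⁅Q, Q⁆ := by
    rintro _ ⟨g, hg, rfl⟩
    rw [hxa g, ← map_inv, ← map_mul, hQ, ← Subgroup.map_commutator]
    refine Subgroup.mem_map_of_mem _ ?_
    obtain ⟨a, k, ha, h⟩ := hg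
    have hprod : a 0 * a 1 * a 2 = 1 := by
      rw [← det_mono a k, ← show (g : GL (Fin 3) K) = mono a k from h]
      exact (mem_SLe.mp g.2).2
    set b : Fin 3 → Kˣ := fun i => (a i) ^ l with hb
    have hbS : ∀ i, b i ∈ scalars3 p f K ε := fun i => zpow_mem (ha i) l
    have hbprod : b 0 * b 1 * b 2 = 1 := by
      rw [hb]
      simp only [← mul_zpow]
      rw [hprod, one_zpow]
    -- The entries solve `u i / u (i + 1) = b i ^ 3` together with `u 0 * u 1 * u 2 = 1`, using `b 0
    -- * b 1 * b 2 = 1`.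
    set u : Fin 3 → Kˣ := ![b 0 ^ 2 * b 1, (b 0)⁻¹ * b 1, (b 0)⁻¹ * (b 1)⁻¹ ^ 2] with hu
    refine commDiag_mem_commutator (u := u) ?_ ?_ ?_
    · intro i
      fin_cases i
      · exact mul_mem (pow_mem (hbS 0) 2) (hbS 1)
      · exact mul_mem (inv_mem (hbS 0)) (hbS 1)
      · exact mul_mem (inv_mem (hbS 0)) (pow_mem (inv_mem (hbS 1)) 2)
    · change (b 0 ^ 2 * b 1) * ((b 0)⁻¹ * b 1) * ((b 0)⁻¹ * (b 1)⁻¹ ^ 2) = 1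
      ext
      push_cast
      field_simp
    · rw [Subgroup.coe_mul, coe_twist, Subgroup.coe_inv, show (g : GL (Fin 3) K) = mono a k from h,
        map_mono, commDiag_apply, Subgroup.coe_one, one_mul, inv_one, mul_one, mono_inv, mono_mul,
        add_neg_cancel]
      congr 1
      ext1 i
      change Units.map (τ : K →* K) (a i) * _ = _
      rw [hl _ (ha i), add_sub_cancel_right, mul_inv_cancel_comm]
      change b i ^ 3 = _
      have hb2 : b 2 = (b 0)⁻¹ * (b 1)⁻¹ := by
        rw [← mul_inv, eq_inv_iff_mul_eq_one, mul_comm]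
        exact hbprod
      fin_cases i
      · change b 0 ^ 3 = (b 0 ^ 2 * b 1) * ((b 0)⁻¹ * b 1)⁻¹
        ext
        push_cast
        field_simp
      · change b 1 ^ 3 = ((b 0)⁻¹ * b 1) * ((b 0)⁻¹ * (b 1)⁻¹ ^ 2)⁻¹
        ext
        push_cast
        field_simp
      · change b 2 ^ 3 = ((b 0)⁻¹ * (b 1)⁻¹ ^ 2) * (b 0 ^ 2 * b 1)⁻¹
        rw [hb2]
        ext
        push_cast
        field_simp
  set H : Subgroup P := Q.subgroupOf P with hH
  have hmapH : H.map (P : Subgroup X).subtype = Q := Subgroup.map_subgroupOf_eq_of_le hQP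
  have hQnormal : H.Normal := by
    rw [hH]
    rw [Subgroup.normal_subgroupOf_iff_le_normalizer hQP, hP, sup_le_iff]
    refine ⟨Subgroup.le_normalizer, ?_⟩
    rw [Subgroup.zpowers_le]
    exact mem_normalizer_of_forall Q hnorm
  have hcoe : ∀ y : P, y ∈ ⁅H, H⁆ ↔ (y : X) ∈ ⁅Q, Q⁆ := by
    intro y
    rw [← hmapH, ← Subgroup.map_commutator]
    constructor
    · intro h
      exact Subgroup.mem_map_of_mem (P : Subgroup X).subtype h
    · rintro ⟨y', hy', h⟩
      have : y' = y := Subtype.ext h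
      exact this ▸ hy'
  have hle : commutator P ≤ ⁅H, H⁆ := by
    refine commutator_le_of_sup_zpowers H ⟨w, hwP⟩ ?_ ?_
    · apply Subgroup.map_injective (P : Subgroup X).subtype_injective
      rw [Subgroup.map_sup, hmapH, MonoidHom.map_zpowers, ← MonoidHom.range_eq_map,
        Subgroup.range_subtype]
      exact hP.symm
    · intro h hh
      rw [hcoe]
      exact hcomm h hh
  intro h9
  -- As `P' ≤ Q'`, the index of `P'` is a multiple of `[Q : Q'] [P : Q] = 27`.
  have h1 := Subgroup.index_dvd_of_le hle
  rw [h9, ← Subgroup.relIndex_mul_index (Subgroup.commutator_le_left H H)] at h1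
  have h2 : H.index = 3 := hPQ
  have h4 : ⁅H, H⁆.relIndex H = ⁅Q, Q⁆.relIndex Q := by
    have := Subgroup.relIndex_map_map_of_injective ⁅H, H⁆ H (P : Subgroup X).subtype_injective
    rw [← this, Subgroup.map_commutator, hmapH]
  rw [h2, h4, ← index_commutator_coe, index_commutator_map_sylQ ι hα hz hz1 hz3 hker] at h1
  norm_num at h1

end Extension

end SL3Sylow

/-! ### The groups `PGL₃^ε(q)`, `SL₃^ε(q)`, `PSL₃^ε(q)` and the extensions by a diagonal
automorphism. -/

namespace SL3Sylow

theorem index_eq_three {X : Type*} [Group X] (N : Subgroup X) [N.Normal] (x : X) (hx : x ∉ N)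
    (hx3 : x ^ 3 ∈ N) (h : ∀ y, ∃ j : Fin 3, (x ^ (j : ℕ))⁻¹ * y ∈ N) : N.index = 3 := by
  have h1 := index_le_of_forall_exists N _ h
  rw [Fintype.card_fin] at h1
  have h2 : orderOf (x : X ⧸ N) = 3 := by
    apply orderOf_eq_prime
    · rw [← QuotientGroup.mk_pow]
      exact (QuotientGroup.eq_one_iff _).mpr hx3
    · exact fun h => hx ((QuotientGroup.eq_one_iff _).mp h)
  have h3 : 3 ∣ N.index := h2 ▸ orderOf_dvd_natCard _
  have h4 : N.index ≠ 0 := by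
    have : Finite (X ⧸ N) := Finite.of_surjective (fun j : Fin 3 => ((x ^ (j : ℕ) : X) : X ⧸ N)) (by
      intro y
      induction y using QuotientGroup.induction_on with
      | H y =>
        obtain ⟨j, hj⟩ := h y
        exact ⟨j, QuotientGroup.eq.mpr hj⟩)
    exact Subgroup.index_ne_zero_of_finite
  omega

theorem ordProj_three : ordProj[3] 3 = 3 := by
  rw [Nat.Prime.factorization Nat.prime_three]; simp

section Parts

variable {p f : ℕ} {K : Type*} [Field K] [ExpChar K p] {ε : ℤˣ}

variable (p f K ε) in
/-- The natural map from `SL₃^ε(q)` to `PGL₃^ε(q)`. -/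
def toPGLe : SLe p f K ε →* PGLe p f K ε :=
  (QuotientGroup.mk' _).comp (Subgroup.inclusion SLe_le_GLe)

theorem toPGLe_apply (g : SLe p f K ε) :
    toPGLe p f K ε g = ((⟨g, SLe_le_GLe g.2⟩ : GLe p f K ε) : PGLe p f K ε) := rfl

theorem actsAs_toPGLe (d : GLe p f K ε) : ActsAs (toPGLe p f K ε) (d : PGLe p f K ε) d 1 := by
  intro g
  rw [toPGLe_apply, toPGLe_apply, ← QuotientGroup.mk_mul, ← QuotientGroup.mk_inv,
    ← QuotientGroup.mk_mul]
  congr 1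

theorem det_scalar_const (c : Kˣ) :
    Matrix.GeneralLinearGroup.det (mono (fun _ => c) 0 : GL (Fin 3) K) = c ^ 3 := by
  rw [det_mono, pow_three']

/-- The scalar `c` has determinant `c ^ 3`, so the determinant modulo cubes of scalars detects the
image of `SL₃^ε(q)`. -/
theorem mk_mem_range_toPGLe {z : Kˣ} (hz : z ∈ scalars p f K ε) (hz1 : z ≠ 1) (hz3 : z ^ 3 = 1)
    (d : GLe p f K ε) : (d : PGLe p f K ε) ∈ (toPGLe p f K ε).range ↔
      ∃ c ∈ scalars p f K ε, Matrix.GeneralLinearGroup.det (d : GL (Fin 3) K) = c ^ 3 := by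
  constructor
  · rintro ⟨g, hg⟩
    rw [toPGLe_apply, QuotientGroup.eq] at hg
    obtain ⟨c, hc⟩ := (mem_center_GLe hz hz1 hz3).mp hg
    have hc2 : mono (fun _ => c) 0 ∈ GLe p f K ε := hc ▸ Subtype.property _
    refine ⟨c, (mono_mem_GLe.mp hc2) 0, ?_⟩
    have h1 := congrArg Matrix.GeneralLinearGroup.det hc
    rw [det_scalar_const, Subgroup.coe_mul, map_mul, Subgroup.coe_inv, map_inv,
      (mem_SLe.mp g.2).2, inv_one, one_mul] at h1
    exact h1
  · rintro ⟨c, hc, h⟩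
    have hcG : mono (fun _ => c⁻¹) 0 ∈ GLe p f K ε := mono_mem_GLe.mpr fun _ => inv_mem hc
    refine ⟨⟨d * mono (fun _ => c⁻¹) 0, mem_SLe.mpr ⟨mul_mem d.2 hcG, ?_⟩⟩, ?_⟩
    · rw [map_mul, det_scalar_const, h, inv_pow, mul_inv_cancel]
    · rw [toPGLe_apply]
      symm
      rw [QuotientGroup.eq]
      refine (mem_center_GLe hz hz1 hz3).mpr ⟨c⁻¹, ?_⟩
      simp

theorem toPGLe_ker_le {z : Kˣ} (hz : z ∈ scalars p f K ε) (hz1 : z ≠ 1) (hz3 : z ^ 3 = 1) :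
    (toPGLe p f K ε).ker ≤ Subgroup.center _ := by
  intro g hg
  rw [MonoidHom.mem_ker, toPGLe_apply, QuotientGroup.eq_one_iff] at hg
  exact (mem_center_SLe hz hz1 hz3).mpr ((mem_center_GLe hz hz1 hz3).mp hg)

instance toPGLe_range_normal : (toPGLe p f K ε).range.Normal where
  conj_mem := by
    rintro _ ⟨g, rfl⟩ x
    induction x using QuotientGroup.induction_on with
    | H d => exact ⟨_, (actsAs_toPGLe d g).symm⟩

theorem index_commutator_PGLe [Finite K] {α : Kˣ} (hα : IsGen3 p f ε α) {z : Kˣ}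
    (hz : z ∈ scalars3 p f K ε) (hz1 : z ≠ 1) (hz3 : z ^ 3 = 1) (R : Sylow 3 (PGLe p f K ε)) :
    (commutator R).index = 9 := by
  have hzs := scalars3_le hz
  have hdet : Matrix.GeneralLinearGroup.det (diagOne α hα.1 : GL (Fin 3) K) = α := by
    change Matrix.GeneralLinearGroup.det (mono _ 0) = _
    rw [det_mono]
    simp
  have hncube : ¬ ∃ c ∈ scalars p f K ε,
      Matrix.GeneralLinearGroup.det (diagOne α hα.1 : GL (Fin 3) K) = c ^ 3 := by
    rintro ⟨c, hc, h⟩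
    rw [hdet] at h
    exact hα.not_cube_pow (j := 1) (by norm_num) c hc (by rw [pow_one, h])
  have hx : ((diagOne α hα.1 : GLe p f K ε) : PGLe p f K ε) ∉ (toPGLe p f K ε).range := by
    rw [mk_mem_range_toPGLe hzs hz1 hz3]
    exact hncube
  have hx3 : ((diagOne α hα.1 : GLe p f K ε) : PGLe p f K ε) ^ 3 ∈ (toPGLe p f K ε).range := by
    rw [← QuotientGroup.mk_pow, mk_mem_range_toPGLe hzs hz1 hz3]
    exact ⟨α, scalars3_le hα.1, by rw [Subgroup.coe_pow, map_pow, hdet]⟩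
  have hidx : (toPGLe p f K ε).range.index = 3 := by
    refine index_eq_three _ _ hx hx3 ?_
    intro y
    induction y using QuotientGroup.induction_on with
    | H d =>
      obtain ⟨j, c, hc, h⟩ := hα.exists_pow_mul_cube' (det_mem_scalars d.2)
      refine ⟨j, ?_⟩
      rw [← QuotientGroup.mk_pow, ← QuotientGroup.mk_inv, ← QuotientGroup.mk_mul,
        mk_mem_range_toPGLe hzs hz1 hz3]
      refine ⟨c, hc, ?_⟩
      rw [Subgroup.coe_mul, map_mul, h, Subgroup.coe_inv, map_inv, Subgroup.coe_pow, map_pow, hdet,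
        inv_mul_cancel_left]
  exact index_commutator_of_det_ne_cube hα hz hz1 hz3 (toPGLe_ker_le hzs hz1 hz3)
    (by rw [hidx, ordProj_three]) hx hx3 (σ := 1) rfl (actsAs_toPGLe _) hncube R

theorem index_commutator_SLe [Finite K] {α : Kˣ} (hα : IsGen3 p f ε α) {z : Kˣ}
    (hz : z ∈ scalars3 p f K ε) (hz1 : z ≠ 1) (hz3 : z ^ 3 = 1) (R : Sylow 3 (SLe p f K ε)) :
    (commutator R).index = 9 := by
  refine index_commutator_of_not_dvd (MonoidHom.id _) hα hz hz1 hz3 ?_ ?_ R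
  · intro g hg
    have : g = 1 := hg
    rw [this]
    exact one_mem _
  · rw [MonoidHom.range_eq_top.mpr Function.surjective_id, Subgroup.index_top]
    norm_num

theorem index_commutator_PSLe [Finite K] {α : Kˣ} (hα : IsGen3 p f ε α) {z : Kˣ}
    (hz : z ∈ scalars3 p f K ε) (hz1 : z ≠ 1) (hz3 : z ^ 3 = 1) (R : Sylow 3 (PSLe p f K ε)) :
    (commutator R).index = 9 := by
  refine index_commutator_of_not_dvd (QuotientGroup.mk' _) hα hz hz1 hz3 ?_ ?_ R
  · rw [QuotientGroup.ker_mk']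
  · rw [MonoidHom.range_eq_top.mpr (QuotientGroup.mk'_surjective _), Subgroup.index_top]
    norm_num

/-- The image of `G` is normal of index 3, so `Γ` is finite, and the non-inner action of `δ` says
that `det d` is not a cube. -/
theorem index_commutator_diagonalExtension [Finite K] {α : Kˣ} (hα : IsGen3 p f ε α) {z : Kˣ}
    (hz : z ∈ scalars3 p f K ε) (hz1 : z ≠ 1) (hz3 : z ^ 3 = 1) {Γ : Type*} [Group Γ]
    (ι : SLe p f K ε →* Γ) (δ : Γ) (h : IsDiagonalExtension p f K ε ι δ) (R : Sylow 3 Γ) :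
    (commutator R).index = 9 := by
  obtain ⟨hinj, htop, ⟨d, hd, hact⟩, hninn, hδ3⟩ := h
  have hker : ι.ker ≤ Subgroup.center _ := by
    rw [(MonoidHom.ker_eq_bot_iff ι).mpr hinj]
    exact bot_le
  have hδ : ActsAs ι δ ⟨d, hd⟩ 1 := by
    intro g
    apply hact
    simp [coe_twist, map_one_GL]
  have hfr : Finite ι.range := Finite.of_surjective _ ι.rangeRestrict_surjective
  have hmap : ι.range.map (MulAut.conj δ).toMonoidHom = ι.range := by
    apply Subgroup.eq_of_le_of_card_ge
    · rintro _ ⟨_, ⟨g, rfl⟩, rfl⟩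
      exact ⟨_, (hδ g).symm⟩
    · exact (Nat.card_congr (ι.range.equivMapOfInjective _ (MulAut.conj δ).injective).toEquiv).le
  have hnorm : ι.range.Normal := by
    rw [← Subgroup.normalizer_eq_top_iff, ← top_le_iff, ← htop, sup_le_iff]
    refine ⟨Subgroup.le_normalizer, ?_⟩
    rw [Subgroup.zpowers_le, Subgroup.mem_normalizer_iff]
    intro x
    constructor
    · rintro ⟨g, rfl⟩
      exact ⟨_, (hδ g).symm⟩
    · intro hh
      have hh : δ * x * δ⁻¹ ∈ ι.range := hh
      rw [← hmap] at hh
      obtain ⟨h', hh', h2⟩ := hh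
      have : h' = x := by simpa using h2
      exact this ▸ hh'
  have hδN : δ ∉ ι.range := by
    rintro ⟨x, rfl⟩
    apply hninn
    exact ⟨x, fun g => by simp⟩
  have hidx : ι.range.index = 3 := by
    refine index_eq_three _ δ hδN hδ3 ?_
    intro y
    have hy : y ∈ ι.range ⊔ Subgroup.zpowers δ := htop ▸ Subgroup.mem_top y
    rw [Subgroup.mem_sup_of_normal_left] at hy
    obtain ⟨a, ha, b, ⟨n, rfl⟩, rfl⟩ := hy
    refine ⟨⟨(n % 3).toNat, by omega⟩, ?_⟩
    rw [← QuotientGroup.eq_one_iff]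
    have hδ1 : (δ : Γ ⧸ ι.range) ^ 3 = 1 := by
      rw [← QuotientGroup.mk_pow, QuotientGroup.eq_one_iff]
      exact hδ3
    simp only [QuotientGroup.mk_mul, QuotientGroup.mk_inv, QuotientGroup.mk_pow,
      QuotientGroup.mk_zpow, (QuotientGroup.eq_one_iff _).mpr ha, one_mul]
    rw [← zpow_natCast, inv_mul_eq_one, Int.toNat_of_nonneg (by omega)]
    conv_rhs => rw [← Int.emod_add_mul_ediv n 3, zpow_add, zpow_mul]
    rw [show ((δ : Γ ⧸ ι.range) ^ (3 : ℤ)) = 1 by exact_mod_cast hδ1, one_zpow, mul_one]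
  have hfin : Finite Γ := by
    have : Finite (Γ ⧸ ι.range) := by
      apply Nat.finite_of_card_ne_zero
      rw [← Subgroup.index, hidx]
      norm_num
    exact Finite.of_subgroup_quotient ι.range
  -- If `det d = c ^ 3`, then `c⁻¹ d` has determinant 1 and induces the same automorphism as `d`,
  -- which would be inner.
  have hncube : ¬ ∃ c ∈ scalars p f K ε, Matrix.GeneralLinearGroup.det d = c ^ 3 := by
    rintro ⟨c, hc, h⟩
    have hcG : mono (fun _ => c⁻¹) 0 ∈ GLe p f K ε := mono_mem_GLe.mpr fun _ => inv_mem hc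
    apply hninn
    refine ⟨⟨d * mono (fun _ => c⁻¹) 0, mem_SLe.mpr ⟨mul_mem hd hcG, ?_⟩⟩, ?_⟩
    · rw [map_mul, det_scalar_const, h, inv_pow, mul_inv_cancel]
    · intro g
      apply hact
      simp only [Subgroup.coe_mul, Subgroup.coe_inv, mul_inv_rev]
      rw [mul_assoc d, mono_const_comm, mul_assoc d, mul_assoc _ (mono _ _), mul_inv_cancel_left,
        mul_assoc]
  exact index_commutator_of_det_ne_cube hα hz hz1 hz3 hker
    (by rw [hidx, ordProj_three]) hδN hδ3 (σ := 1) rfl hδ hncube R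

end Parts

end SL3Sylow

namespace SL3Sylow

/-! ### The Fourier matrix, an element of `SL₃^ε(q)` inverting the cyclic permutation, and the
centre of `PSL₃^ε(q)`. -/

section Fourier

variable {p f : ℕ} {K : Type*} [Field K] [ExpChar K p] {ε : ℤˣ}

/-- The matrix of the discrete Fourier transform of order `3`, scaled to have determinant `1`. -/
def fourierMatrix (z : K) : Matrix (Fin 3) (Fin 3) K :=
  (z - z ^ 2)⁻¹ • !![1, 1, 1; 1, z, z ^ 2; 1, z ^ 2, z]

theorem root_sub_sq_ne {z : Kˣ} (hz1 : z ≠ 1) : (z : K) - (z : K) ^ 2 ≠ 0 := by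
  intro h
  have : (z : K) * (1 - z) = 0 := by linear_combination h
  rcases mul_eq_zero.mp this with h | h
  · exact z.ne_zero h
  · apply hz1
    ext
    rw [sub_eq_zero] at h
    simpa using h.symm

theorem det_fourierMatrix {z : Kˣ} (hz1 : z ≠ 1) (hz3 : z ^ 3 = 1) : (fourierMatrix (z : K)).det = 1 := by
  have h1 := cube_root_sum hz1 hz3
  have h2 := root_sub_sq_ne (K := K) hz1
  rw [fourierMatrix, Matrix.det_smul, Fintype.card_fin, inv_pow,
    inv_mul_eq_one₀ (pow_ne_zero 3 h2)]
  rw [Matrix.det_fin_three]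
  simp
  linear_combination (-(z : K) ^ 4 + 4 * z ^ 3 - 5 * z ^ 2 + 2 * z) * h1

/-- The discrete Fourier transform as an element of `GL₃`. -/
def fourierGL {z : Kˣ} (hz1 : z ≠ 1) (hz3 : z ^ 3 = 1) : GL (Fin 3) K :=
  Matrix.GeneralLinearGroup.mkOfDetNeZero (fourierMatrix (z : K)) (by rw [det_fourierMatrix hz1 hz3]; exact one_ne_zero)

theorem coe_fourierGL {z : Kˣ} (hz1 : z ≠ 1) (hz3 : z ^ 3 = 1) :
    (fourierGL hz1 hz3 : Matrix (Fin 3) (Fin 3) K) = fourierMatrix (z : K) := rfl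

theorem fourierGL_mem {z : Kˣ} (hz : z ∈ scalars p f K ε) (hz1 : z ≠ 1) (hz3 : z ^ 3 = 1) :
    fourierGL hz1 hz3 ∈ SLe p f K ε := by
  refine mem_SLe.mpr ⟨mem_GLe.mpr ?_, ?_⟩
  · rcases hz with hz | hz
    · exact Or.inl hz
    · right
      have hφ : iterateFrobenius K p f (z : K) = (z : K) ^ 2 := by
        rw [iterateFrobenius_def]
        have h1 : (z : K) ^ (p ^ f) * z = 1 := by
          rw [← pow_succ, ← Units.val_pow_eq_pow_val, hz, Units.val_one]
        have h2 : (z : K) ^ 3 = 1 := by rw [← Units.val_pow_eq_pow_val, hz3, Units.val_one]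
        apply mul_right_cancel₀ z.ne_zero
        rw [h1, ← h2]; ring
      have h1 := cube_root_sum hz1 hz3
      have h2 := root_sub_sq_ne (K := K) hz1
      rw [coe_fourierGL, fourierMatrix]
      generalize iterateFrobenius K p f = φ at hφ
      -- The `q`-power map exchanges `z` and `z²`. It therefore negates `a = (z - z²)⁻¹`, and `3a² =
      -- -1` makes the matrix unitary.
      have h3 : φ (((z : K) - (z : K) ^ 2)⁻¹) = - ((z : K) - (z : K) ^ 2)⁻¹ := by
        rw [map_inv₀, map_sub, map_pow, hφ, ← inv_neg]
        congr 1
        linear_combination (-(z : K) ^ 2 + z) * h1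
      have h4 : ((z : K) - (z : K) ^ 2)⁻¹ * ((z : K) - (z : K) ^ 2) = 1 := inv_mul_cancel₀ h2
      generalize ((z : K) - (z : K) ^ 2)⁻¹ = a at h3 h4
      generalize (z : K) = x at *
      have h5 : 3 * a ^ 2 = -1 := by
        linear_combination (-(a * (x - x ^ 2)) - 1) * h4 + a ^ 2 * (x ^ 2 - 3 * x + 3) * h1
      ext i j
      fin_cases i <;> fin_cases j <;>
        simp [Matrix.mul_apply, Fin.sum_univ_three, h3, hφ] <;> grind
  · ext
    rw [Matrix.GeneralLinearGroup.val_det_apply, coe_fourierGL, det_fourierMatrix hz1 hz3,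
      Units.val_one]

/-- The discrete Fourier transform as an element of `SL₃^ε(q)`. -/
def fourier {z : Kˣ} (hz : z ∈ scalars p f K ε) (hz1 : z ≠ 1) (hz3 : z ^ 3 = 1) : SLe p f K ε :=
  ⟨fourierGL hz1 hz3, fourierGL_mem hz hz1 hz3⟩

theorem coe_fourier {z : Kˣ} (hz : z ∈ scalars p f K ε) (hz1 : z ≠ 1) (hz3 : z ^ 3 = 1) :
    ((fourier hz hz1 hz3 : GL (Fin 3) K) : Matrix (Fin 3) (Fin 3) K) = fourierMatrix (z : K) := rfl

theorem coe_mono_zero (a : Fin 3 → Kˣ) : (mono a 0 : Matrix (Fin 3) (Fin 3) K) =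
    !![(a 0 : K), 0, 0; 0, (a 1 : K), 0; 0, 0, (a 2 : K)] := by
  ext i j
  fin_cases i <;> fin_cases j <;> simp [mono_apply]

theorem coe_mono_one (a : Fin 3 → Kˣ) : (mono a 1 : Matrix (Fin 3) (Fin 3) K) =
    !![0, (a 0 : K), 0; 0, 0, (a 1 : K); (a 2 : K), 0, 0] := by
  ext i j
  fin_cases i <;> fin_cases j <;> simp [mono_apply]

theorem coe_mono_two (a : Fin 3 → Kˣ) : (mono a 2 : Matrix (Fin 3) (Fin 3) K) =
    !![0, 0, (a 0 : K); (a 1 : K), 0, 0; 0, (a 2 : K), 0] := by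
  ext i j
  fin_cases i <;> fin_cases j <;> simp [mono_apply]

theorem fourier_mul_diagRoot {z : Kˣ} (hz : z ∈ scalars p f K ε) (hz1 : z ≠ 1) (hz3 : z ^ 3 = 1) :
    fourier hz hz1 hz3 * diagRoot z hz hz3 = cyc * fourier hz hz1 hz3 := by
  have h3 : (z : K) ^ 3 = 1 := by rw [← Units.val_pow_eq_pow_val, hz3, Units.val_one]
  ext1
  apply Units.ext
  rw [Subgroup.coe_mul, Subgroup.coe_mul, Units.val_mul, Units.val_mul, coe_fourier, coe_cyc,
    show ((diagRoot z hz hz3 : SLe p f K ε) : GL (Fin 3) K) = mono ![1, z, z ^ 2] 0 from rfl,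
    coe_mono_zero, coe_mono_one, fourierMatrix, Matrix.smul_mul, Matrix.mul_smul]
  congr 1
  ext i j
  fin_cases i <;> fin_cases j <;> simp [Matrix.mul_apply, Fin.sum_univ_three] <;> grind

theorem fourier_mul_cyc {z : Kˣ} (hz : z ∈ scalars p f K ε) (hz1 : z ≠ 1) (hz3 : z ^ 3 = 1) :
    diagRoot z hz hz3 * (fourier hz hz1 hz3 * cyc) = fourier hz hz1 hz3 := by
  have h3 : (z : K) ^ 3 = 1 := by rw [← Units.val_pow_eq_pow_val, hz3, Units.val_one]
  ext1
  apply Units.ext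
  rw [Subgroup.coe_mul, Subgroup.coe_mul, Units.val_mul, Units.val_mul, coe_fourier, coe_cyc,
    show ((diagRoot z hz hz3 : SLe p f K ε) : GL (Fin 3) K) = mono ![1, z, z ^ 2] 0 from rfl,
    coe_mono_zero, coe_mono_one, fourierMatrix, Matrix.smul_mul, Matrix.mul_smul]
  congr 1
  ext i j
  fin_cases i <;> fin_cases j <;> simp [Matrix.mul_apply, Fin.sum_univ_three] <;> grind

/-- The monomial matrix that exchanges the first and the last basis vector, up to sign. -/
def swapGL : GL (Fin 3) K where
  val := !![0, 0, -1; 0, -1, 0; -1, 0, 0]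
  inv := !![0, 0, -1; 0, -1, 0; -1, 0, 0]
  val_inv := by
    ext i j
    fin_cases i <;> fin_cases j <;> simp [Matrix.mul_apply, Fin.sum_univ_three]
  inv_val := by
    ext i j
    fin_cases i <;> fin_cases j <;> simp [Matrix.mul_apply, Fin.sum_univ_three]

theorem coe_swapGL : ((swapGL : GL (Fin 3) K) : Matrix (Fin 3) (Fin 3) K) =
    !![0, 0, -1; 0, -1, 0; -1, 0, 0] := rfl

variable (p f K ε) in
/-- `swapGL` as an element of `SL₃^ε(q)`. -/
def swap : SLe p f K ε := ⟨swapGL, by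
  refine mem_SLe.mpr ⟨mem_GLe.mpr (Or.inr ?_), ?_⟩
  · rw [coe_swapGL]
    ext i j
    fin_cases i <;> fin_cases j <;> simp [Matrix.mul_apply, Fin.sum_univ_three]
  · ext
    rw [Matrix.GeneralLinearGroup.val_det_apply, coe_swapGL, Matrix.det_fin_three]
    simp⟩

theorem coe_swap : (swap p f K ε : GL (Fin 3) K) = swapGL := rfl

theorem swap_mul_cyc : swap p f K ε * cyc = cyc⁻¹ * swap p f K ε := by
  rw [eq_inv_mul_iff_mul_eq]
  ext1
  apply Units.ext
  simp only [Subgroup.coe_mul, Units.val_mul, coe_swap, coe_swapGL, coe_cyc, coe_mono_one]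
  ext i j
  fin_cases i <;> fin_cases j <;> simp [Matrix.mul_apply, Fin.sum_univ_three]

theorem swapGL_mul_mono (a : Fin 3 → Kˣ) : swapGL * mono a 0 = mono ![a 2, a 1, a 0] 0 * swapGL := by
  apply Units.ext
  simp only [Units.val_mul, coe_swapGL, coe_mono_zero]
  ext i j
  fin_cases i <;> fin_cases j <;> simp [Matrix.mul_apply, Fin.sum_univ_three]

/-- A matrix commuting with `diag(1, z, z²)` up to a scalar is monomial. -/
theorem exists_mono_of_comm {z : Kˣ} (hz1 : z ≠ 1) (hz3 : z ^ 3 = 1) {g : GL (Fin 3) K} {c : Kˣ}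
    (h1 : mono ![1, z, z ^ 2] 0 * g = g * mono ![1, z, z ^ 2] 0 * mono (fun _ => c) 0) :
    ∃ a k, g = mono a k := by
  have hc : ∀ M : GL (Fin 3) K, ((M * mono (fun _ => c) 0 : GL (Fin 3) K) :
      Matrix (Fin 3) (Fin 3) K) = (c : K) • (M : Matrix (Fin 3) (Fin 3) K) := by
    intro M
    ext i j
    rw [Units.val_mul, coe_mono_zero]
    fin_cases j <;> simp [Matrix.mul_apply, Fin.sum_univ_three, mul_comm]
  have h1' := fun i j => diag_comm_apply (g := (g : Matrix (Fin 3) (Fin 3) K)) (c := c)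
    (by rw [← Units.val_mul, h1, hc, Units.val_mul]) i j
  have hrow : ∀ i, ∃ j, g i j ≠ 0 := by
    intro i
    by_contra hcon
    push Not at hcon
    exact Matrix.GeneralLinearGroup.det_ne_zero g (Matrix.det_eq_zero_of_row_eq_zero i hcon)
  have hz3' : (z : K) ^ 3 = 1 := by rw [← Units.val_pow_eq_pow_val, hz3, Units.val_one]
  have hent : ∀ i : Fin 3, ((![1, z, z ^ 2] : Fin 3 → Kˣ) i : K) = (z : K) ^ (i : ℕ) := by
    intro i; fin_cases i <;> simp
  have hent2 : ∀ i j : Fin 3, g i j ≠ 0 → (z : K) ^ (i : ℕ) = c * (z : K) ^ (j : ℕ) := by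
    intro i j h
    have := h1' i j
    rw [hent, hent] at this
    apply mul_right_cancel₀ h
    rw [this]; ring
  have hzo : orderOf z = 3 := orderOf_eq_prime hz3 hz1
  have huniq : ∀ i j i' j' : Fin 3, g i j ≠ 0 → g i' j' ≠ 0 → j - i = j' - i' := by
    intro i j i' j' h h'
    have e1 := hent2 i j h
    have e2 := hent2 i' j' h'
    have e3 : (z : K) ^ ((i : ℕ) + j') = z ^ ((i' : ℕ) + j) := by
      rw [pow_add, pow_add, e1, e2]; ring
    have e4 : z ^ ((i : ℕ) + j') = z ^ ((i' : ℕ) + j) := by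
      ext; push_cast; exact e3
    rw [pow_eq_pow_iff_modEq, hzo] at e4
    clear * - e4
    revert i j i' j'
    decide
  obtain ⟨k, hk⟩ := hrow 0
  have hall : ∀ i, g i (i + k) ≠ 0 := by
    intro i
    obtain ⟨j, hj⟩ := hrow i
    have := huniq i j 0 k hj hk
    have : j = i + k := by rw [sub_zero] at this; rw [← this]; simp
    exact this ▸ hj
  refine ⟨fun i => Units.mk0 _ (hall i), k, ?_⟩
  ext i j
  rw [mono_apply]
  split_ifs with h
  · subst h; rfl
  · by_contra hne
    apply h
    have := huniq i j 0 k hne hk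
    rw [sub_zero] at this
    rw [← this]; simp

/-- A preimage of a central element commutes up to scalars with `diag(1, z, z²)`, which makes it
monomial, and with the Fourier matrix, which makes its permutation part trivial and its entries
equal. -/
theorem center_PSLe {z : Kˣ} (hz : z ∈ scalars p f K ε) (hz1 : z ≠ 1) (hz3 : z ^ 3 = 1)
    {g : SLe p f K ε} (hg : (g : PSLe p f K ε) ∈ Subgroup.center (PSLe p f K ε)) :
    g ∈ Subgroup.center (SLe p f K ε) := by
  have hcomm : ∀ h : SLe p f K ε, ∃ c : Kˣ,
      (h : GL (Fin 3) K) * g = g * h * mono (fun _ => c) 0 := by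
    intro h
    have h1 := Subgroup.mem_center_iff.mp hg h
    rw [← QuotientGroup.mk_mul, ← QuotientGroup.mk_mul, eq_comm, QuotientGroup.eq] at h1
    obtain ⟨c, hc⟩ := (mem_center_SLe hz hz1 hz3).mp h1
    refine ⟨c, ?_⟩
    rw [← hc]
    simp only [Subgroup.coe_mul, Subgroup.coe_inv]
    group
  obtain ⟨c, hc⟩ := hcomm (diagRoot z hz hz3)
  obtain ⟨a, k, ha⟩ := exists_mono_of_comm hz1 hz3 hc
  obtain ⟨e, he⟩ := hcomm (fourier hz hz1 hz3)
  have h3 : (z : K) ^ 3 = 1 := by rw [← Units.val_pow_eq_pow_val, hz3, Units.val_one]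
  have hz1' : (z : K) ≠ 1 := by simpa using hz1
  have hs := inv_ne_zero (root_sub_sq_ne (K := K) hz1)
  rw [mem_center_SLe hz hz1 hz3]
  have he' := fun i j => congrArg (fun g : GL (Fin 3) K => (g : Matrix (Fin 3) (Fin 3) K) i j) he
  simp only [ha, Units.val_mul, coe_fourier, coe_mono_zero] at he'
  have e00 := he' 0 0
  have e01 := he' 0 1
  have e02 := he' 0 2
  have e10 := he' 1 0
  have h0 := (a 0).ne_zero
  have h1 := (a 1).ne_zero
  have h2 := (a 2).ne_zero
  have hk : k = 0 ∨ k = 1 ∨ k = 2 := (by decide : ∀ k : Fin 3, k = 0 ∨ k = 1 ∨ k = 2) k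
  rcases hk with rfl | rfl | rfl
  · refine ⟨a 0, ?_⟩
    rw [ha]
    congr 1
    rw [coe_mono_zero] at e00 e01 e02
    simp [fourierMatrix, Matrix.mul_apply, Fin.sum_univ_three] at e00 e01 e02
    ext i
    fin_cases i
    · rfl
    · simp only [Fin.mk_one]; grind
    · simp only [Fin.reduceFinMk]; grind
  · exfalso
    rw [coe_mono_one] at e00 e01 e02 e10
    simp [fourierMatrix, Matrix.mul_apply, Fin.sum_univ_three] at e00 e01 e02 e10
    generalize ((z : K) - (z : K) ^ 2)⁻¹ = s at *
    grind
  · exfalso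
    rw [coe_mono_two] at e00 e01 e02 e10
    simp [fourierMatrix, Matrix.mul_apply, Fin.sum_univ_three] at e00 e01 e02 e10
    generalize ((z : K) - (z : K) ^ 2)⁻¹ = s at *
    grind

end Fourier

end SL3Sylow

/-! ### Automorphisms of `p`-groups that are trivial on the abelianization. -/

namespace SL3Sylow

/-- A maximal subgroup of a nilpotent group is normal and contains the derived subgroup, because the
quotient is solvable without proper nontrivial subgroups. -/
theorem eq_top_of_sup_commutator_eq_top {G : Type*} [Group G] [Finite G] [Group.IsNilpotent G]
    {H : Subgroup G} (h : H ⊔ commutator G = ⊤) : H = ⊤ := by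
  by_contra hne
  obtain ⟨K, hK, hHK⟩ := (eq_top_or_exists_le_coatom H).resolve_left hne
  have hn : K.Normal := Subgroup.NormalizerCondition.normal_of_coatom K Group.normalizerCondition_of_isNilpotent hK
  have hnt : Nontrivial (G ⧸ K) := QuotientGroup.nontrivial_iff.mpr hK.1
  have hlt := Group.IsSolvable.commutator_lt_top_of_nontrivial (G ⧸ K)
  have hle : commutator G ≤ K := by
    by_contra hnle
    have h1 : K ⊔ commutator G = ⊤ := hK.2 _ (left_lt_sup.mpr hnle)
    apply hlt.ne
    rw [eq_top_iff, ← Subgroup.map_top_of_surjective (QuotientGroup.mk' K)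
      (QuotientGroup.mk'_surjective K), ← h1, Subgroup.map_sup, QuotientGroup.map_mk'_self,
      bot_sup_eq, Subgroup.map_le_iff_le_comap]
    exact commutator_le_comap _
  exact hK.1 (top_le_iff.mp (h ▸ sup_le hHK hle))

/-- Each coset of `G'` is invariant under `e` and has `p`-power size. Counting modulo `l` gives a
fixed point in it, so the fixed points generate `G` modulo `G'`. -/
theorem eq_one_of_pow_prime {p l : ℕ} [Fact p.Prime] [Fact l.Prime] (hlp : l ≠ p)
    {G : Type*} [Group G] [Finite G] (hG : IsPGroup p G) (e : MulAut G)
    (he : ∀ g, g⁻¹ * e g ∈ commutator G) (hl : e ^ l = 1) : e = 1 := by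
  have hnil : Group.IsNilpotent G := hG.isNilpotent
  let H : Subgroup G :=
    { carrier := {g | e g = g}
      one_mem' := map_one e
      mul_mem' := fun {a b} ha hb => by
        simp only [Set.mem_ofPred_eq] at ha hb ⊢
        rw [map_mul, ha, hb]
      inv_mem' := fun {a} ha => by
        simp only [Set.mem_ofPred_eq] at ha ⊢
        rw [map_inv, ha] }
  have hH : H = ⊤ := by
    apply eq_top_of_sup_commutator_eq_top
    rw [eq_top_iff]
    intro g _
    let φ : Function.End {x : G // g⁻¹ * x ∈ commutator G} := fun x => ⟨e x, by
      rw [← mul_inv_cancel_left (x : G) (e x), ← mul_assoc g⁻¹, ← mul_assoc]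
      rw [mul_assoc (g⁻¹ * (x : G))]
      exact mul_mem x.2 (he x)⟩
    have hφ : ∀ n x, (((φ ^ n) x : {x : G // g⁻¹ * x ∈ commutator G}) : G) = (e ^ n) x := by
      intro n
      induction n with
      | zero => intro x; rfl
      | succ n ih =>
        intro x
        rw [pow_succ, pow_succ, MulAut.mul_apply]
        exact ih (φ x)
    have hφ1 : φ ^ l ^ 1 = 1 := by
      funext x
      apply Subtype.ext
      rw [hφ, pow_one, hl]
      rfl
    classical
    have hfin : Fintype {x : G // g⁻¹ * x ∈ commutator G} := Fintype.ofFinite _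
    have hcard : Nat.card {x : G // g⁻¹ * x ∈ commutator G} ≡ Nat.card φ.fixedPoints [MOD l] := by
      simp only [Nat.card_eq_fintype_card]
      exact Equiv.Perm.card_fixedPoints_modEq (f := φ) (p := l) (n := 1) hφ1
    have hc : Nat.card {x : G // g⁻¹ * x ∈ commutator G} = Nat.card (commutator G) := by
      exact Nat.card_congr ((Equiv.mulLeft g⁻¹).subtypeEquiv fun x => Iff.rfl)
    obtain ⟨n, hn⟩ := IsPGroup.iff_card.mp (hG.to_subgroup (commutator G))
    have hne : Nat.card φ.fixedPoints ≠ 0 := by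
      intro h0
      rw [h0, hc, hn, Nat.modEq_zero_iff_dvd] at hcard
      exact hlp ((Nat.prime_dvd_prime_iff_eq Fact.out Fact.out).mp
        ((Fact.out : l.Prime).dvd_of_dvd_pow hcard))
    obtain ⟨⟨x, hx⟩⟩ := (Nat.card_pos_iff.mp (Nat.pos_of_ne_zero hne)).1
    have hxH : (x : G) ∈ H := congrArg Subtype.val hx
    have : g = x * (g⁻¹ * (x : G))⁻¹ := by group
    rw [this]
    exact Subgroup.mul_mem_sup hxH (inv_mem x.2)
  ext g
  have : g ∈ H := hH ▸ Subgroup.mem_top g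
  exact this

/-- An automorphism of a finite `p`-group that is trivial modulo the derived subgroup has
`p`-power order. -/
theorem exists_pow_eq_one_of_trivial_mod_commutator {p : ℕ} [Fact p.Prime]
    {G : Type*} [Group G] [Finite G] (hG : IsPGroup p G) (e : MulAut G)
    (he : ∀ g, g⁻¹ * e g ∈ commutator G) : ∃ k, e ^ p ^ k = 1 := by
  obtain ⟨k, m, hm, hkm⟩ := Nat.exists_eq_pow_mul_and_not_dvd (orderOf_pos e).ne' p
    (Fact.out : p.Prime).ne_one
  refine ⟨k, ?_⟩
  have hpow : ∀ n g, g⁻¹ * (e ^ n) g ∈ commutator G := by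
    intro n
    induction n with
    | zero => intro g; simp
    | succ n ih =>
      intro g
      rw [pow_succ, MulAut.mul_apply, ← mul_inv_cancel_left (e g) ((e ^ n) (e g)), ← mul_assoc]
      exact mul_mem (he g) (ih _)
  by_cases hm1 : m = 1
  · rw [hm1, mul_one] at hkm
    rw [← hkm, pow_orderOf_eq_one]
  · obtain ⟨l, hl, hlm⟩ := Nat.exists_prime_and_dvd hm1
    have : Fact l.Prime := ⟨hl⟩
    obtain ⟨r, rfl⟩ := hlm
    exfalso
    have h1 := eq_one_of_pow_prime (l := l) (by rintro rfl; exact hm (dvd_mul_right _ _)) hG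
      (e ^ (p ^ k * r)) (hpow _) (by rw [← pow_mul, mul_assoc, mul_comm r, ← hkm, pow_orderOf_eq_one])
    have h2 := orderOf_dvd_of_pow_eq_one h1
    rw [hkm] at h2
    have hpos : 0 < p ^ k * r := by
      have := orderOf_pos e
      rw [hkm] at this
      apply Nat.pos_of_ne_zero
      rintro h
      rw [mul_left_comm, h] at this
      simp at this
    have h3 := Nat.le_of_dvd hpos h2
    have := hl.two_le
    nlinarith

/-- `x` has coprime powers in `W`: the given one, and the one with exponent the index of `N`. -/
theorem mem_of_pow_mem_of_not_dvd_index {X : Type*} [Group X] [Finite X] {N W : Subgroup X}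
    [N.Normal] (hNW : N ≤ W) (hN : ¬ 3 ∣ N.index) {x : X} {k : ℕ} (hx : x ^ 3 ^ k ∈ W) : x ∈ W := by
  have h1 : x ^ N.index ∈ W := hNW (N.pow_index_mem x)
  have hcop : Nat.Coprime (3 ^ k) N.index :=
    Nat.Coprime.pow_left k ((Nat.Prime.coprime_iff_not_dvd Nat.prime_three).mpr hN)
  obtain ⟨a, b, hab⟩ : ∃ a b : ℤ, (3 ^ k : ℕ) * a + N.index * b = 1 :=
    ⟨_, _, by rw [← Nat.gcd_eq_gcd_ab, hcop]; rfl⟩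
  rw [← zpow_one x, ← hab, zpow_add, zpow_mul, zpow_mul, zpow_natCast, zpow_natCast]
  exact mul_mem (zpow_mem hx _) (zpow_mem h1 _)

end SL3Sylow

namespace SL3Sylow

/-! ### The action of the normalizer of a Sylow 3-subgroup on its abelianization. -/

section Coordinates

variable {G : Type*} [Group G]

/-- Coordinates on the abelianization of a group generated, modulo the derived subgroup of
index `9`, by two elements of order `3`. -/
theorem exists_coordinates [Finite G] {t w : G} (hindex : (commutator G).index = 9)
    (ht : t ^ 3 ∈ commutator G) (hw : w ^ 3 ∈ commutator G)
    (hgen : ∀ g, ∃ k l : ℕ, (w ^ k * t ^ l)⁻¹ * g ∈ commutator G) :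
    ∃ χ : G →* Multiplicative (Fin 2 → ZMod 3), χ.ker = commutator G ∧
      χ t = Multiplicative.ofAdd ![1, 0] ∧ χ w = Multiplicative.ofAdd ![0, 1] := by
  let V := Additive (Abelianization G)
  let T : V := Additive.ofMul (Abelianization.of t)
  let W : V := Additive.ofMul (Abelianization.of w)
  have hT : (3 : ℕ) • T = 0 := by
    apply Additive.toMul.injective
    change (Abelianization.of t) ^ 3 = 1
    rw [← map_pow]
    exact (QuotientGroup.eq_one_iff _).mpr ht
  have hW : (3 : ℕ) • W = 0 := by
    apply Additive.toMul.injective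
    change (Abelianization.of w) ^ 3 = 1
    rw [← map_pow]
    exact (QuotientGroup.eq_one_iff _).mpr hw
  have hVgen : ∀ v : V, ∃ k l : ℕ, v = k • W + l • T := by
    intro v
    obtain ⟨g, hg⟩ := QuotientGroup.mk_surjective (Additive.toMul v)
    obtain ⟨k, l, h⟩ := hgen g
    refine ⟨k, l, ?_⟩
    apply Additive.toMul.injective
    exact hg.symm.trans (QuotientGroup.eq.mpr h).symm
  have h3 : ∀ v : V, (3 : ℕ) • v = 0 := by
    intro v
    obtain ⟨k, l, rfl⟩ := hVgen v
    rw [smul_add, smul_comm, hW, smul_comm, hT, smul_zero, smul_zero, add_zero]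
  let : Module (ZMod 3) V := AddCommGroup.zmodModule h3
  let L := Fintype.linearCombination (ZMod 3) ![T, W]
  have hLap : ∀ v, L v = v 0 • T + v 1 • W := by
    intro v
    rw [Fintype.linearCombination_apply, Fin.sum_univ_two]
    rfl
  have hsurj : Function.Surjective L := by
    intro v
    obtain ⟨k, l, rfl⟩ := hVgen v
    refine ⟨![l, k], ?_⟩
    rw [hLap]
    simp only [Matrix.cons_val_zero, Matrix.cons_val_one, Nat.cast_smul_eq_nsmul]
    rw [add_comm]
  have hcard : Nat.card (Fin 2 → ZMod 3) ≤ Nat.card V := by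
    have : Nat.card V = 9 := hindex
    rw [this]
    simp
  have hbij := hsurj.bijective_of_nat_card_le hcard
  let E := LinearEquiv.ofBijective L hbij
  let χ : G →* Multiplicative (Fin 2 → ZMod 3) :=
    (AddMonoidHom.toMultiplicativeRight (E.symm : V →ₗ[ZMod 3] (Fin 2 → ZMod 3)).toAddMonoidHom).comp
      Abelianization.of
  have hχ : ∀ g, χ g = Multiplicative.ofAdd (E.symm (Additive.ofMul (Abelianization.of g))) :=
    fun _ => rfl
  refine ⟨χ, ?_, ?_, ?_⟩
  · ext g
    rw [MonoidHom.mem_ker, hχ, ofAdd_eq_one, LinearEquiv.map_eq_zero_iff, ofMul_eq_zero]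
    exact QuotientGroup.eq_one_iff _
  · rw [hχ]
    congr 1
    rw [LinearEquiv.symm_apply_eq]
    change _ = L _
    rw [hLap]
    simp [T]
  · rw [hχ]
    congr 1
    rw [LinearEquiv.symm_apply_eq]
    change _ = L _
    rw [hLap]
    simp [W]

variable (χ : G →* Multiplicative (Fin 2 → ZMod 3)) (t w : G)

/-- The matrix by which an automorphism acts in the coordinates `χ`, for which `t`, `w` are the
basis vectors. -/
def actionMatrix (e : MulAut G) : Matrix (Fin 2) (Fin 2) (ZMod 3) :=
  Matrix.of fun i j => ![(χ (e t)).toAdd i, (χ (e w)).toAdd i] j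

variable {χ t w}

theorem actionMatrix_mulVec (hχ : χ.ker = commutator G)
    (ht : χ t = Multiplicative.ofAdd ![1, 0]) (hw : χ w = Multiplicative.ofAdd ![0, 1])
    (e : MulAut G) (g : G) :
    (χ (e g)).toAdd = actionMatrix χ t w e *ᵥ (χ g).toAdd := by
  let v := (χ g).toAdd
  have h1 : (t ^ (v 0).val * w ^ (v 1).val)⁻¹ * g ∈ χ.ker := by
    rw [MonoidHom.mem_ker, map_mul, map_inv, map_mul, map_pow, map_pow, ht, hw, inv_mul_eq_one]
    apply Multiplicative.toAdd.injective
    ext i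
    fin_cases i <;> simp [v]
  rw [hχ] at h1
  have h2 : e ((t ^ (v 0).val * w ^ (v 1).val)⁻¹ * g) ∈ χ.ker := by
    rw [hχ]
    exact commutator_le_comap (e : G →* G) h1
  rw [MonoidHom.mem_ker, map_mul, map_inv, map_mul, map_mul, map_inv, map_mul, map_pow, map_pow,
    map_pow, map_pow, inv_mul_eq_one] at h2
  rw [← h2]
  ext i
  simp only [toAdd_mul, toAdd_pow, Pi.add_apply, Pi.smul_apply]
  simp only [nsmul_eq_mul, ZMod.natCast_val,
    ZMod.cast_id', id, Matrix.mulVec, dotProduct, Fin.sum_univ_two, actionMatrix, Matrix.of_apply,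
    Matrix.cons_val_zero, Matrix.cons_val_one, v]
  ring

theorem actionMatrix_ext (M N : Matrix (Fin 2) (Fin 2) (ZMod 3))
    (ht : χ t = Multiplicative.ofAdd ![1, 0]) (hw : χ w = Multiplicative.ofAdd ![0, 1])
    (h : ∀ g, M *ᵥ (χ g).toAdd = N *ᵥ (χ g).toAdd) : M = N := by
  ext i j
  have h0 := congrFun (h t) i
  have h1 := congrFun (h w) i
  rw [ht] at h0
  rw [hw] at h1
  simp [Matrix.mulVec, dotProduct, Fin.sum_univ_two] at h0 h1
  fin_cases j
  · exact h0
  · exact h1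

theorem actionMatrix_mul (hχ : χ.ker = commutator G)
    (ht : χ t = Multiplicative.ofAdd ![1, 0]) (hw : χ w = Multiplicative.ofAdd ![0, 1])
    (e e' : MulAut G) :
    actionMatrix χ t w (e * e') = actionMatrix χ t w e * actionMatrix χ t w e' := by
  apply actionMatrix_ext (χ := χ) (t := t) (w := w) _ _ ht hw
  intro g
  rw [← actionMatrix_mulVec hχ ht hw, ← Matrix.mulVec_mulVec, ← actionMatrix_mulVec hχ ht hw,
    ← actionMatrix_mulVec hχ ht hw]
  rfl

theorem actionMatrix_one (hχ : χ.ker = commutator G)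
    (ht : χ t = Multiplicative.ofAdd ![1, 0]) (hw : χ w = Multiplicative.ofAdd ![0, 1]) :
    actionMatrix χ t w 1 = 1 := by
  apply actionMatrix_ext (χ := χ) (t := t) (w := w) _ _ ht hw
  intro g
  rw [← actionMatrix_mulVec hχ ht hw, Matrix.one_mulVec]
  rfl

theorem mem_commutator_of_actionMatrix (hχ : χ.ker = commutator G)
    (ht : χ t = Multiplicative.ofAdd ![1, 0]) (hw : χ w = Multiplicative.ofAdd ![0, 1])
    {e : MulAut G} (he : actionMatrix χ t w e = 1) (g : G) : g⁻¹ * e g ∈ commutator G := by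
  rw [← hχ, MonoidHom.mem_ker, map_mul, map_inv, inv_mul_eq_one]
  apply Multiplicative.toAdd.injective
  rw [actionMatrix_mulVec hχ ht hw, he, Matrix.one_mulVec]

end Coordinates

/-- The index of `N C(P)`, where `N` is a normal subgroup of index prime to `3` containing the Sylow
`3`-subgroup `P`, if `N` induces enough automorphisms on `P / P'`. -/
theorem index_sup_centralizer_le {X : Type*} [Group X] [Finite X] (N : Subgroup X) [N.Normal]
    (hN : ¬ 3 ∣ N.index) (P : Sylow 3 X) (hP : (P : Subgroup X) ≤ N)
    (χ : P →* Multiplicative (Fin 2 → ZMod 3)) (t w : P)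
    (hχ : χ.ker = commutator P)
    (ht : χ t = Multiplicative.ofAdd ![1, 0]) (hw : χ w = Multiplicative.ofAdd ![0, 1])
    (h : ∀ n : Subgroup.normalizer (P : Set X),
      (actionMatrix χ t w (Subgroup.normalizerMonoidHom (P : Subgroup X) n)).det = 1 →
      ∃ m : Subgroup.normalizer (P : Set X), (m : X) ∈ N ∧
        (actionMatrix χ t w (Subgroup.normalizerMonoidHom (P : Subgroup X) m) *
          actionMatrix χ t w (Subgroup.normalizerMonoidHom (P : Subgroup X) n)) ^ 3 = 1) :
    (N ⊔ Subgroup.centralizer (P : Set X)).index ≤ 2 := by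
  set W := N ⊔ Subgroup.centralizer (P : Set X) with hW
  let c := Subgroup.normalizerMonoidHom (P : Subgroup X)
  let M : Subgroup.normalizer (P : Set X) → Matrix (Fin 2) (Fin 2) (ZMod 3) :=
    fun n => actionMatrix χ t w (c n)
  have hMmul : ∀ m n, M (m * n) = M m * M n := by
    intro m n
    simp only [M, map_mul, actionMatrix_mul hχ ht hw]
  have hM1 : M 1 = 1 := by
    simp only [M, map_one, actionMatrix_one hχ ht hw]
  -- Triviality on `P/P'` gives an automorphism of `P` of 3-power order. So a 3-power of `n`
  -- centralizes `P`, and `N` has index prime to 3.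
  have hone : ∀ n, M n = 1 → (n : X) ∈ W := by
    intro n hn
    obtain ⟨k, hk⟩ := exists_pow_eq_one_of_trivial_mod_commutator P.2 (c n)
      (mem_commutator_of_actionMatrix hχ ht hw hn)
    apply mem_of_pow_mem_of_not_dvd_index (k := k) le_sup_left hN
    apply Subgroup.mem_sup_right
    rw [← map_pow] at hk
    have h1 : n ^ 3 ^ k ∈ c.ker := hk
    rw [Subgroup.normalizerMonoidHom_ker, Subgroup.mem_subgroupOf] at h1
    exact h1
  -- After multiplication by some `m` in `N`, the cube acts trivially on `P/P'`; again the factor 3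
  -- is harmless modulo `N`.
  have hdet : ∀ n, (M n).det = 1 → (n : X) ∈ W := by
    intro n hn
    obtain ⟨m, hm, hmn⟩ := h n hn
    have h1 := hone ((m * n) ^ 3) (by
      rw [pow_succ, pow_two, hMmul, hMmul, hMmul, ← hmn, pow_succ, pow_two])
    have h2 := mem_of_pow_mem_of_not_dvd_index (k := 1) (W := W) le_sup_left hN
      (x := ((m * n : Subgroup.normalizer (P : Set X)) : X)) h1
    have h3 := mul_mem (inv_mem (Subgroup.mem_sup_left (S := N)
      (T := Subgroup.centralizer (P : Set X)) hm)) h2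
    rwa [Subgroup.coe_mul, inv_mul_cancel_left] at h3
  have hcase : ∀ n, (M n).det = 1 ∨ (M n).det = -1 := by
    intro n
    have h1 : (M n).det * (M n⁻¹).det = 1 := by
      rw [← Matrix.det_mul, ← hMmul, mul_inv_cancel, hM1, Matrix.det_one]
    generalize (M n).det = x at *
    generalize (M n⁻¹).det = y at *
    revert x y
    decide
  -- Frattini's argument. It reduces the cosets to the normalizer of `P`, where only the sign of the
  -- determinant remains.
  have hsplit : ∀ x : X, ∃ n : Subgroup.normalizer (P : Set X), ∃ y ∈ N, x = n * y := by
    intro x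
    have h1 : x ∈ Subgroup.normalizer (P : Set X) ⊔ N := by
      rw [P.normalizer_sup_eq_top' hP]
      exact Subgroup.mem_top x
    obtain ⟨n, hn, y, hy, rfl⟩ := Subgroup.mem_sup_of_normal_right.mp h1
    exact ⟨⟨n, hn⟩, y, hy, rfl⟩
  by_cases hs : ∃ s, (M s).det = -1
  · obtain ⟨s, hs⟩ := hs
    refine index_le_of_forall_exists (ι := Fin 2) W ![1, (s : X)] fun x => ?_
    obtain ⟨n, y, hy, rfl⟩ := hsplit x
    rcases hcase n with hn | hn
    · refine ⟨0, ?_⟩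
      simp only [Matrix.cons_val_zero, inv_one, one_mul]
      exact mul_mem (hdet n hn) (Subgroup.mem_sup_left hy)
    · refine ⟨1, ?_⟩
      simp only [Matrix.cons_val_one]
      rw [← mul_assoc]
      refine mul_mem ?_ (Subgroup.mem_sup_left hy)
      have h1 : (M s⁻¹).det = -1 := by
        have h1 : (M s).det * (M s⁻¹).det = 1 := by
          rw [← Matrix.det_mul, ← hMmul, mul_inv_cancel, hM1, Matrix.det_one]
        rw [hs] at h1
        linear_combination -h1
      have := hdet (s⁻¹ * n) (by rw [hMmul, Matrix.det_mul, h1, hn]; ring)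
      simpa using this
  · have htop : W = ⊤ := by
      rw [eq_top_iff]
      intro x _
      obtain ⟨n, y, hy, rfl⟩ := hsplit x
      refine mul_mem (hdet n ?_) (Subgroup.mem_sup_left hy)
      exact (hcase n).resolve_right fun h => hs ⟨n, h⟩
    rw [htop, Subgroup.index_top]
    norm_num

theorem index_sup_centralizer_eq {X : Type*} [Group X] [Finite X] (N : Subgroup X) [N.Normal]
    (P R : Sylow 3 X) : (N ⊔ Subgroup.centralizer (R : Set X)).index =
      (N ⊔ Subgroup.centralizer (P : Set X)).index := by
  obtain ⟨g, hg⟩ := MulAction.exists_smul_eq X P R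
  have h1 : (N ⊔ Subgroup.centralizer (P : Set X)).map (MulAut.conj g : X →* X) =
      N ⊔ Subgroup.centralizer (R : Set X) := by
    rw [Subgroup.map_sup]
    congr 1
    · ext x
      constructor
      · rintro ⟨y, hy, rfl⟩
        exact Subgroup.Normal.conj_mem ‹_› y hy g
      · intro hx
        refine ⟨g⁻¹ * x * g, ?_, ?_⟩
        · simpa using Subgroup.Normal.conj_mem ‹_› x hx g⁻¹
        · simp [mul_assoc]
    · rw [← hg]
      ext x
      simp only [Subgroup.mem_map, Subgroup.mem_centralizer_iff]
      constructor
      · rintro ⟨y, hy, rfl⟩ r hr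
        obtain ⟨s, hs, rfl⟩ : ∃ s ∈ P, g * s * g⁻¹ = r := by
          obtain ⟨s, hs, h⟩ := hr
          exact ⟨s, hs, h⟩
        have := hy s hs
        simp only [MonoidHom.coe_coe, MulAut.conj_apply]
        rw [show g * s * g⁻¹ * (g * y * g⁻¹) = g * (s * y) * g⁻¹ by group, this]
        group
      · intro hx
        refine ⟨g⁻¹ * x * g, ?_, by simp [mul_assoc]⟩
        intro s hs
        have h2 := hx (g * s * g⁻¹) ⟨s, hs, rfl⟩
        rw [show s * (g⁻¹ * x * g) = g⁻¹ * (g * s * g⁻¹ * x) * g by group, h2]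
        group
  rw [← h1, Subgroup.index_map_equiv _ (MulAut.conj g)]

end SL3Sylow

/-! ### Coordinates on the standard Sylow 3-subgroup. -/

namespace SL3Sylow

/-- It suffices to test elements generating `P` modulo `P'`, since these generate `P`. -/
theorem mem_normalizer_of_generators {X : Type*} [Group X] [Finite X] {P : Sylow 3 X} {t w : P}
    (hgen : ∀ g, ∃ k l : ℕ, (w ^ k * t ^ l)⁻¹ * g ∈ commutator P) {m : X}
    (ht : m * t * m⁻¹ ∈ P) (hw : m * w * m⁻¹ ∈ P) :
    m ∈ Subgroup.normalizer (P : Set X) := by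
  have hnil : Group.IsNilpotent P := P.2.isNilpotent
  let H : Subgroup P := ((P : Subgroup X).comap (MulAut.conj m : X →* X)).subgroupOf P
  have hH : H = ⊤ := by
    apply eq_top_of_sup_commutator_eq_top
    rw [eq_top_iff]
    intro g _
    obtain ⟨k, l, h⟩ := hgen g
    rw [← mul_inv_cancel_left (w ^ k * t ^ l) g]
    refine Subgroup.mul_mem_sup (mul_mem (pow_mem ?_ _) (pow_mem ?_ _)) h
    · exact hw
    · exact ht
  refine mem_normalizer_of_forall (P : Subgroup X) fun h hh => ?_
  have : (⟨h, hh⟩ : P) ∈ H := hH ▸ Subgroup.mem_top _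
  exact this

variable {p f : ℕ} {K : Type*} [Field K] [ExpChar K p] {ε : ℤˣ}

/-- The cube of `(β, 1, 1)` divided by the scalar `β` has product of entries 1, and scalars do not
change `commDiag`. -/
theorem commDiag_cube_mem_commutator {β : Kˣ} (hβ : β ∈ scalars3 p f K ε) {t : SLe p f K ε}
    (ht : (t : GL (Fin 3) K) = commDiag ![β, 1, 1]) : t ^ 3 ∈ ⁅sylQ p f K ε, sylQ p f K ε⁆ := by
  refine commDiag_mem_commutator (u := ![β, 1, 1] ^ 3 * fun _ => β⁻¹) ?_ ?_ ?_
  · intro i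
    fin_cases i <;> simp [hβ, pow_mem, mul_mem]
  · simp [pow_succ, mul_assoc]
  · rw [Subgroup.coe_pow, ht, map_mul, map_pow, commDiag_const, mul_one]

variable {X : Type*} [Group X] [Finite X] (ι : SLe p f K ε →* X)

/-- The classes of `t` and of the cyclic permutation form a basis of `P/P'`. The last clause records
that diagonal elements lie on the line of `t`. -/
theorem exists_sylow_coordinates [Finite K] {α : Kˣ} (hα : IsGen3 p f ε α) {z : Kˣ}
    (hz : z ∈ scalars3 p f K ε) (hz1 : z ≠ 1) (hz3 : z ^ 3 = 1)
    (hker : ι.ker ≤ Subgroup.center _) (hι : ¬ 3 ∣ ι.range.index)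
    {β : Kˣ} (hβ : IsNoncube p f ε β) {t : SLe p f K ε}
    (ht : (t : GL (Fin 3) K) = commDiag ![β, 1, 1]) :
    ∃ (P : Sylow 3 X) (T W : P) (χ : P →* Multiplicative (Fin 2 → ZMod 3)),
      (P : Subgroup X) = (sylQ p f K ε).map ι ∧ (T : X) = ι t ∧ (W : X) = ι cyc ∧
      (∀ g, ∃ k l : ℕ, (W ^ k * T ^ l)⁻¹ * g ∈ commutator P) ∧
      χ.ker = commutator P ∧ χ T = Multiplicative.ofAdd ![1, 0] ∧
      χ W = Multiplicative.ofAdd ![0, 1] ∧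
      ∀ g ∈ sylT p f K ε, ∀ y : P, (y : X) = ι g → (χ y).toAdd 1 = 0 := by
  obtain ⟨P, hP⟩ := exists_sylow_eq_map ι hz hz1 hz3 hι
  have hcomm : ∀ x ∈ ⁅sylQ p f K ε, sylQ p f K ε⁆, ∀ y : P, (y : X) = ι x → y ∈ commutator P := by
    intro x hx y hy
    refine (mem_commutator_iff_coe (P : Subgroup X) y).mpr ?_
    have : ⁅(P : Subgroup X), (P : Subgroup X)⁆ = ⁅sylQ p f K ε, sylQ p f K ε⁆.map ι := by
      rw [hP, Subgroup.map_commutator]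
    rw [this]
    exact ⟨x, hx, hy.symm⟩
  have htT : t ∈ sylT p f K ε := by
    refine ⟨_, ?_, ht.trans (commDiag_apply _)⟩
    intro i
    fin_cases i <;> simp [hβ.1]
  have hmem : ∀ x ∈ sylQ p f K ε, ι x ∈ P := by
    intro x hx
    change ι x ∈ (P : Subgroup X)
    rw [hP]
    exact ⟨x, hx, rfl⟩
  let T : P := ⟨ι t, hmem t (sylT_le htT)⟩
  let W : P := ⟨ι cyc, hmem cyc cyc_mem_sylQ⟩
  have hgen : ∀ g : P, ∃ k l : ℕ, (W ^ k * T ^ l)⁻¹ * g ∈ commutator P := by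
    intro g
    have hg : (g : X) ∈ (P : Subgroup X) := g.2
    rw [hP] at hg
    obtain ⟨q, hq, hqg⟩ := hg
    obtain ⟨k, hk⟩ := exists_cyc_inv_mul_mem hq
    obtain ⟨l, hl⟩ := hβ.exists_inv_mul_mem hk ht
    refine ⟨k, l, hcomm _ hl _ ?_⟩
    change (ι cyc ^ (k : ℕ) * ι t ^ (l : ℕ))⁻¹ * (g : X) = _
    rw [← hqg]
    simp only [map_mul, map_inv, map_pow, mul_inv_rev, mul_assoc]
  have hindex : (commutator P).index = 9 := by
    rw [← index_commutator_map_sylQ ι hα hz hz1 hz3 hker, index_commutator_coe, ← hP]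
    exact (index_commutator_coe (P : Subgroup X)).symm
  obtain ⟨χ, hχ, hχT, hχW⟩ := exists_coordinates (t := T) (w := W) hindex
    (hcomm _ (commDiag_cube_mem_commutator hβ.1 ht) _ (by simp [T]))
    (hcomm 1 (one_mem _) _ (by
      rw [Subgroup.coe_pow, ← map_pow, cyc_pow_three])) hgen
  refine ⟨P, T, W, χ, hP, rfl, rfl, hgen, hχ, hχT, hχW, ?_⟩
  intro g hg y hy
  obtain ⟨l, hl⟩ := hβ.exists_inv_mul_mem hg ht
  have h1 : (T ^ (l : ℕ))⁻¹ * y ∈ commutator P := hcomm _ hl _ (by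
    change (ι t ^ (l : ℕ))⁻¹ * (y : X) = _
    rw [hy, map_mul, map_inv, map_pow])
  have h1 : (T ^ (l : ℕ))⁻¹ * y ∈ χ.ker := by
    rw [hχ]
    exact h1
  rw [MonoidHom.mem_ker, map_mul, map_inv, inv_mul_eq_one] at h1
  rw [← h1, map_pow, hχT]
  simp

/-- The cube of a monomial matrix whose permutation part is a 3-cycle is the scalar matrix of the
product of its entries, here the determinant 1. -/
theorem cube_eq_one_of_mem_sylQ {g : SLe p f K ε} (hg : g ∈ sylQ p f K ε)
    (hgT : g ∉ sylT p f K ε) : g ^ 3 = 1 := by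
  obtain ⟨a, k, ha, h⟩ := hg
  have h' : (g : GL (Fin 3) K) = mono a k := h
  have hdet : a 0 * a 1 * a 2 = 1 := by
    rw [← det_mono a k, ← h']
    exact (mem_SLe.mp g.2).2
  have hk : k = 0 ∨ k = 1 ∨ k = 2 := (by decide : ∀ k : Fin 3, k = 0 ∨ k = 1 ∨ k = 2) k
  have hk0 : k ≠ 0 := by
    rintro rfl
    exact hgT ⟨a, ha, h⟩
  ext1
  rw [Subgroup.coe_pow, h', Subgroup.coe_one, ← mono_one, pow_succ, pow_two, mono_mul, mono_mul]
  rcases hk with rfl | rfl | rfl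
  · exact absurd rfl hk0
  · congr 1
    ext i
    have hdet' := congrArg Units.val hdet
    fin_cases i <;> simp at hdet' ⊢ <;> linear_combination hdet'
  · congr 1
    ext i
    have hdet' := congrArg Units.val hdet
    fin_cases i <;> simp at hdet' ⊢ <;> linear_combination hdet'

end SL3Sylow

/-! ### Enough elements of determinant 1 on the abelianization. -/

namespace SL3Sylow

/-- The diagonal entries are both 1 or both -1, so up to sign the matrix is unipotent over the field
with three elements. -/
theorem exists_mul_cube_eq_one_of_triangular : ∀ a b d : ZMod 3, a * d = 1 →
    (!![a, b; 0, d] ^ 3 = 1 ∨ (-1 * !![a, b; 0, d]) ^ 3 = (1 : Matrix (Fin 2) (Fin 2) (ZMod 3))) := by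
  decide

/-- The two fixed matrices have order 4 and generate the quaternion group, which is normal of index
3 in `SL₂(3)`, so each of its cosets contains elements with cube 1. -/
theorem exists_mul_cube_eq_one : ∀ a b c d : ZMod 3, a * d - b * c = 1 →
    ∃ k l : Fin 4, (!![0, -1; 1, 0] ^ (k : ℕ) * !![2, 1; 1, 1] ^ (l : ℕ) * !![a, b; c, d]) ^ 3 =
      (1 : Matrix (Fin 2) (Fin 2) (ZMod 3)) := by
  decide

variable {p f : ℕ} {K : Type*} [Field K] [ExpChar K p] {ε : ℤˣ}

/-- Conjugating the Fourier transform by `D`, which centralizes `t` and sends `w` to `t²w`, gives a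
second quaternion element. -/
theorem conj_fourier_relations {F t w D : GL (Fin 3) K} (h1 : F * t = w * F) (h2 : t * (F * w) = F)
    (h3 : D * t = t * D) (h4 : D * w = t ^ 2 * w * D) (h5 : t ^ 3 = 1) :
    D * F * D⁻¹ * t = t ^ 2 * w * (D * F * D⁻¹) ∧
      D * F * D⁻¹ * w = t ^ 2 * w * t⁻¹ * (D * F * D⁻¹) := by
  have h3' : t * D⁻¹ = D⁻¹ * t := by
    rw [eq_inv_mul_iff_mul_eq, ← mul_assoc, h3, mul_inv_cancel_right]
  have h6 : D⁻¹ * w = t * w * D⁻¹ := by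
    rw [inv_mul_eq_iff_eq_mul, ← mul_assoc, eq_mul_inv_iff_mul_eq, ← mul_assoc, h3, mul_assoc t, h4,
      ← mul_assoc, ← mul_assoc, ← pow_succ', h5, one_mul]
  have h7 : F * w = t⁻¹ * F := by rw [eq_inv_mul_iff_mul_eq, h2]
  constructor
  · rw [mul_assoc _ D⁻¹, ← h3', ← mul_assoc, mul_assoc D, h1, ← mul_assoc, h4]
    group
  · rw [mul_assoc _ D⁻¹, h6, ← mul_assoc, ← mul_assoc, mul_assoc D F t, h1, ← mul_assoc D w F, h4,
      mul_assoc _ F w, h7, ← mul_assoc, mul_assoc _ D t⁻¹]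
    have : D * t⁻¹ = t⁻¹ * D := by
      rw [eq_inv_mul_iff_mul_eq, ← mul_assoc, ← h3, mul_inv_cancel_right]
    rw [this]
    group

theorem commDiag_sq {z : Kˣ} (hz3 : z ^ 3 = 1) : (commDiag ![z ^ 2, 1, 1] : GL (Fin 3) K) =
    mono ![1, z, z ^ 2] 0 * mono (fun _ => z ^ 2) 0 := by
  rw [commDiag_apply, mono_mul]
  congr 1
  ext i
  have hz4 : z ^ 2 * z ^ 2 = z := by rw [← pow_add, pow_succ, hz3, one_mul]
  have hz2 : (z ^ 2)⁻¹ = z := by rw [inv_eq_iff_mul_eq_one, ← pow_succ, hz3]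
  fin_cases i
  · simp
  · simp [← pow_succ', hz3]
  · simp only [Fin.reduceFinMk, Matrix.cons_val, hz4]
    simp [hz2]

theorem diag_relations {z : Kˣ} (hz3 : z ^ 3 = 1) :
    (mono ![1, z, z ^ 2] 0 ^ 3 : GL (Fin 3) K) = 1 ∧
    (mono ![1, 1, z] 0 * mono 1 1 : GL (Fin 3) K) =
      mono ![1, z, z ^ 2] 0 ^ 2 * mono 1 1 * mono ![1, 1, z] 0 ∧
    (mono ![1, 1, z] 0 * mono ![1, z, z ^ 2] 0 : GL (Fin 3) K) =
      mono ![1, z, z ^ 2] 0 * mono ![1, 1, z] 0 := by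
  have h3 : (z : K) ^ 3 = 1 := by rw [← Units.val_pow_eq_pow_val, hz3, Units.val_one]
  refine ⟨?_, ?_, ?_⟩
  · rw [pow_succ, pow_two, mono_mul, mono_mul, ← mono_one]
    congr 1
    ext i
    fin_cases i <;> simp <;> grind
  · rw [mono_mul, pow_two, mono_mul, mono_mul, mono_mul]
    congr 1
    ext i
    fin_cases i <;> simp <;> grind
  · rw [mono_mul, mono_mul]
    congr 1
    ext i
    simp [mul_comm]

theorem coe_diagRoot {z : Kˣ} (hzs : z ∈ scalars p f K ε) (hz3 : z ^ 3 = 1) :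
    (diagRoot z hzs hz3 : GL (Fin 3) K) = mono ![1, z, z ^ 2] 0 := rfl

/-- The conjugating matrix `diag(1, 1, z)` need not have determinant 1; it only has to lie in
`GL₃^ε(q)`, which normalizes `SL₃^ε(q)`. -/
theorem exists_quaternion_action {z : Kˣ} (hzs : z ∈ scalars p f K ε) (hz1 : z ≠ 1)
    (hz3 : z ^ 3 = 1) : ∃ F F' : SLe p f K ε,
      F * diagRoot z hzs hz3 = cyc * F ∧ diagRoot z hzs hz3 * (F * cyc) = F ∧
      F' * diagRoot z hzs hz3 = diagRoot z hzs hz3 ^ 2 * cyc * F' ∧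
      F' * cyc = diagRoot z hzs hz3 ^ 2 * cyc * (diagRoot z hzs hz3)⁻¹ * F' := by
  have h1 := fourier_mul_diagRoot hzs hz1 hz3
  have h2 := fourier_mul_cyc hzs hz1 hz3
  generalize fourier hzs hz1 hz3 = F at h1 h2
  have hD : mono ![1, 1, z] 0 ∈ GLe p f K ε := by
    rw [mono_mem_GLe]
    intro i
    fin_cases i
    · exact one_mem _
    · exact one_mem _
    · exact hzs
  obtain ⟨r1, r2, r3⟩ := diag_relations hz3
  have e1 := congrArg (Subgroup.subtype (SLe p f K ε)) h1
  have e2 := congrArg (Subgroup.subtype (SLe p f K ε)) h2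
  simp only [map_mul, Subgroup.subtype_apply, coe_diagRoot, coe_cyc] at e1 e2
  obtain ⟨q1, q2⟩ := conj_fourier_relations e1 e2 r3 r2 r1
  refine ⟨F, ⟨_, conj_mem_SLe hD F.2⟩, h1, h2, ?_, ?_⟩
  · ext1
    simp only [Subgroup.coe_mul, Subgroup.coe_pow, coe_diagRoot, coe_cyc]
    exact q1
  · ext1
    simp only [Subgroup.coe_mul, Subgroup.coe_pow, Subgroup.coe_inv, coe_diagRoot, coe_cyc]
    exact q2

variable {X : Type*} [Group X] [Finite X] (ι : SLe p f K ε →* X)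

/-- The case in which the diagonal matrices generate a distinguished subgroup. -/
theorem index_sup_centralizer_range_of_cube_ne [Finite K] [ι.range.Normal] {α : Kˣ}
    (hα : IsGen3 p f ε α) {z : Kˣ}
    (hz : z ∈ scalars3 p f K ε) (hz1 : z ≠ 1) (hz3 : z ^ 3 = 1)
    (hker : ι.ker ≤ Subgroup.center _) (hι : ¬ 3 ∣ ι.range.index) (hα3 : α ^ 3 ≠ 1)
    (R : Sylow 3 X) :
    (ι.range ⊔ Subgroup.centralizer (R : Set X)).index ≤ 2 := by
  have hα' : ∀ i, ![α, 1, 1] i ∈ scalars p f K ε := by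
    intro i
    fin_cases i
    · exact scalars3_le hα.1
    · exact one_mem _
    · exact one_mem _
  let t : SLe p f K ε := ⟨commDiag ![α, 1, 1], commDiag_mem_SLe hα'⟩
  obtain ⟨P, T, W, χ, hP, hT, hW, hgen, hχ, hχT, hχW, hχ0⟩ :=
    exists_sylow_coordinates ι hα hz hz1 hz3 hker hι hα.isNoncube (t := t) rfl
  have ht : (t : GL (Fin 3) K) = mono ![α, 1, α⁻¹] 0 := by
    change commDiag _ = _
    rw [commDiag_apply]
    congr 1
    ext i
    fin_cases i <;> simp
  have htswap : swap p f K ε * t = t⁻¹ * swap p f K ε := by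
    ext1
    rw [Subgroup.coe_mul, Subgroup.coe_mul, Subgroup.coe_inv, ht, coe_swap, swapGL_mul_mono,
      mono_inv]
    congr 2
    ext i
    fin_cases i <;> simp
  have hsT : ι (swap p f K ε) * T * (ι (swap p f K ε))⁻¹ = (T : X)⁻¹ := by
    rw [hT, ← map_mul, htswap, map_mul, mul_inv_cancel_right, map_inv]
  have hsW : ι (swap p f K ε) * W * (ι (swap p f K ε))⁻¹ = (W : X)⁻¹ := by
    rw [hW, ← map_mul, swap_mul_cyc, map_mul, mul_inv_cancel_right, map_inv]
  let s : Subgroup.normalizer (P : Set X) := ⟨ι (swap p f K ε), mem_normalizer_of_generators hgen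
    (by rw [hsT]; exact inv_mem T.2) (by rw [hsW]; exact inv_mem W.2)⟩
  have hs : actionMatrix χ T W (Subgroup.normalizerMonoidHom (P : Subgroup X) s) = -1 := by
    have h1 : Subgroup.normalizerMonoidHom (P : Subgroup X) s T = T⁻¹ := Subtype.ext hsT
    have h2 : Subgroup.normalizerMonoidHom (P : Subgroup X) s W = W⁻¹ := Subtype.ext hsW
    ext i j
    rw [actionMatrix, h1, h2, χ.map_inv, χ.map_inv, hχT, hχW]
    fin_cases i <;> fin_cases j <;> simp
  rw [index_sup_centralizer_eq ι.range P R]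
  refine index_sup_centralizer_le ι.range hι P ?_ χ T W hχ hχT hχW ?_
  · rw [hP]
    rintro _ ⟨g, -, rfl⟩
    exact ⟨g, rfl⟩
  intro n hn
  set A := actionMatrix χ T W (Subgroup.normalizerMonoidHom (P : Subgroup X) n) with hA
  -- Elements of `Q` outside `T` have cube 1, whereas the cube of `t` is not scalar because `α ^ 3 ≠
  -- 1`. Conjugates of `t` within `P` are therefore images of diagonal matrices, and the line of `t`
  -- is invariant.
  have h10 : A 1 0 = 0 := by
    let y : P := Subgroup.normalizerMonoidHom (P : Subgroup X) n T
    have hy : (y : X) = (n : X) * T * (n : X)⁻¹ := rfl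
    have hyP : (y : X) ∈ (P : Subgroup X) := y.2
    rw [hP] at hyP
    obtain ⟨q, hq, hqy⟩ := hyP
    change (χ y).toAdd 1 = 0
    refine hχ0 q ?_ y hqy.symm
    by_contra hqT
    have h1 : ι q ^ 3 = 1 := by rw [← map_pow, cube_eq_one_of_mem_sylQ hq hqT, map_one]
    rw [hqy, hy, conj_pow, conj_eq_one_iff, hT, ← map_pow] at h1
    obtain ⟨c, hc⟩ := (mem_center_SLe (scalars3_le hz) hz1 hz3).mp (hker h1)
    rw [Subgroup.coe_pow, ht, pow_succ, pow_two, mono_mul, mono_mul] at hc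
    have h2 := (mono_injective hc).1
    have h3 := congrFun h2 0
    have h4 := congrFun h2 1
    apply hα3
    simp at h3 h4
    rw [h4, ← h3, pow_succ, pow_two]
  have hdet : A 0 0 * A 1 1 = 1 := by
    rw [Matrix.det_fin_two, h10, mul_zero, sub_zero] at hn
    exact hn
  have hAeq : A = !![A 0 0, A 0 1; 0, A 1 1] := by
    rw [← h10]
    exact Matrix.eta_fin_two A
  rcases exists_mul_cube_eq_one_of_triangular (A 0 0) (A 0 1) (A 1 1) hdet with h | h
  · refine ⟨1, one_mem _, ?_⟩
    rw [map_one, actionMatrix_one hχ hχT hχW, one_mul, hAeq, h]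
  · refine ⟨s, ⟨_, rfl⟩, ?_⟩
    rw [hs, hAeq, h]

/-- The case in which all diagonal matrices of `3`-power order have order `3`. -/
theorem index_sup_centralizer_range_of_cube_eq [Finite K] [ι.range.Normal] {α : Kˣ}
    (hα : IsGen3 p f ε α) {z : Kˣ}
    (hz : z ∈ scalars3 p f K ε) (hz1 : z ≠ 1) (hz3 : z ^ 3 = 1)
    (hker : ι.ker = Subgroup.center _) (hι : ¬ 3 ∣ ι.range.index) (hα3 : α ^ 3 = 1)
    (R : Sylow 3 X) :
    (ι.range ⊔ Subgroup.centralizer (R : Set X)).index ≤ 2 := by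
  have hzs := scalars3_le hz
  -- With `z ^ 2` as the noncube, `commDiag ![z ^ 2, 1, 1]` is `diag(1, z, z²)` up to a scalar, so
  -- the relations with the Fourier matrix apply.
  have hβ : IsNoncube p f ε (z ^ 2) := by
    obtain ⟨k, hk⟩ := hα.2.1 z hz
    have hk3 : ¬ 3 ∣ k := by
      rintro ⟨m, rfl⟩
      rw [pow_mul, hα3, one_pow] at hk
      exact hz1 hk
    have := hα.isNoncube.pow_mul_cube (j := k * 2) (c := 1) (by omega) (one_mem _)
    rwa [one_pow, mul_one, pow_mul, ← hk] at this
  have hβ' : ∀ i, ![z ^ 2, 1, 1] i ∈ scalars p f K ε := by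
    intro i
    fin_cases i
    · exact pow_mem hzs 2
    · exact one_mem _
    · exact one_mem _
  let t : SLe p f K ε := ⟨commDiag ![z ^ 2, 1, 1], commDiag_mem_SLe hβ'⟩
  obtain ⟨P, T, W, χ, hP, hT, hW, hgen, hχ, hχT, hχW, hχ0⟩ :=
    exists_sylow_coordinates ι hα hz hz1 hz3 hker.le hι hβ (t := t) rfl
  have ht : (t : GL (Fin 3) K) = mono ![1, z, z ^ 2] 0 * mono (fun _ => z ^ 2) 0 :=
    commDiag_sq hz3
  set d := diagRoot z hzs hz3 with hd
  have hT' : (T : X) = ι d := by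
    rw [hT, ← inv_mul_eq_one, ← map_inv, ← map_mul, ← MonoidHom.mem_ker, hker,
      mem_center_SLe hzs hz1 hz3]
    refine ⟨(z ^ 2)⁻¹, ?_⟩
    rw [Subgroup.coe_mul, Subgroup.coe_inv, ht, mul_inv_rev]
    change _ * (mono ![1, z, z ^ 2] 0)⁻¹ * mono ![1, z, z ^ 2] 0 = _
    rw [inv_mul_cancel_right, mono_inv]
    rfl
  obtain ⟨F, F', hF1, hF2, hr1, hr2⟩ := exists_quaternion_action hzs hz1 hz3
  have hFT : ι F * T * (ι F)⁻¹ = W := by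
    rw [hT', hW, ← map_mul, hF1, map_mul, mul_inv_cancel_right]
  have hFW : ι F * W * (ι F)⁻¹ = (T : X)⁻¹ := by
    rw [hT', hW, ← map_mul, show F * cyc = d⁻¹ * F from by
      rw [eq_inv_mul_iff_mul_eq, hF2], map_mul, mul_inv_cancel_right, map_inv]
  have hF'T : ι F' * T * (ι F')⁻¹ = ((T ^ 2 * W : P) : X) := by
    rw [Subgroup.coe_mul, Subgroup.coe_pow, hT', hW, ← map_mul, hr1, map_mul, mul_inv_cancel_right,
      map_mul, map_pow]
  have hF'W : ι F' * W * (ι F')⁻¹ = ((T ^ 2 * W * T⁻¹ : P) : X) := by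
    rw [Subgroup.coe_mul, Subgroup.coe_mul, Subgroup.coe_pow, Subgroup.coe_inv, hT', hW, ← map_mul,
      hr2, map_mul, mul_inv_cancel_right, map_mul, map_mul, map_pow, map_inv]
  let r : Subgroup.normalizer (P : Set X) := ⟨ι F, mem_normalizer_of_generators hgen
    (by rw [hFT]; exact W.2) (by rw [hFW]; exact inv_mem T.2)⟩
  let s : Subgroup.normalizer (P : Set X) := ⟨ι F', mem_normalizer_of_generators hgen
    (by rw [hF'T]; exact (T ^ 2 * W).2) (by rw [hF'W]; exact (T ^ 2 * W * T⁻¹).2)⟩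
  have hr : actionMatrix χ T W (Subgroup.normalizerMonoidHom (P : Subgroup X) r) =
      !![0, -1; 1, 0] := by
    have h1 : Subgroup.normalizerMonoidHom (P : Subgroup X) r T = W := Subtype.ext hFT
    have h2 : Subgroup.normalizerMonoidHom (P : Subgroup X) r W = T⁻¹ := Subtype.ext hFW
    ext i j
    rw [actionMatrix, h1, h2, χ.map_inv, hχT, hχW]
    fin_cases i <;> fin_cases j <;> simp
  have hs : actionMatrix χ T W (Subgroup.normalizerMonoidHom (P : Subgroup X) s) =
      !![2, 1; 1, 1] := by
    have h1 : Subgroup.normalizerMonoidHom (P : Subgroup X) s T = T ^ 2 * W := Subtype.ext hF'T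
    have h2 : Subgroup.normalizerMonoidHom (P : Subgroup X) s W = T ^ 2 * W * T⁻¹ :=
      Subtype.ext hF'W
    ext i j
    rw [actionMatrix, h1, h2, χ.map_mul, χ.map_mul, χ.map_mul, χ.map_inv, χ.map_pow, hχT, hχW]
    fin_cases i <;> fin_cases j <;> simp <;> rfl
  rw [index_sup_centralizer_eq ι.range P R]
  refine index_sup_centralizer_le ι.range hι P ?_ χ T W hχ hχT hχW ?_
  · rw [hP]
    rintro _ ⟨g, -, rfl⟩
    exact ⟨g, rfl⟩
  intro n hn
  set A := actionMatrix χ T W (Subgroup.normalizerMonoidHom (P : Subgroup X) n) with hA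
  rw [Matrix.det_fin_two] at hn
  obtain ⟨k, l, hkl⟩ := exists_mul_cube_eq_one _ _ _ _ hn
  have hpow : ∀ (m : Subgroup.normalizer (P : Set X)) (j : ℕ),
      actionMatrix χ T W (Subgroup.normalizerMonoidHom (P : Subgroup X) (m ^ j)) =
      actionMatrix χ T W (Subgroup.normalizerMonoidHom (P : Subgroup X) m) ^ j := by
    intro m j
    induction j with
    | zero => rw [pow_zero, pow_zero, map_one, actionMatrix_one hχ hχT hχW]
    | succ j ih => rw [pow_succ, pow_succ, map_mul, actionMatrix_mul hχ hχT hχW, ih]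
  refine ⟨r ^ (k : ℕ) * s ^ (l : ℕ), mul_mem (pow_mem (show (r : X) ∈ ι.range from ⟨F, rfl⟩) _)
    (pow_mem (show (s : X) ∈ ι.range from ⟨F', rfl⟩) _), ?_⟩
  rw [map_mul, actionMatrix_mul hχ hχT hχW, hpow, hpow, hr, hs]
  rw [← Matrix.eta_fin_two A] at hkl
  exact hkl

end SL3Sylow

/-! ### Groups between `S` and `Aut(S)`: the index of `S C_A(R)`. -/

namespace SL3Sylow

variable {p f : ℕ} {K : Type*} [Field K] [ExpChar K p] {ε : ℤˣ}

/-- The homomorphism from `SL₃^ε(q)` to a group of automorphisms of `PSL₃^ε(q)` containing the inner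
ones. -/
def innerHom {A : Subgroup (MulAut (PSLe p f K ε))} (hA : Inn (PSLe p f K ε) ≤ A) :
    SLe p f K ε →* A :=
  ((MulAut.conj : PSLe p f K ε →* _).comp (QuotientGroup.mk' _)).codRestrict A
    fun _ => hA ⟨_, rfl⟩

theorem coe_innerHom {A : Subgroup (MulAut (PSLe p f K ε))} (hA : Inn (PSLe p f K ε) ≤ A)
    (g : SLe p f K ε) : (innerHom hA g : MulAut (PSLe p f K ε)) = MulAut.conj (g : PSLe p f K ε) :=
  rfl

theorem range_innerHom {A : Subgroup (MulAut (PSLe p f K ε))} (hA : Inn (PSLe p f K ε) ≤ A) :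
    (innerHom hA).range = inside A := by
  ext x
  rw [Subgroup.mem_subgroupOf]
  constructor
  · rintro ⟨g, rfl⟩
    exact ⟨g, rfl⟩
  · rintro ⟨s, hs⟩
    obtain ⟨g, rfl⟩ := QuotientGroup.mk_surjective s
    exact ⟨g, Subtype.ext hs⟩

instance normal_range_innerHom {A : Subgroup (MulAut (PSLe p f K ε))}
    (hA : Inn (PSLe p f K ε) ≤ A) : (innerHom hA).range.Normal := by
  rw [range_innerHom]
  infer_instance

theorem ker_innerHom {A : Subgroup (MulAut (PSLe p f K ε))} (hA : Inn (PSLe p f K ε) ≤ A) {z : Kˣ}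
    (hz : z ∈ scalars p f K ε) (hz1 : z ≠ 1) (hz3 : z ^ 3 = 1) :
    (innerHom hA).ker = Subgroup.center (SLe p f K ε) := by
  ext g
  rw [MonoidHom.mem_ker]
  constructor
  · intro h
    apply center_PSLe hz hz1 hz3
    rw [Subgroup.mem_center_iff]
    intro x
    have h1 : MulAut.conj (g : PSLe p f K ε) = 1 := congrArg Subtype.val h
    have h2 := DFunLike.congr_fun h1 x
    rw [MulAut.conj_apply, MulAut.one_apply, mul_inv_eq_iff_eq_mul] at h2
    exact h2.symm
  · intro h
    apply Subtype.ext
    rw [coe_innerHom, (QuotientGroup.eq_one_iff g).mpr h, map_one]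
    rfl

theorem index_sup_centralizer_Aut [Finite K] {α : Kˣ} (hα : IsGen3 p f ε α) {z : Kˣ}
    (hz : z ∈ scalars3 p f K ε) (hz1 : z ≠ 1) (hz3 : z ^ 3 = 1)
    (A : Subgroup (MulAut (PSLe p f K ε))) (hA : Inn (PSLe p f K ε) ≤ A)
    (h3 : ¬ 3 ∣ Nat.card (A ⧸ inside A)) (R : Sylow 3 A) :
    (inside A ⊔ Subgroup.centralizer (R : Set A)).index ≤ 2 := by
  have hfin : Finite A := inferInstance
  rw [← range_innerHom hA]
  have hι : ¬ 3 ∣ (innerHom hA).range.index := by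
    rw [range_innerHom]
    exact h3
  have hker := ker_innerHom hA (scalars3_le hz) hz1 hz3
  by_cases hα3 : α ^ 3 = 1
  · exact index_sup_centralizer_range_of_cube_eq _ hα hz hz1 hz3 hker hι hα3 R
  · exact index_sup_centralizer_range_of_cube_ne _ hα hz hz1 hz3 hker.le hι hα3 R

end SL3Sylow

/-! ### The criterion for `[R : R'] ≠ 9`, granting semilinearity. -/

namespace SL3Sylow

variable {p f : ℕ} {K : Type*} [Field K] [ExpChar K p] {ε : ℤˣ}

/-- `σ` permutes the two roots `z` and `z²` of `X² + X + 1`, so its square fixes them. -/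
theorem map_map_cube_root {z : Kˣ} (hz1 : z ≠ 1) (hz3 : z ^ 3 = 1) (σ : K ≃+* K) :
    (σ * σ) (z : K) = z := by
  have h1 := cube_root_sum hz1 hz3
  have h2 : (σ z : K) ^ 2 + σ z + 1 = 0 := by
    rw [← map_pow, ← map_one σ, ← map_add, ← map_add, h1, map_zero]
  have h3 : (z : K) ^ 3 = 1 := by rw [← Units.val_pow_eq_pow_val, hz3, Units.val_one]
  have h4 : (σ z - z) * (σ z - (z : K) ^ 2) = 0 := by
    linear_combination h2 - σ z * h1 + h3
  rw [RingAut.mul_apply]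
  rcases mul_eq_zero.mp h4 with h | h
  · rw [sub_eq_zero] at h
    rw [h, h]
  · rw [sub_eq_zero] at h
    rw [h, map_pow, h]
    linear_combination (z : K) * h3

theorem isFieldAut_iff {φ : MulAut (PSLe p f K ε)} :
    IsFieldAut p f K ε φ ↔ ∃ σ, φ = twistAut 1 σ := by
  have hcoe : ∀ (σ : K ≃+* K) (g : SLe p f K ε), (twist 1 σ g : GL (Fin 3) K) =
      Matrix.GeneralLinearGroup.map (σ : K →+* K) (g : GL (Fin 3) K) := by
    intro σ g
    rw [coe_twist, Subgroup.coe_one, inv_one, mul_one, one_mul]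
  constructor
  · rintro ⟨σ, h⟩
    refine ⟨σ, ?_⟩
    ext x
    induction x using QuotientGroup.induction_on with
    | H g =>
      obtain ⟨k, hk, hφ⟩ := h g
      rw [hφ, twistAut_mk]
      congr 1
      ext1
      rw [hk, hcoe]
  · rintro ⟨σ, rfl⟩
    exact ⟨σ, fun g => ⟨twist 1 σ g, hcoe σ g, twistAut_mk _ _ _⟩⟩

theorem actsAs_of_coe_eq {A : Subgroup (MulAut (PSLe p f K ε))} (hA : Inn (PSLe p f K ε) ≤ A)
    {x : A} {d : GLe p f K ε} {σ : K ≃+* K}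
    (hx : (x : MulAut (PSLe p f K ε)) = twistAut d σ) : ActsAs (innerHom hA) x d σ := by
  intro g
  ext1
  rw [Subgroup.coe_mul, Subgroup.coe_mul, Subgroup.coe_inv, coe_innerHom, coe_innerHom, ← twistAut_mk,
    ← hx]
  ext y
  simp [MulAut.mul_apply, MulAut.conj_apply]

theorem conj_mk_eq_twistAut (g : SLe p f K ε) :
    (MulAut.conj (g : PSLe p f K ε)) = twistAut ⟨g, SLe_le_GLe g.2⟩ 1 := by
  ext y
  induction y using QuotientGroup.induction_on with
  | H h =>
    rw [twistAut_mk, MulAut.conj_apply, ← QuotientGroup.mk_mul, ← QuotientGroup.mk_inv,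
      ← QuotientGroup.mk_mul]
    congr 1

theorem twistAut_eq_of_eq_mul_scalar {d e : GLe p f K ε} {σ : K ≃+* K} (c : Kˣ)
    (h : (d : GL (Fin 3) K) = e * mono (fun _ => c) 0) : twistAut d σ = twistAut e σ := by
  ext y
  induction y using QuotientGroup.induction_on with
  | H g =>
    rw [twistAut_mk, twistAut_mk]
    congr 1
    ext1
    rw [coe_twist, coe_twist, h, mul_inv_rev, mul_assoc (e : GL (Fin 3) K), mono_const_comm]
    group

/-- The second assertion of the theorem, for groups in which the automorphisms of order `3` modulo
inner ones are semilinear. -/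
theorem index_commutator_Aut_ne_nine_iff [Finite K] {α : Kˣ} (hα : IsGen3 p f ε α) {z : Kˣ}
    (hz : z ∈ scalars3 p f K ε) (hz1 : z ≠ 1) (hz3 : z ^ 3 = 1)
    (hAut : ∀ φ : MulAut (PSLe p f K ε), φ ^ 3 ∈ Inn (PSLe p f K ε) → φ ∈ semilinearAut p f K ε)
    (A : Subgroup (MulAut (PSLe p f K ε))) (hA : Inn (PSLe p f K ε) ≤ A)
    (h3 : ordProj[3] (Nat.card (A ⧸ inside A)) = 3) (R : Sylow 3 A) (Y : Sylow 3 (A ⧸ inside A)) :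
    (commutator R).index ≠ 9 ↔
      ∃ φ : A, IsFieldAut p f K ε (φ : MulAut (PSLe p f K ε)) ∧
        (Y : Subgroup (A ⧸ inside A)) = Subgroup.zpowers (φ : A ⧸ inside A) := by
  have hfin : Finite A := inferInstance
  have hker := (ker_innerHom hA (scalars3_le hz) hz1 hz3).le
  have hidx : ordProj[3] (innerHom hA).range.index = 3 := by
    rw [range_innerHom]
    exact h3
  have hY : Nat.card Y = 3 := by
    rw [Y.card_eq_multiplicity]
    exact h3
  have hmem : ∀ x : A, x ∈ (innerHom hA).range ↔ (x : A ⧸ inside A) = 1 := by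
    intro x
    rw [range_innerHom, QuotientGroup.eq_one_iff]
  -- A generator of the group `Y` of order 3 is replaced by its square, which generates the same
  -- group and whose field part, being a square, fixes the cube roots of unity.
  have hsq : ∀ y : A, (Y : Subgroup (A ⧸ inside A)) = Subgroup.zpowers (y : A ⧸ inside A) →
      y * y ∉ (innerHom hA).range ∧ (y * y) ^ 3 ∈ (innerHom hA).range ∧
      Subgroup.zpowers (y : A ⧸ inside A) = Subgroup.zpowers ((y * y : A) : A ⧸ inside A) := by
    intro y hy
    have ho : orderOf (y : A ⧸ inside A) = 3 := by
      rw [← Nat.card_zpowers, ← hy]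
      exact hY
    have ho3 : (y : A ⧸ inside A) ^ 3 = 1 :=
      orderOf_dvd_iff_pow_eq_one.mp ho.dvd
    have hne : (y : A ⧸ inside A) ≠ 1 := by
      intro h
      rw [h, orderOf_one] at ho
      norm_num at ho
    refine ⟨?_, ?_, ?_⟩
    · rw [hmem, QuotientGroup.mk_mul, ← pow_two]
      intro h
      apply hne
      rw [pow_succ, h, one_mul] at ho3
      exact ho3
    · rw [hmem, QuotientGroup.mk_pow, QuotientGroup.mk_mul, ← pow_two, ← pow_mul, mul_comm, pow_mul,
        ho3, one_pow]
    · apply le_antisymm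
      · rw [Subgroup.zpowers_le]
        refine ⟨2, ?_⟩
        change ((y * y : A) : A ⧸ inside A) ^ (2 : ℤ) = _
        rw [QuotientGroup.mk_mul, ← pow_two, zpow_ofNat, ← pow_mul, pow_succ, ho3, one_mul]
      · rw [Subgroup.zpowers_le, QuotientGroup.mk_mul]
        exact mul_mem (Subgroup.mem_zpowers _) (Subgroup.mem_zpowers _)
  constructor
  · intro h9
    have hcyc : IsCyclic Y := isCyclic_of_prime_card (p := 3) hY
    obtain ⟨⟨g, hgY⟩, hg⟩ := hcyc.exists_generator
    obtain ⟨y, rfl⟩ := QuotientGroup.mk_surjective g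
    have hy : (Y : Subgroup (A ⧸ inside A)) = Subgroup.zpowers (y : A ⧸ inside A) := by
      apply le_antisymm
      · intro u hu
        obtain ⟨k, hk⟩ := hg ⟨u, hu⟩
        exact ⟨k, congrArg Subtype.val hk⟩
      · rw [Subgroup.zpowers_le]
        exact hgY
    obtain ⟨hxN, hx3, hgen⟩ := hsq y hy
    have hy3 : (y : MulAut (PSLe p f K ε)) ^ 3 ∈ Inn (PSLe p f K ε) := by
      have h1 : (y : A ⧸ inside A) ^ 3 = 1 := by
        have h2 : (⟨y, hgY⟩ : Y) ^ 3 = 1 :=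
          orderOf_dvd_iff_pow_eq_one.mp ((orderOf_dvd_natCard _).trans hY.dvd)
        exact congrArg Subtype.val h2
      rw [← QuotientGroup.mk_pow, QuotientGroup.eq_one_iff, Subgroup.mem_subgroupOf] at h1
      exact h1
    obtain ⟨e, τ, hyt⟩ := hAut y hy3
    have hx : ((y * y : A) : MulAut (PSLe p f K ε)) = twistAut (e * fieldMap τ e) (τ * τ) := by
      rw [Subgroup.coe_mul, hyt, twistAut_mul]
    have hσ := map_map_cube_root hz1 hz3 τ
    generalize e * fieldMap τ e = d at hx
    generalize τ * τ = σ at hx hσ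
    by_contra hnf
    apply h9
    refine index_commutator_of_det_ne_cube hα hz hz1 hz3 hker hidx hxN hx3 hσ
      (actsAs_of_coe_eq hA hx) ?_ R
    -- If the determinant were a cube, dividing by the scalar `c` would exhibit `y * y` as an inner
    -- automorphism times a field automorphism, against `hnf`.
    rintro ⟨c, hc, hdc⟩
    apply hnf
    have hcG : mono (fun _ => c⁻¹) 0 ∈ GLe p f K ε := mono_mem_GLe.mpr fun _ => inv_mem hc
    let g : SLe p f K ε := ⟨d * mono (fun _ => c⁻¹) 0, mem_SLe.mpr ⟨mul_mem d.2 hcG, by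
      rw [map_mul, hdc, det_mono]
      rw [← pow_two, ← pow_succ, ← mul_pow, mul_inv_cancel, one_pow]⟩⟩
    have hdg : twistAut d σ = twistAut ⟨g, SLe_le_GLe g.2⟩ 1 * twistAut 1 σ := by
      rw [twistAut_mul]
      have : (⟨g, SLe_le_GLe g.2⟩ : GLe p f K ε) * fieldMap 1 1 = ⟨g, SLe_le_GLe g.2⟩ := by
        ext1
        rw [Subgroup.coe_mul, coe_fieldMap, Subgroup.coe_one, map_one, mul_one]
      rw [this, one_mul]
      refine twistAut_eq_of_eq_mul_scalar c ?_
      change (d : GL (Fin 3) K) = d * mono (fun _ => c⁻¹) 0 * mono (fun _ => c) 0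
      rw [mul_assoc, mono_mul, eq_comm, mul_eq_left, ← mono_one]
      congr 1
      ext i
      simp
    refine ⟨(innerHom hA g)⁻¹ * (y * y), ?_, ?_⟩
    · rw [isFieldAut_iff]
      refine ⟨σ, ?_⟩
      rw [Subgroup.coe_mul, Subgroup.coe_inv, hx, coe_innerHom, conj_mk_eq_twistAut, hdg,
        inv_mul_cancel_left]
    · rw [hy, hgen, QuotientGroup.mk_mul _ (innerHom hA g)⁻¹, QuotientGroup.mk_inv,
        (hmem _).mp ⟨g, rfl⟩, inv_one, one_mul]
  · rintro ⟨φ, hφ, hYφ⟩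
    obtain ⟨hxN, hx3, -⟩ := hsq φ hYφ
    obtain ⟨σ, hσ⟩ := isFieldAut_iff.mp hφ
    refine index_commutator_of_field hα hz hz1 hz3 hker hidx hxN hx3
      (map_map_cube_root hz1 hz3 σ) (actsAs_of_coe_eq hA (d := 1) (σ := σ * σ) ?_) R
    rw [Subgroup.coe_mul, hσ, twistAut_mul]
    congr 1
    ext1
    rw [Subgroup.coe_mul, coe_fieldMap, Subgroup.coe_one, map_one, mul_one]

end SL3Sylow

/-! ### Unitriangular subgroups as Sylow `p`-subgroups of `PSL₃^ε(q)`. -/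

namespace SL3Sylow

variable {p f : ℕ} {K : Type*} [Field K] {ε : ℤˣ}

/-- The upper unitriangular matrix with entries `a`, `b` in the first row and `c` in the second. -/
def upperGL (a b c : K) : GL (Fin 3) K where
  val := !![1, a, b; 0, 1, c; 0, 0, 1]
  inv := !![1, -a, a * c - b; 0, 1, -c; 0, 0, 1]
  val_inv := by
    ext i j
    fin_cases i <;> fin_cases j <;> simp [Matrix.mul_apply, Fin.sum_univ_three]
    ring
  inv_val := by
    ext i j
    fin_cases i <;> fin_cases j <;> simp [Matrix.mul_apply, Fin.sum_univ_three]
    ring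

theorem coe_upperGL (a b c : K) :
    (upperGL a b c : Matrix (Fin 3) (Fin 3) K) = !![1, a, b; 0, 1, c; 0, 0, 1] := rfl

theorem upperGL_mul (a b c a' b' c' : K) :
    upperGL a b c * upperGL a' b' c' = upperGL (a + a') (b + b' + a * c') (c + c') := by
  apply Units.ext
  rw [Units.val_mul, coe_upperGL, coe_upperGL, coe_upperGL]
  ext i j
  fin_cases i <;> fin_cases j <;> simp [Matrix.mul_apply, Fin.sum_univ_three] <;> ring

theorem upperGL_zero : (upperGL 0 0 0 : GL (Fin 3) K) = 1 := by
  apply Units.ext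
  rw [coe_upperGL, Units.val_one, Matrix.one_fin_three]

theorem upperGL_inv (a b c : K) : (upperGL a b c)⁻¹ = upperGL (-a) (a * c - b) (-c) := by
  rw [inv_eq_iff_mul_eq_one, upperGL_mul, ← upperGL_zero]
  congr 1 <;> ring

theorem upperGL_injective {a b c a' b' c' : K} (h : upperGL a b c = upperGL a' b' c') :
    a = a' ∧ b = b' ∧ c = c' := by
  have h' := fun i j => congrArg (fun g : GL (Fin 3) K => (g : Matrix (Fin 3) (Fin 3) K) i j) h
  exact ⟨h' 0 1, h' 0 2, h' 1 2⟩

variable [ExpChar K p]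

variable (p f ε) in
/-- The elements of `SL₃^ε(q)` that become upper unitriangular after conjugation by `M`. -/
def unip (M : GL (Fin 3) K) : Subgroup (SLe p f K ε) where
  carrier := {g | ∃ a b c, (g : GL (Fin 3) K) = M * upperGL a b c * M⁻¹}
  one_mem' := ⟨0, 0, 0, by rw [upperGL_zero]; simp⟩
  mul_mem' := by
    rintro g h ⟨a, b, c, hg⟩ ⟨a', b', c', hh⟩
    refine ⟨a + a', b + b' + a * c', c + c', ?_⟩
    rw [Subgroup.coe_mul, hg, hh, ← upperGL_mul]
    group
  inv_mem' := by
    rintro g ⟨a, b, c, hg⟩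
    refine ⟨-a, a * c - b, -c, ?_⟩
    rw [Subgroup.coe_inv, hg, ← upperGL_inv]
    group

theorem mem_unip {M : GL (Fin 3) K} {g : SLe p f K ε} :
    g ∈ unip p f ε M ↔ ∃ a b c, (g : GL (Fin 3) K) = M * upperGL a b c * M⁻¹ := Iff.rfl

/-- In characteristic `p` the power of `1 + N` is `1 + N ^ p ^ 2`, and `N ^ 3 = 0` with `p ^ 2 ≥ 3`.
-/
theorem upperGL_pow_char [Fact p.Prime] [CharP K p] (a b c : K) : upperGL a b c ^ p ^ 2 = 1 := by
  apply Units.ext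
  rw [Units.val_pow_eq_pow_val, Units.val_one]
  have h1 : (upperGL a b c : Matrix (Fin 3) (Fin 3) K) = 1 + !![0, a, b; 0, 0, c; 0, 0, 0] := by
    rw [coe_upperGL]
    ext i j
    fin_cases i <;> fin_cases j <;> simp
  have h3 : (!![0, a, b; 0, 0, c; 0, 0, 0] : Matrix (Fin 3) (Fin 3) K) ^ 3 = 0 := by
    rw [pow_succ, pow_two]
    ext i j
    fin_cases i <;> fin_cases j <;> simp [Matrix.mul_apply, Fin.sum_univ_three]
  rw [h1, add_pow_char_pow_of_commute _ _ (Commute.one_left _), one_pow]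
  have h4 : 3 ≤ p ^ 2 := by
    have := (Fact.out : p.Prime).two_le
    nlinarith
  rw [← Nat.sub_add_cancel h4, pow_add, h3, mul_zero, add_zero]

theorem isPGroup_unip [Fact p.Prime] [CharP K p] (M : GL (Fin 3) K) :
    IsPGroup p (unip p f ε M) := by
  rintro ⟨g, a, b, c, hg⟩
  refine ⟨2, ?_⟩
  ext1
  ext1
  rw [Subgroup.coe_pow, Subgroup.coe_pow, hg, conj_pow, upperGL_pow_char]
  simp

theorem trace_conj_upperGL (M : GL (Fin 3) K) (a b c : K) :
    (M * upperGL a b c * M⁻¹ : GL (Fin 3) K).1.trace = 3 := by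
  rw [Units.val_mul, Units.val_mul, Matrix.trace_mul_comm, ← mul_assoc, ← Units.val_mul,
    inv_mul_cancel, Units.val_one, one_mul, coe_upperGL, Matrix.trace_fin_three]
  simp
  norm_num

/-- Since 3 is nonzero in `K`, trace 3 singles out one scalar multiple. Unipotent elements thus have
a canonical lift from `PSL₃^ε(q)`. -/
theorem eq_one_of_trace {g h : GL (Fin 3) K} (h3 : (3 : K) ≠ 0) (hg : g.1.trace = 3)
    (hh : h.1.trace = 3) {c : Kˣ} (hc : g = h * mono (fun _ => c) 0) : c = 1 := by
  have h1 : g.1 = (c : K) • h.1 := by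
    rw [hc, Units.val_mul]
    ext i j
    rw [Matrix.mul_apply, Finset.sum_eq_single j, Matrix.smul_apply, mono_apply, if_pos (by simp),
      smul_eq_mul, mul_comm]
    · intro k _ hk
      rw [mono_apply, if_neg (by simpa using hk.symm), mul_zero]
    · simp
  rw [h1, Matrix.trace_smul, hh, smul_eq_mul] at hg
  ext
  exact mul_right_cancel₀ h3 (hg.trans (one_mul 3).symm)

/-- Two elements of trace `3` with the same image in `PSL₃^ε(q)` are equal. -/
theorem eq_of_mk_eq {z : Kˣ} (hz : z ∈ scalars p f K ε) (hz1 : z ≠ 1) (hz3 : z ^ 3 = 1)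
    {g h : SLe p f K ε} (hg : (g : GL (Fin 3) K).1.trace = 3) (hh : (h : GL (Fin 3) K).1.trace = 3)
    (hgh : (g : PSLe p f K ε) = h) : g = h := by
  rw [eq_comm, QuotientGroup.eq] at hgh
  obtain ⟨c, hc⟩ := (mem_center_SLe hz hz1 hz3).mp hgh
  have h1 : (g : GL (Fin 3) K) = h * mono (fun _ => c) 0 := by
    rw [← hc, Subgroup.coe_mul, Subgroup.coe_inv, mul_inv_cancel_left]
  have h2 := eq_one_of_trace (three_ne_zero_of_cube_root hz1 hz3) hg hh h1
  ext1
  rw [h1, h2, ← Pi.one_def, mono_one, mul_one]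

theorem trace_of_mem_unip {M : GL (Fin 3) K} {g : SLe p f K ε} (hg : g ∈ unip p f ε M) :
    (g : GL (Fin 3) K).1.trace = 3 := by
  obtain ⟨a, b, c, hg⟩ := hg
  rw [hg, trace_conj_upperGL]

theorem trace_conj (g h : GL (Fin 3) K) : (g * h * g⁻¹).1.trace = h.1.trace := by
  rw [Units.val_mul, Units.val_mul, Matrix.trace_mul_comm, ← mul_assoc, ← Units.val_mul,
    inv_mul_cancel, Units.val_one, one_mul]

/-- A matrix conjugating a regular unipotent upper triangular matrix to an upper unitriangular one
is upper triangular. -/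
theorem upper_of_conj {h : GL (Fin 3) K} {a b c a' b' c' : K} (ha : a ≠ 0) (hc : c ≠ 0)
    (hh : h * upperGL a b c = upperGL a' b' c' * h) :
    h.1 1 0 = 0 ∧ h.1 2 0 = 0 ∧ h.1 2 1 = 0 := by
  have e : ∀ i j, (h.1 * (upperGL a b c).1) i j = ((upperGL a' b' c').1 * h.1) i j := fun i j =>
    congrArg (fun g : GL (Fin 3) K => g.1 i j) hh
  simp only [coe_upperGL, Matrix.mul_apply, Fin.sum_univ_three] at e
  have e20 := e 2 0
  have e21 := e 2 1
  have e22 := e 2 2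
  have e10 := e 1 0
  have e11 := e 1 1
  have e12 := e 1 2
  simp at e20 e21 e22 e10 e11 e12
  have h20 : h.1 2 0 = 0 := e21.resolve_right ha
  have h21 : h.1 2 1 = 0 := by
    rw [h20] at e22
    simpa [hc] using e22
  rw [h21] at e11
  refine ⟨?_, h20, h21⟩
  simpa [ha] using e11

/-- The elements normalizing the image of `unip M` are upper triangular after conjugation. -/
theorem upper_of_normalizes {z : Kˣ} (hz : z ∈ scalars p f K ε) (hz1 : z ≠ 1) (hz3 : z ^ 3 = 1)
    {M M' : GL (Fin 3) K} {u : SLe p f K ε} {a b c : K} (ha : a ≠ 0) (hc : c ≠ 0)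
    (hu : (u : GL (Fin 3) K) = M * upperGL a b c * M⁻¹) {g u' : SLe p f K ε}
    (hu' : u' ∈ unip p f ε M')
    (h : (g * u * g⁻¹ : SLe p f K ε) = (u' : PSLe p f K ε)) :
    (M'⁻¹ * g * M).1 1 0 = 0 ∧ (M'⁻¹ * g * M).1 2 0 = 0 ∧ (M'⁻¹ * g * M).1 2 1 = 0 := by
  have h1 : g * u * g⁻¹ = u' := by
    refine eq_of_mk_eq hz hz1 hz3 ?_ (trace_of_mem_unip hu') h
    rw [Subgroup.coe_mul, Subgroup.coe_mul, Subgroup.coe_inv, trace_conj]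
    exact trace_of_mem_unip ⟨a, b, c, hu⟩
  obtain ⟨a', b', c', hu''⟩ := hu'
  refine upper_of_conj ha hc (b := b) (a' := a') (b' := b') (c' := c') ?_
  have h2 := congrArg (Subgroup.subtype (SLe p f K ε)) h1
  simp only [map_mul, map_inv, Subgroup.subtype_apply, hu, hu''] at h2
  have h3 : (M'⁻¹ * g * M) * upperGL a b c * (M'⁻¹ * g * M)⁻¹ = upperGL a' b' c' := by
    calc (M'⁻¹ * g * M) * upperGL a b c * (M'⁻¹ * g * M)⁻¹
        = M'⁻¹ * (g * (M * upperGL a b c * M⁻¹) * (g : GL (Fin 3) K)⁻¹) * M' := by group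
      _ = _ := by rw [h2]; group
  rw [← h3]
  group

theorem mem_scalars_of_cube {z : Kˣ} (hz : z ∈ scalars p f K ε) (hz1 : z ≠ 1) (hz3 : z ^ 3 = 1)
    {c : Kˣ} (hc : c ^ 3 = 1) : c ∈ scalars p f K ε := by
  have h1 := cube_root_sum hz1 hz3
  have h2 : (c : K) ^ 3 = 1 := by rw [← Units.val_pow_eq_pow_val, hc, Units.val_one]
  have h3 : (z : K) ^ 3 = 1 := by rw [← Units.val_pow_eq_pow_val, hz3, Units.val_one]
  have h4 : ((c : K) - 1) * (c - z) * (c - (z : K) ^ 2) = 0 := by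
    linear_combination h2 - h3 + (c : K) * (z - c) * h1
  rcases mul_eq_zero.mp h4 with h | h
  · rcases mul_eq_zero.mp h with h | h
    · rw [sub_eq_zero] at h
      rw [show c = 1 from Units.ext h]
      exact one_mem _
    · rw [sub_eq_zero] at h
      rwa [show c = z from Units.ext h]
  · rw [sub_eq_zero] at h
    rw [show c = z ^ 2 from Units.ext (by simpa using h)]
    exact pow_mem hz 2

theorem upper_pow_diag {M : Matrix (Fin 3) (Fin 3) K} (h : M 1 0 = 0 ∧ M 2 0 = 0 ∧ M 2 1 = 0) (n : ℕ) :
    ((M ^ n) 1 0 = 0 ∧ (M ^ n) 2 0 = 0 ∧ (M ^ n) 2 1 = 0) ∧ ∀ i, (M ^ n) i i = M i i ^ n := by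
  obtain ⟨h1, h2, h3⟩ := h
  induction n with
  | zero => simp
  | succ n ih =>
    obtain ⟨⟨i1, i2, i3⟩, i4⟩ := ih
    refine ⟨⟨?_, ?_, ?_⟩, fun i => ?_⟩
    · rw [pow_succ, Matrix.mul_apply, Fin.sum_univ_three, i1, h1, h2]; ring
    · rw [pow_succ, Matrix.mul_apply, Fin.sum_univ_three, i2, h1, h2]; ring
    · rw [pow_succ, Matrix.mul_apply, Fin.sum_univ_three, i2, i3, h3]; ring
    · rw [pow_succ, pow_succ, Matrix.mul_apply, Fin.sum_univ_three, ← i4]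
      fin_cases i <;> simp [h1, h2, h3, i1, i2, i3]

theorem upper_mul_scalar {h : GL (Fin 3) K} (hup : h.1 1 0 = 0 ∧ h.1 2 0 = 0 ∧ h.1 2 1 = 0)
    (hdiag : ∀ i, h.1 i i = h.1 0 0) {s : Kˣ} (hs : (s : K) = h.1 0 0) :
    h * mono (fun _ => s⁻¹) 0 =
      upperGL ((s : K)⁻¹ * h.1 0 1) ((s : K)⁻¹ * h.1 0 2) ((s : K)⁻¹ * h.1 1 2) := by
  have h1 : ∀ i j, (h * mono (fun _ => s⁻¹) 0).1 i j = (s : K)⁻¹ * h.1 i j := by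
    intro i j
    rw [Units.val_mul, Matrix.mul_apply, Finset.sum_eq_single j, mono_apply, if_pos (by simp),
      mul_comm, Units.val_inv_eq_inv_val]
    · intro k _ hk
      rw [mono_apply, if_neg (by simpa using hk.symm), mul_zero]
    · simp
  have hd : ∀ i, (s : K)⁻¹ * h.1 i i = 1 := by
    intro i
    rw [hdiag, ← hs, inv_mul_cancel₀ s.ne_zero]
  obtain ⟨h10, h20, h21⟩ := hup
  apply Units.ext
  ext i j
  rw [h1, coe_upperGL]
  fin_cases i <;> fin_cases j
  · exact hd 0
  · rfl
  · rfl
  · change _ * h.1 1 0 = 0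
    rw [h10, mul_zero]
  · exact hd 1
  · rfl
  · change _ * h.1 2 0 = 0
    rw [h20, mul_zero]
  · change _ * h.1 2 1 = 0
    rw [h21, mul_zero]
  · exact hd 2

/-- The image of `unip M` in `PSL₃^ε(q)` is a Sylow `p`-subgroup if it has regular elements. -/
theorem exists_sylow_unip [Finite K] [Fact p.Prime] [CharP K p] {z : Kˣ}
    (hz : z ∈ scalars p f K ε) (hz1 : z ≠ 1) (hz3 : z ^ 3 = 1) (M : GL (Fin 3) K)
    {u : SLe p f K ε} {a b c : K} (ha : a ≠ 0) (hc : c ≠ 0)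
    (hu : (u : GL (Fin 3) K) = M * upperGL a b c * M⁻¹) :
    ∃ P : Sylow p (PSLe p f K ε), (P : Subgroup (PSLe p f K ε)) =
      (unip p f ε M).map (QuotientGroup.mk' _) := by
  refine exists_sylow_coe_eq _ ((isPGroup_unip M).map _) ?_
  intro y hy hyk
  obtain ⟨g, rfl⟩ := QuotientGroup.mk_surjective y
  obtain ⟨u', hu', he⟩ := hy (u : PSLe p f K ε) ⟨u, ⟨a, b, c, hu⟩, rfl⟩
  have hup := upper_of_normalizes hz hz1 hz3 ha hc hu hu' (g := g) he.symm
  obtain ⟨k, hk⟩ := hyk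
  rw [← QuotientGroup.mk_pow, QuotientGroup.eq_one_iff, mem_center_SLe hz hz1 hz3] at hk
  obtain ⟨e, he⟩ := hk
  set h := M⁻¹ * (g : GL (Fin 3) K) * M with hh
  have hhk : h ^ p ^ k = mono (fun _ => e) 0 := by
    rw [hh, show M⁻¹ * (g : GL (Fin 3) K) * M = M⁻¹ * (g : GL (Fin 3) K) * (M⁻¹)⁻¹ by rw [inv_inv],
      conj_pow, ← Subgroup.coe_pow, he, inv_inv, mul_assoc, mono_const_comm, inv_mul_cancel_left]
  have hdiag : ∀ i, h.1 i i ^ p ^ k = (e : K) := by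
    intro i
    rw [← (upper_pow_diag hup (p ^ k)).2, ← Units.val_pow_eq_pow_val, hhk, mono_apply,
      if_pos (by simp)]
  -- The diagonal entries have a common `p ^ k`-th power, and Frobenius is injective; the common
  -- entry is then a cube root of unity and can be divided out as a central scalar.
  have hinj : ∀ i, h.1 i i = h.1 0 0 := by
    intro i
    exact iterateFrobenius_inj K p k
      (by rw [iterateFrobenius_def, iterateFrobenius_def, hdiag, hdiag])
  have hdet : h.1 0 0 ^ 3 = 1 := by
    have h1 : Matrix.GeneralLinearGroup.det h = 1 := by
      rw [hh, map_mul, map_mul, (mem_SLe.mp g.2).2, mul_one, ← map_mul, inv_mul_cancel, map_one]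
    have h2 := congrArg Units.val h1
    rw [Matrix.GeneralLinearGroup.val_det_apply, Matrix.det_fin_three, Units.val_one] at h2
    obtain ⟨h10, h20, h21⟩ := hup
    have i1 := hinj 1
    have i2 := hinj 2
    rw [h10, h20, h21, i1, i2] at h2
    linear_combination h2
  let s : Kˣ := Units.mkOfMulEqOne (h.1 0 0) (h.1 0 0 ^ 2) (by rw [← pow_succ', hdet])
  have hs3 : s ^ 3 = 1 := Units.ext (by rw [Units.val_pow_eq_pow_val]; exact hdet)
  have hsmem : s ∈ scalars p f K ε := mem_scalars_of_cube hz hz1 hz3 hs3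
  have hsc : mono (fun _ => s⁻¹) 0 ∈ SLe p f K ε := by
    refine mem_SLe.mpr ⟨mono_mem_GLe.mpr fun _ => inv_mem hsmem, ?_⟩
    rw [det_mono, ← pow_two, ← pow_succ, inv_pow, hs3, inv_one]
  have hs : (s : K) = h.1 0 0 := rfl
  refine ⟨g * ⟨_, hsc⟩, ?_, ?_⟩
  · refine ⟨(s : K)⁻¹ * h.1 0 1, (s : K)⁻¹ * h.1 0 2, (s : K)⁻¹ * h.1 1 2, ?_⟩
    rw [Subgroup.coe_mul, eq_mul_inv_iff_mul_eq, ← inv_mul_eq_iff_eq_mul, mul_assoc _ _ M,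
      mono_const_comm, ← mul_assoc, ← mul_assoc, ← hh]
    exact upper_mul_scalar hup hinj hs
  · change ((g * _ : SLe p f K ε) : PSLe p f K ε) = g
    rw [eq_comm, QuotientGroup.eq, inv_mul_cancel_left, mem_center_SLe hz hz1 hz3]
    exact ⟨_, rfl⟩

/-- Automorphisms permute the Sylow subgroups. -/
theorem exists_map_eq_conj {G : Type*} [Group G] [Finite G] {p : ℕ} [Fact p.Prime] (P : Sylow p G)
    (α : MulAut G) : ∃ g : G, (P : Subgroup G).map (α : G →* G) =
      (P : Subgroup G).map (MulAut.conj g : G →* G) := by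
  obtain ⟨g, hg⟩ := MulAction.exists_smul_eq G P (α • P)
  exact ⟨g, (congrArg (fun Q : Sylow p G => (Q : Subgroup G)) hg).symm⟩

end SL3Sylow

namespace SL3Sylow

/-! ### Hexagons of flags in the projective plane. -/

section Flags

variable {K : Type*} [Field K]

/-- Two vectors span the same line. -/
def Par (x y : Fin 3 → K) : Prop := ∃ c : Kˣ, x = (c : K) • y

theorem Par.refl (x : Fin 3 → K) : Par x x := ⟨1, by simp⟩

theorem Par.symm {x y : Fin 3 → K} (h : Par x y) : Par y x := by
  obtain ⟨c, rfl⟩ := h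
  exact ⟨c⁻¹, by rw [smul_smul, ← Units.val_mul, inv_mul_cancel, Units.val_one, one_smul]⟩

theorem Par.trans {x y z : Fin 3 → K} (h : Par x y) (h' : Par y z) : Par x z := by
  obtain ⟨c, rfl⟩ := h
  obtain ⟨d, rfl⟩ := h'
  exact ⟨c * d, by rw [smul_smul, Units.val_mul]⟩

theorem Par.dot_eq_zero {x y φ : Fin 3 → K} (h : Par x y) : φ ⬝ᵥ x = 0 ↔ φ ⬝ᵥ y = 0 := by
  obtain ⟨c, rfl⟩ := h
  rw [dotProduct_smul, smul_eq_mul, mul_eq_zero, or_iff_right c.ne_zero]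

theorem Par.dot_eq_zero_left {φ ψ x : Fin 3 → K} (h : Par φ ψ) : φ ⬝ᵥ x = 0 ↔ ψ ⬝ᵥ x = 0 := by
  rw [dotProduct_comm, h.dot_eq_zero, dotProduct_comm]

theorem par_or_linearIndependent {x y : Fin 3 → K} (hx : x ≠ 0) (hy : y ≠ 0) :
    Par x y ∨ LinearIndependent K ![x, y] := by
  by_contra h
  rw [not_or, LinearIndependent.pair_iff' hx] at h
  push Not at h
  obtain ⟨h1, a, ha⟩ := h
  have ha0 : a ≠ 0 := by
    rintro rfl
    rw [zero_smul] at ha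
    exact hy ha.symm
  exact h1 (Par.symm ⟨Units.mk0 a ha0, ha.symm⟩)

/-- Two points on two lines of the projective plane. -/
theorem par_or_par {v w φ ψ : Fin 3 → K} (hv : v ≠ 0) (hw : w ≠ 0) (hφ : φ ≠ 0) (hψ : ψ ≠ 0)
    (h1 : φ ⬝ᵥ v = 0) (h2 : φ ⬝ᵥ w = 0) (h3 : ψ ⬝ᵥ v = 0) (h4 : ψ ⬝ᵥ w = 0) :
    Par v w ∨ Par φ ψ := by
  by_contra h
  rw [not_or] at h
  have i1 := (par_or_linearIndependent hv hw).resolve_left h.1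
  have i2 := (par_or_linearIndependent hφ hψ).resolve_left h.2
  have r1 : (Matrix.of ![v, w]).rank = 2 := by
    rw [LinearIndependent.rank_matrix (M := Matrix.of ![v, w]) i1, Fintype.card_fin]
  have r2 : (Matrix.of ![φ, ψ]).rank = 2 := by
    rw [LinearIndependent.rank_matrix (M := Matrix.of ![φ, ψ]) i2, Fintype.card_fin]
  have hmul : Matrix.of ![φ, ψ] * (Matrix.of ![v, w])ᵀ = 0 := by
    ext i j
    fin_cases i <;> fin_cases j
    · exact h1
    · exact h2
    · exact h3
    · exact h4
  have := Matrix.rank_add_rank_le_card_of_mul_eq_zero hmul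
  rw [r2, Matrix.rank_transpose, r1, Fintype.card_fin] at this
  omega

/-- A hexagon of flags in the projective plane, indexed by the roots `(i, j)`, `i ≠ j`. -/
structure FlagHexagon (v φ : Fin 3 → Fin 3 → Fin 3 → K) : Prop where
  point_ne : ∀ i j, i ≠ j → v i j ≠ 0
  line_ne : ∀ i j, i ≠ j → φ i j ≠ 0
  flag : ∀ i j, i ≠ j → φ i j ⬝ᵥ v i j = 0
  adj : ∀ i j k l, i ≠ j → k ≠ l → j ≠ k → i ≠ l → φ i j ⬝ᵥ v k l = 0
  far : ∀ i j k, i ≠ j → j ≠ k → i ≠ k → ¬ (φ i j ⬝ᵥ v j k = 0 ∧ φ j k ⬝ᵥ v i j = 0)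

variable {v φ : Fin 3 → Fin 3 → Fin 3 → K}

theorem FlagHexagon.par_or (h : FlagHexagon v φ) {i j k l : Fin 3} (hij : i ≠ j) (hkl : k ≠ l)
    (hjk : j ≠ k) (hil : i ≠ l) : Par (v i j) (v k l) ∨ Par (φ i j) (φ k l) :=
  par_or_par (h.point_ne _ _ hij) (h.point_ne _ _ hkl) (h.line_ne _ _ hij) (h.line_ne _ _ hkl)
    (h.flag _ _ hij) (h.adj _ _ _ _ hij hkl hjk hil) (h.adj _ _ _ _ hkl hij hil.symm hjk.symm)
    (h.flag _ _ hkl)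

/-- Consecutive flags share a point or a line. Three consecutive flags through one point would make
the outer two incident, which `far` forbids; so points and lines alternate around the hexagon. -/
theorem FlagHexagon.par_line (h : FlagHexagon v φ) {i j k : Fin 3} (hij : i ≠ j) (hjk : j ≠ k)
    (hik : i ≠ k) (hp : Par (v i j) (v i k)) : Par (φ i k) (φ j k) := by
  refine (h.par_or hik hjk hjk.symm hik).resolve_left fun hp' => ?_
  have hp2 := hp.trans hp'
  exact h.far i j k hij hjk hik ⟨hp2.symm.dot_eq_zero.mpr (h.flag _ _ hij),
    hp2.dot_eq_zero.mpr (h.flag _ _ hjk)⟩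

theorem FlagHexagon.par_point (h : FlagHexagon v φ) {i j k : Fin 3} (hij : i ≠ j) (hjk : j ≠ k)
    (hik : i ≠ k) (hp : Par (φ i k) (φ j k)) : Par (v j k) (v j i) := by
  refine (h.par_or hjk hij.symm hjk.symm hij.symm).resolve_right fun hp' => ?_
  have hp2 := hp.trans hp'
  exact h.far j i k hij.symm hik hjk ⟨hp2.symm.dot_eq_zero_left.mpr (h.flag _ _ hik),
    hp2.dot_eq_zero_left.mpr (h.flag _ _ hij.symm)⟩

/-- A hexagon of flags in which the flags of the roots in the first row have a common point comes
from a basis. -/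
theorem FlagHexagon.exists_basis (h : FlagHexagon v φ) (hp : Par (v 0 1) (v 0 2)) :
    ∃ g : GL (Fin 3) K, ∀ i j, i ≠ j → ∃ c : K, Matrix.vecMulVec (v i j) (φ i j) =
      c • (g.1 * Matrix.single i j 1 * g⁻¹.1) := by
  have d01 : (0 : Fin 3) ≠ 1 := by decide
  have d02 : (0 : Fin 3) ≠ 2 := by decide
  have d12 : (1 : Fin 3) ≠ 2 := by decide
  have l2 := h.par_line d01 d12 d02 hp
  have p1 := h.par_point d01 d12 d02 l2
  have l1 := h.par_line d02 d12.symm d01 hp.symm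
  have p2 := h.par_point d02 d12.symm d01 l1
  have l0 := h.par_line d12 d02.symm d01.symm p1
  -- Around the hexagon there remain three points `a i` and three lines `ψ j`. They form a basis
  -- and, after rescaling, its dual basis.
  let a : Fin 3 → Fin 3 → K := ![v 0 1, v 1 2, v 2 0]
  let ψ : Fin 3 → Fin 3 → K := ![φ 1 0, φ 2 1, φ 0 2]
  have ha : ∀ i j, i ≠ j → Par (v i j) (a i) := by
    intro i j hij
    fin_cases i <;> fin_cases j
    · exact absurd rfl hij
    · exact Par.refl _
    · exact hp.symm
    · exact p1.symm
    · exact absurd rfl hij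
    · exact Par.refl _
    · exact Par.refl _
    · exact p2
    · exact absurd rfl hij
  have hψ : ∀ i j, i ≠ j → Par (φ i j) (ψ j) := by
    intro i j hij
    fin_cases i <;> fin_cases j
    · exact absurd rfl hij
    · exact l1
    · exact Par.refl _
    · exact Par.refl _
    · exact absurd rfl hij
    · exact l2.symm
    · exact l0.symm
    · exact Par.refl _
    · exact absurd rfl hij
  have hoff : ∀ i j, i ≠ j → ψ i ⬝ᵥ a j = 0 := by
    intro i j hij
    rw [← (ha j i hij.symm).dot_eq_zero, ← (hψ j i hij.symm).dot_eq_zero_left]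
    exact h.flag _ _ hij.symm
  have hon : ∀ i, ψ i ⬝ᵥ a i ≠ 0 := by
    intro i h0
    obtain ⟨j, k, hji, hik, hjk⟩ : ∃ j k : Fin 3, j ≠ i ∧ i ≠ k ∧ j ≠ k := by
      exact (by decide : ∀ i : Fin 3, ∃ j k : Fin 3, j ≠ i ∧ i ≠ k ∧ j ≠ k) i
    refine h.far j i k hji hik hjk ⟨?_, ?_⟩
    · rwa [(hψ j i hji).dot_eq_zero_left, (ha i k hik).dot_eq_zero]
    · rw [(hψ i k hik).dot_eq_zero_left, (ha j i hji).dot_eq_zero]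
      exact hoff _ _ hjk.symm
  have hmul : Matrix.of ψ * (Matrix.of a)ᵀ = Matrix.diagonal fun i => ψ i ⬝ᵥ a i := by
    ext i j
    by_cases hij : i = j
    · subst hij
      rw [Matrix.diagonal_apply_eq]
      rfl
    · rw [Matrix.diagonal_apply_ne _ hij]
      exact hoff _ _ hij
  let D : Matrix (Fin 3) (Fin 3) K := Matrix.diagonal fun i => (ψ i ⬝ᵥ a i)⁻¹
  have hleft : (D * Matrix.of ψ) * (Matrix.of a)ᵀ = 1 := by
    rw [Matrix.mul_assoc, hmul, Matrix.diagonal_mul_diagonal, ← Matrix.diagonal_one]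
    congr 1
    ext i
    exact inv_mul_cancel₀ (hon i)
  let g : GL (Fin 3) K := ⟨(Matrix.of a)ᵀ, D * Matrix.of ψ, mul_eq_one_comm.mp hleft, hleft⟩
  refine ⟨g, fun i j hij => ?_⟩
  obtain ⟨c, hc⟩ := ha i j hij
  obtain ⟨e, he⟩ := hψ i j hij
  refine ⟨c * e * (ψ j ⬝ᵥ a j), ?_⟩
  have h1 : g.1 * Matrix.single i j 1 * g⁻¹.1 =
      Matrix.vecMulVec (a i) ((ψ j ⬝ᵥ a j)⁻¹ • ψ j) := by
    rw [Matrix.single_eq_single_vecMulVec_single, Matrix.mul_vecMulVec, Matrix.vecMulVec_mul]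
    congr 1
    · ext r
      simp [g]
    · ext r
      change (Pi.single j 1 ᵥ* (D * Matrix.of ψ)) r = _
      simp [D, Matrix.diagonal_mul]
  rw [h1, hc, he, Matrix.vecMulVec_smul, Matrix.vecMulVec_smul, Matrix.smul_vecMulVec, smul_smul,
    smul_smul, mul_assoc, mul_inv_cancel₀ (hon j), mul_one, mul_comm]

end Flags

end SL3Sylow

namespace SL3Sylow

/-! ### Elementary matrices and their relations. -/

section RootElements

variable {p f : ℕ} {K : Type*} [Field K] [ExpChar K p]

theorem mem_SLe_one {g : GL (Fin 3) K} :
    g ∈ SLe p f K 1 ↔ g.1.det = 1 := by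
  rw [mem_SLe, mem_GLe]
  constructor
  · rintro ⟨-, h⟩
    exact congrArg Units.val h
  · intro h
    exact ⟨Or.inl rfl, Units.ext h⟩

variable (p f) in
/-- The elementary matrix with entry `s` in position `(i, j)` as an element of `SL₃(q)`. -/
def elem {i j : Fin 3} (hij : i ≠ j) (s : K) : SLe p f K 1 :=
  ⟨Matrix.SpecialLinearGroup.toGL (Matrix.SpecialLinearGroup.transvection hij s),
    mem_SLe_one.mpr (Matrix.det_transvection_of_ne i j hij s)⟩

theorem coe_elem {i j : Fin 3} (hij : i ≠ j) (s : K) :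
    (elem p f hij s).1.1 = 1 + Matrix.single i j s := rfl

theorem SLe_ext {ε : ℤˣ} {g h : SLe p f K ε} (hgh : g.1.1 = h.1.1) : g = h :=
  Subtype.ext (Units.ext hgh)

theorem elem_mul {i j : Fin 3} (hij : i ≠ j) (s t : K) :
    elem p f hij s * elem p f hij t = elem p f hij (s + t) := by
  apply SLe_ext
  rw [Subgroup.coe_mul, Units.val_mul, coe_elem, coe_elem, coe_elem, mul_add, add_mul, add_mul,
    Matrix.single_mul_single_of_ne _ _ _ _ hij.symm, Matrix.single_add]
  simp [add_assoc]

theorem elem_zero {i j : Fin 3} (hij : i ≠ j) : elem p f hij (0 : K) = 1 := by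
  apply SLe_ext
  rw [coe_elem, Matrix.single_zero, add_zero]
  rfl

theorem elem_inv {i j : Fin 3} (hij : i ≠ j) (s : K) :
    (elem p f hij s)⁻¹ = elem p f hij (-s) := by
  rw [inv_eq_iff_mul_eq_one, elem_mul, add_neg_cancel, elem_zero]

theorem elem_injective {i j : Fin 3} (hij : i ≠ j) {s t : K}
    (h : elem p f hij s = elem p f hij t) : s = t := by
  have h1 := congrArg (fun g : SLe p f K 1 => g.1.1 i j) h
  simpa [coe_elem, Matrix.one_apply_ne hij] using h1

theorem trace_elem {i j : Fin 3} (hij : i ≠ j) (s : K) : (elem p f hij s).1.1.trace = 3 := by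
  rw [coe_elem, Matrix.trace_add, Matrix.trace_single_eq_of_ne _ _ _ hij, Matrix.trace_one]
  simp

theorem elem_comm_iff {i j k l : Fin 3} (hij : i ≠ j) (hkl : k ≠ l) (s t : K) :
    elem p f hij s * elem p f hkl t = elem p f hkl t * elem p f hij s ↔
      Matrix.single i j s * Matrix.single k l t = Matrix.single k l t * Matrix.single i j s := by
  constructor
  · intro h
    have h1 := congrArg (fun g : SLe p f K 1 => g.1.1) h
    simp only [Subgroup.coe_mul, Units.val_mul, coe_elem, mul_add, add_mul, mul_one, one_mul] at h1
    rw [add_assoc, add_assoc, add_right_inj, ← add_assoc, ← add_assoc,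
      add_comm (Matrix.single k l t)] at h1
    exact add_left_cancel h1
  · intro h
    apply SLe_ext
    simp only [Subgroup.coe_mul, Units.val_mul, coe_elem, mul_add, add_mul, mul_one, one_mul]
    rw [h]
    abel

theorem elem_comm {i j k l : Fin 3} (hij : i ≠ j) (hkl : k ≠ l) (hjk : j ≠ k) (hil : i ≠ l)
    (s t : K) : elem p f hij s * elem p f hkl t = elem p f hkl t * elem p f hij s := by
  rw [elem_comm_iff, Matrix.single_mul_single_of_ne _ _ _ _ hjk,
    Matrix.single_mul_single_of_ne _ _ _ _ hil.symm]

theorem elem_not_comm {i j k : Fin 3} (hij : i ≠ j) (hjk : j ≠ k) (hik : i ≠ k) :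
    elem p f hij (1 : K) * elem p f hjk 1 ≠ elem p f hjk 1 * elem p f hij 1 := by
  rw [Ne, elem_comm_iff, Matrix.single_mul_single_same,
    Matrix.single_mul_single_of_ne _ _ _ _ hik.symm]
  intro h
  have := congrFun (congrFun h i) k
  simp at this

theorem elem_commutator {i j k : Fin 3} (hij : i ≠ j) (hjk : j ≠ k) (hik : i ≠ k) (s t : K) :
    elem p f hij s * elem p f hjk t = elem p f hik (s * t) * (elem p f hjk t * elem p f hij s) := by
  apply SLe_ext
  simp only [Subgroup.coe_mul, Units.val_mul, coe_elem, mul_add, add_mul, mul_one, one_mul,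
    Matrix.single_mul_single_same, Matrix.single_mul_single_of_ne _ _ _ _ hik.symm,
    Matrix.single_mul_single_of_ne _ _ _ _ hjk.symm]
  abel_nf
  simp

/-- The Weyl group, represented by the cyclic permutation and the swap, is transitive on the roots;
so one root subgroup suffices for what follows. -/
theorem exists_conj_elem_eq {i j : Fin 3} (hij : i ≠ j) : ∃ w : SLe p f K 1, ∀ s : K,
    ∃ s', elem p f hij s = w * elem p f (i := 0) (j := 2) (by decide) s' * w⁻¹ := by
  have key : ∀ w : SLe p f K 1, ∀ e : K, w.1.1 * Matrix.single 0 2 e = Matrix.single i j 1 * w.1.1 →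
      ∀ s : K, ∃ s', elem p f hij s = w * elem p f (i := 0) (j := 2) (by decide) s' * w⁻¹ := by
    intro w e hw s
    refine ⟨s * e, ?_⟩
    rw [eq_mul_inv_iff_mul_eq]
    apply SLe_ext
    rw [Subgroup.coe_mul, Subgroup.coe_mul, Units.val_mul, Units.val_mul, coe_elem, coe_elem,
      mul_add, add_mul, mul_one, one_mul]
    have h1 : (Matrix.single i j s : Matrix (Fin 3) (Fin 3) K) = s • Matrix.single i j 1 := by simp
    have h2 : (Matrix.single 0 2 (s * e) : Matrix (Fin 3) (Fin 3) K) = s • Matrix.single 0 2 e := by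
      simp
    rw [h1, h2, Matrix.smul_mul, Matrix.mul_smul, hw]
  have hs : (swap p f K 1).1.1 = !![0, 0, -1; 0, -1, 0; -1, 0, 0] := rfl
  have hc : (cyc : SLe p f K 1).1.1 = !![0, 1, 0; 0, 0, 1; 1, 0, 0] := by
    rw [coe_cyc, coe_mono_one]
    simp
  have hw : ∃ (w : SLe p f K 1) (e : K),
      w.1.1 * Matrix.single 0 2 e = Matrix.single i j 1 * w.1.1 := by
    fin_cases i <;> fin_cases j
    · exact absurd rfl hij
    · refine ⟨cyc * cyc * swap p f K 1, 1, ?_⟩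
      rw [Subgroup.coe_mul, Units.val_mul, Subgroup.coe_mul, Units.val_mul, hs, hc]
      ext r s
      fin_cases r <;> fin_cases s <;> simp [Matrix.mul_apply, Matrix.single_apply]
    · refine ⟨1, 1, ?_⟩
      simp
    · refine ⟨cyc * cyc, 1, ?_⟩
      rw [Subgroup.coe_mul, Units.val_mul, hc]
      ext r s
      fin_cases r <;> fin_cases s <;> simp [Matrix.mul_apply, Matrix.single_apply]
    · exact absurd rfl hij
    · refine ⟨cyc * swap p f K 1, 1, ?_⟩
      rw [Subgroup.coe_mul, Units.val_mul, hs, hc]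
      ext r s
      fin_cases r <;> fin_cases s <;> simp [Matrix.mul_apply, Matrix.single_apply]
    · refine ⟨swap p f K 1, 1, ?_⟩
      rw [hs]
      ext r s
      fin_cases r <;> fin_cases s <;> simp [Matrix.mul_apply, Matrix.single_apply]
    · refine ⟨cyc, 1, ?_⟩
      rw [hc]
      ext r s
      fin_cases r <;> fin_cases s <;> simp [Matrix.mul_apply, Matrix.single_apply]
    · exact absurd rfl hij
  obtain ⟨w, e, hw⟩ := hw
  exact ⟨w, key w e hw⟩

theorem transvection_mul_three {i j : Fin 3} (hij : i ≠ j) {c : K} (hc : c ≠ 0) :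
    Matrix.transvection i j c * Matrix.transvection j i (-c⁻¹) * Matrix.transvection i j c =
      1 - Matrix.single i i 1 - Matrix.single j j 1 + Matrix.single i j c -
        Matrix.single j i c⁻¹ := by
  simp only [Matrix.transvection, mul_add, add_mul, mul_one, one_mul,
    Matrix.single_mul_single_same,
    Matrix.single_mul_single_of_ne _ _ _ _ hij.symm, add_zero, mul_neg, neg_mul,
    mul_inv_cancel₀ hc, inv_mul_cancel₀ hc]
  have h : ∀ (r s : Fin 3) (e : K), Matrix.single r s (-e) = -Matrix.single r s e := by
    intro r s e
    rw [← Matrix.single_neg]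
  simp only [h]
  abel

/-- The usual rank-one formula: a torus element is a product of two Weyl elements, each of which is
a product of three transvections. -/
theorem diag2n_eq_prod_transvection {i j : Fin 3} (hij : i ≠ j) {c : K} (hc : c ≠ 0) :
    Matrix.SpecialLinearGroup.diag2n hij c hc =
      (Matrix.SpecialLinearGroup.transvection hij c *
        Matrix.SpecialLinearGroup.transvection hij.symm (- c⁻¹) *
        Matrix.SpecialLinearGroup.transvection hij c) *
        (Matrix.SpecialLinearGroup.transvection hij (-1) *
        Matrix.SpecialLinearGroup.transvection hij.symm 1 *
        Matrix.SpecialLinearGroup.transvection hij (-1)) := by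
  apply Subtype.ext
  have h1 := transvection_mul_three hij hc
  have h2 := transvection_mul_three hij (neg_ne_zero.mpr (one_ne_zero (α := K)))
  rw [inv_neg, inv_one, neg_neg] at h2
  change _ = (Matrix.transvection i j c * Matrix.transvection j i (-c⁻¹) * Matrix.transvection i j c) *
    (Matrix.transvection i j (-1) * Matrix.transvection j i 1 * Matrix.transvection i j (-1))
  rw [h1, h2, Matrix.SpecialLinearGroup.diag2n_coe]
  ext r s
  fin_cases i <;> fin_cases j <;> first | exact absurd rfl hij | skip
  all_goals
    fin_cases r <;> fin_cases s <;>
      simp [Matrix.mul_apply, Matrix.single_apply, Matrix.one_apply]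

/-- Endomorphisms that agree on the elementary matrices are equal. -/
theorem eq_of_eq_elem {β γ : MulAut (PSLe p f K 1)}
    (h : ∀ (i j : Fin 3) (hij : i ≠ j) (s : K),
      β (elem p f hij s : PSLe p f K 1) = γ (elem p f hij s : PSLe p f K 1)) : β = γ := by
  have key : ∀ M : Matrix.SpecialLinearGroup (Fin 3) K, ∀ g : SLe p f K 1, g.1.1 = M.1 →
      β (g : PSLe p f K 1) = γ (g : PSLe p f K 1) := by
    have hmul : ∀ A B : Matrix.SpecialLinearGroup (Fin 3) K,
        (∀ g : SLe p f K 1, g.1.1 = A.1 → β (g : PSLe p f K 1) = γ (g : PSLe p f K 1)) →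
        (∀ g : SLe p f K 1, g.1.1 = B.1 → β (g : PSLe p f K 1) = γ (g : PSLe p f K 1)) →
        (∀ g : SLe p f K 1, g.1.1 = (A * B).1 →
          β (g : PSLe p f K 1) = γ (g : PSLe p f K 1)) := by
      intro A B hA hB g hg
      let a : SLe p f K 1 := ⟨Matrix.SpecialLinearGroup.toGL A, mem_SLe_one.mpr A.2⟩
      let b : SLe p f K 1 := ⟨Matrix.SpecialLinearGroup.toGL B, mem_SLe_one.mpr B.2⟩
      have hab : g = a * b := SLe_ext hg
      rw [hab, QuotientGroup.mk_mul, map_mul, map_mul, hA a rfl, hB b rfl]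
    have htr : ∀ (i j : Fin 3) (hij : i ≠ j) (c : K), ∀ g : SLe p f K 1,
        g.1.1 = (Matrix.SpecialLinearGroup.transvection hij c).1 →
        β (g : PSLe p f K 1) = γ (g : PSLe p f K 1) := by
      intro i j hij c g hg
      have : g = elem p f hij c := SLe_ext hg
      rw [this, h]
    intro M
    refine Matrix.SpecialLinearGroup.diagonal_transvection_induction' _ M ?_ htr hmul
    intro i j hij c hc
    rw [diag2n_eq_prod_transvection hij hc]
    exact hmul _ _ (hmul _ _ (hmul _ _ (htr _ _ _ _) (htr _ _ _ _)) (htr _ _ _ _))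
      (hmul _ _ (hmul _ _ (htr _ _ _ _) (htr _ _ _ _)) (htr _ _ _ _))
  ext x
  induction x using QuotientGroup.induction_on with
  | H g => exact key ⟨g.1.1, mem_SLe_one.mp g.2⟩ g rfl

end RootElements

end SL3Sylow

namespace SL3Sylow

/-! ### Images of root subgroups under an automorphism of `PSL₃(q)`. -/

section RootImages

variable {p f : ℕ} {K : Type*} [Field K] [ExpChar K p]

/-- The automorphism `α` maps the transvections `x(s)` to transvections with a given centre and
axis. -/
def MapsToFlag (α : MulAut (PSLe p f K 1)) (x : K → SLe p f K 1) (v φ : Fin 3 → K) : Prop :=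
  v ≠ 0 ∧ φ ≠ 0 ∧ φ ⬝ᵥ v = 0 ∧ ∀ s, ∃ (r : K) (y : SLe p f K 1),
    α (x s : PSLe p f K 1) = y ∧ y.1.1 = 1 + r • Matrix.vecMulVec v φ

theorem conj_one_add_smul_vecMulVec (g h : GL (Fin 3) K) (r : K) (v φ : Fin 3 → K)
    (hh : h.1 = 1 + r • Matrix.vecMulVec v φ) :
    (g * h * g⁻¹).1 = 1 + r • Matrix.vecMulVec (g.1 *ᵥ v) (φ ᵥ* g⁻¹.1) := by
  rw [Units.val_mul, Units.val_mul, hh, mul_add, add_mul, mul_one, ← Units.val_mul, mul_inv_cancel,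
    Units.val_one, Matrix.mul_smul, Matrix.smul_mul, Matrix.mul_vecMulVec, Matrix.vecMulVec_mul]

theorem mulVec_ne_zero (g : GL (Fin 3) K) {v : Fin 3 → K} (hv : v ≠ 0) : g.1 *ᵥ v ≠ 0 := by
  intro h
  apply hv
  rw [← Matrix.one_mulVec v, ← Units.val_one, ← inv_mul_cancel g, Units.val_mul,
    ← Matrix.mulVec_mulVec, h, Matrix.mulVec_zero]

theorem vecMul_ne_zero (g : GL (Fin 3) K) {v : Fin 3 → K} (hv : v ≠ 0) : v ᵥ* g.1 ≠ 0 := by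
  intro h
  apply hv
  rw [← Matrix.vecMul_one v, ← Units.val_one, ← mul_inv_cancel g, Units.val_mul,
    ← Matrix.vecMul_vecMul, h, Matrix.zero_vecMul]

theorem vecMul_dot_mulVec (g : GL (Fin 3) K) (v φ : Fin 3 → K) :
    (φ ᵥ* g⁻¹.1) ⬝ᵥ (g.1 *ᵥ v) = φ ⬝ᵥ v := by
  rw [Matrix.dotProduct_mulVec, Matrix.vecMul_vecMul, ← Units.val_mul, inv_mul_cancel,
    Units.val_one, Matrix.vecMul_one]

theorem MapsToFlag.conj {α : MulAut (PSLe p f K 1)} {x x' : K → SLe p f K 1} {v φ : Fin 3 → K}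
    (h : MapsToFlag α x v φ) (w : SLe p f K 1) (hw : ∀ s, ∃ s', x' s = w * x s' * w⁻¹) :
    ∃ v' φ', MapsToFlag α x' v' φ' := by
  obtain ⟨hv, hφ, h0, h⟩ := h
  obtain ⟨w', hw'⟩ := QuotientGroup.mk_surjective (α (w : PSLe p f K 1))
  refine ⟨w'.1.1 *ᵥ v, φ ᵥ* w'.1⁻¹.1, mulVec_ne_zero _ hv, vecMul_ne_zero _ hφ,
    (vecMul_dot_mulVec _ _ _).trans h0, fun s => ?_⟩
  obtain ⟨s', hs⟩ := hw s
  obtain ⟨r, y, hy, hyr⟩ := h s'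
  refine ⟨r, w' * y * w'⁻¹, ?_, conj_one_add_smul_vecMulVec _ _ _ _ _ hyr⟩
  rw [hs, QuotientGroup.mk_mul, QuotientGroup.mk_mul, QuotientGroup.mk_inv, map_mul, map_mul, map_inv,
    hy, ← hw']
  rfl

theorem trace_one_add_smul_vecMulVec {g : GL (Fin 3) K} {r : K} {v φ : Fin 3 → K} (h0 : φ ⬝ᵥ v = 0)
    (hg : g.1 = 1 + r • Matrix.vecMulVec v φ) : g.1.trace = 3 := by
  rw [hg, Matrix.trace_add, Matrix.trace_smul, Matrix.trace_vecMulVec, dotProduct_comm, h0, smul_zero,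
    Matrix.trace_one]
  simp

/-- Commutation in the quotient lifts: the conjugate of `h` by `g` has the same image and the same
trace 3 as `h`. -/
theorem commute_of_mk {ε : ℤˣ} {z : Kˣ} (hz : z ∈ scalars p f K ε) (hz1 : z ≠ 1) (hz3 : z ^ 3 = 1)
    {g h : SLe p f K ε} (hh : h.1.1.trace = 3)
    (hgh : (g : PSLe p f K ε) * h = h * g) : g * h = h * g := by
  have h1 : g * h * g⁻¹ = h := by
    refine eq_of_mk_eq hz hz1 hz3 ?_ hh ?_
    · rw [Subgroup.coe_mul, Subgroup.coe_mul, Subgroup.coe_inv, trace_conj, hh]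
    · rw [QuotientGroup.mk_mul, QuotientGroup.mk_mul, QuotientGroup.mk_inv, hgh, mul_inv_cancel_right]
  exact mul_inv_eq_iff_eq_mul.mp h1

/-- The root subgroup in position `(0, 2)` is the centre of the unitriangular Sylow `p`-subgroup. By
Sylow's theorem its image is the centre of a conjugate, which consists of transvections with fixed
centre and axis. -/
theorem exists_mapsToFlag_zero_two [Finite K] [Fact p.Prime] [CharP K p] {z : Kˣ}
    (hz : z ∈ scalars p f K 1) (hz1 : z ≠ 1) (hz3 : z ^ 3 = 1) (α : MulAut (PSLe p f K 1)) :
    ∃ v φ, MapsToFlag α (fun s => elem p f (i := 0) (j := 2) (by decide) s) v φ := by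
  have hmem : ∀ a b c : K, upperGL a b c ∈ SLe p f K 1 := by
    intro a b c
    rw [mem_SLe_one, coe_upperGL, Matrix.det_fin_three]
    simp
  let u : K → K → K → SLe p f K 1 := fun a b c => ⟨upperGL a b c, hmem a b c⟩
  have hu : ∀ a b c, (u a b c).1 = 1 * upperGL a b c * 1⁻¹ := by
    intro a b c
    simp [u]
  have huU : ∀ a b c, u a b c ∈ unip p f 1 (1 : GL (Fin 3) K) := fun a b c => ⟨a, b, c, hu a b c⟩
  have hUu : ∀ g ∈ unip p f 1 (1 : GL (Fin 3) K), ∃ a b c, g = u a b c := by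
    rintro g ⟨a, b, c, hg⟩
    exact ⟨a, b, c, Subtype.ext (hg.trans (hu a b c).symm)⟩
  obtain ⟨P, hP⟩ := exists_sylow_unip hz hz1 hz3 (1 : GL (Fin 3) K) one_ne_zero one_ne_zero (hu 1 0 1)
  obtain ⟨g', hg'⟩ := exists_map_eq_conj P α
  obtain ⟨g, rfl⟩ := QuotientGroup.mk_surjective g'
  rw [hP, Subgroup.map_map, Subgroup.map_map] at hg'
  refine ⟨g.1.1 *ᵥ Pi.single 0 1, Pi.single 2 1 ᵥ* g.1⁻¹.1, mulVec_ne_zero _ (by simp),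
    vecMul_ne_zero _ (by simp), (vecMul_dot_mulVec _ _ _).trans (by simp), fun s => ?_⟩
  have hes : elem p f (i := 0) (j := 2) (by decide) s = u 0 s 0 := by
    apply SLe_ext
    rw [coe_elem]
    change _ = !![1, 0, s; 0, 1, 0; 0, 0, 1]
    ext i j
    fin_cases i <;> fin_cases j <;> simp
  have hin : α (u 0 s 0 : PSLe p f K 1) ∈ (unip p f 1 (1 : GL (Fin 3) K)).map
      ((MulAut.conj (g : PSLe p f K 1) : PSLe p f K 1 →* _).comp (QuotientGroup.mk' _)) := by
    rw [← hg']
    exact ⟨_, huU 0 s 0, rfl⟩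
  obtain ⟨u', hu', hαu⟩ := hin
  obtain ⟨a, b, c, rfl⟩ := hUu u' hu'
  have hcomm : ∀ a' b' c', u a b c * u a' b' c' = u a' b' c' * u a b c := by
    intro a' b' c'
    apply commute_of_mk hz hz1 hz3 (trace_of_mem_unip (huU _ _ _))
    have h1 : (MulAut.conj (g : PSLe p f K 1)) (u a' b' c' : PSLe p f K 1) ∈
        (unip p f 1 (1 : GL (Fin 3) K)).map ((α : PSLe p f K 1 →* _).comp (QuotientGroup.mk' _)) := by
      rw [hg']
      exact ⟨_, huU _ _ _, rfl⟩
    obtain ⟨w, hw, hαw⟩ := h1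
    obtain ⟨a₁, b₁, c₁, rfl⟩ := hUu w hw
    have h2 : u 0 s 0 * u a₁ b₁ c₁ = u a₁ b₁ c₁ * u 0 s 0 := by
      apply Subtype.ext
      change upperGL _ _ _ * upperGL _ _ _ = upperGL _ _ _ * upperGL _ _ _
      rw [upperGL_mul, upperGL_mul]
      congr 1 <;> ring
    have h3 := congrArg (fun x : SLe p f K 1 => α (x : PSLe p f K 1)) h2
    simp only [QuotientGroup.mk_mul, map_mul] at h3
    change α (u a₁ b₁ c₁ : PSLe p f K 1) = _ at hαw
    change MulAut.conj (g : PSLe p f K 1) (u a b c : PSLe p f K 1) = _ at hαu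
    rw [hαw, ← hαu, ← map_mul, ← map_mul] at h3
    exact (MulAut.conj (g : PSLe p f K 1)).injective h3
  have hc : c = 0 := by
    have h1 := congrArg Subtype.val (hcomm 1 0 0)
    change upperGL _ _ _ * upperGL _ _ _ = upperGL _ _ _ * upperGL _ _ _ at h1
    rw [upperGL_mul, upperGL_mul] at h1
    simpa using (upperGL_injective h1).2.1
  have ha : a = 0 := by
    have h1 := congrArg Subtype.val (hcomm 0 0 1)
    change upperGL _ _ _ * upperGL _ _ _ = upperGL _ _ _ * upperGL _ _ _ at h1
    rw [upperGL_mul, upperGL_mul] at h1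
    simpa using (upperGL_injective h1).2.1
  subst hc ha
  refine ⟨b, g * u 0 b 0 * g⁻¹, ?_, ?_⟩
  · simp only [hes, ← hαu]
    rfl
  · refine conj_one_add_smul_vecMulVec _ _ _ _ _ ?_
    rw [← Matrix.single_eq_single_vecMulVec_single]
    change !![1, 0, b; 0, 1, 0; 0, 0, 1] = _
    ext i j
    fin_cases i <;> fin_cases j <;> simp

theorem exists_mapsToFlag [Finite K] [Fact p.Prime] [CharP K p] {z : Kˣ}
    (hz : z ∈ scalars p f K 1) (hz1 : z ≠ 1) (hz3 : z ^ 3 = 1) (α : MulAut (PSLe p f K 1))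
    {i j : Fin 3} (hij : i ≠ j) : ∃ v φ, MapsToFlag α (fun s => elem p f hij s) v φ := by
  obtain ⟨v, φ, h⟩ := exists_mapsToFlag_zero_two hz hz1 hz3 α
  obtain ⟨w, hw⟩ := exists_conj_elem_eq (p := p) (f := f) (K := K) hij
  exact h.conj w hw

theorem MapsToFlag.exists_one {α : MulAut (PSLe p f K 1)} {z : Kˣ}
    (hz : z ∈ scalars p f K 1) (hz1 : z ≠ 1) (hz3 : z ^ 3 = 1) {i j : Fin 3} {hij : i ≠ j}
    {v φ : Fin 3 → K} (h : MapsToFlag α (fun s => elem p f hij s) v φ) {s : K} (hs : s ≠ 0) :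
    ∃ (r : K) (y : SLe p f K 1), r ≠ 0 ∧ y.1.1.trace = 3 ∧
      α (elem p f hij s : PSLe p f K 1) = y ∧ y.1.1 = 1 + r • Matrix.vecMulVec v φ := by
  obtain ⟨hv, hφ, h0, h⟩ := h
  obtain ⟨r, y, hy, hyr⟩ := h s
  refine ⟨r, y, ?_, trace_one_add_smul_vecMulVec h0 hyr, hy, hyr⟩
  rintro rfl
  have h1 : y = 1 := SLe_ext (by rw [hyr, zero_smul, add_zero]; rfl)
  rw [h1, QuotientGroup.mk_one, map_eq_one_iff α α.injective, ← QuotientGroup.mk_one] at hy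
  have h2 := eq_of_mk_eq hz hz1 hz3 (trace_elem hij s) (by
    rw [Subgroup.coe_one, Units.val_one, Matrix.trace_one]; simp) hy
  rw [← elem_zero hij] at h2
  exact hs (elem_injective hij h2)

/-- Two nontrivial transvections commute exactly when each centre lies on the other axis. -/
theorem dot_eq_zero_of_comm {g h : GL (Fin 3) K} {r s : K} {v φ w ψ : Fin 3 → K} (hr : r ≠ 0)
    (hs : s ≠ 0) (hv : v ≠ 0) (hφ : φ ≠ 0) (hw : w ≠ 0) (hψ : ψ ≠ 0) (h0 : φ ⬝ᵥ v = 0)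
    (hg : g.1 = 1 + r • Matrix.vecMulVec v φ) (hh : h.1 = 1 + s • Matrix.vecMulVec w ψ) :
    g * h = h * g ↔ φ ⬝ᵥ w = 0 ∧ ψ ⬝ᵥ v = 0 := by
  have key : g * h = h * g ↔ (φ ⬝ᵥ w) • Matrix.vecMulVec v ψ = (ψ ⬝ᵥ v) • Matrix.vecMulVec w φ := by
    rw [Units.ext_iff, Units.val_mul, Units.val_mul, hg, hh]
    have h1 : (1 + r • Matrix.vecMulVec v φ) * (1 + s • Matrix.vecMulVec w ψ) =
        1 + r • Matrix.vecMulVec v φ + s • Matrix.vecMulVec w ψ +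
          (r * s) • ((φ ⬝ᵥ w) • Matrix.vecMulVec v ψ) := by
      rw [add_mul, mul_add, mul_one, one_mul, Matrix.smul_mul, mul_add, mul_one, Matrix.mul_smul,
        Matrix.vecMulVec_mul_vecMulVec, Matrix.vecMulVec_smul, smul_add, smul_smul r s]
      abel
    have h2 : (1 + s • Matrix.vecMulVec w ψ) * (1 + r • Matrix.vecMulVec v φ) =
        1 + r • Matrix.vecMulVec v φ + s • Matrix.vecMulVec w ψ +
          (r * s) • ((ψ ⬝ᵥ v) • Matrix.vecMulVec w φ) := by
      rw [add_mul, mul_add, mul_one, one_mul, Matrix.smul_mul, mul_add, mul_one, Matrix.mul_smul,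
        Matrix.vecMulVec_mul_vecMulVec, Matrix.vecMulVec_smul, smul_add, smul_smul s r, mul_comm s r]
      abel
    rw [h1, h2, add_right_inj, smul_right_inj (mul_ne_zero hr hs)]
  rw [key]
  constructor
  · intro h
    have h1 := congrArg (fun M => φ ᵥ* M) h
    simp only [Matrix.vecMul_smul, Matrix.vecMul_vecMulVec, h0, zero_smul, smul_zero] at h1
    rw [smul_smul, eq_comm, smul_eq_zero, or_iff_left hφ, mul_eq_zero] at h1
    have hvψ : Matrix.vecMulVec v ψ ≠ 0 := by
      rw [Ne, Matrix.vecMulVec_eq_zero]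
      exact not_or.mpr ⟨hv, hψ⟩
    have h2 : ψ ⬝ᵥ v = 0 → φ ⬝ᵥ w = 0 := by
      intro h2
      rw [h2, zero_smul, smul_eq_zero] at h
      exact h.resolve_right hvψ
    rcases h1 with h1 | h1
    · exact ⟨h2 h1, h1⟩
    · refine ⟨h1, ?_⟩
      rw [h1, zero_smul, eq_comm, smul_eq_zero] at h
      refine h.resolve_right fun h3 => ?_
      rw [Matrix.vecMulVec_eq_zero] at h3
      exact h3.elim hw hφ
  · rintro ⟨h1, h2⟩
    rw [h1, h2, zero_smul, zero_smul]

/-- Commutation of root elements of value 1 is preserved by `α`, and it translates into incidence of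
the image flags. -/
theorem exists_flagHexagon [Finite K] [Fact p.Prime] [CharP K p] {z : Kˣ}
    (hz : z ∈ scalars p f K 1) (hz1 : z ≠ 1) (hz3 : z ^ 3 = 1) (α : MulAut (PSLe p f K 1)) :
    ∃ v φ, FlagHexagon v φ ∧ ∀ (i j : Fin 3) (hij : i ≠ j),
      MapsToFlag α (fun s => elem p f hij s) (v i j) (φ i j) := by
  have h : ∀ i j : Fin 3, ∃ v φ, ∀ hij : i ≠ j, MapsToFlag α (fun s => elem p f hij s) v φ := by
    intro i j
    by_cases hij : i = j
    · exact ⟨0, 0, fun h => absurd hij h⟩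
    · obtain ⟨v, φ, h⟩ := exists_mapsToFlag hz hz1 hz3 α hij
      exact ⟨v, φ, fun _ => h⟩
  choose v φ h using h
  have hcomm : ∀ {i j k l : Fin 3} (hij : i ≠ j) (hkl : k ≠ l),
      elem p f hij (1 : K) * elem p f hkl 1 = elem p f hkl 1 * elem p f hij 1 ↔
        φ i j ⬝ᵥ v k l = 0 ∧ φ k l ⬝ᵥ v i j = 0 := by
    intro i j k l hij hkl
    obtain ⟨r, y, hr, hyt, hy, hyr⟩ := (h i j hij).exists_one hz hz1 hz3 one_ne_zero
    obtain ⟨s, x, hs, hxt, hx, hxs⟩ := (h k l hkl).exists_one hz hz1 hz3 one_ne_zero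
    rw [← dot_eq_zero_of_comm hr hs (h i j hij).1 (h i j hij).2.1 (h k l hkl).1 (h k l hkl).2.1
      (h i j hij).2.2.1 hyr hxs]
    constructor
    · intro hc
      have h1 : y * x = x * y := by
        apply commute_of_mk hz hz1 hz3 hxt
        rw [← hy, ← hx, ← map_mul, ← map_mul, ← QuotientGroup.mk_mul, ← QuotientGroup.mk_mul, hc]
      exact congrArg Subtype.val h1
    · intro hc
      apply commute_of_mk hz hz1 hz3 (trace_elem hkl 1)
      apply α.injective
      rw [map_mul, map_mul, hy, hx, ← QuotientGroup.mk_mul, ← QuotientGroup.mk_mul,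
        show y * x = x * y from Subtype.ext hc]
  refine ⟨v, φ, ⟨fun i j hij => (h i j hij).1, fun i j hij => (h i j hij).2.1,
    fun i j hij => (h i j hij).2.2.1, ?_, ?_⟩, h⟩
  · intro i j k l hij hkl hjk hil
    exact ((hcomm hij hkl).mp (elem_comm hij hkl hjk hil 1 1)).1
  · intro i j k hij hjk hik hc
    exact elem_not_comm hij hjk hik ((hcomm hij hjk).mpr hc)

end RootImages

end SL3Sylow

namespace SL3Sylow

/-! ### Recovering a field automorphism from the commutator relations. -/

section LinearCase

variable {p f : ℕ} {K : Type*} [Field K] [ExpChar K p]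

theorem coe_mono_zero_diagonal (a : Fin 3 → Kˣ) :
    (mono a 0).1 = Matrix.diagonal fun i => (a i : K) := by
  ext i j
  rw [mono_apply, add_zero, Matrix.diagonal_apply]
  simp only [eq_comm]

/-- An automorphism preserving all the root subgroups is semilinear. -/
theorem mem_semilinearAut_of_preserves [Finite K] {z : Kˣ}
    (hz : z ∈ scalars p f K 1) (hz1 : z ≠ 1) (hz3 : z ^ 3 = 1) (β : MulAut (PSLe p f K 1))
    (hβ : ∀ (i j : Fin 3) (hij : i ≠ j) (s : K), ∃ r : K,
      β (elem p f hij s : PSLe p f K 1) = (elem p f hij r : PSLe p f K 1)) :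
    β ∈ semilinearAut p f K 1 := by
  have h : ∀ (i j : Fin 3) (s : K), ∃ r : K, ∀ hij : i ≠ j,
      β (elem p f hij s : PSLe p f K 1) = (elem p f hij r : PSLe p f K 1) := by
    intro i j s
    by_cases hij : i = j
    · exact ⟨0, fun h => absurd hij h⟩
    · obtain ⟨r, hr⟩ := hβ i j hij s
      exact ⟨r, fun _ => hr⟩
  choose F hF using h
  have hinj : ∀ {i j : Fin 3} (hij : i ≠ j) {s t : K},
      (elem p f hij s : PSLe p f K 1) = (elem p f hij t : PSLe p f K 1) → s = t := by
    intro i j hij s t hst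
    exact elem_injective hij (eq_of_mk_eq hz hz1 hz3 (trace_elem hij s) (trace_elem hij t) hst)
  have hadd : ∀ {i j : Fin 3} (_ : i ≠ j) (s t : K), F i j (s + t) = F i j s + F i j t := by
    intro i j hij s t
    apply hinj hij
    rw [← hF i j (s + t) hij, ← elem_mul, ← elem_mul, QuotientGroup.mk_mul, QuotientGroup.mk_mul,
      map_mul, hF i j s hij, hF i j t hij]
  have hFinj : ∀ {i j : Fin 3} (_ : i ≠ j) (s t : K), F i j s = F i j t → s = t := by
    intro i j hij s t hst
    apply hinj hij
    apply β.injective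
    rw [hF i j s hij, hF i j t hij, hst]
  have hzero : ∀ {i j : Fin 3} (_ : i ≠ j), F i j 0 = 0 := by
    intro i j hij
    have := hadd hij 0 0
    rwa [add_zero, left_eq_add] at this
  have hmul : ∀ {i j k : Fin 3} (_ : i ≠ j) (_ : j ≠ k) (_ : i ≠ k) (s t : K),
      F i k (s * t) = F i j s * F j k t := by
    intro i j k hij hjk hik s t
    apply hinj hik
    have h1 := congrArg (fun g : SLe p f K 1 => β (g : PSLe p f K 1))
      (elem_commutator (p := p) (f := f) hij hjk hik s t)
    have h2 := congrArg (fun g : SLe p f K 1 => (g : PSLe p f K 1))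
      (elem_commutator (p := p) (f := f) hij hjk hik (F i j s) (F j k t))
    simp only [QuotientGroup.mk_mul, map_mul, hF i j _ hij, hF j k _ hjk, hF i k _ hik] at h1 h2
    rw [h1] at h2
    exact mul_right_cancel h2
  have d01 : (0 : Fin 3) ≠ 1 := by decide
  have d02 : (0 : Fin 3) ≠ 2 := by decide
  have d12 : (1 : Fin 3) ≠ 2 := by decide
  have hc : ∀ {i j : Fin 3} (_ : i ≠ j), F i j 1 ≠ 0 := by
    intro i j hij h0
    exact one_ne_zero (hFinj hij 1 0 (h0.trans (hzero hij).symm))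
  have c01 := hc d01
  have c02 := hc d02
  have c12 := hc d12
  -- The relations `F i k (s * t) = F i j s * F j k t` make the additive map `F 0 1` multiplicative
  -- after division by its value at 1.
  let σ₀ : K →+* K :=
    { toFun := fun s => F 0 1 s / F 0 1 1
      map_one' := div_self c01
      map_zero' := by rw [hzero d01, zero_div]
      map_add' := fun s t => by rw [hadd d01, add_div]
      map_mul' := fun s t => by
        have e1 := hmul d01 d12 d02 s t
        have e2 := hmul d01 d12 d02 1 t
        have e3 := hmul d01 d12 d02 (s * t) 1
        have e4 := hmul d01 d12 d02 t 1
        have e5 := hc d12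
        rw [mul_one] at e3 e4
        rw [one_mul] at e2
        field_simp
        apply mul_right_cancel₀ e5
        linear_combination (F 0 1 1) * (e1 - e3) + (F 0 1 s) * (e4 - e2) }
  let σ : K ≃+* K := RingEquiv.ofBijective σ₀
    ⟨σ₀.injective, Finite.surjective_of_injective σ₀.injective⟩
  have hσ : ∀ s, F 0 1 s = F 0 1 1 * σ s := by
    intro s
    change _ = _ * (F 0 1 s / F 0 1 1)
    rw [mul_div_cancel₀ _ c01]
  -- The diagonal entries absorb the constants `F 0 2 1` and `F 1 2 1`; the remaining constants are
  -- determined by the commutator relations.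
  let d : GLe p f K 1 := ⟨mono ![Units.mk0 _ c02, Units.mk0 _ c12, 1] 0, mem_GLe.mpr (Or.inl rfl)⟩
  have htw : ∀ {i j : Fin 3} (hij : i ≠ j) (s : K), twist d σ (elem p f hij s) =
      elem p f hij ((![F 0 2 1, F 1 2 1, 1] i) * σ s * (![F 0 2 1, F 1 2 1, 1] j)⁻¹) := by
    intro i j hij s
    apply SLe_ext
    rw [coe_twist, Units.val_mul, Units.val_mul, coe_elem]
    have h1 : (Matrix.GeneralLinearGroup.map (σ : K →+* K) (elem p f hij s).1).1 =
        1 + Matrix.single i j (σ s) := by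
      ext r t
      rw [Matrix.GeneralLinearGroup.map_apply, coe_elem, Matrix.add_apply, Matrix.add_apply, map_add]
      simp only [Matrix.one_apply, Matrix.single_apply]
      split_ifs <;> simp
    rw [h1, mul_add, add_mul, mul_one, ← Units.val_mul, mul_inv_cancel, Units.val_one, add_right_inj]
    change (mono _ 0).1 * _ * ((mono _ 0)⁻¹).1 = _
    rw [mono_inv, neg_zero, coe_mono_zero_diagonal, coe_mono_zero_diagonal]
    ext r t
    rw [Matrix.mul_diagonal, Matrix.diagonal_mul, Matrix.single_apply, Matrix.single_apply]
    split_ifs with hrt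
    · obtain ⟨rfl, rfl⟩ := hrt
      congr 1
      · congr 1
        fin_cases i <;> rfl
      · rw [sub_zero, Units.val_inv_eq_inv_val]
        congr 1
        fin_cases j <;> rfl
    · rw [mul_zero, zero_mul]
  refine ⟨d, σ, eq_of_eq_elem fun i j hij s => ?_⟩
  rw [twistAut_mk, htw hij, hF i j s hij]
  congr 2
  have e02 : F 0 2 s = F 0 2 1 * σ s := by
    have e1 := hmul d01 d12 d02 s 1
    have e2 := hmul d01 d12 d02 1 1
    rw [mul_one] at e1 e2
    rw [e1, e2, hσ]
    ring
  have e12 : F 1 2 s = F 1 2 1 * σ s := by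
    have e1 := hmul d01 d12 d02 1 s
    have e2 := hmul d01 d12 d02 1 1
    rw [one_mul] at e1 e2
    rw [e02, e2] at e1
    apply mul_left_cancel₀ c01
    rw [← e1]
    ring
  have k1 := hmul d01 d12 d02 1 1
  rw [mul_one] at k1
  fin_cases i <;> fin_cases j
  · exact absurd rfl hij
  · change F 0 1 s = F 0 2 1 * σ s * (F 1 2 1)⁻¹
    rw [hσ, k1]
    field_simp
  · change F 0 2 s = F 0 2 1 * σ s * 1⁻¹
    rw [e02, inv_one, mul_one]
  · change F 1 0 s = F 1 2 1 * σ s * (F 0 2 1)⁻¹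
    have e1 := hmul d01.symm d02 d12 s 1
    rw [mul_one, e12] at e1
    rw [e1, mul_inv_cancel_right₀ c02]
  · exact absurd rfl hij
  · change F 1 2 s = F 1 2 1 * σ s * 1⁻¹
    rw [e12, inv_one, mul_one]
  · change F 2 0 s = 1 * σ s * (F 0 2 1)⁻¹
    have e1 := hmul d12 d02.symm d01.symm 1 s
    have e2 := hmul d01.symm d02 d12 s 1
    rw [one_mul] at e1
    rw [mul_one, e12, e1] at e2
    rw [eq_mul_inv_iff_mul_eq₀ c02]
    apply mul_left_cancel₀ c12
    linear_combination -e2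
  · change F 2 1 s = 1 * σ s * (F 1 2 1)⁻¹
    have e1 := hmul d02 d12.symm d01 1 s
    rw [one_mul, hσ] at e1
    rw [eq_mul_inv_iff_mul_eq₀ c12]
    apply mul_left_cancel₀ (mul_ne_zero c01 c12)
    rw [k1] at e1
    linear_combination -(F 1 2 1) * e1
  · exact absurd rfl hij

/-- An automorphism mapping the transvections with a common centre to transvections with a common
centre is semilinear. -/
theorem mem_semilinearAut_of_par [Finite K] {z : Kˣ}
    (hz : z ∈ scalars p f K 1) (hz1 : z ≠ 1) (hz3 : z ^ 3 = 1) (α : MulAut (PSLe p f K 1))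
    {v φ : Fin 3 → Fin 3 → Fin 3 → K} (hvφ : FlagHexagon v φ) (h : ∀ (i j : Fin 3) (hij : i ≠ j),
      MapsToFlag α (fun s => elem p f hij s) (v i j) (φ i j)) (hp : Par (v 0 1) (v 0 2)) :
    α ∈ semilinearAut p f K 1 := by
  obtain ⟨g, hg⟩ := hvφ.exists_basis hp
  let d : GLe p f K 1 := ⟨g, mem_GLe.mpr (Or.inl rfl)⟩
  have hd : twistAut d 1 ∈ semilinearAut p f K 1 := ⟨d, 1, rfl⟩
  rw [← mul_inv_cancel_left (twistAut d 1) α]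
  refine mul_mem hd (mem_semilinearAut_of_preserves hz hz1 hz3 _ fun i j hij s => ?_)
  obtain ⟨r, y, hy, hyr⟩ := (h i j hij).2.2.2 s
  obtain ⟨c, hc⟩ := hg i j hij
  refine ⟨r * c, ?_⟩
  rw [MulAut.mul_apply, hy]
  change (twistAut d 1).symm _ = _
  rw [MulEquiv.symm_apply_eq, twistAut_mk]
  congr 1
  apply SLe_ext
  rw [coe_twist, map_one_GL, Units.val_mul, Units.val_mul, coe_elem, hyr, hc, mul_add, add_mul,
    mul_one]
  change _ = g.1 * g⁻¹.1 + g.1 * _ * g⁻¹.1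
  rw [← Units.val_mul, mul_inv_cancel, Units.val_one, smul_smul, ← Matrix.smul_mul, ← Matrix.mul_smul]
  simp

end LinearCase

end SL3Sylow

namespace SL3Sylow

/-! ### Duality, the graph automorphism, and semilinearity for `PSL₃(q)`. -/

section Hexagon

variable {K : Type*} [Field K] {v φ : Fin 3 → Fin 3 → Fin 3 → K}

theorem FlagHexagon.dual (h : FlagHexagon v φ) : FlagHexagon φ v where
  point_ne := h.line_ne
  line_ne := h.point_ne
  flag i j hij := by rw [dotProduct_comm, h.flag i j hij]
  adj i j k l hij hkl hjk hil := by rw [dotProduct_comm, h.adj k l i j hkl hij hil.symm hjk.symm]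
  far i j k hij hjk hik := by
    rw [dotProduct_comm, dotProduct_comm (v j k), and_comm]
    exact h.far i j k hij hjk hik

theorem FlagHexagon.opposite (h : FlagHexagon v φ) :
    FlagHexagon (fun i j => v j i) (fun i j => φ j i) where
  point_ne i j hij := h.point_ne _ _ hij.symm
  line_ne i j hij := h.line_ne _ _ hij.symm
  flag i j hij := h.flag _ _ hij.symm
  adj i j k l hij hkl hjk hil := h.adj _ _ _ _ hij.symm hkl.symm hil hjk
  far i j k hij hjk hik := by
    rw [and_comm]
    exact h.far k j i hjk.symm hij.symm hik.symm

end Hexagon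

section Graph

variable {p f : ℕ} {K : Type*} [Field K] [ExpChar K p]

/-- The inverse transpose of an invertible matrix, as a homomorphism. -/
def invTranspose : GL (Fin 3) K →* GL (Fin 3) K where
  toFun g := ⟨g⁻¹.1ᵀ, g.1ᵀ, by
    rw [← Matrix.transpose_mul, ← Units.val_mul, mul_inv_cancel, Units.val_one,
      Matrix.transpose_one], by
    rw [← Matrix.transpose_mul, ← Units.val_mul, inv_mul_cancel, Units.val_one,
      Matrix.transpose_one]⟩
  map_one' := by
    apply Units.ext
    change (1 : GL (Fin 3) K)⁻¹.1ᵀ = 1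
    rw [inv_one, Units.val_one, Matrix.transpose_one]
  map_mul' g h := by
    apply Units.ext
    change (g * h)⁻¹.1ᵀ = g⁻¹.1ᵀ * h⁻¹.1ᵀ
    rw [mul_inv_rev, Units.val_mul, Matrix.transpose_mul]

theorem coe_invTranspose (g : GL (Fin 3) K) : (invTranspose g).1 = g⁻¹.1ᵀ := rfl

theorem invTranspose_invTranspose (g : GL (Fin 3) K) : invTranspose (invTranspose g) = g :=
  Units.ext (Matrix.transpose_transpose _)

theorem invTranspose_map (σ : K ≃+* K) (g : GL (Fin 3) K) :
    invTranspose (Matrix.GeneralLinearGroup.map (σ : K →+* K) g) =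
      Matrix.GeneralLinearGroup.map (σ : K →+* K) (invTranspose g) := by
  apply Units.ext
  rw [coe_invTranspose, ← map_inv]
  rfl

/-- The inverse transpose map on `SL₃(q)`. -/
def graphEquiv : SLe p f K 1 ≃* SLe p f K 1 :=
  let τ : SLe p f K 1 →* SLe p f K 1 := (invTranspose.comp (SLe p f K 1).subtype).codRestrict _
    fun g => mem_SLe_one.mpr (by
      rw [MonoidHom.comp_apply, coe_invTranspose, Matrix.det_transpose]
      exact mem_SLe_one.mp (inv_mem g.2))
  have h : τ.comp τ = MonoidHom.id _ :=
    MonoidHom.ext fun g => Subtype.ext (invTranspose_invTranspose g.1)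
  MonoidHom.toMulEquiv τ τ h h

theorem coe_graphEquiv (g : SLe p f K 1) : (graphEquiv g : GL (Fin 3) K) = invTranspose g := rfl

variable (p f K) in
/-- The graph automorphism of `PSL₃(q)`. -/
def graphAut : MulAut (PSLe p f K 1) :=
  QuotientGroup.congr _ _ graphEquiv
    (Subgroup.characteristic_iff_map_eq.mp inferInstance graphEquiv)

theorem graphAut_mk (g : SLe p f K 1) :
    graphAut p f K (g : PSLe p f K 1) = (graphEquiv g : PSLe p f K 1) := rfl

theorem graphAut_mul_self : graphAut p f K * graphAut p f K = 1 := by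
  ext x
  induction x using QuotientGroup.induction_on with
  | H g =>
    rw [MulAut.mul_apply, graphAut_mk, graphAut_mk, MulAut.one_apply,
      show graphEquiv (graphEquiv g) = g from Subtype.ext (invTranspose_invTranspose g.1)]

theorem graphAut_conj_mem {β : MulAut (PSLe p f K 1)} (h : β ∈ semilinearAut p f K 1) :
    graphAut p f K * β * graphAut p f K ∈ semilinearAut p f K 1 := by
  obtain ⟨d, σ, rfl⟩ := h
  refine ⟨⟨invTranspose d, mem_GLe.mpr (Or.inl rfl)⟩, σ, ?_⟩
  ext x
  induction x using QuotientGroup.induction_on with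
  | H g =>
    rw [MulAut.mul_apply, MulAut.mul_apply, graphAut_mk, twistAut_mk, twistAut_mk, graphAut_mk]
    congr 1
    ext1
    rw [coe_graphEquiv, coe_twist, coe_twist, coe_graphEquiv, map_mul, map_mul, map_inv,
      invTranspose_map, invTranspose_invTranspose]

theorem graphAut_elem {i j : Fin 3} (hij : i ≠ j) (s : K) :
    graphAut p f K (elem p f hij s : PSLe p f K 1) = (elem p f hij.symm (-s) : PSLe p f K 1) := by
  rw [graphAut_mk]
  congr 1
  apply SLe_ext
  rw [coe_graphEquiv, coe_invTranspose, ← Subgroup.coe_inv, elem_inv, coe_elem, coe_elem,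
    Matrix.transpose_add, Matrix.transpose_one, Matrix.transpose_single]

/-- The square of an automorphism of `PSL₃(q)` is semilinear. -/
theorem sq_mem_semilinearAut [Finite K] [Fact p.Prime] [CharP K p] {z : Kˣ}
    (hz : z ∈ scalars p f K 1) (hz1 : z ≠ 1) (hz3 : z ^ 3 = 1) (α : MulAut (PSLe p f K 1)) :
    α ^ 2 ∈ semilinearAut p f K 1 := by
  obtain ⟨v, φ, h, hα⟩ := exists_flagHexagon hz hz1 hz3 α
  have d01 : (0 : Fin 3) ≠ 1 := by decide
  have d02 : (0 : Fin 3) ≠ 2 := by decide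
  have d12 : (1 : Fin 3) ≠ 2 := by decide
  rcases h.par_or d01 d02 d01.symm d02 with hp | hp
  · exact pow_mem (mem_semilinearAut_of_par hz hz1 hz3 α h hα hp) 2
  -- If the first-row flags share a line instead, the graph automorphism passes to the opposite
  -- roots, where the hexagon has a common point. Since it normalizes the semilinear group and has
  -- square 1, the square of `α` is semilinear.
  · have hp' := h.dual.par_line d12 d02.symm d01.symm
      (h.dual.par_point d01 d12 d02 (h.dual.par_line d01 d12 d02 hp))
    have hm : α * graphAut p f K ∈ semilinearAut p f K 1 := by
      refine mem_semilinearAut_of_par hz hz1 hz3 _ h.opposite (fun i j hij => ?_) hp'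
      obtain ⟨h1, h2, h3, h4⟩ := hα j i hij.symm
      refine ⟨h1, h2, h3, fun s => ?_⟩
      obtain ⟨r, y, hy, hyr⟩ := h4 (-s)
      refine ⟨r, y, ?_, hyr⟩
      rw [MulAut.mul_apply, graphAut_elem, hy]
    have h1 := mul_mem hm (graphAut_conj_mem hm)
    have h2 : α * graphAut p f K * (graphAut p f K * (α * graphAut p f K) * graphAut p f K) =
        α ^ 2 := by
      calc _ = α * (graphAut p f K * graphAut p f K) * α * (graphAut p f K * graphAut p f K) := by
            group
        _ = _ := by rw [graphAut_mul_self, mul_one, mul_one, pow_two]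
    rwa [h2] at h1

/-- An automorphism of `PSL₃(q)` whose cube is inner is semilinear. -/
theorem mem_semilinearAut_of_cube_linear [Finite K] [Fact p.Prime] [CharP K p] {z : Kˣ}
    (hz : z ∈ scalars p f K 1) (hz1 : z ≠ 1) (hz3 : z ^ 3 = 1) {α : MulAut (PSLe p f K 1)}
    (h : α ^ 3 ∈ Inn (PSLe p f K 1)) : α ∈ semilinearAut p f K 1 := by
  -- `α` is the product of its cube, which is inner, and the inverse of its square.
  have h1 := mul_mem (Inn_le_semilinearAut h)
    (inv_mem (sq_mem_semilinearAut hz hz1 hz3 α))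
  rwa [pow_succ', mul_inv_cancel_right] at h1

end Graph

end SL3Sylow

namespace SL3Sylow

/-! ### Hermitian bases and the Bruhat decomposition of the unitary group. -/

section HermitianBasis

variable {p f : ℕ} {K : Type*} [Field K] [ExpChar K p]

variable (p f) in
/-- The `q`-power map, `q = p ^ f`. -/
abbrev bar : K →+* K := iterateFrobenius K p f

variable (K) in
/-- The antidiagonal permutation matrix. -/
def flipGL : GL (Fin 3) K where
  val := !![0, 0, 1; 0, 1, 0; 1, 0, 0]
  inv := !![0, 0, 1; 0, 1, 0; 1, 0, 0]
  val_inv := by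
    ext i j
    fin_cases i <;> fin_cases j <;> simp
  inv_val := by
    ext i j
    fin_cases i <;> fin_cases j <;> simp

theorem coe_flipGL : (flipGL K).1 = !![0, 0, 1; 0, 1, 0; 1, 0, 0] := rfl

theorem flipGL_mul_self : flipGL K * flipGL K = 1 := Units.ext (flipGL K).val_inv

theorem bar_flipGL : ((flipGL K).1.map (bar p f))ᵀ = (flipGL K).1 := by
  ext i j
  fin_cases i <;> fin_cases j <;> simp [coe_flipGL]

variable (p f) in
/-- The columns of `M` form a basis of isotropic, unit and isotropic vectors, as in the standard
form of a hermitian plane plus a line. -/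
def IsHermBasis (M : GL (Fin 3) K) : Prop := (M.1.map (bar p f))ᵀ * M.1 = (flipGL K).1

variable (p f) in
/-- `X` preserves the antidiagonal hermitian form. -/
def PreservesForm (X : GL (Fin 3) K) : Prop :=
  (X.1.map (bar p f))ᵀ * (flipGL K).1 * X.1 = (flipGL K).1

theorem IsHermBasis.mul {M : GL (Fin 3) K} (hM : IsHermBasis p f M) {X : GL (Fin 3) K}
    (hX : PreservesForm p f X) : IsHermBasis p f (M * X) := by
  unfold IsHermBasis
  rw [Units.val_mul, Matrix.map_mul, Matrix.transpose_mul, Matrix.mul_assoc, ← Matrix.mul_assoc _ M.1,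
    hM, ← Matrix.mul_assoc, hX]

theorem preservesForm_flipGL : PreservesForm p f (flipGL K) := by
  unfold PreservesForm
  rw [bar_flipGL, ← Units.val_mul, flipGL_mul_self, Units.val_one, one_mul]

theorem PreservesForm.mul {X Y : GL (Fin 3) K} (hX : PreservesForm p f X) (hY : PreservesForm p f Y) :
    PreservesForm p f (X * Y) := by
  unfold PreservesForm at *
  rw [Units.val_mul, Matrix.map_mul, Matrix.transpose_mul, Matrix.mul_assoc, Matrix.mul_assoc,
    ← Matrix.mul_assoc (flipGL K).1, ← Matrix.mul_assoc _ _ Y.1, ← Matrix.mul_assoc _ _ X.1, hX,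
    ← Matrix.mul_assoc, hY]

theorem PreservesForm.inv {X : GL (Fin 3) K} (hX : PreservesForm p f X) :
    PreservesForm p f X⁻¹ := by
  unfold PreservesForm at *
  have h : (X⁻¹.1.map (bar p f))ᵀ * (X.1.map (bar p f))ᵀ = 1 := by
    rw [← Matrix.transpose_mul, ← Matrix.map_mul, ← Units.val_mul, mul_inv_cancel, Units.val_one,
      Matrix.map_one _ (map_zero _) (map_one _), Matrix.transpose_one]
  calc _ = (X⁻¹.1.map (bar p f))ᵀ * ((X.1.map (bar p f))ᵀ * (flipGL K).1 * X.1) * X⁻¹.1 := by rw [hX]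
    _ = ((X⁻¹.1.map (bar p f))ᵀ * (X.1.map (bar p f))ᵀ) * (flipGL K).1 * (X.1 * X⁻¹.1) := by
        simp only [Matrix.mul_assoc]
    _ = _ := by rw [h, ← Units.val_mul, mul_inv_cancel, Units.val_one, one_mul, mul_one]

/-- Change of basis between the standard and the antidiagonal form; in the latter, stabilizers of
isotropic lines are upper triangular. -/
theorem IsHermBasis.conj_mem_GLe {M : GL (Fin 3) K} (hM : IsHermBasis p f M) {X : GL (Fin 3) K} :
    M * X * M⁻¹ ∈ GLe p f K (-1) ↔ PreservesForm p f X := by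
  rw [mem_GLe, or_iff_right (by decide)]
  unfold PreservesForm
  have h : (M⁻¹.1.map (bar p f))ᵀ * (M.1.map (bar p f))ᵀ = 1 := by
    rw [← Matrix.transpose_mul, ← Matrix.map_mul, ← Units.val_mul, mul_inv_cancel, Units.val_one,
      Matrix.map_one _ (map_zero _) (map_one _), Matrix.transpose_one]
  have h' : M⁻¹.1 * M.1 = 1 := by rw [← Units.val_mul, inv_mul_cancel, Units.val_one]
  have e : ((M * X * M⁻¹).1.map (bar p f))ᵀ * (M * X * M⁻¹).1 =
      (M⁻¹.1.map (bar p f))ᵀ * ((X.1.map (bar p f))ᵀ * (flipGL K).1 * X.1) * M⁻¹.1 := by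
    rw [← show _ = _ from hM]
    simp only [Units.val_mul, Matrix.map_mul, Matrix.transpose_mul, Matrix.mul_assoc]
  have e1 : (M⁻¹.1.map (bar p f))ᵀ * (flipGL K).1 * M⁻¹.1 = 1 := by
    rw [← show _ = _ from hM, ← Matrix.mul_assoc, h, one_mul, ← Units.val_mul, mul_inv_cancel,
      Units.val_one]
  rw [e]
  constructor
  · intro h1
    rw [← e1] at h1
    have h2 := congrArg (fun N => (M.1.map (bar p f))ᵀ * N * M.1) h1
    have h3 := mul_eq_one_comm.mp h
    simp only [Matrix.mul_assoc, h'] at h2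
    simp only [← Matrix.mul_assoc, h3, one_mul, mul_one] at h2
    exact h2
  · intro h1
    rw [h1, e1]

theorem IsHermBasis.conj_mem_SLe {M : GL (Fin 3) K} (hM : IsHermBasis p f M) {X : GL (Fin 3) K} :
    M * X * M⁻¹ ∈ SLe p f K (-1) ↔ PreservesForm p f X ∧ X.1.det = 1 := by
  rw [mem_SLe, hM.conj_mem_GLe, map_mul, map_mul, mul_right_comm, ← map_mul, mul_inv_cancel, map_one,
    one_mul, Units.ext_iff, Matrix.GeneralLinearGroup.val_det_apply, Units.val_one]

theorem preservesForm_iff {X : GL (Fin 3) K} : PreservesForm p f X ↔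
    ∀ i j, bar p f (X.1 0 i) * X.1 2 j + bar p f (X.1 1 i) * X.1 1 j + bar p f (X.1 2 i) * X.1 0 j =
      (flipGL K).1 i j := by
  unfold PreservesForm
  rw [← Matrix.ext_iff]
  refine forall_congr' fun i => forall_congr' fun j => ?_
  rw [Matrix.mul_apply, Fin.sum_univ_three, Matrix.mul_apply, Matrix.mul_apply, Matrix.mul_apply,
    Fin.sum_univ_three, Fin.sum_univ_three, Fin.sum_univ_three]
  simp only [Matrix.transpose_apply, Matrix.map_apply, coe_flipGL]
  simp only [Matrix.of_apply, Matrix.cons_val, mul_zero, mul_one, zero_add, add_zero]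
  rw [show bar p f (X.1 2 i) * X.1 0 j + bar p f (X.1 1 i) * X.1 1 j + bar p f (X.1 0 i) * X.1 2 j =
    bar p f (X.1 0 i) * X.1 2 j + bar p f (X.1 1 i) * X.1 1 j + bar p f (X.1 2 i) * X.1 0 j by ring]

/-- An upper triangular matrix. -/
def IsUpper (X : GL (Fin 3) K) : Prop := X.1 1 0 = 0 ∧ X.1 2 0 = 0 ∧ X.1 2 1 = 0

theorem IsUpper.diag_ne_zero {X : GL (Fin 3) K} (h : IsUpper X) (i : Fin 3) : X.1 i i ≠ 0 := by
  have hd := Matrix.GeneralLinearGroup.det_ne_zero X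
  obtain ⟨h1, h2, h3⟩ := h
  rw [Matrix.det_fin_three, h1, h2, h3] at hd
  intro h0
  apply hd
  fin_cases i
  · rw [show X.1 0 0 = 0 from h0]; ring
  · rw [show X.1 1 1 = 0 from h0]; ring
  · rw [show X.1 2 2 = 0 from h0]; ring

theorem IsUpper.mul_upperGL {X : GL (Fin 3) K} (h : IsUpper X) (a b c : K) :
    ∃ b', X * upperGL a b c = upperGL (X.1 0 0 / X.1 1 1 * a) b' (X.1 1 1 / X.1 2 2 * c) * X := by
  have d1 := h.diag_ne_zero 1
  have d2 := h.diag_ne_zero 2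
  obtain ⟨h1, h2, h3⟩ := h
  refine ⟨(X.1 0 0 * b + X.1 0 1 * c - X.1 0 0 / X.1 1 1 * a * X.1 1 2) / X.1 2 2, ?_⟩
  apply Units.ext
  rw [Units.val_mul, Units.val_mul, coe_upperGL, coe_upperGL]
  ext i j
  rw [Matrix.mul_apply, Matrix.mul_apply, Fin.sum_univ_three, Fin.sum_univ_three]
  fin_cases i <;> fin_cases j <;> simp [h1, h2, h3]
  · field_simp
    ring
  · field_simp
    ring
  · field_simp
    ring

theorem IsUpper.upperGL_mul {X : GL (Fin 3) K} (h : IsUpper X) (a b c : K) :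
    ∃ a' b' c', upperGL a b c * X = X * upperGL a' b' c' := by
  have d0 := h.diag_ne_zero 0
  have d1 := h.diag_ne_zero 1
  obtain ⟨h1, h2, h3⟩ := h
  refine ⟨a * X.1 1 1 / X.1 0 0, (b * X.1 2 2 + a * X.1 1 2 - X.1 0 1 * (c * X.1 2 2 / X.1 1 1)) /
    X.1 0 0, c * X.1 2 2 / X.1 1 1, ?_⟩
  apply Units.ext
  rw [Units.val_mul, Units.val_mul, coe_upperGL, coe_upperGL]
  ext i j
  rw [Matrix.mul_apply, Matrix.mul_apply, Fin.sum_univ_three, Fin.sum_univ_three]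
  fin_cases i <;> fin_cases j <;> simp [h1, h2, h3]
  · field_simp
    ring
  · field_simp
    ring
  · field_simp
    ring

/-- A matrix preserving the form and fixing the first coordinate line is upper triangular. -/
theorem PreservesForm.isUpper {X : GL (Fin 3) K} (hX : PreservesForm p f X) (h : X.1 2 0 = 0) :
    IsUpper X := by
  rw [preservesForm_iff] at hX
  have h1 : X.1 1 0 = 0 := by
    have e := hX 0 0
    rw [h, map_zero, mul_zero, zero_mul, add_zero, zero_add] at e
    rcases mul_eq_zero.mp (e.trans rfl) with e | e
    · exact (map_eq_zero _).mp e
    · exact e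
  refine ⟨h1, h, ?_⟩
  have e := hX 0 1
  rw [h1, h, map_zero, zero_mul, zero_mul, add_zero, add_zero] at e
  rcases mul_eq_zero.mp (e.trans rfl) with e | e
  · have hd := Matrix.GeneralLinearGroup.det_ne_zero X
    rw [Matrix.det_fin_three, h1, h, (map_eq_zero _).mp e] at hd
    exact absurd (by ring) hd
  · exact e

theorem preservesForm_upperGL (hbar : ∀ x : K, bar p f (bar p f x) = x) {a b : K}
    (h : b + bar p f b + a * bar p f a = 0) : PreservesForm p f (upperGL a b (-bar p f a)) := by
  rw [preservesForm_iff]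
  intro i j
  fin_cases i <;> fin_cases j <;> simp [coe_upperGL, coe_flipGL, hbar]
  linear_combination h

theorem upperGL_of_preservesForm {a b c : K} (h : PreservesForm p f (upperGL a b c)) :
    c = -bar p f a ∧ b + bar p f b + a * bar p f a = 0 := by
  rw [preservesForm_iff] at h
  have h1 := h 1 2
  have h2 := h 2 1
  have h3 := h 2 2
  simp [coe_upperGL, coe_flipGL] at h1 h2 h3
  have h4 : c = -bar p f a := by linear_combination h1
  refine ⟨h4, ?_⟩
  have h5 : bar p f c = -a := by linear_combination h2
  rw [h4, map_neg] at h5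
  rw [h4, map_neg] at h3
  linear_combination h3 + bar p f a * h5

/-- The Bruhat decomposition for the unitary group. -/
theorem PreservesForm.bruhat (hbar : ∀ x : K, bar p f (bar p f x) = x) {X : GL (Fin 3) K}
    (hX : PreservesForm p f X) : IsUpper X ∨ ∃ a b Y, b + bar p f b + a * bar p f a = 0 ∧ IsUpper Y ∧
      X = upperGL a b (-bar p f a) * flipGL K * Y := by
  by_cases h2 : X.1 2 0 = 0
  · exact Or.inl (hX.isUpper h2)
  right
  have e := preservesForm_iff.mp hX 0 0
  change _ = (0 : K) at e
  have h2' : bar p f (X.1 2 0) ≠ 0 := (map_ne_zero _).mpr h2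
  -- These values make `upperGL a b (-bar p f a) * flipGL K` send the first basis vector to the line
  -- of the first column of `X`; the norm condition on `a`, `b` says that this column is isotropic.
  set a := -bar p f (X.1 1 0 / X.1 2 0) with ha
  set b := X.1 0 0 / X.1 2 0 with hb
  have hab : b + bar p f b + a * bar p f a = 0 := by
    rw [ha, map_neg, hbar, hb, map_div₀, map_div₀]
    field_simp
    linear_combination e
  have hu := preservesForm_upperGL hbar hab
  refine ⟨a, b, (upperGL a b (-bar p f a) * flipGL K)⁻¹ * X, hab, ?_, ?_⟩
  · refine ((hu.mul preservesForm_flipGL).inv.mul hX).isUpper ?_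
    have e1 : (upperGL a b (-bar p f a) * flipGL K)⁻¹ * X =
        flipGL K * (upperGL (-a) (a * (-bar p f a) - b) (- -bar p f a) * X) := by
      rw [mul_inv_rev, upperGL_inv, mul_assoc, inv_eq_of_mul_eq_one_left flipGL_mul_self]
    rw [e1, Units.val_mul, Units.val_mul, Matrix.mul_apply, Fin.sum_univ_three, Matrix.mul_apply,
      Matrix.mul_apply, Matrix.mul_apply, Fin.sum_univ_three, Fin.sum_univ_three, Fin.sum_univ_three]
    simp [coe_flipGL, coe_upperGL, ha, hb, hbar]
    field_simp
    ring
  · rw [mul_inv_cancel_left]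

end HermitianBasis

end SL3Sylow

namespace SL3Sylow

/-! ### Sylow `p`-subgroups of `PSU₃(q)` and isotropic lines. -/

section UnipotentImages

variable {p f : ℕ} {K : Type*} [Field K] [ExpChar K p] {ε : ℤˣ}

theorem IsUpper.unip_mul {T : GL (Fin 3) K} (hT : IsUpper T) (M : GL (Fin 3) K) :
    unip p f ε (M * T) = unip p f ε M := by
  ext g
  rw [mem_unip, mem_unip]
  constructor
  · rintro ⟨a, b, c, h⟩
    obtain ⟨b', h'⟩ := hT.mul_upperGL a b c
    refine ⟨T.1 0 0 / T.1 1 1 * a, b', T.1 1 1 / T.1 2 2 * c, ?_⟩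
    rw [h, mul_assoc M, h']
    group
  · rintro ⟨a, b, c, h⟩
    obtain ⟨a', b', c', h'⟩ := hT.upperGL_mul a b c
    refine ⟨a', b', c', ?_⟩
    rw [h, mul_assoc M T, ← h']
    group

variable (p f ε) in
/-- The image of `unip M` in `PSL₃^ε(q)`. -/
def unipBar (M : GL (Fin 3) K) : Subgroup (PSLe p f K ε) :=
  (unip p f ε M).map (QuotientGroup.mk' _)

theorem unipBar_smul (g : SLe p f K ε) (M : GL (Fin 3) K) :
    unipBar p f ε (g.1 * M) =
      (unipBar p f ε M).map (MulAut.conj (g : PSLe p f K ε) : PSLe p f K ε →* PSLe p f K ε) := by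
  ext x
  constructor
  · rintro ⟨u, ⟨a, b, c, hu⟩, rfl⟩
    refine ⟨(g⁻¹ * u * g : SLe p f K ε), ⟨g⁻¹ * u * g, ⟨a, b, c, ?_⟩, rfl⟩, ?_⟩
    · rw [Subgroup.coe_mul, Subgroup.coe_mul, hu, Subgroup.coe_inv]
      group
    · change (g : PSLe p f K ε) * ((g⁻¹ * u * g : SLe p f K ε) : PSLe p f K ε) *
        (g : PSLe p f K ε)⁻¹ = (u : PSLe p f K ε)
      rw [QuotientGroup.mk_mul, QuotientGroup.mk_mul, QuotientGroup.mk_inv]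
      group
  · rintro ⟨_, ⟨u, ⟨a, b, c, hu⟩, rfl⟩, rfl⟩
    refine ⟨g * u * g⁻¹, ⟨a, b, c, ?_⟩, rfl⟩
    rw [Subgroup.coe_mul, Subgroup.coe_mul, hu, Subgroup.coe_inv]
    group

theorem IsUpper.unipBar_mul {T : GL (Fin 3) K} (hT : IsUpper T) (M : GL (Fin 3) K) :
    unipBar p f ε (M * T) = unipBar p f ε M := by
  rw [unipBar, hT.unip_mul, unipBar]

/-- A regular unipotent element fixes a unique flag, so the Sylow subgroup determines the flag. -/
theorem isUpper_of_unipBar_eq {z : Kˣ} (hz : z ∈ scalars p f K ε) (hz1 : z ≠ 1) (hz3 : z ^ 3 = 1)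
    {M M' : GL (Fin 3) K} {u : SLe p f K ε} {a b c : K} (ha : a ≠ 0) (hc : c ≠ 0)
    (hu : (u : GL (Fin 3) K) = M * upperGL a b c * M⁻¹)
    (h : unipBar p f ε M = unipBar p f ε M') : IsUpper (M'⁻¹ * M) := by
  have h1 : (u : PSLe p f K ε) ∈ unipBar p f ε M' := h ▸ ⟨u, ⟨a, b, c, hu⟩, rfl⟩
  obtain ⟨u', hu', he⟩ := h1
  have := upper_of_normalizes hz hz1 hz3 ha hc hu hu' (g := 1)
    (by rw [one_mul, inv_one, mul_one]; exact he.symm)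
  rwa [Subgroup.coe_one, mul_one] at this

end UnipotentImages

section Hermitian

variable {p f : ℕ} {K : Type*} [Field K] [ExpChar K p] {M : GL (Fin 3) K}

/-- The unipotent elements of the stabilizer of an isotropic line. -/
def ux (hbar : ∀ x : K, bar p f (bar p f x) = x) (hM : IsHermBasis p f M) {a b : K}
    (h : b + bar p f b + a * bar p f a = 0) : SLe p f K (-1) :=
  ⟨M * upperGL a b (-bar p f a) * M⁻¹, hM.conj_mem_SLe.mpr ⟨preservesForm_upperGL hbar h, by
    rw [coe_upperGL, Matrix.det_fin_three]; simp⟩⟩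

variable {hbar : ∀ x : K, bar p f (bar p f x) = x}

theorem coe_ux (hM : IsHermBasis p f M) {a b : K} (h : b + bar p f b + a * bar p f a = 0) :
    (ux hbar hM h : GL (Fin 3) K) = M * upperGL a b (-bar p f a) * M⁻¹ := rfl

theorem ux_mem_unip (hM : IsHermBasis p f M) {a b : K} (h : b + bar p f b + a * bar p f a = 0) :
    ux hbar hM h ∈ unip p f (-1) M := ⟨_, _, _, rfl⟩

theorem trace_ux (hM : IsHermBasis p f M) {a b : K} (h : b + bar p f b + a * bar p f a = 0) :
    (ux hbar hM h).1.1.trace = 3 := trace_of_mem_unip (ux_mem_unip hM h)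

theorem exists_ux_of_mem_unip (hM : IsHermBasis p f M) {g : SLe p f K (-1)}
    (hg : g ∈ unip p f (-1) M) : ∃ (a b : K) (h : b + bar p f b + a * bar p f a = 0),
      g = ux hbar hM h := by
  obtain ⟨a, b, c, hg⟩ := hg
  have h1 := g.2
  rw [hg, hM.conj_mem_SLe] at h1
  obtain ⟨rfl, h2⟩ := upperGL_of_preservesForm h1.1
  exact ⟨a, b, h2, Subtype.ext hg⟩

/-- The Heisenberg law: `a` is additive, the elements with `a = 0` are central, and commutators are
read off from `a * bar p f a'`. -/
theorem ux_mul (hM : IsHermBasis p f M) {a b a' b' : K} (h : b + bar p f b + a * bar p f a = 0)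
    (h' : b' + bar p f b' + a' * bar p f a' = 0) : ∃ h'', ux hbar hM h * ux hbar hM h' =
      ux hbar hM (a := a + a') (b := b + b' - a * bar p f a') h'' := by
  refine ⟨?_, ?_⟩
  · simp only [map_add, map_sub, map_mul, hbar]
    linear_combination h + h'
  · apply Subtype.ext
    have e := upperGL_mul a b (-bar p f a) a' b' (-bar p f a')
    rw [show b + b' + a * -bar p f a' = b + b' - a * bar p f a' by ring,
      show -bar p f a + -bar p f a' = -bar p f (a + a') by rw [map_add]; ring] at e
    rw [Subgroup.coe_mul, coe_ux, coe_ux, coe_ux, ← e]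
    group

theorem ux_injective (hM : IsHermBasis p f M) {a b a' b' : K}
    {h : b + bar p f b + a * bar p f a = 0} {h' : b' + bar p f b' + a' * bar p f a' = 0}
    (e : ux hbar hM h = ux hbar hM h') : a = a' ∧ b = b' := by
  have e1 := congrArg Subtype.val e
  rw [coe_ux, coe_ux, mul_left_inj, mul_right_inj] at e1
  exact ⟨(upperGL_injective e1).1, (upperGL_injective e1).2.1⟩

theorem mk_ux_injective {z : Kˣ} (hz : z ∈ scalars p f K (-1)) (hz1 : z ≠ 1) (hz3 : z ^ 3 = 1)
    (hM : IsHermBasis p f M) {a b a' b' : K} {h : b + bar p f b + a * bar p f a = 0}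
    {h' : b' + bar p f b' + a' * bar p f a' = 0}
    (e : (ux hbar hM h : PSLe p f K (-1)) = ux hbar hM h') : a = a' ∧ b = b' :=
  ux_injective hM (eq_of_mk_eq hz hz1 hz3 (trace_ux hM h) (trace_ux hM h') e)

theorem bar_cube_root {z : Kˣ} (hz : z ∈ scalars p f K (-1)) (hz3 : z ^ 3 = 1) :
    bar p f (z : K) = (z : K) ^ 2 := by
  have h1 : z ^ (p ^ f + 1) = 1 := (mem_scalars.mp hz).resolve_left (by decide)
  rw [iterateFrobenius_def, ← Units.val_pow_eq_pow_val, ← Units.val_pow_eq_pow_val]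
  congr 1
  apply mul_right_cancel (b := z)
  rw [← pow_succ, ← pow_succ, h1, hz3]

/-- As `z` and its conjugate `z²` sum to -1, `b = z * (a * bar p f a)` is an explicit solution for
every `a`. -/
theorem ux_relation {z : Kˣ} (hz : z ∈ scalars p f K (-1)) (hz1 : z ≠ 1) (hz3 : z ^ 3 = 1)
    (hbar : ∀ x : K, bar p f (bar p f x) = x) (a : K) :
    (z : K) * (a * bar p f a) + bar p f ((z : K) * (a * bar p f a)) + a * bar p f a = 0 := by
  rw [map_mul, map_mul, hbar, bar_cube_root hz hz3]
  linear_combination a * bar p f a * cube_root_sum hz1 hz3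

/-- Hermitian bases with the same Sylow subgroup differ by an upper triangular matrix. -/
theorem IsHermBasis.isUpper_of_unipBar_eq (hM : IsHermBasis p f M)
    (hbar : ∀ x : K, bar p f (bar p f x) = x) {z : Kˣ} (hz : z ∈ scalars p f K (-1)) (hz1 : z ≠ 1)
    (hz3 : z ^ 3 = 1) {M' : GL (Fin 3) K} (h : unipBar p f (-1) M = unipBar p f (-1) M') :
    IsUpper (M'⁻¹ * M) :=
  SL3Sylow.isUpper_of_unipBar_eq hz hz1 hz3 one_ne_zero (by simp)
    (coe_ux (hbar := hbar) hM (ux_relation hz hz1 hz3 hbar 1)) h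

theorem IsHermBasis.flip (hM : IsHermBasis p f M) : IsHermBasis p f (M * flipGL K) :=
  hM.mul preservesForm_flipGL

/-- The Sylow subgroups are parametrized by the isotropic lines. -/
theorem IsHermBasis.unipBar_smul_cases (hM : IsHermBasis p f M)
    (hbar : ∀ x : K, bar p f (bar p f x) = x) (g : SLe p f K (-1)) :
    unipBar p f (-1) (g.1 * M) = unipBar p f (-1) M ∨ ∃ u ∈ unip p f (-1) M,
      unipBar p f (-1) (g.1 * M) = unipBar p f (-1) (u.1 * (M * flipGL K)) := by
  set X := M⁻¹ * (g : GL (Fin 3) K) * M with hX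
  have hg : (g : GL (Fin 3) K) = M * X * M⁻¹ := by rw [hX]; group
  have hgM : (g : GL (Fin 3) K) * M = M * X := by rw [hX]; group
  have hXf : PreservesForm p f X := (hM.conj_mem_SLe.mp (hg ▸ g.2)).1
  rw [hgM]
  rcases hXf.bruhat hbar with h | ⟨a, b, Y, hab, hY, h⟩
  · exact Or.inl (h.unipBar_mul M)
  · refine Or.inr ⟨ux hbar hM hab, ux_mem_unip hM hab, ?_⟩
    rw [h, ← mul_assoc, hY.unipBar_mul, coe_ux]
    congr 1
    group

/-- The flip has determinant -1. The scalar -1 corrects this without changing the Sylow subgroups.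
-/
theorem IsHermBasis.exists_flip (hM : IsHermBasis p f M) : ∃ w : SLe p f K (-1), ∀ X : GL (Fin 3) K,
    unipBar p f (-1) (w.1 * (M * X)) = unipBar p f (-1) (M * (flipGL K * X)) := by
  have hs : IsUpper (mono (fun _ => (-1 : Kˣ)) 0 : GL (Fin 3) K) := by
    refine ⟨?_, ?_, ?_⟩ <;> rw [mono_apply, if_neg (by decide)]
  have hp : PreservesForm p f (mono (fun _ => (-1 : Kˣ)) 0 : GL (Fin 3) K) := by
    rw [preservesForm_iff]
    intro i j
    fin_cases i <;> fin_cases j <;> simp [mono_apply, coe_flipGL]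
  refine ⟨⟨M * (flipGL K * mono (fun _ => -1) 0) * M⁻¹, hM.conj_mem_SLe.mpr
    ⟨preservesForm_flipGL.mul hp, ?_⟩⟩, fun X => ?_⟩
  · rw [Units.val_mul, Matrix.det_mul, coe_flipGL, Matrix.det_fin_three, Matrix.det_fin_three]
    simp [mono_apply]
  · rw [← mul_assoc, inv_mul_cancel_right, mul_assoc, mul_assoc, mono_const_comm, ← mul_assoc,
      ← mul_assoc, hs.unipBar_mul, mul_assoc]

theorem IsHermBasis.unipBar_flip_ne (hM : IsHermBasis p f M)
    (hbar : ∀ x : K, bar p f (bar p f x) = x) {z : Kˣ} (hz : z ∈ scalars p f K (-1)) (hz1 : z ≠ 1)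
    (hz3 : z ^ 3 = 1) : unipBar p f (-1) (M * flipGL K) ≠ unipBar p f (-1) M := by
  intro h
  have := (hM.flip.isUpper_of_unipBar_eq hbar hz hz1 hz3 h).2.1
  rw [inv_mul_cancel_left] at this
  simp [coe_flipGL] at this

theorem map_conj_of_mem {G : Type*} [Group G] {H : Subgroup G} {u : G} (hu : u ∈ H) :
    H.map (MulAut.conj u : G →* G) = H := by
  ext x
  constructor
  · rintro ⟨y, hy, rfl⟩
    exact mul_mem (mul_mem hu hy) (inv_mem hu)
  · intro hx
    refine ⟨u⁻¹ * x * u, mul_mem (mul_mem (inv_mem hu) hx) hu, ?_⟩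
    change u * (u⁻¹ * x * u) * u⁻¹ = x
    group

theorem map_mul_aut {G : Type*} [Group G] (H : Subgroup G) (α β : MulAut G) :
    H.map ((α * β : MulAut G) : G →* G) = (H.map (β : G →* G)).map (α : G →* G) := by
  rw [Subgroup.map_map]
  rfl

theorem mul_conj {G : Type*} [Group G] (α : MulAut G) (w : G) :
    α * MulAut.conj w = MulAut.conj (α w) * α := by
  ext y
  simp [MulAut.mul_apply, MulAut.conj_apply]

/-- Up to inner automorphisms, an automorphism preserves two opposite Sylow subgroups. -/
theorem IsHermBasis.exists_inner_mul [Finite K] [Fact p.Prime] [CharP K p] (hM : IsHermBasis p f M)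
    (hbar : ∀ x : K, bar p f (bar p f x) = x) {z : Kˣ} (hz : z ∈ scalars p f K (-1)) (hz1 : z ≠ 1)
    (hz3 : z ^ 3 = 1) (α : MulAut (PSLe p f K (-1))) : ∃ x : PSLe p f K (-1),
      (unipBar p f (-1) M).map ((MulAut.conj x * α : MulAut _) : _ →* PSLe p f K (-1)) =
        unipBar p f (-1) M ∧
      (unipBar p f (-1) (M * flipGL K)).map ((MulAut.conj x * α : MulAut _) : _ →* PSLe p f K (-1)) =
        unipBar p f (-1) (M * flipGL K) := by
  obtain ⟨P, hP⟩ := exists_sylow_unip hz hz1 hz3 M (one_ne_zero (α := K)) (by simp)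
    (coe_ux (hbar := hbar) hM (ux_relation hz hz1 hz3 hbar 1))
  obtain ⟨g, hg⟩ := exists_map_eq_conj P α
  rw [hP] at hg
  change (unipBar p f (-1) M).map _ = (unipBar p f (-1) M).map _ at hg
  have h1 : (unipBar p f (-1) M).map ((MulAut.conj g⁻¹ * α : MulAut _) : _ →* PSLe p f K (-1)) =
      unipBar p f (-1) M := by
    rw [map_mul_aut, hg, ← map_mul_aut, ← map_mul, inv_mul_cancel, map_one]
    exact Subgroup.map_id _
  obtain ⟨w, hwX⟩ := hM.exists_flip
  have hw := hwX 1
  rw [mul_one, mul_one] at hw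
  obtain ⟨w', hw'⟩ := QuotientGroup.mk_surjective ((MulAut.conj g⁻¹ * α) (w : PSLe p f K (-1)))
  have h2 : (unipBar p f (-1) (M * flipGL K)).map
      ((MulAut.conj g⁻¹ * α : MulAut _) : _ →* PSLe p f K (-1)) = unipBar p f (-1) (w'.1 * M) := by
    rw [← hw, unipBar_smul, unipBar_smul, hw']
    rw [← map_mul_aut, mul_conj, map_mul_aut, h1]
  -- The image of the opposite Sylow subgroup differs from the fixed one, so it lies in the big cell
  -- and an element of the fixed Sylow subgroup moves it back.
  rcases hM.unipBar_smul_cases hbar w' with h3 | ⟨u, hu, h3⟩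
  · rw [h3] at h2
    conv_rhs at h2 => rw [← h1]
    exact absurd (Subgroup.map_injective (MulEquiv.injective _) h2) (hM.unipBar_flip_ne hbar hz hz1 hz3)
  · refine ⟨(u : PSLe p f K (-1))⁻¹ * g⁻¹, ?_, ?_⟩
    · rw [map_mul, mul_assoc, map_mul_aut, h1]
      exact map_conj_of_mem (inv_mem ⟨u, hu, rfl⟩)
    · rw [map_mul, mul_assoc, map_mul_aut, h2, h3, unipBar_smul, ← map_mul_aut, ← map_mul,
        inv_mul_cancel, map_one]
      exact Subgroup.map_id _

end Hermitian

end SL3Sylow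

namespace SL3Sylow

/-! ### Norms, subfields and existence of a hermitian basis. -/

section FiniteFields

variable {p f : ℕ} {K : Type*} [Field K] [Finite K]

theorem orderOf_generator {g : Kˣ} (hg : ∀ x, x ∈ Subgroup.zpowers g) :
    orderOf g + 1 = Nat.card K := by
  rw [orderOf_eq_card_of_forall_mem_zpowers hg, Nat.card_units]
  have := Finite.one_lt_card (α := K)
  omega

variable [ExpChar K p]

theorem bar_bar (hK : Nat.card K = (p ^ f) ^ 2) (x : K) : bar p f (bar p f x) = x := by
  have := Fintype.ofFinite K
  rw [iterateFrobenius_def, iterateFrobenius_def, ← pow_mul, ← pow_two, ← hK, Nat.card_eq_fintype_card,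
    FiniteField.pow_card]

/-- The norm map is surjective onto the fixed field of `bar`. -/
theorem exists_norm_eq (hK : Nat.card K = (p ^ f) ^ 2) {x : K} (hx : x ≠ 0) (hxb : bar p f x = x) :
    ∃ y : K, y * bar p f y = x := by
  obtain ⟨g, hg⟩ := IsCyclic.exists_generator (α := Kˣ)
  have ho := orderOf_generator hg
  obtain ⟨k, hk⟩ := (mem_powers_iff_mem_zpowers.mpr (hg (Units.mk0 x hx)) : Units.mk0 x hx ∈ _)
  change g ^ k = _ at hk
  have hq : 1 < p ^ f := by
    by_contra h
    have h1 : p ^ f ≤ 1 := not_lt.mp h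
    have h2 := Finite.one_lt_card (α := K)
    rw [hK] at h2
    have h3 := Nat.pow_le_pow_left h1 2
    omega
  have h1 : (Units.mk0 x hx) ^ (p ^ f - 1) = 1 := by
    apply mul_right_cancel (b := Units.mk0 x hx)
    rw [one_mul, ← pow_succ, Nat.sub_add_cancel hq.le]
    ext
    rw [Units.val_pow_eq_pow_val, Units.val_mk0, ← iterateFrobenius_def]
    exact hxb
  rw [← hk, ← pow_mul, ← orderOf_dvd_iff_pow_eq_one] at h1
  have h2 : orderOf g = (p ^ f + 1) * (p ^ f - 1) := by
    obtain ⟨m, hm⟩ := Nat.exists_eq_add_of_lt hq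
    rw [hK] at ho
    rw [hm] at ho ⊢
    rw [show 1 + m + 1 - 1 = m + 1 by omega]
    nlinarith
  rw [h2] at h1
  obtain ⟨m, rfl⟩ := Nat.dvd_of_mul_dvd_mul_right (by omega) h1
  refine ⟨((g ^ m : Kˣ) : K), ?_⟩
  rw [iterateFrobenius_def, ← pow_succ', ← Units.val_pow_eq_pow_val, ← pow_mul, mul_comm m, hk,
    Units.val_mk0]

/-- For `x` outside `T` the sums `a + b x` with `a`, `b` in `T` are pairwise distinct. -/
theorem card_le_of_subfield_ne_top (T : Subfield K) (hT : T ≠ ⊤) : Nat.card T ^ 2 ≤ Nat.card K := by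
  obtain ⟨x, hx⟩ : ∃ x, x ∉ T := by
    by_contra! h
    exact hT (eq_top_iff.mpr fun x _ => h x)
  rw [pow_two, ← Nat.card_prod]
  refine Nat.card_le_card_of_injective (fun y : T × T => (y.1 : K) + y.2 * x) ?_
  rintro ⟨a, b⟩ ⟨a', b'⟩ h
  change (a : K) + b * x = a' + b' * x at h
  by_cases hb : (b : K) = b'
  · rw [hb, add_left_inj] at h
    exact Prod.ext (Subtype.ext h) (Subtype.ext hb)
  · refine absurd ?_ hx
    have h1 : x = (a' - a) / (b - b') := by
      rw [eq_div_iff (sub_ne_zero.mpr hb)]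
      linear_combination h
    rw [h1]
    exact div_mem (sub_mem a'.2 a.2) (sub_mem b.2 b'.2)

/-- A proper subfield has at most `q` elements. With `n = |T| - 1` and `g` a generator of `Kˣ`,
raising `g² / ḡ` to the power `n` gives `g^(2n) = ḡ^n`; conjugating this leads to `g^(3n) = 1`,
impossible since `3(q - 1) < q² - 1` for `q > 2`. -/
theorem subfield_eq_top (hK : Nat.card K = (p ^ f) ^ 2) (hq : 2 < p ^ f) (T : Subfield K)
    (hT : ∀ t : K, t ≠ 0 → t ^ 2 / bar p f t ∈ T) : T = ⊤ := by
  by_contra hne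
  have h1 := card_le_of_subfield_ne_top T hne
  rw [hK] at h1
  have h2 : Nat.card T ≤ p ^ f := (Nat.pow_le_pow_iff_left two_ne_zero).mp h1
  obtain ⟨g, hg⟩ := IsCyclic.exists_generator (α := Kˣ)
  have ho := orderOf_generator hg
  have hc0 : (⟨_, hT g g.ne_zero⟩ : T) ≠ 0 := by
    intro h
    have h' := congrArg Subtype.val h
    change (g : K) ^ 2 / bar p f (g : K) = 0 at h'
    rcases div_eq_zero_iff.mp h' with h' | h'
    · exact g.ne_zero (pow_eq_zero_iff two_ne_zero |>.mp h')
    · exact g.ne_zero ((map_eq_zero _).mp h')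
  have := Fintype.ofFinite T
  have hc := FiniteField.pow_card_sub_one_eq_one _ hc0
  rw [← Nat.card_eq_fintype_card] at hc
  have hc' := congrArg Subtype.val hc
  change ((g : K) ^ 2 / bar p f (g : K)) ^ (Nat.card T - 1) = 1 at hc'
  set n := Nat.card T - 1 with hn
  have h3 : (g : K) ^ n ^ 1 ≠ 0 := pow_ne_zero _ g.ne_zero
  rw [pow_one] at h3
  rw [div_pow, ← map_pow, ← pow_mul, mul_comm 2, pow_mul, div_eq_one_iff_eq
    ((map_ne_zero _).mpr h3)] at hc'
  have h4 := congrArg (bar p f) hc'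
  rw [bar_bar hK, map_pow, ← hc'] at h4
  have h5 : g ^ (3 * n) = 1 := by
    ext
    rw [Units.val_pow_eq_pow_val, Units.val_one, mul_comm, pow_mul]
    apply mul_right_cancel₀ h3
    linear_combination h4
  have hn0 : 0 < n := by
    have := Finite.one_lt_card (α := T)
    omega
  have h6 := Nat.le_of_dvd (by omega) (orderOf_dvd_of_pow_eq_one h5)
  rw [hK] at ho
  have h7 : n ≤ p ^ f - 1 := by omega
  obtain ⟨m, hm⟩ := Nat.exists_eq_add_of_lt hq
  rw [hm] at ho h7
  have : n ≤ m + 2 := by omega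
  nlinarith

/-- The power `q - 1` of a generator has order `q + 1 > 3`. -/
theorem exists_norm_one_cube_ne (hK : Nat.card K = (p ^ f) ^ 2) (hq : 2 < p ^ f) :
    ∃ t : K, t * bar p f t = 1 ∧ t ^ 3 ≠ 1 := by
  obtain ⟨g, hg⟩ := IsCyclic.exists_generator (α := Kˣ)
  have ho := orderOf_generator hg
  have h2 : (p ^ f - 1) * (p ^ f + 1) = orderOf g := by
    obtain ⟨m, hm⟩ := Nat.exists_eq_add_of_lt hq
    rw [hK] at ho
    rw [hm] at ho ⊢
    rw [show 2 + m + 1 - 1 = m + 2 by omega]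
    nlinarith
  refine ⟨((g ^ (p ^ f - 1) : Kˣ) : K), ?_, fun h => ?_⟩
  · rw [iterateFrobenius_def, ← pow_succ', ← Units.val_pow_eq_pow_val, ← pow_mul, h2, pow_orderOf_eq_one,
      Units.val_one]
  · rw [← Units.val_pow_eq_pow_val, Units.val_eq_one, ← pow_mul] at h
    have h3 := Nat.le_of_dvd (by omega) (orderOf_dvd_of_pow_eq_one h)
    rw [← h2] at h3
    have := Nat.le_of_mul_le_mul_left h3 (by omega)
    omega

/-- There is a hermitian basis. -/
theorem exists_isHermBasis (hK : Nat.card K = (p ^ f) ^ 2) {z : Kˣ} (hz : z ∈ scalars p f K (-1))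
    (hz1 : z ≠ 1) (hz3 : z ^ 3 = 1) : ∃ M : GL (Fin 3) K, IsHermBasis p f M := by
  obtain ⟨ν, hν⟩ := exists_norm_eq hK (neg_ne_zero.mpr (one_ne_zero (α := K))) (by simp)
  have hz' : (1 : K) - z ≠ 0 := sub_ne_zero.mpr fun h => hz1 (Units.ext h.symm)
  have hz2 : (1 : K) - (z : K) ^ 2 ≠ 0 := by
    intro h
    have h1 := cube_root_sum hz1 hz3
    have h2 : (z : K) ^ 3 = 1 := by rw [← Units.val_pow_eq_pow_val, hz3, Units.val_one]
    apply hz'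
    linear_combination -(z : K) * h - h2
  have hb := bar_cube_root hz hz3
  have h3 : (z : K) ^ 3 = 1 := by rw [← Units.val_pow_eq_pow_val, hz3, Units.val_one]
  -- With `ν` of norm -1, the vectors `(1, ν, 0)` and `(1, z ν, 0)` are isotropic with product `1 -
  -- z`; dividing the second by `1 - z` gives a hyperbolic pair.
  set N : Matrix (Fin 3) (Fin 3) K := !![1, 0, 1 / (1 - (z : K)); ν, 0, z * ν / (1 - z); 0, 1, 0] with hN
  have h : (N.map (bar p f))ᵀ * N = (flipGL K).1 := by
    ext i j
    rw [Matrix.mul_apply, Fin.sum_univ_three]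
    simp only [Matrix.transpose_apply, Matrix.map_apply]
    have e1 : bar p f (1 / (1 - (z : K))) = 1 / (1 - (z : K) ^ 2) := by simp [hb]
    have e2 : bar p f (z * ν / (1 - z)) = (z : K) ^ 2 * bar p f ν / (1 - (z : K) ^ 2) := by simp [hb]
    fin_cases i <;> fin_cases j <;> simp only [hN, coe_flipGL] <;>
      simp only [Matrix.of_apply, Fin.zero_eta, Fin.mk_one, Fin.reduceFinMk, Matrix.cons_val, e1, e2,
        map_one, map_zero, mul_zero, zero_mul, mul_one, one_mul, add_zero, zero_add]
    · linear_combination hν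
    · field_simp
      linear_combination z * hν
    · field_simp
      linear_combination (z : K) ^ 2 * hν
    · field_simp
      linear_combination (z : K) ^ 3 * hν - h3
  have hd : N.det ≠ 0 := by
    intro h0
    have h1 := congrArg Matrix.det h
    rw [Matrix.det_mul, h0, mul_zero] at h1
    exact Matrix.GeneralLinearGroup.det_ne_zero (flipGL K) h1.symm
  exact ⟨Matrix.GeneralLinearGroup.mkOfDetNeZero N hd, h⟩

end FiniteFields

end SL3Sylow

namespace SL3Sylow

/-! ### The torus stabilizing two opposite isotropic lines. -/

section Torus

variable {p f : ℕ} {K : Type*} [Field K]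

theorem mono_mul_upperGL (x : Fin 3 → Kˣ) (a b c : K) :
    mono x 0 * upperGL a b c = upperGL (x 0 / x 1 * a) (x 0 / x 2 * b) (x 1 / x 2 * c) * mono x 0 := by
  apply Units.ext
  rw [Units.val_mul, Units.val_mul, coe_upperGL, coe_upperGL, coe_mono_zero]
  ext i j
  rw [Matrix.mul_apply, Matrix.mul_apply, Fin.sum_univ_three, Fin.sum_univ_three]
  fin_cases i <;> fin_cases j <;> simp <;> field_simp

theorem eq_of_upper_of_flip {X : GL (Fin 3) K}
    (h' : IsUpper (flipGL K * X * flipGL K)) :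
    X.1 0 1 = 0 ∧ X.1 0 2 = 0 ∧ X.1 1 2 = 0 := by
  have e : ∀ i j, (flipGL K * X * flipGL K).1 i j = X.1 (2 - i) (2 - j) := by
    intro i j
    rw [Units.val_mul, Units.val_mul, Matrix.mul_apply, Fin.sum_univ_three, Matrix.mul_apply,
      Matrix.mul_apply, Matrix.mul_apply, Fin.sum_univ_three, Fin.sum_univ_three, Fin.sum_univ_three]
    fin_cases i <;> fin_cases j <;> simp [coe_flipGL]
  obtain ⟨h1, h2, h3⟩ := h'
  rw [e] at h1 h2 h3
  exact ⟨h3, h2, h1⟩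

variable [ExpChar K p] {M : GL (Fin 3) K}

variable (p f) in
/-- A diagonal matrix of determinant `1` preserving the antidiagonal form. -/
def torusGL (t : Kˣ) : GL (Fin 3) K :=
  mono ![t, Units.map ((bar p f : K →+* K) : K →* K) t / t, (Units.map ((bar p f : K →+* K) : K →* K) t)⁻¹] 0

theorem preservesForm_torusGL (hbar : ∀ x : K, bar p f (bar p f x) = x) (t : Kˣ) :
    PreservesForm p f (torusGL p f t) := by
  rw [preservesForm_iff]
  intro i j
  have h1 : bar p f (t : K) ≠ 0 := (map_ne_zero _).mpr t.ne_zero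
  fin_cases i <;> fin_cases j <;> simp [torusGL, coe_mono_zero, coe_flipGL, hbar]

theorem det_torusGL (t : Kˣ) : (torusGL p f t).1.det = 1 := by
  have h1 : bar p f (t : K) ≠ 0 := (map_ne_zero _).mpr t.ne_zero
  rw [torusGL, coe_mono_zero, Matrix.det_fin_three]
  simp
  field_simp

theorem isUpper_torusGL (t : Kˣ) : IsUpper (torusGL p f t) := by
  refine ⟨?_, ?_, ?_⟩ <;> rw [torusGL, coe_mono_zero] <;> rfl

theorem isUpper_flip_torusGL (t : Kˣ) : IsUpper (flipGL K * torusGL p f t * flipGL K) := by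
  rw [torusGL]
  refine ⟨?_, ?_, ?_⟩ <;>
  rw [Units.val_mul, Units.val_mul, Matrix.mul_apply, Fin.sum_univ_three, Matrix.mul_apply,
      Matrix.mul_apply, Matrix.mul_apply, Fin.sum_univ_three, Fin.sum_univ_three, Fin.sum_univ_three,
      coe_mono_zero] <;> simp [coe_flipGL]

/-- The elements of a maximal torus normalizing two opposite Sylow subgroups. -/
def torus (hbar : ∀ x : K, bar p f (bar p f x) = x) (hM : IsHermBasis p f M) (t : Kˣ) :
    SLe p f K (-1) :=
  ⟨M * torusGL p f t * M⁻¹, hM.conj_mem_SLe.mpr ⟨preservesForm_torusGL hbar t, det_torusGL t⟩⟩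

variable {hbar : ∀ x : K, bar p f (bar p f x) = x}

theorem coe_torus (hM : IsHermBasis p f M) (t : Kˣ) :
    (torus hbar hM t : GL (Fin 3) K) = M * torusGL p f t * M⁻¹ := rfl

theorem torus_mul_ux (hM : IsHermBasis p f M) (t : Kˣ) {a b : K}
    (h : b + bar p f b + a * bar p f a = 0) : ∃ h', torus hbar hM t * ux hbar hM h =
      ux hbar hM (a := t ^ 2 / bar p f (t : K) * a) (b := t * bar p f (t : K) * b) h' *
        torus hbar hM t := by
  have h1 : bar p f (t : K) ≠ 0 := (map_ne_zero _).mpr t.ne_zero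
  refine ⟨?_, ?_⟩
  · simp only [map_mul, map_div₀, map_pow, hbar]
    field_simp
    linear_combination t * bar p f (t : K) * h
  · apply Subtype.ext
    rw [Subgroup.coe_mul, Subgroup.coe_mul, coe_torus, coe_ux, coe_ux]
    have e := mono_mul_upperGL ![t, Units.map ((bar p f : K →+* K) : K →* K) t / t,
      (Units.map ((bar p f : K →+* K) : K →* K) t)⁻¹] a b (-bar p f a)
    have e2 : upperGL (t ^ 2 / bar p f (t : K) * a) (t * bar p f (t : K) * b)
        (-bar p f (t ^ 2 / bar p f (t : K) * a)) * torusGL p f t =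
          torusGL p f t * upperGL a b (-bar p f a) := by
      rw [torusGL, e]
      congr 2
      · simp
        left
        field_simp
      · simp
      · simp [hbar]
        left
        field_simp
    calc _ = M * (torusGL p f t * upperGL a b (-bar p f a)) * M⁻¹ := by group
      _ = _ := by rw [← e2]; group

/-- Stabilizing both lines makes the matrix diagonal; the form and the determinant then express all
entries through the first. -/
theorem exists_eq_torus (hM : IsHermBasis p f M) {g : SLe p f K (-1)}
    (h : IsUpper (M⁻¹ * g.1 * M)) (h' : IsUpper ((M * flipGL K)⁻¹ * g.1 * (M * flipGL K))) :
    ∃ t, g = torus hbar hM t := by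
  set X := M⁻¹ * (g : GL (Fin 3) K) * M with hX
  have hg : (g : GL (Fin 3) K) = M * X * M⁻¹ := by rw [hX]; group
  obtain ⟨hXf, hXd⟩ := hM.conj_mem_SLe.mp (hg ▸ g.2)
  have h'' : IsUpper (flipGL K * X * flipGL K) := by
    rw [hX]
    rw [mul_inv_rev, inv_eq_of_mul_eq_one_left flipGL_mul_self] at h'
    simpa only [mul_assoc] using h'
  obtain ⟨e01, e02, e12⟩ := eq_of_upper_of_flip h''
  have d0 := h.diag_ne_zero 0
  obtain ⟨e10, e20, e21⟩ := h
  have f1 := preservesForm_iff.mp hXf 0 2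
  rw [Matrix.det_fin_three, e01, e02, e12, e10, e20, e21] at hXd
  rw [e12, e02, e10, mul_zero, mul_zero, add_zero, add_zero] at f1
  change _ = (1 : K) at f1
  let t := Units.mk0 _ d0
  have hb : bar p f (t : K) ≠ 0 := (map_ne_zero _).mpr t.ne_zero
  have e22 : X.1 2 2 = (bar p f (X.1 0 0))⁻¹ := eq_inv_of_mul_eq_one_right f1
  have e11 : X.1 1 1 = bar p f (X.1 0 0) / X.1 0 0 := by
    rw [e22] at hXd
    change bar p f (X.1 0 0) ≠ 0 at hb
    field_simp at hXd ⊢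
    linear_combination hXd
  refine ⟨t, Subtype.ext ?_⟩
  rw [hg, coe_torus]
  congr 2
  apply Units.ext
  rw [torusGL, coe_mono_zero]
  ext i j
  fin_cases i <;> fin_cases j
  · rfl
  · exact e01
  · exact e02
  · exact e10
  · exact e11.trans (by simp [t])
  · exact e12
  · exact e20
  · exact e21
  · exact e22.trans (by simp [t])

/-- The images of elements normalizing a Sylow subgroup preserved by an automorphism. -/
theorem IsHermBasis.isUpper_of_map (hM : IsHermBasis p f M)
    (hbar : ∀ x : K, bar p f (bar p f x) = x) {z : Kˣ} (hz : z ∈ scalars p f K (-1)) (hz1 : z ≠ 1)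
    (hz3 : z ^ 3 = 1) {β : MulAut (PSLe p f K (-1))}
    (hβ : (unipBar p f (-1) M).map (β : PSLe p f K (-1) →* PSLe p f K (-1)) = unipBar p f (-1) M)
    {g g' : SLe p f K (-1)} (hg : IsUpper (M⁻¹ * g.1 * M))
    (h : β (g : PSLe p f K (-1)) = (g' : PSLe p f K (-1))) : IsUpper (M⁻¹ * g'.1 * M) := by
  have h1 : unipBar p f (-1) (g.1 * M) = unipBar p f (-1) M := by
    have := hg.unipBar_mul (p := p) (f := f) (ε := -1) M
    rwa [show M * (M⁻¹ * g.1 * M) = g.1 * M by group] at this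
  have h2 : unipBar p f (-1) (g'.1 * M) = unipBar p f (-1) M := by
    conv_rhs => rw [← hβ, ← h1]
    rw [unipBar_smul, unipBar_smul, ← map_mul_aut, mul_conj, map_mul_aut, hβ, h]
  have hgM : IsHermBasis p f (g'.1 * M) := by
    have h3 : g'.1 = M * (M⁻¹ * g'.1 * M) * M⁻¹ := by group
    have h4 := hM.mul (hM.conj_mem_SLe.mp (h3 ▸ g'.2)).1
    rwa [show M * (M⁻¹ * g'.1 * M) = g'.1 * M by group] at h4
  have h3 := hgM.isUpper_of_unipBar_eq hbar hz hz1 hz3 h2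
  rwa [← mul_assoc] at h3

/-- The torus consists of the elements normalizing both Sylow subgroups, and `β` preserves each of
them. -/
theorem exists_map_torus (hM : IsHermBasis p f M)
    {z : Kˣ} (hz : z ∈ scalars p f K (-1)) (hz1 : z ≠ 1)
    (hz3 : z ^ 3 = 1) {β : MulAut (PSLe p f K (-1))}
    (hβ : (unipBar p f (-1) M).map (β : PSLe p f K (-1) →* PSLe p f K (-1)) = unipBar p f (-1) M)
    (hβ' : (unipBar p f (-1) (M * flipGL K)).map (β : PSLe p f K (-1) →* PSLe p f K (-1)) =
      unipBar p f (-1) (M * flipGL K)) (t : Kˣ) :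
    ∃ s, β (torus hbar hM t : PSLe p f K (-1)) = (torus hbar hM s : PSLe p f K (-1)) := by
  obtain ⟨g', hg'⟩ := QuotientGroup.mk_surjective (β (torus hbar hM t : PSLe p f K (-1)))
  have e1 : M⁻¹ * (torus hbar hM t : GL (Fin 3) K) * M = torusGL p f t := by
    rw [coe_torus]
    group
  have e2 : (M * flipGL K)⁻¹ * (torus hbar hM t : GL (Fin 3) K) * (M * flipGL K) =
      flipGL K * torusGL p f t * flipGL K := by
    rw [coe_torus, mul_inv_rev, inv_eq_of_mul_eq_one_left flipGL_mul_self]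
    group
  obtain ⟨s, rfl⟩ := exists_eq_torus (hbar := hbar) hM
    (hM.isUpper_of_map hbar hz hz1 hz3 hβ (e1 ▸ isUpper_torusGL t) hg'.symm)
    (hM.flip.isUpper_of_map hbar hz hz1 hz3 hβ' (e2 ▸ isUpper_flip_torusGL t) hg'.symm)
  exact ⟨s, hg'.symm⟩

end Torus

end SL3Sylow

namespace SL3Sylow

/-! ### The action on a Sylow `p`-subgroup of `PSU₃(q)` modulo its centre. -/

section Coordinates

variable {p f : ℕ} {K : Type*} [Field K] [ExpChar K p] {M : GL (Fin 3) K}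
  {hbar : ∀ x : K, bar p f (bar p f x) = x}

theorem exists_ux_of_mem_unipBar (hM : IsHermBasis p f M) {y : PSLe p f K (-1)}
    (hy : y ∈ unipBar p f (-1) M) : ∃ (a b : K) (h : b + bar p f b + a * bar p f a = 0),
      y = (ux hbar hM h : PSLe p f K (-1)) := by
  obtain ⟨u, hu, rfl⟩ := hy
  obtain ⟨a, b, h, rfl⟩ := exists_ux_of_mem_unip (hbar := hbar) hM hu
  exact ⟨a, b, h, rfl⟩

theorem ux_congr (hM : IsHermBasis p f M) {a b a' b' : K} (h : b + bar p f b + a * bar p f a = 0)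
    (ha : a = a') (hb : b = b') : ∃ h', ux hbar hM h = ux hbar hM (a := a') (b := b') h' := by
  subst ha hb
  exact ⟨h, rfl⟩

/-- Commuting with the elements over `x = 1` and `x = z` gives two equations whose only common
solution is `a = 0`. -/
theorem mk_ux_comm_iff {z : Kˣ} (hz : z ∈ scalars p f K (-1)) (hz1 : z ≠ 1) (hz3 : z ^ 3 = 1)
    (hM : IsHermBasis p f M) {a b : K} (h : b + bar p f b + a * bar p f a = 0) :
    (∀ y ∈ unipBar p f (-1) M, (ux hbar hM h : PSLe p f K (-1)) * y = y * ux hbar hM h) ↔ a = 0 := by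
  constructor
  · intro hc
    have key : ∀ x : K, a * bar p f x = x * bar p f a := by
      intro x
      have hx := ux_relation hz hz1 hz3 hbar x
      have h1 := hc _ ⟨_, ux_mem_unip (hbar := hbar) hM hx, rfl⟩
      have h2 := commute_of_mk hz hz1 hz3 (trace_ux hM hx) h1
      obtain ⟨h3, e3⟩ := ux_mul (hbar := hbar) hM h hx
      obtain ⟨h4, e4⟩ := ux_mul (hbar := hbar) hM hx h
      rw [e3, e4] at h2
      linear_combination -(ux_injective hM h2).2
    have k1 := key 1
    have k2 := key z
    rw [bar_cube_root hz hz3] at k2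
    rw [map_one] at k1
    have h3 : (z : K) - 1 ≠ 0 := sub_ne_zero.mpr fun h => hz1 (Units.ext h)
    refine (mul_eq_zero.mp (show a * (z * (z - 1)) = 0 by linear_combination k2 - z * k1)).resolve_right
      (mul_ne_zero z.ne_zero h3)
  · rintro rfl y hy
    obtain ⟨a', b', h', rfl⟩ := exists_ux_of_mem_unipBar (hbar := hbar) hM hy
    rw [← QuotientGroup.mk_mul, ← QuotientGroup.mk_mul]
    obtain ⟨h3, e3⟩ := ux_mul (hbar := hbar) hM h h'
    obtain ⟨h4, e4⟩ := ux_mul (hbar := hbar) hM h' h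
    rw [e3, e4]
    congr 1
    obtain ⟨h5, e5⟩ := ux_congr (hbar := hbar) hM h3 (a' := a' + 0) (b' := b' + b - a' * bar p f 0)
      (by ring) (by rw [map_zero]; ring)
    exact e5

theorem exists_map_ux (hM : IsHermBasis p f M) {β : MulAut (PSLe p f K (-1))}
    (hβ : (unipBar p f (-1) M).map (β : PSLe p f K (-1) →* PSLe p f K (-1)) = unipBar p f (-1) M)
    {a b : K} (h : b + bar p f b + a * bar p f a = 0) :
    ∃ (a' b' : K) (h' : b' + bar p f b' + a' * bar p f a' = 0),
      β (ux hbar hM h : PSLe p f K (-1)) = (ux hbar hM h' : PSLe p f K (-1)) :=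
  exists_ux_of_mem_unipBar hM (hβ ▸ ⟨_, ⟨_, ux_mem_unip hM h, rfl⟩, rfl⟩)

/-- The action of an automorphism on a Sylow subgroup modulo its centre. -/
theorem exists_additive (hbar : ∀ x : K, bar p f (bar p f x) = x) {z : Kˣ}
    (hz : z ∈ scalars p f K (-1)) (hz1 : z ≠ 1)
    (hz3 : z ^ 3 = 1) (hM : IsHermBasis p f M) {β : MulAut (PSLe p f K (-1))}
    (hβ : (unipBar p f (-1) M).map (β : PSLe p f K (-1) →* PSLe p f K (-1)) = unipBar p f (-1) M) :
    ∃ A : K →+ K, (∀ a, A a = 0 → a = 0) ∧ ∀ {a b : K} (h : b + bar p f b + a * bar p f a = 0),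
      ∃ b' h', β (ux hbar hM h : PSLe p f K (-1)) =
        (ux hbar hM (a := A a) (b := b') h' : PSLe p f K (-1)) := by
  have hcen : ∀ {a b a' b' : K} (h : b + bar p f b + a * bar p f a = 0)
      (h' : b' + bar p f b' + a' * bar p f a' = 0), β (ux hbar hM h : PSLe p f K (-1)) =
        (ux hbar hM h' : PSLe p f K (-1)) → (a = 0 ↔ a' = 0) := by
    intro a b a' b' h h' e
    rw [← mk_ux_comm_iff (hbar := hbar) hz hz1 hz3 hM h, ← mk_ux_comm_iff (hbar := hbar) hz hz1 hz3 hM h']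
    constructor
    · intro hc y hy
      rw [← hβ] at hy
      obtain ⟨x, hx, rfl⟩ := hy
      rw [← e]
      change β _ * β _ = β _ * β _
      rw [← map_mul, ← map_mul, hc x hx]
    · intro hc y hy
      apply β.injective
      rw [map_mul, map_mul, e]
      exact hc _ (hβ ▸ ⟨y, hy, rfl⟩)
  have hex := fun a : K => exists_map_ux (hbar := hbar) hM hβ (ux_relation hz hz1 hz3 hbar a)
  choose A B hA eA using hex
  have hgen : ∀ {a b : K} (h : b + bar p f b + a * bar p f a = 0),
      ∃ b' h', β (ux hbar hM h : PSLe p f K (-1)) =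
        (ux hbar hM (a := A a) (b := b') h' : PSLe p f K (-1)) := by
    intro a b h
    have h1 := ux_relation hz hz1 hz3 hbar a
    have h2 : (b - z * (a * bar p f a)) + bar p f (b - z * (a * bar p f a)) + 0 * bar p f 0 = 0 := by
      rw [map_sub, zero_mul]
      linear_combination h - h1
    obtain ⟨c, d, h3, e3⟩ := exists_map_ux (hbar := hbar) hM hβ h2
    have hc : c = 0 := (hcen h2 h3 e3).mp rfl
    obtain ⟨h4, e4⟩ := ux_mul (hbar := hbar) hM h1 h2
    obtain ⟨h5, e5⟩ := ux_congr (hbar := hbar) hM h4 (a' := a) (b' := b) (by ring)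
      (by rw [map_zero]; ring)
    obtain ⟨h6, e6⟩ := ux_mul (hbar := hbar) hM (hA a) h3
    obtain ⟨h7, e7⟩ := ux_congr (hbar := hbar) hM h6 (a' := A a) (by rw [hc, add_zero]) rfl
    refine ⟨_, h7, ?_⟩
    rw [← e7, ← e6, ← e5, ← e4, QuotientGroup.mk_mul, map_mul, eA, e3, QuotientGroup.mk_mul]
  have hadd : ∀ a a', A (a + a') = A a + A a' := by
    intro a a'
    obtain ⟨h1, e1⟩ := ux_mul (hbar := hbar) hM (ux_relation hz hz1 hz3 hbar a)
      (ux_relation hz hz1 hz3 hbar a')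
    obtain ⟨h2, e2⟩ := ux_mul (hbar := hbar) hM (hA a) (hA a')
    obtain ⟨b', h3, e3⟩ := hgen h1
    rw [← e1, QuotientGroup.mk_mul, map_mul, eA, eA, ← QuotientGroup.mk_mul, e2] at e3
    exact (mk_ux_injective hz hz1 hz3 hM e3).1.symm
  exact ⟨AddMonoidHom.mk' A hadd, fun a ha => (hcen (ux_relation hz hz1 hz3 hbar a) (hA a) (eA a)).mpr ha,
    hgen⟩

/-- The action on a Sylow subgroup modulo its centre is semilinear. -/
theorem exists_semilinear [Finite K] (hK : Nat.card K = (p ^ f) ^ 2) (hq : 2 < p ^ f) {z : Kˣ}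
    (hz : z ∈ scalars p f K (-1)) (hz1 : z ≠ 1)
    (hz3 : z ^ 3 = 1) (hM : IsHermBasis p f M) {β : MulAut (PSLe p f K (-1))}
    (hβ : (unipBar p f (-1) M).map (β : PSLe p f K (-1) →* PSLe p f K (-1)) = unipBar p f (-1) M)
    (hβ' : (unipBar p f (-1) (M * flipGL K)).map (β : PSLe p f K (-1) →* PSLe p f K (-1)) =
      unipBar p f (-1) (M * flipGL K)) :
    ∃ (r : Kˣ) (σ : K ≃+* K), ∀ {a b : K} (h : b + bar p f b + a * bar p f a = 0),
      ∃ b' h', β (ux hbar hM h : PSLe p f K (-1)) =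
        (ux hbar hM (a := r * σ a) (b := b') h' : PSLe p f K (-1)) := by
  obtain ⟨A, hA0, hA⟩ := exists_additive hbar hz hz1 hz3 hM hβ
  have htor : ∀ t : Kˣ, ∃ s : Kˣ, ∀ a, A (t ^ 2 / bar p f (t : K) * a) =
      s ^ 2 / bar p f (s : K) * A a := by
    intro t
    obtain ⟨s, hs⟩ := exists_map_torus (hbar := hbar) hM hz hz1 hz3 hβ hβ' t
    refine ⟨s, fun a => ?_⟩
    have h := ux_relation hz hz1 hz3 hbar a
    obtain ⟨h1, e1⟩ := torus_mul_ux (hbar := hbar) hM t h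
    obtain ⟨b2, h2, e2⟩ := hA h
    obtain ⟨b3, h3, e3⟩ := hA h1
    obtain ⟨h4, e4⟩ := torus_mul_ux (hbar := hbar) hM s h2
    have e5 := congrArg (fun g : SLe p f K (-1) => β (g : PSLe p f K (-1))) e1
    simp only [QuotientGroup.mk_mul, map_mul, hs, e2, e3] at e5
    rw [← QuotientGroup.mk_mul, e4, QuotientGroup.mk_mul, mul_left_inj] at e5
    exact (mk_ux_injective hz hz1 hz3 hM e5).1.symm
  have hA1 : ∀ {a}, a ≠ 0 → A a ≠ 0 := fun h h' => h (hA0 _ h')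
  -- The multipliers `c` that `A` turns into multipliers form a subfield. Torus equivariance puts
  -- every `t² / t̄` into it, so it is all of `K`.
  let T : Subfield K :=
    { carrier := {c | ∃ c', ∀ a, A (c * a) = c' * A a}
      one_mem' := ⟨1, fun a => by rw [one_mul, one_mul]⟩
      zero_mem' := ⟨0, fun a => by rw [zero_mul, zero_mul, map_zero]⟩
      neg_mem' := by
        rintro c ⟨c', h⟩
        exact ⟨-c', fun a => by rw [neg_mul, map_neg, h, neg_mul]⟩
      add_mem' := by
        rintro c d ⟨c', hc⟩ ⟨d', hd⟩
        exact ⟨c' + d', fun a => by rw [add_mul, map_add, hc, hd, add_mul]⟩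
      mul_mem' := by
        rintro c d ⟨c', hc⟩ ⟨d', hd⟩
        exact ⟨c' * d', fun a => by rw [mul_assoc, hc, hd, mul_assoc]⟩
      inv_mem' := by
        rintro c ⟨c', h⟩
        by_cases hc : c = 0
        · exact ⟨0, fun a => by rw [hc, inv_zero, zero_mul, zero_mul, map_zero]⟩
        have hc' : c' ≠ 0 := by
          rintro rfl
          have := h 1
          rw [zero_mul, mul_one] at this
          exact hA1 hc this
        refine ⟨c'⁻¹, fun a => ?_⟩
        rw [eq_inv_mul_iff_mul_eq₀ hc', ← h, mul_inv_cancel_left₀ hc] }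
  have hT : T = ⊤ := subfield_eq_top hK hq T fun t ht => by
    obtain ⟨s, hs⟩ := htor (Units.mk0 t ht)
    exact ⟨_, hs⟩
  have h1 := hA1 (one_ne_zero (α := K))
  have hmul : ∀ c a, A (c * a) * A 1 = A c * A a := by
    intro c a
    obtain ⟨c', hc⟩ : c ∈ T := hT ▸ Subfield.mem_top c
    have h2 := hc 1
    rw [mul_one] at h2
    rw [hc, h2]
    ring
  let σ₀ : K →+* K :=
    { toFun := fun s => A s / A 1
      map_one' := div_self h1
      map_zero' := by rw [map_zero, zero_div]
      map_add' := fun s t => by rw [map_add, add_div]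
      map_mul' := fun s t => by
        field_simp
        exact hmul s t }
  let σ : K ≃+* K := RingEquiv.ofBijective σ₀
    ⟨σ₀.injective, Finite.surjective_of_injective σ₀.injective⟩
  refine ⟨Units.mk0 _ h1, σ, fun {a b} h => ?_⟩
  have e : A a = A 1 * σ a := by
    change _ = _ * (A a / A 1)
    rw [mul_div_cancel₀ _ h1]
  rw [Units.val_mk0, ← e]
  exact hA h

end Coordinates

end SL3Sylow

namespace SL3Sylow

/-! ### Semilinear automorphisms realizing a prescribed action on the Sylow subgroup. -/

section Twist

variable {p f : ℕ} {K : Type*} [Field K] [ExpChar K p] {ε : ℤˣ}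

theorem map_upperGL (σ : K ≃+* K) (a b c : K) :
    Matrix.GeneralLinearGroup.map (σ : K →+* K) (upperGL a b c) = upperGL (σ a) (σ b) (σ c) := by
  apply Units.ext
  ext i j
  rw [Matrix.GeneralLinearGroup.map_apply, coe_upperGL, coe_upperGL]
  fin_cases i <;> fin_cases j <;> simp

theorem unipBar_map_twistAut (d : GLe p f K ε) (σ : K ≃+* K) (N : GL (Fin 3) K) :
    (unipBar p f ε N).map (twistAut d σ : PSLe p f K ε →* PSLe p f K ε) =
      unipBar p f ε (d.1 * Matrix.GeneralLinearGroup.map (σ : K →+* K) N) := by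
  ext x
  constructor
  · rintro ⟨_, ⟨g, ⟨a, b, c, hg⟩, rfl⟩, rfl⟩
    refine ⟨twist d σ g, ⟨σ a, σ b, σ c, ?_⟩, rfl⟩
    rw [coe_twist, hg, ← map_upperGL, map_mul, map_mul, map_inv]
    group
  · rintro ⟨g, ⟨a, b, c, hg⟩, rfl⟩
    obtain ⟨g, rfl⟩ := (twistEquiv d σ).surjective g
    refine ⟨_, ⟨g, ⟨σ.symm a, σ.symm b, σ.symm c, ?_⟩, rfl⟩, rfl⟩
    rw [twistEquiv_apply, coe_twist] at hg
    have h1 : Function.Injective (Matrix.GeneralLinearGroup.map (n := Fin 3) (σ : K →+* K)) := by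
      intro A B hAB
      apply Units.ext
      ext i j
      have := congrArg (fun g : GL (Fin 3) K => g.1 i j) hAB
      exact σ.injective this
    apply h1
    rw [map_mul, map_mul, map_inv, map_upperGL, RingEquiv.apply_symm_apply, RingEquiv.apply_symm_apply,
      RingEquiv.apply_symm_apply]
    have h2 := congrArg (fun x => d.1⁻¹ * x * d.1) hg
    calc _ = d.1⁻¹ * (d.1 * Matrix.GeneralLinearGroup.map (σ : K →+* K) g.1 * d.1⁻¹) * d.1 := by group
      _ = _ := h2
      _ = _ := by group

end Twist

section Normalize

variable {p f : ℕ} {K : Type*} [Field K] [ExpChar K p] {M : GL (Fin 3) K}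
  {hbar : ∀ x : K, bar p f (bar p f x) = x}

theorem IsHermBasis.mul_inv_mem_GLe {N : GL (Fin 3) K} (hM : IsHermBasis p f M)
    (hN : IsHermBasis p f N) : M * N⁻¹ ∈ GLe p f K (-1) := by
  rw [mem_GLe, or_iff_right (by decide)]
  have h : (N⁻¹.1.map (bar p f))ᵀ * (N.1.map (bar p f))ᵀ = 1 := by
    rw [← Matrix.transpose_mul, ← Matrix.map_mul, ← Units.val_mul, mul_inv_cancel, Units.val_one,
      Matrix.map_one _ (map_zero _) (map_one _), Matrix.transpose_one]
  change ((M * N⁻¹).1.map (bar p f))ᵀ * (M * N⁻¹).1 = 1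
  rw [Units.val_mul, Matrix.map_mul, Matrix.transpose_mul, Matrix.mul_assoc, ← Matrix.mul_assoc _ M.1,
    hM, ← show _ = _ from hN, ← Matrix.mul_assoc, ← Matrix.mul_assoc, h, one_mul, ← Units.val_mul,
    mul_inv_cancel, Units.val_one]

theorem bar_comm (σ : K ≃+* K) (x : K) : bar p f (σ x) = σ (bar p f x) := by
  rw [iterateFrobenius_def, iterateFrobenius_def, map_pow]

theorem IsHermBasis.map (hM : IsHermBasis p f M) (σ : K ≃+* K) :
    IsHermBasis p f (Matrix.GeneralLinearGroup.map (σ : K →+* K) M) := by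
  have h := congrArg (fun N => N.map (σ : K →+* K)) (show _ = _ from hM)
  simp only [Matrix.map_mul] at h
  have h1 : (flipGL K).1.map (σ : K →+* K) = (flipGL K).1 := by
    ext i j
    fin_cases i <;> fin_cases j <;> simp [coe_flipGL]
  rw [h1] at h
  unfold IsHermBasis
  rw [← h]
  congr 1
  ext i j
  exact bar_comm σ _

variable (p f) in
/-- A diagonal matrix preserving the antidiagonal form. -/
def diagGL (r : Kˣ) : GL (Fin 3) K :=
  mono ![r, 1, (Units.map ((bar p f : K →+* K) : K →* K) r)⁻¹] 0

theorem preservesForm_diagGL (hbar : ∀ x : K, bar p f (bar p f x) = x) (r : Kˣ) :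
    PreservesForm p f (diagGL p f r) := by
  rw [preservesForm_iff]
  intro i j
  fin_cases i <;> fin_cases j <;> simp [diagGL, coe_mono_zero, coe_flipGL, hbar]

theorem isUpper_diagGL (r : Kˣ) : IsUpper (diagGL p f r) := by
  refine ⟨?_, ?_, ?_⟩ <;> rw [diagGL, coe_mono_zero] <;> rfl

theorem isUpper_flip_diagGL (r : Kˣ) : IsUpper (flipGL K * diagGL p f r * flipGL K) := by
  rw [diagGL]
  refine ⟨?_, ?_, ?_⟩ <;>
  rw [Units.val_mul, Units.val_mul, Matrix.mul_apply, Fin.sum_univ_three, Matrix.mul_apply,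
      Matrix.mul_apply, Matrix.mul_apply, Fin.sum_univ_three, Fin.sum_univ_three, Fin.sum_univ_three,
      coe_mono_zero] <;> simp [coe_flipGL]

/-- Every semilinear action on a Sylow subgroup modulo its centre comes from a semilinear
automorphism. -/
theorem exists_twistAut (hbar : ∀ x : K, bar p f (bar p f x) = x) (hM : IsHermBasis p f M) (r : Kˣ)
    (σ : K ≃+* K) : ∃ γ ∈ semilinearAut p f K (-1),
      (unipBar p f (-1) M).map (γ : PSLe p f K (-1) →* PSLe p f K (-1)) = unipBar p f (-1) M ∧
      (unipBar p f (-1) (M * flipGL K)).map (γ : PSLe p f K (-1) →* PSLe p f K (-1)) =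
        unipBar p f (-1) (M * flipGL K) ∧
      ∀ {a b : K} (h : b + bar p f b + a * bar p f a = 0),
      ∃ b' h', γ (ux hbar hM h : PSLe p f K (-1)) =
        (ux hbar hM (a := r * σ a) (b := b') h' : PSLe p f K (-1)) := by
  have hd := (hM.mul (preservesForm_diagGL hbar r)).mul_inv_mem_GLe (hM.map σ)
  refine ⟨twistAut ⟨_, hd⟩ σ, ⟨_, _, rfl⟩, ?_, ?_, ?_⟩
  · rw [unipBar_map_twistAut, inv_mul_cancel_right, (isUpper_diagGL r).unipBar_mul]
  · have h1 : Matrix.GeneralLinearGroup.map (σ : K →+* K) (flipGL K) = flipGL K := by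
      apply Units.ext
      ext i j
      rw [Matrix.GeneralLinearGroup.map_apply, coe_flipGL]
      fin_cases i <;> fin_cases j <;> simp
    rw [unipBar_map_twistAut, map_mul, h1, ← mul_assoc, inv_mul_cancel_right]
    have h2 : M * diagGL p f r * flipGL K =
        M * flipGL K * (flipGL K * diagGL p f r * flipGL K) := by
      calc _ = M * (flipGL K * flipGL K) * diagGL p f r * flipGL K := by
            rw [flipGL_mul_self, mul_one]
        _ = _ := by group
    rw [h2, (isUpper_flip_diagGL r).unipBar_mul]
  · intro a b h
    refine ⟨r * bar p f (r : K) * σ b, ?_, ?_⟩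
    · have h' := congrArg σ h
      simp only [map_add, map_mul, map_zero, hbar, bar_comm] at h' ⊢
      linear_combination r * bar p f (r : K) * h'
    · rw [twistAut_mk]
      congr 1
      apply Subtype.ext
      have hr : bar p f (r : K) ≠ 0 := (map_ne_zero _).mpr r.ne_zero
      have e := mono_mul_upperGL ![r, 1, (Units.map ((bar p f : K →+* K) : K →* K) r)⁻¹] (σ a) (σ b)
        (σ (-bar p f a))
      have e2 : upperGL (r * σ a) (r * bar p f (r : K) * σ b) (-bar p f (r * σ a)) * diagGL p f r =
          diagGL p f r * upperGL (σ a) (σ b) (σ (-bar p f a)) := by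
        rw [diagGL, e]
        congr 2
        · simp
        · simp
        · simp [bar_comm]
      rw [coe_twist, coe_ux, coe_ux, map_mul, map_mul, map_inv, map_upperGL]
      calc _ = M * (diagGL p f r * upperGL (σ a) (σ b) (σ (-bar p f a))) * (diagGL p f r)⁻¹ * M⁻¹ := by
            group
        _ = _ := by rw [← e2]; group

end Normalize

/-! ### Automorphisms trivial on a Sylow `p`-subgroup modulo its centre. -/

section Rigidity

variable {p f : ℕ} {K : Type*} [Field K] [ExpChar K p] {M : GL (Fin 3) K}
  {hbar : ∀ x : K, bar p f (bar p f x) = x} {z : Kˣ} {β : MulAut (PSLe p f K (-1))}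

/-- A central element is a commutator of elements over `z * b` and 1, and such a commutator depends
only on classes modulo the centre. -/
theorem map_ux_central (hz : z ∈ scalars p f K (-1)) (hz1 : z ≠ 1) (hz3 : z ^ 3 = 1)
    (hM : IsHermBasis p f M)
    (hβ : ∀ {a b : K} (h : b + bar p f b + a * bar p f a = 0), ∃ b' h',
      β (ux hbar hM h : PSLe p f K (-1)) = (ux hbar hM (a := a) (b := b') h' : PSLe p f K (-1)))
    {b : K} (h : b + bar p f b + 0 * bar p f 0 = 0) :
    β (ux hbar hM h : PSLe p f K (-1)) = (ux hbar hM h : PSLe p f K (-1)) := by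
  have key : ∀ {c c₁ : K} (hc : c + bar p f c + (z * b) * bar p f (z * b) = 0)
      (hc₁ : c₁ + bar p f c₁ + 1 * bar p f 1 = 0),
      ux hbar hM hc * ux hbar hM hc₁ = ux hbar hM h * (ux hbar hM hc₁ * ux hbar hM hc) := by
    intro c c₁ hc hc₁
    obtain ⟨h1, e1⟩ := ux_mul (hbar := hbar) hM hc hc₁
    obtain ⟨h2, e2⟩ := ux_mul (hbar := hbar) hM hc₁ hc
    obtain ⟨h3, e3⟩ := ux_mul (hbar := hbar) hM h h2
    rw [e1, e2, e3]
    obtain ⟨h4, e4⟩ := ux_congr (hbar := hbar) hM h1 (a' := 0 + (1 + z * b))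
      (b' := b + (c₁ + c - 1 * bar p f (z * b)) - 0 * bar p f (1 + z * b)) (by ring) (by
        have hb : bar p f b = -b := by linear_combination h
        rw [map_one, map_mul, bar_cube_root hz hz3, hb]
        linear_combination -b * cube_root_sum hz1 hz3)
    exact e4
  obtain ⟨c, hc⟩ : ∃ c, c + bar p f c + (z * b) * bar p f (z * b) = 0 :=
    ⟨_, ux_relation hz hz1 hz3 hbar (z * b)⟩
  obtain ⟨c₁, hc₁⟩ : ∃ c, c + bar p f c + 1 * bar p f (1 : K) = 0 :=
    ⟨_, ux_relation hz hz1 hz3 hbar 1⟩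
  obtain ⟨c', hc', ec⟩ := hβ hc
  obtain ⟨c₁', hc₁', ec₁⟩ := hβ hc₁
  have e1 := congrArg (fun g : SLe p f K (-1) => β (g : PSLe p f K (-1))) (key hc hc₁)
  have e2 := congrArg (fun g : SLe p f K (-1) => (g : PSLe p f K (-1))) (key hc' hc₁')
  simp only [QuotientGroup.mk_mul, map_mul, ec, ec₁] at e1 e2
  rw [e2] at e1
  exact (mul_right_cancel e1).symm

/-- `β` changes `b` by an additive function `μ` of `a`. A torus element of norm 1 acts on `a` by
`t³` and trivially on `b`; so `μ` vanishes on multiples of `t³ - 1`, which is nonzero for a suitable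
`t` when `q > 2`. -/
theorem map_ux_eq [Finite K] (hK : Nat.card K = (p ^ f) ^ 2) (hq : 2 < p ^ f)
    (hz : z ∈ scalars p f K (-1)) (hz1 : z ≠ 1) (hz3 : z ^ 3 = 1)
    (hM : IsHermBasis p f M)
    (hV : (unipBar p f (-1) M).map (β : PSLe p f K (-1) →* PSLe p f K (-1)) = unipBar p f (-1) M)
    (hV' : (unipBar p f (-1) (M * flipGL K)).map (β : PSLe p f K (-1) →* PSLe p f K (-1)) =
      unipBar p f (-1) (M * flipGL K))
    (hβ : ∀ {a b : K} (h : b + bar p f b + a * bar p f a = 0), ∃ b' h',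
      β (ux hbar hM h : PSLe p f K (-1)) = (ux hbar hM (a := a) (b := b') h' : PSLe p f K (-1)))
    {a b : K} (h : b + bar p f b + a * bar p f a = 0) :
    β (ux hbar hM h : PSLe p f K (-1)) = (ux hbar hM h : PSLe p f K (-1)) := by
  choose B hB eB using fun a : K => hβ (ux_relation hz hz1 hz3 hbar a)
  let μ : K → K := fun a => B a - z * (a * bar p f a)
  have hμ : ∀ {a b : K} (h : b + bar p f b + a * bar p f a = 0), ∃ h',
      β (ux hbar hM h : PSLe p f K (-1)) =
        (ux hbar hM (a := a) (b := b + μ a) h' : PSLe p f K (-1)) := by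
    intro a b h
    have h1 := ux_relation hz hz1 hz3 hbar a
    have h2 : (b - z * (a * bar p f a)) + bar p f (b - z * (a * bar p f a)) + 0 * bar p f 0 = 0 := by
      rw [map_sub, zero_mul]
      linear_combination h - h1
    have e3 := map_ux_central hz hz1 hz3 hM hβ h2
    obtain ⟨h4, e4⟩ := ux_mul (hbar := hbar) hM h1 h2
    obtain ⟨h5, e5⟩ := ux_congr (hbar := hbar) hM h4 (a' := a) (b' := b) (by ring)
      (by rw [map_zero]; ring)
    obtain ⟨h6, e6⟩ := ux_mul (hbar := hbar) hM (hB a) h2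
    obtain ⟨h7, e7⟩ := ux_congr (hbar := hbar) hM h6 (a' := a) (b' := b + μ a) (by rw [add_zero])
      (by rw [map_zero]; ring)
    refine ⟨h7, ?_⟩
    rw [← e7, ← e6, ← e5, ← e4, QuotientGroup.mk_mul, map_mul, eB, e3, QuotientGroup.mk_mul]
  have hadd : ∀ a a', μ (a + a') = μ a + μ a' := by
    intro a a'
    have k1 := ux_relation hz hz1 hz3 hbar a
    have k2 := ux_relation hz hz1 hz3 hbar a'
    obtain ⟨h1, e1⟩ := ux_mul (hbar := hbar) hM k1 k2
    obtain ⟨h2, e2⟩ := hμ k1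
    obtain ⟨h3, e3⟩ := hμ k2
    obtain ⟨h4, e4⟩ := ux_mul (hbar := hbar) hM h2 h3
    obtain ⟨h5, e5⟩ := hμ h1
    rw [← e1, QuotientGroup.mk_mul, map_mul, e2, e3, ← QuotientGroup.mk_mul, e4] at e5
    linear_combination -(mk_ux_injective hz hz1 hz3 hM e5).2
  have htor : ∀ (t : Kˣ) (a : K), μ (t ^ 2 / bar p f (t : K) * a) = t * bar p f (t : K) * μ a := by
    intro t
    obtain ⟨s, hs⟩ := exists_map_torus (hbar := hbar) hM hz hz1 hz3 hV hV' t
    have key : ∀ {a b : K} (h : b + bar p f b + a * bar p f a = 0),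
        t ^ 2 / bar p f (t : K) * a = s ^ 2 / bar p f (s : K) * a ∧
        t * bar p f (t : K) * b + μ (t ^ 2 / bar p f (t : K) * a) =
          s * bar p f (s : K) * (b + μ a) := by
      intro a b h
      obtain ⟨h1, e1⟩ := torus_mul_ux (hbar := hbar) hM t h
      obtain ⟨h2, e2⟩ := hμ h
      obtain ⟨h3, e3⟩ := hμ h1
      obtain ⟨h4, e4⟩ := torus_mul_ux (hbar := hbar) hM s h2
      have e5 := congrArg (fun g : SLe p f K (-1) => β (g : PSLe p f K (-1))) e1
      simp only [QuotientGroup.mk_mul, map_mul, hs, e2, e3] at e5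
      rw [← QuotientGroup.mk_mul, e4, QuotientGroup.mk_mul, mul_left_inj] at e5
      have := mk_ux_injective hz hz1 hz3 hM e5
      exact ⟨this.1.symm, this.2.symm⟩
    have hμ0 : μ 0 = 0 := by
      have := hadd 0 0
      rwa [add_zero, left_eq_add] at this
    have h3 : (z : K) - z ^ 2 ≠ 0 := by
      intro h
      have h1 : (z : K) * (1 - z) = 0 := by linear_combination h
      rcases mul_eq_zero.mp h1 with h1 | h1
      · exact z.ne_zero h1
      · exact hz1 (Units.ext (sub_eq_zero.mp h1).symm)
    have h4 : (z : K) ^ 3 = 1 := by rw [← Units.val_pow_eq_pow_val, hz3, Units.val_one]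
    -- Comparison on the central element with `b = z - z²`, a nonzero element of trace 0.
    have hn : (t : K) * bar p f (t : K) = s * bar p f (s : K) := by
      have := (key (a := 0) (b := (z : K) - z ^ 2) (by
        rw [map_sub, map_pow, bar_cube_root hz hz3]
        linear_combination -(z : K) * h4)).2
      rw [mul_zero, hμ0, add_zero, add_zero] at this
      exact mul_right_cancel₀ h3 this
    intro a
    have := (key (ux_relation hz hz1 hz3 hbar a)).2
    rw [← hn] at this
    linear_combination this
  obtain ⟨t, ht, ht3⟩ := exists_norm_one_cube_ne hK hq
  have ht0 : t ≠ 0 := left_ne_zero_of_mul_eq_one ht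
  have htb : bar p f t = t⁻¹ := eq_inv_of_mul_eq_one_right ht
  have hμ0 : ∀ a, μ a = 0 := by
    intro a
    have h1 := htor (Units.mk0 t ht0) (a / (t ^ 3 - 1))
    have h2 := hadd (a / (t ^ 3 - 1)) a
    have h3 := sub_ne_zero.mpr ht3
    rw [Units.val_mk0, ht, one_mul, htb, div_inv_eq_mul, ← pow_succ] at h1
    have e : t ^ (2 + 1) * (a / (t ^ 3 - 1)) = a / (t ^ 3 - 1) + a := by
      field_simp
      ring
    rw [e, h2] at h1
    linear_combination h1
  obtain ⟨h1, e1⟩ := hμ h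
  obtain ⟨h2, e2⟩ := ux_congr (hbar := hbar) hM h1 (a' := a) (b' := b) rfl (by rw [hμ0, add_zero])
  rw [e1, e2]

/-- All other conjugates of the Sylow subgroup come from the opposite one by elements that `β`
fixes, so `β` preserves every one of them. Hence `g⁻¹ β(g)` normalizes all of them, and an element
lying in the torus and in a unipotent conjugate of it is scalar. -/
theorem eq_one_of_map_ux (hz : z ∈ scalars p f K (-1)) (hz1 : z ≠ 1) (hz3 : z ^ 3 = 1)
    (hM : IsHermBasis p f M)
    (hV : (unipBar p f (-1) M).map (β : PSLe p f K (-1) →* PSLe p f K (-1)) = unipBar p f (-1) M)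
    (hV' : (unipBar p f (-1) (M * flipGL K)).map (β : PSLe p f K (-1) →* PSLe p f K (-1)) =
      unipBar p f (-1) (M * flipGL K))
    (hβ : ∀ {a b : K} (h : b + bar p f b + a * bar p f a = 0),
      β (ux hbar hM h : PSLe p f K (-1)) = (ux hbar hM h : PSLe p f K (-1))) : β = 1 := by
  have hpres : ∀ g : SLe p f K (-1), (unipBar p f (-1) (g.1 * M)).map
      (β : PSLe p f K (-1) →* PSLe p f K (-1)) = unipBar p f (-1) (g.1 * M) := by
    intro g
    rcases hM.unipBar_smul_cases hbar g with h | ⟨u, hu, h⟩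
    · rw [h, hV]
    · obtain ⟨a, b, h', rfl⟩ := exists_ux_of_mem_unip (hbar := hbar) hM hu
      rw [h, unipBar_smul, ← map_mul_aut, mul_conj, map_mul_aut, hV', hβ]
  have hpres' : ∀ g g' : SLe p f K (-1), β (g : PSLe p f K (-1)) = g' →
      unipBar p f (-1) (g.1 * M) = unipBar p f (-1) (g'.1 * M) := by
    intro g g' h
    rw [← hpres, unipBar_smul, unipBar_smul, ← map_mul_aut, mul_conj, map_mul_aut, hV, h]
  ext x
  obtain ⟨g, rfl⟩ := QuotientGroup.mk_surjective x
  obtain ⟨g', hg'⟩ := QuotientGroup.mk_surjective (β (g : PSLe p f K (-1)))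
  rw [MulAut.one_apply, ← hg', eq_comm, QuotientGroup.eq]
  have hn : ∀ y : SLe p f K (-1), unipBar p f (-1) ((g⁻¹ * g').1 * (y.1 * M)) =
      unipBar p f (-1) (y.1 * M) := by
    intro y
    obtain ⟨y', hy'⟩ := QuotientGroup.mk_surjective (β (y : PSLe p f K (-1)))
    have h1 := hpres' y y' hy'.symm
    have h2 := hpres' (g * y) (g' * y') (by
      rw [QuotientGroup.mk_mul, map_mul, ← hg', ← hy', QuotientGroup.mk_mul])
    rw [Subgroup.coe_mul, Subgroup.coe_mul, mul_assoc, mul_assoc, unipBar_smul, unipBar_smul g', ← h1] at h2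
    rw [unipBar_smul, QuotientGroup.mk_mul, map_mul, map_mul_aut, ← h2, ← map_mul_aut, ← map_mul,
      QuotientGroup.mk_inv, inv_mul_cancel, map_one]
    exact Subgroup.map_id _
  set n := g⁻¹ * g' with hn'
  have hmul : ∀ (y : SLe p f K (-1)) {N : GL (Fin 3) K}, IsHermBasis p f N →
      IsHermBasis p f (y.1 * N) := by
    intro y N hN
    have h3 : y.1 = N * (N⁻¹ * y.1 * N) * N⁻¹ := by group
    have h4 := hN.mul (hN.conj_mem_SLe.mp (h3 ▸ y.2)).1
    rwa [show N * (N⁻¹ * y.1 * N) = y.1 * N by group] at h4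
  have hup : ∀ {N : GL (Fin 3) K}, IsHermBasis p f N →
      unipBar p f (-1) (n.1 * N) = unipBar p f (-1) N → IsUpper (N⁻¹ * n.1 * N) := by
    intro N hN h
    rw [mul_assoc]
    exact (hmul n hN).isUpper_of_unipBar_eq hbar hz hz1 hz3 h
  obtain ⟨w, hwX⟩ := hM.exists_flip
  have hw := hwX 1
  rw [mul_one, mul_one] at hw
  have htor : ∀ u ∈ unip p f (-1) M, ∀ hu : IsHermBasis p f (u.1 * M), ∃ t,
      n = torus hbar hu t := by
    intro u _ hu
    refine exists_eq_torus hu (hup hu (hn u)) (hup hu.flip ?_)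
    have h1 := hn (u * w)
    rw [Subgroup.coe_mul _ u w, mul_assoc] at h1
    rw [mul_assoc u.1, unipBar_smul, unipBar_smul, ← hw, ← unipBar_smul, ← unipBar_smul]
    exact h1
  obtain ⟨t, ht⟩ := htor 1 (one_mem _) (hmul 1 hM)
  let u := ux hbar hM (ux_relation hz hz1 hz3 hbar 1)
  obtain ⟨t', ht'⟩ := htor u (ux_mem_unip hM _) (hmul u hM)
  rw [ht] at ht'
  have e := congrArg Subtype.val ht'
  rw [coe_torus, coe_torus, Subgroup.coe_one, one_mul] at e
  set U := upperGL (1 : K) (z * (1 * bar p f (1 : K))) (-bar p f (1 : K)) with hU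
  have e1 : torusGL p f t * U =
      U * torusGL p f t' := by
    have h1 : u.1 * M = M * U := inv_mul_cancel_right (M * U) M
    rw [h1] at e
    have h2 := congrArg (fun x => M⁻¹ * x * M * U) e
    calc _ = M⁻¹ * (M * torusGL p f t * M⁻¹) * M * U := by
          group
      _ = _ := h2
      _ = _ := by group
  have e2 : ∀ i j, (torusGL p f t * U).1 i j =
      (U * torusGL p f t').1 i j := fun i j => by rw [e1]
  have e00 := e2 0 0
  have e01 := e2 0 1
  have e11 := e2 1 1
  have e12 := e2 1 2
  have e22 := e2 2 2
  rw [Units.val_mul, Units.val_mul, Matrix.mul_apply, Matrix.mul_apply, Fin.sum_univ_three,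
    Fin.sum_univ_three, torusGL, torusGL, coe_mono_zero, coe_mono_zero, hU, coe_upperGL] at e00 e01 e11 e12 e22
  simp at e00 e01 e11 e12 e22
  rw [mem_center_SLe hz hz1 hz3]
  refine ⟨t, ?_⟩
  rw [ht, coe_torus]
  have h1 : torusGL p f t = mono (fun _ => t) 0 := by
    rw [torusGL]
    congr 1
    ext i
    fin_cases i
    · rfl
    · simp
      rw [e11, ← e01]
    · simp
      rw [e22, ← e12, e11, ← e01]
  rw [h1, Subgroup.coe_one, one_mul, mul_assoc, mono_const_comm, mul_inv_cancel_left]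

end Rigidity

end SL3Sylow

namespace SL3Sylow

/-! ### The case `q = 2` and the automorphisms of `PSU₃(q)`. -/

section FourElements

variable {p f : ℕ} {K : Type*} [Field K] [ExpChar K p] {M : GL (Fin 3) K}
  {hbar : ∀ x : K, bar p f (bar p f x) = x} {z : Kˣ} {β : MulAut (PSLe p f K (-1))}

theorem eq_of_card_four [Finite K] (hK : Nat.card K = 4) (hz1 : z ≠ 1) (hz3 : z ^ 3 = 1) (x : K) :
    x = 0 ∨ x = 1 ∨ x = z ∨ x = -z - 1 := by
  have := Fintype.ofFinite K
  have h1 := FiniteField.pow_card x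
  rw [← Nat.card_eq_fintype_card, hK] at h1
  have h2 : x * (x - 1) * (x - z) * (x - (-z - 1)) = 0 := by
    linear_combination h1 - x * (x - 1) * cube_root_sum hz1 hz3
  rcases mul_eq_zero.mp h2 with h2 | h2
  · rcases mul_eq_zero.mp h2 with h2 | h2
    · rcases mul_eq_zero.mp h2 with h2 | h2
      · exact Or.inl h2
      · exact Or.inr (Or.inl (sub_eq_zero.mp h2))
    · exact Or.inr (Or.inr (Or.inl (sub_eq_zero.mp h2)))
  · exact Or.inr (Or.inr (Or.inr (sub_eq_zero.mp h2)))

/-- An additive bijection of the field with four elements is semilinear. -/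
theorem exists_semilinear_of_card_four [Finite K] (hK : Nat.card K = 4) (hz : z ∈ scalars p f K (-1))
    (hz1 : z ≠ 1) (hz3 : z ^ 3 = 1) (A : K →+ K) (hA : ∀ a, A a = 0 → a = 0) :
    ∃ (r : Kˣ) (σ : K ≃+* K), ∀ a, A a = r * σ a := by
  have h1 : A 1 ≠ 0 := fun h => one_ne_zero (hA _ h)
  have key : ∀ σ : K ≃+* K, A z = A 1 * σ z → ∀ a, A a = A 1 * σ a := by
    intro σ h a
    rcases eq_of_card_four hK hz1 hz3 a with rfl | rfl | rfl | rfl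
    · rw [map_zero, map_zero, mul_zero]
    · rw [map_one σ, mul_one]
    · exact h
    · rw [map_sub, map_neg, h, map_sub, map_neg, map_one σ]
      ring
  have h2 : A z / A 1 ≠ 1 := by
    intro h
    rw [div_eq_one_iff_eq h1] at h
    have h3 : A (z - 1) = 0 := by rw [map_sub, h, sub_self]
    exact hz1 (Units.ext (sub_eq_zero.mp (hA _ h3)))
  refine ⟨Units.mk0 _ h1, ?_⟩
  rcases eq_of_card_four hK hz1 hz3 (A z / A 1) with h | h | h | h
  · rcases div_eq_zero_iff.mp h with h | h
    · exact absurd (hA _ h) z.ne_zero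
    · exact absurd h h1
  · exact absurd h h2
  · exact ⟨RingEquiv.refl K, key _ (by rw [div_eq_iff h1] at h; rw [h, mul_comm]; rfl)⟩
  · refine ⟨RingEquiv.ofBijective (bar p f)
      ⟨iterateFrobenius_inj K p f, Finite.surjective_of_injective (iterateFrobenius_inj K p f)⟩, key _ ?_⟩
    change _ = _ * bar p f (z : K)
    rw [div_eq_iff h1] at h
    rw [h, bar_cube_root hz hz3]
    linear_combination -(A 1) * cube_root_sum hz1 hz3

/-- For `q = 2` all `t² / t̄` are 1 and the torus gives nothing, but every additive bijection of the
field with four elements is semilinear. -/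
theorem exists_semilinear_of_le [Finite K] (hK : Nat.card K = (p ^ f) ^ 2) (hq : 2 ≤ p ^ f)
    (hz : z ∈ scalars p f K (-1)) (hz1 : z ≠ 1)
    (hz3 : z ^ 3 = 1) (hM : IsHermBasis p f M)
    (hβ : (unipBar p f (-1) M).map (β : PSLe p f K (-1) →* PSLe p f K (-1)) = unipBar p f (-1) M)
    (hβ' : (unipBar p f (-1) (M * flipGL K)).map (β : PSLe p f K (-1) →* PSLe p f K (-1)) =
      unipBar p f (-1) (M * flipGL K)) :
    ∃ (r : Kˣ) (σ : K ≃+* K), ∀ {a b : K} (h : b + bar p f b + a * bar p f a = 0),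
      ∃ b' h', β (ux hbar hM h : PSLe p f K (-1)) =
        (ux hbar hM (a := r * σ a) (b := b') h' : PSLe p f K (-1)) := by
  rcases hq.lt_or_eq with hq | hq
  · exact exists_semilinear hK hq hz hz1 hz3 hM hβ hβ'
  · obtain ⟨A, hA0, hA⟩ := exists_additive hbar hz hz1 hz3 hM hβ
    rw [← hq] at hK
    obtain ⟨r, σ, h⟩ := exists_semilinear_of_card_four hK hz hz1 hz3 A hA0
    refine ⟨r, σ, fun {a b} h' => ?_⟩
    rw [← h]
    exact hA h'

/-- Equal Sylow subgroups in the big cell make the quotient of the two unipotent matrices lower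
triangular as well. -/
theorem eq_of_unipBar_ux_flip (hz : z ∈ scalars p f K (-1)) (hz1 : z ≠ 1) (hz3 : z ^ 3 = 1)
    (hM : IsHermBasis p f M) {a b a' b' : K} (h : b + bar p f b + a * bar p f a = 0)
    (h' : b' + bar p f b' + a' * bar p f a' = 0)
    (e : unipBar p f (-1) ((ux hbar hM h).1 * (M * flipGL K)) =
      unipBar p f (-1) ((ux hbar hM h').1 * (M * flipGL K))) : a = a' := by
  have e1 : ∀ {a b : K} (h : b + bar p f b + a * bar p f a = 0),
      (ux hbar hM h).1 * (M * flipGL K) = M * (upperGL a b (-bar p f a) * flipGL K) := by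
    intro a b h
    rw [coe_ux]
    group
  rw [e1 h, e1 h'] at e
  have h1 := (hM.mul ((preservesForm_upperGL hbar h).mul preservesForm_flipGL)).isUpper_of_unipBar_eq
    hbar hz hz1 hz3 e
  have h2 : (M * (upperGL a' b' (-bar p f a') * flipGL K))⁻¹ *
      (M * (upperGL a b (-bar p f a) * flipGL K)) =
      flipGL K * ((upperGL a' b' (-bar p f a'))⁻¹ * upperGL a b (-bar p f a)) * flipGL K := by
    rw [mul_inv_rev, mul_inv_rev, inv_eq_of_mul_eq_one_left flipGL_mul_self]
    group
  rw [h2, upperGL_inv, upperGL_mul] at h1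
  have h3 := (eq_of_upper_of_flip h1).1
  change -a' + a = 0 at h3
  linear_combination h3

/-- The flip maps the Sylow subgroup of an isotropic line in the big cell to another such one. -/
theorem exists_unipBar_flip_ux (hM : IsHermBasis p f M) {w : SLe p f K (-1)}
    (hw : ∀ X : GL (Fin 3) K,
      unipBar p f (-1) (w.1 * (M * X)) = unipBar p f (-1) (M * (flipGL K * X)))
    {a b : K} (h : b + bar p f b + a * bar p f a = 0) (hb : b ≠ 0) :
    ∃ (a₁ b₁ : K) (h₁ : b₁ + bar p f b₁ + a₁ * bar p f a₁ = 0), a₁ * bar p f b = a ∧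
      unipBar p f (-1) (w.1 * ((ux hbar hM h).1 * (M * flipGL K))) =
        unipBar p f (-1) ((ux hbar hM h₁).1 * (M * flipGL K)) := by
  have e1 : ∀ {a b : K} (h : b + bar p f b + a * bar p f a = 0),
      (ux hbar hM h).1 * (M * flipGL K) = M * (upperGL a b (-bar p f a) * flipGL K) := by
    intro a b h
    rw [coe_ux]
    group
  have hX : PreservesForm p f (flipGL K * (upperGL a b (-bar p f a) * flipGL K)) :=
    preservesForm_flipGL.mul ((preservesForm_upperGL hbar h).mul preservesForm_flipGL)
  have ex : ∀ i, (flipGL K * (upperGL a b (-bar p f a) * flipGL K)).1 i 0 =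
      (upperGL a b (-bar p f a)).1 (2 - i) 2 := by
    intro i
    rw [Units.val_mul, Units.val_mul, Matrix.mul_apply, Fin.sum_univ_three, Matrix.mul_apply,
      Matrix.mul_apply, Matrix.mul_apply, Fin.sum_univ_three, Fin.sum_univ_three, Fin.sum_univ_three]
    fin_cases i <;> simp [coe_flipGL]
  rw [e1, hw]
  rcases hX.bruhat hbar with hu | ⟨a₁, b₁, Y, h₁, hY, e⟩
  · have := hu.2.1
    rw [ex] at this
    exact absurd this hb
  · refine ⟨a₁, b₁, h₁, ?_, ?_⟩
    · have ey : ∀ i, (upperGL a₁ b₁ (-bar p f a₁) * flipGL K * Y).1 i 0 =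
          (upperGL a₁ b₁ (-bar p f a₁)).1 i 2 * Y.1 0 0 := by
        intro i
        rw [Units.val_mul, Units.val_mul, Matrix.mul_apply, Fin.sum_univ_three, Matrix.mul_apply,
          Matrix.mul_apply, Matrix.mul_apply, Fin.sum_univ_three, Fin.sum_univ_three,
          Fin.sum_univ_three, hY.1, hY.2.1]
        fin_cases i <;> simp [coe_flipGL]
      have e2 := ey 2
      have e3 := ey 1
      rw [← e, ex] at e2 e3
      change b = 1 * Y.1 0 0 at e2
      change -bar p f a = -bar p f a₁ * Y.1 0 0 at e3
      rw [one_mul] at e2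
      rw [← e2] at e3
      have e4 := congrArg (bar p f) e3
      rw [map_neg, map_mul, map_neg, hbar, hbar] at e4
      linear_combination e4
    · rw [e1, e, ← mul_assoc, hY.unipBar_mul]

/-- For `q = 2` the torus is scalar, so `β` fixes the Weyl element `w`. The flip sends the line with
coordinates `(a, b)` to one with first coordinate `a / b̄`; since `β` preserves first coordinates,
it preserves `b`. -/
theorem map_ux_eq_of_le [Finite K] (hK : Nat.card K = (p ^ f) ^ 2) (hq : 2 ≤ p ^ f)
    (hz : z ∈ scalars p f K (-1)) (hz1 : z ≠ 1) (hz3 : z ^ 3 = 1)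
    (hM : IsHermBasis p f M)
    (hV : (unipBar p f (-1) M).map (β : PSLe p f K (-1) →* PSLe p f K (-1)) = unipBar p f (-1) M)
    (hV' : (unipBar p f (-1) (M * flipGL K)).map (β : PSLe p f K (-1) →* PSLe p f K (-1)) =
      unipBar p f (-1) (M * flipGL K))
    (hβ : ∀ {a b : K} (h : b + bar p f b + a * bar p f a = 0), ∃ b' h',
      β (ux hbar hM h : PSLe p f K (-1)) = (ux hbar hM (a := a) (b := b') h' : PSLe p f K (-1)))
    {a b : K} (h : b + bar p f b + a * bar p f a = 0) :
    β (ux hbar hM h : PSLe p f K (-1)) = (ux hbar hM h : PSLe p f K (-1)) := by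
  rcases hq.lt_or_eq with hq | hq
  · exact map_ux_eq hK hq hz hz1 hz3 hM hV hV' hβ h
  obtain ⟨w, hw⟩ := hM.exists_flip
  have hwM := hw 1
  rw [mul_one, mul_one] at hwM
  have hwM' := hw (flipGL K)
  rw [flipGL_mul_self, mul_one] at hwM'
  have hmap : ∀ {g g' : SLe p f K (-1)} {H : Subgroup (PSLe p f K (-1))},
      β (g : PSLe p f K (-1)) = (g' : PSLe p f K (-1)) →
      (H.map (MulAut.conj (g : PSLe p f K (-1)) : _ →* PSLe p f K (-1))).map
        (β : PSLe p f K (-1) →* PSLe p f K (-1)) =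
      (H.map (β : PSLe p f K (-1) →* PSLe p f K (-1))).map
        (MulAut.conj (g' : PSLe p f K (-1)) : _ →* PSLe p f K (-1)) := by
    intro g g' H e
    rw [← map_mul_aut, mul_conj, map_mul_aut, e]
  -- `w⁻¹ β(w)` normalizes both Sylow subgroups and lies in the torus, which consists of scalars
  -- because `t̄ = t²` and `t³ = 1`.
  have hβw : β (w : PSLe p f K (-1)) = (w : PSLe p f K (-1)) := by
    obtain ⟨g', hg'⟩ := QuotientGroup.mk_surjective (β (w : PSLe p f K (-1)))
    have hgen : ∀ {N : GL (Fin 3) K}, IsHermBasis p f N →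
        (unipBar p f (-1) N).map (β : PSLe p f K (-1) →* PSLe p f K (-1)) = unipBar p f (-1) N →
        (unipBar p f (-1) (w.1 * N)).map (β : PSLe p f K (-1) →* PSLe p f K (-1)) =
          unipBar p f (-1) (w.1 * N) → IsUpper (N⁻¹ * (w⁻¹ * g' : SLe p f K (-1)).1 * N) := by
      intro N hN h1 h2
      rw [unipBar_smul, hmap hg'.symm, h1, ← unipBar_smul, ← unipBar_smul] at h2
      have h3 : IsHermBasis p f (g'.1 * N) := by
        have h3 : g'.1 = N * (N⁻¹ * g'.1 * N) * N⁻¹ := by group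
        have h4 := hN.mul (hN.conj_mem_SLe.mp (h3 ▸ g'.2)).1
        rwa [show N * (N⁻¹ * g'.1 * N) = g'.1 * N by group] at h4
      have h4 := h3.isUpper_of_unipBar_eq hbar hz hz1 hz3 h2
      rw [Subgroup.coe_mul, Subgroup.coe_inv]
      rwa [mul_inv_rev, show N⁻¹ * w.1⁻¹ * (g'.1 * N) = N⁻¹ * (w.1⁻¹ * g'.1) * N by group] at h4
    obtain ⟨t, ht⟩ := exists_eq_torus (hbar := hbar) hM
      (hgen hM hV (by rw [hwM, hV'])) (hgen hM.flip hV' (by rw [hwM', hV]))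
    rw [← hg', eq_comm, QuotientGroup.eq, ht, mem_center_SLe hz hz1 hz3]
    have h2 : Units.map ((bar p f : K →+* K) : K →* K) t = t ^ 2 := by
      ext
      change bar p f (t : K) = _
      rw [iterateFrobenius_def, ← hq, Units.val_pow_eq_pow_val]
    have h3 : t ^ 3 = 1 := by
      have := pow_card_eq_one' (x := t)
      rwa [Nat.card_units, hK, ← hq] at this
    have h4 : torusGL p f t = mono (fun _ => t) 0 := by
      rw [torusGL, h2]
      congr 1
      ext1 i
      fin_cases i
      · rfl
      · change t ^ 2 / t = t
        rw [pow_two, mul_div_cancel_right]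
      · change (t ^ 2)⁻¹ = t
        rw [inv_eq_iff_mul_eq_one, ← pow_succ, h3]
    refine ⟨t, ?_⟩
    rw [coe_torus, h4, mul_assoc, mono_const_comm, mul_inv_cancel_left]
  by_cases ha : a = 0
  · subst ha
    exact map_ux_central hz hz1 hz3 hM hβ h
  have hb0 : ∀ {b : K}, b + bar p f b + a * bar p f a = 0 → b ≠ 0 := by
    rintro b h rfl
    rw [map_zero, add_zero, zero_add, mul_eq_zero, map_eq_zero] at h
    exact h.elim ha ha
  obtain ⟨b', h', e⟩ := hβ h
  obtain ⟨a₁, b₁, h₁, k₁, e₁⟩ := exists_unipBar_flip_ux (hbar := hbar) hM hw h (hb0 h)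
  obtain ⟨a₂, b₂, h₂, k₂, e₂⟩ := exists_unipBar_flip_ux (hbar := hbar) hM hw h' (hb0 h')
  obtain ⟨b₁', h₁', e₁'⟩ := hβ h₁
  have e3 := congrArg (fun H => H.map (β : PSLe p f K (-1) →* PSLe p f K (-1))) e₁
  simp only [unipBar_smul] at e3 e₂
  rw [hmap hβw, hmap e, hV', e₂, hmap e₁', hV', ← unipBar_smul, ← unipBar_smul] at e3
  have e4 := eq_of_unipBar_ux_flip hz hz1 hz3 hM _ _ e3
  have ha₁ : a₁ ≠ 0 := by
    rintro rfl
    exact ha (by rw [← k₁, zero_mul])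
  have e5 : b = b' := by
    apply (bar p f).injective
    apply mul_left_cancel₀ ha₁
    rw [k₁, ← e4, k₂]
  obtain ⟨h6, e6⟩ := ux_congr (hbar := hbar) hM h' rfl e5.symm
  rw [e, e6]

/-- Every automorphism of `PSU₃(q)`, is semilinear. -/
theorem mem_semilinearAut_unitary [Finite K] [Fact p.Prime] [CharP K p]
    (hK : Nat.card K = (p ^ f) ^ 2) (hq : 2 ≤ p ^ f) (hz : z ∈ scalars p f K (-1)) (hz1 : z ≠ 1)
    (hz3 : z ^ 3 = 1) (α : MulAut (PSLe p f K (-1))) : α ∈ semilinearAut p f K (-1) := by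
  have hbar : ∀ x : K, bar p f (bar p f x) = x := bar_bar hK
  obtain ⟨M, hM⟩ := exists_isHermBasis hK hz hz1 hz3
  obtain ⟨x, hV, hV'⟩ := hM.exists_inner_mul hbar hz hz1 hz3 α
  obtain ⟨r, σ, hσ⟩ := exists_semilinear_of_le (hbar := hbar) hK hq hz hz1 hz3 hM hV hV'
  obtain ⟨γ, hγ, hγV, hγV', hγu⟩ := exists_twistAut hbar hM r σ
  have hback : ∀ N : GL (Fin 3) K, (unipBar p f (-1) N).map
      (γ : PSLe p f K (-1) →* PSLe p f K (-1)) = unipBar p f (-1) N →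
      (unipBar p f (-1) N).map (γ⁻¹ : MulAut _).toMonoidHom = unipBar p f (-1) N := by
    intro N hN
    conv_lhs => rw [← hN]
    change Subgroup.map ((γ⁻¹ : MulAut _) : PSLe p f K (-1) →* PSLe p f K (-1)) _ = _
    rw [← map_mul_aut, inv_mul_cancel]
    exact Subgroup.map_id _
  set α' := MulAut.conj x * α with hα'
  have h1 : γ⁻¹ * α' = 1 := by
    have w1 : (unipBar p f (-1) M).map ((γ⁻¹ * α' : MulAut _) : PSLe p f K (-1) →* PSLe p f K (-1)) =
        unipBar p f (-1) M := by
      rw [map_mul_aut, hV]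
      exact hback M hγV
    have w2 : (unipBar p f (-1) (M * flipGL K)).map
        ((γ⁻¹ * α' : MulAut _) : PSLe p f K (-1) →* PSLe p f K (-1)) =
          unipBar p f (-1) (M * flipGL K) := by
      rw [map_mul_aut, hV']
      exact hback _ hγV'
    have w3 : ∀ {a b : K} (h : b + bar p f b + a * bar p f a = 0), ∃ b' h',
        (γ⁻¹ * α') (ux hbar hM h : PSLe p f K (-1)) =
          (ux hbar hM (a := a) (b := b') h' : PSLe p f K (-1)) := by
      intro a b h
      obtain ⟨a', b', h', e⟩ := exists_map_ux (hbar := hbar) hM w1 h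
      obtain ⟨b1, h1, e1⟩ := hσ h
      obtain ⟨b2, h2, e2⟩ := hγu h'
      have e3 : α' (ux hbar hM h : PSLe p f K (-1)) = γ (ux hbar hM h' : PSLe p f K (-1)) := by
        rw [← e, ← MulAut.mul_apply, mul_inv_cancel_left]
      rw [e1, e2] at e3
      have h3 := σ.injective (mul_left_cancel₀ r.ne_zero (mk_ux_injective hz hz1 hz3 hM e3).1)
      obtain ⟨h4, e4⟩ := ux_congr (hbar := hbar) hM h' (a' := a) h3.symm rfl
      exact ⟨b', h4, by rw [e, e4]⟩
    exact eq_one_of_map_ux (hbar := hbar) hz hz1 hz3 hM w1 w2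
      (fun h => map_ux_eq_of_le hK hq hz hz1 hz3 hM w1 w2 w3 h)
  have h2 : α = (MulAut.conj x)⁻¹ * γ := by
    rw [inv_mul_eq_one] at h1
    rw [h1, hα', inv_mul_cancel_left]
  rw [h2]
  exact mul_mem (inv_mem (Inn_le_semilinearAut ⟨x, rfl⟩)) hγ

end FourElements

end SL3Sylow

theorem proposition5p11 (p f : ℕ) [Fact p.Prime] (hf : 0 < f) (ε : ℤˣ)
    (h3 : (3 : ℤ) ∣ (p : ℤ) ^ f - (ε : ℤ))
    (K : Type*) [Field K] [CharP K p] (hK : Nat.card K = SL3Sylow.fieldCard ε (p ^ f)) :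
    -- (i)
    ((∀ R : Sylow 3 (SL3Sylow.PSLe p f K ε), (commutator R).index = 9) ∧
      (∀ R : Sylow 3 (SL3Sylow.PGLe p f K ε), (commutator R).index = 9) ∧
      (∀ R : Sylow 3 (SL3Sylow.SLe p f K ε), (commutator R).index = 9) ∧
      (∀ (Γ : Type*) [Group Γ] (ι : SL3Sylow.SLe p f K ε →* Γ) (δ : Γ),
        SL3Sylow.IsDiagonalExtension p f K ε ι δ →
        ∀ R : Sylow 3 Γ, (commutator R).index = 9)) ∧
    -- (ii)
    (∀ A : Subgroup (MulAut (SL3Sylow.PSLe p f K ε)),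
      SL3Sylow.Inn (SL3Sylow.PSLe p f K ε) ≤ A →
      ordProj[3] (Nat.card (A ⧸ SL3Sylow.inside A)) = 3 →
      ∀ (R : Sylow 3 A) (Y : Sylow 3 (A ⧸ SL3Sylow.inside A)),
        (commutator R).index ≠ 9 ↔
          ∃ φ : A, SL3Sylow.IsFieldAut p f K ε (φ : MulAut (SL3Sylow.PSLe p f K ε)) ∧
            (Y : Subgroup (A ⧸ SL3Sylow.inside A)) =
              Subgroup.zpowers (φ : A ⧸ SL3Sylow.inside A)) ∧
    -- (iii)
    (∀ A : Subgroup (MulAut (SL3Sylow.PSLe p f K ε)),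
      SL3Sylow.Inn (SL3Sylow.PSLe p f K ε) ≤ A →
      ¬ 3 ∣ Nat.card (A ⧸ SL3Sylow.inside A) →
      ∀ R : Sylow 3 A,
        (SL3Sylow.inside A ⊔ Subgroup.centralizer (R : Set A)).index ≤ 2) := by
  obtain ⟨α, hα⟩ := SL3Sylow.exists_isGen3 h3 hK
  obtain ⟨z, hz, hz1, hz3⟩ := SL3Sylow.exists_cube_root h3 hK
  have hfin : Finite K := SL3Sylow.finite_of_card hK
  refine ⟨⟨fun R => SL3Sylow.index_commutator_PSLe hα hz hz1 hz3 R,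
    fun R => SL3Sylow.index_commutator_PGLe hα hz hz1 hz3 R,
    fun R => SL3Sylow.index_commutator_SLe hα hz hz1 hz3 R,
    fun Γ _ ι δ h R => SL3Sylow.index_commutator_diagonalExtension hα hz hz1 hz3 ι δ h R⟩,
    fun A hA h R Y => SL3Sylow.index_commutator_Aut_ne_nine_iff hα hz hz1 hz3 ?_ A hA h R Y,
    fun A hA h R => SL3Sylow.index_sup_centralizer_Aut hα hz hz1 hz3 A hA h R⟩
  -- What remains is semilinearity of automorphisms with inner cube. In the linear case the
  -- condition on the cube excludes graph automorphisms; in the unitary case it is not needed.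
  intro φ hφ
  rcases Int.units_eq_one_or ε with rfl | rfl
  · exact SL3Sylow.mem_semilinearAut_of_cube_linear hz.1 hz1 hz3 hφ
  · exact SL3Sylow.mem_semilinearAut_unitary hK ((Fact.out : p.Prime).two_le.trans
      (Nat.le_self_pow hf.ne' p)) hz.1 hz1 hz3 φ
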